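/- **Setting.** Let $\kappa$ be an algebraically closed field and $X_0$ a proper, reduced, connected nodal curve over $\kappa$ with smooth irreducible components $Z_v$, indexed by the vertices $v$ of its dual graph $G$. Write $\overline G$ for the simple graph obtained from $G$ by identifying all edges joining the same two vertices, and assume that $X_0$ is of pseudocompact type, i.e. $\overline G$ is a tree. For an edge $e$ of $G$ incident on $v$ let $P_e^v\in Z_v$ be the corresponding point. Let $\bm n\colon E(G)\to\mathbb Z_{>0}$ be a chain structure, $\Gamma$ the metric graph with edge lengths $\bm n(e)$, and $\mathfrak C=\mathfrak C_{X_0,\bm n}$ the metrized complex given by $\Gamma$, the curves $Z_v$ and the points $P_e^v$. **Multidegrees.** Fix a direction of the edges of $G$, and put $\sigma(e,v)=1$ if $v$ is the tail of $e$ and $\sigma(e,v)=-1$ if it is the head. An admissible multidegree $w=(w_G,\mu)$ of degree $d$ consists of $w_G\colon V(G)\to\mathbb Z$ and $\mu(e)\in\mathbb Z/\bm n(e)$ with $d=\#\{e:\mu(e)\ne0\}+\sum_v w_G(v)$; it corresponds to the divisor $D_w$ on $\Gamma$ with coefficient $w_G(v)$ at $v$ and one chip at distance $\mu(e)$ from the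 tail of $e$ whenever $\mu(e)\neq 0$. The twist at $v$ does the following for every $e$ at $v$, with other end $u$: raise $w_G(u)$ by $1$ if $\mu(e)+\sigma(e,v)=0$; lower $w_G(v)$ by $1$ if $\mu(e)=0$; add $\sigma(e,v)$ to $\mu(e)$. For an edge $e$ of $\overline G$ containing $v$, the twist at $(e,v)$ does this only for the edges of $G$ over $e$. Negative twists are the inverse operations. Fix $w_0$ of degree $d$, and let $V(G(w_0))$ be the set of multidegrees obtained from $w_0$ by twists at vertices. A multidegree $w$ is concentrated on $v$ if there is an ordering of $V(G)$ starting at $v$ such that for each later vertex $u$, the negative twists of $w$ at all vertices before $u$ make it negative at $u$. A tuple $(w_v)_{v\in V(G)}$ in $V(G(w_0))$ is tight if each $w_v$ is concentrated on $v$ and for each edge $e=\{v,v'\}$ of $\overline G$, $w_v$ is obtained from $w_{v'}$ by $b_{v,v'}\ge0$ twists at $(e,v')$ (then $b_{v,v'}=b_{v',v}$). Let $w_v^{\mathrm{red}}$ be the unique element of $V(G(w_0))$ with $D_{w_v^{\mathrm{red}}}$ $v$-reduced. For $w,w'\in V(G(w_0))$ let $D^v_{w,w'}=\sum_{e\ni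 v}\mathrm{slp}_{e,v}(f)P_e^v$, where $f$ is a piecewise linear function on $\Gamma$ with $D_{w'}=D_w+\mathrm{div}(f)$ and $\mathrm{slp}_{e,v}$ denotes the outgoing slope at $v$ along $e$. **Pre-limit linear series.** For $e=\{v,v'\}\in E(\overline G)$ put $D_0^{e,v}=0$ and let $D_{i+1}^{e,v}-D_i^{e,v}$ be the sum of the $P_{e'}^v$ over the edges $e'$ of $G$ over $e$ with $\sigma(e',v)\mu_v(e')\equiv -i \pmod{\bm n(e')}$, where $\mu_v$ belongs to $w_v$; $i$ is critical if this difference is nonzero. Let $P^r_d(X_0,\bm n,(w_v)_v)$ be the set of isomorphism classes of tuples $(\mathscr L_v,V_v)_v$ with $\mathscr L_v$ a line bundle on $Z_v$ of degree $(w_v)_G(v)$ and $V_v\subseteq H^0(Z_v,\mathscr L_v)$ of dimension $r+1$, such that for every edge $e=\{v,v'\}$ of $\overline G$ the following holds. Let $a_0^{e,v}\le\dots\le a_r^{e,v}$ be the sequence in which $\deg D_i^{e,v}$, for $i$ critical, occurs $\dim V_v(-D_i^{e,v})/V_v(-D_{i+1}^{e,v})$ times; then whenever $a_l^{e,v}=\deg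 D_j^{e,v}$ with $j$ critical and $j\le b_{v,v'}$, one has $a_{r-l}^{e,v'}\ge\deg D_{b_{v,v'}-j}^{e,v'}$. (This is used for tight tuples and for $(w_v^{\mathrm{red}})_v$; if the latter is not tight, then $(w_v^{\mathrm{red}})_G(v)<0$ for some $v$, and the set is empty for reasons of degree.) Such a tuple satisfies the weak glueing condition if for all such $e$ and all critical $j\le b=b_{v,v'}$ there are subspaces $W_v\subseteq V_v(-D_j^{e,v})/V_v(-D_{j+1}^{e,v})$ and $W_{v'}\subseteq V_{v'}(-D_{b-j}^{e,v'})/V_{v'}(-D_{b-j+1}^{e,v'})$, both of dimension $\#\{l: a_l^{e,v}=\deg D_j^{e,v},\ a_{r-l}^{e,v'}=\deg D_{b-j}^{e,v'}\}$, such that for every set $I$ of edges of $G$ occurring in $D_{j+1}^{e,v}-D_j^{e,v}$, the sets of elements of $W_v$, resp. $W_{v'}$, which are nonzero exactly at the points $P_{e'}^v$, resp. $P_{e'}^{v'}$, with $e'\in I$ (among the points of $D_{j+1}^{e,v}-D_j^{e,v}$, resp. $D_{b-j+1}^{e,v'}-D_{b-j}^{e,v'}$) have the same dimension. **Limit linear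 series on $\mathfrak C$.** A limit $\mathfrak g^r_d$ on $\mathfrak C$ is a class of pairs $(\mathcal D,\mathcal H)$ with $\mathcal D$ a divisor of degree $d$ on $\mathfrak C$ and $\mathcal H=(H_v)_v$ a family of $(r+1)$-dimensional subspaces $H_v$ of the function fields $K(Z_v)$, such that $r$ is the largest integer for which every effective divisor $\mathcal E$ of degree $r$ on $\mathfrak C$ admits a nonzero rational function $\mathfrak f$ on $\mathfrak C$ with $\mathfrak f_v\in H_v$ for all $v$ and $\mathcal D+\mathrm{div}(\mathfrak f)-\mathcal E\ge0$; pairs $(\mathcal D,\mathcal H)$ and $(\mathcal D+\mathrm{div}(\mathfrak f),\mathcal H')$ with $H_v=H'_v\cdot\mathfrak f_v$ are identified. It is of multidegree $w$ if some representative has $\mathcal D_\Gamma=D_{w}$ (where $\mathcal D_\Gamma$, $\mathcal D_v$ are the $\Gamma$- and $Z_v$-parts). Let $\mathfrak G^r_d(\mathfrak C,w_0)$ be the set of limit $\mathfrak g^r_d$s of multidegree $w_0$. For a tuple $(w_v)_v$ in $V(G(w_0))$, $\mathfrak F_{(w_v)_v}$ sends $(\mathscr L_v,V_v)_v$ to the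 class of $(\mathcal D,\mathcal H)$, where one chooses $w\in V(G(w_0))$ and $0\ne s_v\in V_v$, $\mathcal D$ has multidegree $w$ with $\mathcal D_v=\mathrm{div}^0(s_v)-D^v_{w,w_v}$, and $H_v=\{s/s_v: s\in V_v\}$. **Statement.** Let $r\ge0$. The multidegrees $w_v^{\mathrm{red}}$ exist and are unique, and $\mathfrak F_{(w_v^{\mathrm{red}})_v}$ is a well-defined map into limit $\mathfrak g^r_d$s on $\mathfrak C$ (independent of the choices). For any tight tuple $(w_v)_v$ in $V(G(w_0))$, so is $\mathfrak F_{(w_v)_v}$, and: 1. There is a bijection $\mathfrak I\colon P^r_d(X_0,\bm n,(w_v)_v)\to P^r_d(X_0,\bm n,(w_v^{\mathrm{red}})_v)$ with $\mathfrak F_{(w_v)_v}=\mathfrak F_{(w_v^{\mathrm{red}})_v}\circ\mathfrak I$. The divisors $D_v=D^v_{w_v^{\mathrm{red}},w_v}$ are effective, and $\mathfrak I^{-1}$ sends $(\mathscr L_v,V_v)_v$ to $(\mathscr L_v(D_v),V_v)_v$, with $V_v$ embedded by $H^0(Z_v,\mathscr L_v)\subseteq H^0(Z_v,\mathscr L_v(D_v))$.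 Moreover $\mathfrak I$ induces a bijection between the subsets of elements satisfying the weak glueing condition. 2. $\mathfrak F_{(w_v)_v}$ is a bijection onto $\mathfrak G^r_d(\mathfrak C,w_0)$. For a limit $\mathfrak g^r_d$ $(\mathcal D,\mathcal H)$ with $\mathcal D_\Gamma=D_{w_0}$ one has $H_v\subseteq H^0(Z_v,\mathscr O_{Z_v}(\mathcal D_v+D^v_{w_0,w_v}))$ for all $v$, and the preimage of its class is $(\mathscr O_{Z_v}(\mathcal D_v+D^v_{w_0,w_v}),H_v)_v$. -/

import Mathlib

open AlgebraicGeometry CategoryTheory Filter Topology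
open scoped Classical

universe u

noncomputable section

namespace LimitLinear

/-! ### Smooth proper curves, their divisors and rational functions -/

/-- A smooth (= nonsingular, the base field being algebraically closed in all uses) proper integral
curve over `κ`: an integral scheme, proper over `κ`, whose local rings at closed points are
discrete valuation rings. -/
structure SmoothCurve (κ : Type u) [Field κ] where
  X : Scheme.{u}
  str : X ⟶ Spec (CommRingCat.of κ)
  isIntegral : AlgebraicGeometry.IsIntegral X
  isProper : IsProper str
  isDVR : ∀ x : X, IsClosed ({x} : Set X) → IsDiscreteValuationRing (X.presheaf.stalk x)

namespace SmoothCurve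

variable {κ : Type u} [Field κ] (C : SmoothCurve κ)

instance : AlgebraicGeometry.IsIntegral C.X := C.isIntegral

instance : IsProper C.str := C.isProper

instance : IsLocallyNoetherian C.X := LocallyOfFiniteType.isLocallyNoetherian C.str

/-- The closed points of the curve. -/
abbrev Pt : Type u := {x : C.X // IsClosed ({x} : Set C.X)}

/-- The field of rational functions. -/
abbrev K : Type u := C.X.functionField

/-- The structure map from `κ` to global functions. -/
def const : κ →+* Γ(C.X, ⊤) :=
  (C.str.appTop.hom).comp (Scheme.ΓSpecIso (CommRingCat.of κ)).inv.hom

instance : Nonempty (⊤ : C.X.Opens) := ⟨⟨genericPoint C.X, trivial⟩⟩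

instance : Algebra κ C.K := ((C.X.germToFunctionField ⊤).hom.comp C.const).toAlgebra

/-- The vanishing order of a rational function at a closed point (meaningful for `f ≠ 0`). -/
def ord (P : C.Pt) (f : C.K) : ℤ := Scheme.ord f P.1

lemma ord_mul (P : C.Pt) {f g : C.K} (hf : f ≠ 0) (hg : g ≠ 0) :
    C.ord P (f * g) = C.ord P f + C.ord P g := Scheme.ord_mul hf hg

lemma ord_one (P : C.Pt) : C.ord P 1 = 0 := by
  have h := C.ord_mul P (one_ne_zero (α := C.K)) one_ne_zero
  rw [mul_one] at h
  omega

lemma ord_inv (P : C.Pt) {f : C.K} (hf : f ≠ 0) : C.ord P f⁻¹ = - C.ord P f := by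
  have h := C.ord_mul P hf (inv_ne_zero hf)
  rw [mul_inv_cancel₀ hf, C.ord_one] at h
  omega

lemma min_ord_le_ord_add (P : C.Pt) {f g : C.K} (h : f + g ≠ 0) :
    min (C.ord P f) (C.ord P g) ≤ C.ord P (f + g) := by
  have := C.isDVR P.1 P.2
  exact Scheme.ord_add h

lemma ord_le_ord_smul (P : C.Pt) (c : κ) (hc : c ≠ 0) (f : C.K) :
    C.ord P f ≤ C.ord P (c • f) := by
  have h1 : C.const c ≠ 0 := (map_ne_zero C.const).2 hc
  exact Scheme.ord_le_smul (X := C.X) (x := P.1) (U := ⊤) trivial h1 f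

/-- Divisors on the curve. -/
abbrev Div : Type u := C.Pt →₀ ℤ

/-- `H⁰(C, 𝒪(D))`, as a space of rational functions. -/
def H0 (D : C.Div) : Submodule κ C.K where
  carrier := {f | f ≠ 0 → ∀ P, 0 ≤ C.ord P f + D P}
  zero_mem' := fun h => absurd rfl h
  add_mem' := by
    intro f g hf hg h P
    by_cases f0 : f = 0
    · subst f0
      rw [zero_add] at h ⊢
      exact hg h P
    by_cases g0 : g = 0
    · subst g0
      rw [add_zero] at h ⊢
      exact hf h P
    have h1 := hf f0 P
    have h2 := hg g0 P
    have h3 := C.min_ord_le_ord_add P h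
    rcases min_le_iff.1 h3 with h4 | h4 <;> omega
  smul_mem' := by
    intro c f hf h P
    have hc : c ≠ 0 := by
      rintro rfl
      exact h (zero_smul _ _)
    have f0 : f ≠ 0 := by
      rintro rfl
      exact h (smul_zero _)
    have h1 := hf f0 P
    have h2 := C.ord_le_ord_smul P c hc f
    omega

/-- The subspace `V · f` of the function field. -/
def mulBy (V : Submodule κ C.K) (f : C.K) : Submodule κ C.K := V.map (LinearMap.mulRight κ f)

lemma mulBy_one (V : Submodule κ C.K) : C.mulBy V 1 = V := by
  rw [mulBy, LinearMap.mulRight_one, Submodule.map_id]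

lemma mulBy_mulBy (V : Submodule κ C.K) (f g : C.K) :
    C.mulBy (C.mulBy V f) g = C.mulBy V (f * g) := by
  rw [mulBy, mulBy, mulBy, LinearMap.mulRight_mul, Submodule.map_comp]

end SmoothCurve

/-! ### Chain structures, admissible multidegrees and twists -/

/-- A finite graph without loops (multiple edges allowed), with an (arbitrary) direction of
its edges. -/
structure Multigraph where
  V : Type
  E : Type
  [fintypeV : Fintype V]
  [fintypeE : Fintype E]
  tail : E → V
  head : E → V
  loopless : ∀ e, tail e ≠ head e

attribute [instance] Multigraph.fintypeV Multigraph.fintypeE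

namespace Multigraph

variable (G : Multigraph)

/-- The edge `e` is incident on the vertex `v`. -/
def Inc (e : G.E) (v : G.V) : Prop := v = G.tail e ∨ v = G.head e

/-- `σ(e, v)`, for `e` incident on `v`. -/
def sgn (e : G.E) (v : G.V) : ℤ := if v = G.tail e then 1 else -1

/-- The simple graph `G̅`. -/
def bar : SimpleGraph G.V where
  Adj u v := u ≠ v ∧ ∃ e, G.Inc e u ∧ G.Inc e v
  symm := ⟨fun _ _ h => ⟨h.1.symm, h.2.imp fun _ he => he.symm⟩⟩
  loopless := ⟨fun _ h => h.1 rfl⟩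

/-- `G` is a multitree. -/
def IsMultitree : Prop := G.bar.IsTree

/-- The edges of `G` incident on `v`. -/
def edgesAt (v : G.V) : Finset G.E := Finset.univ.filter fun e => G.Inc e v

/-- The edges of `G` over the edge `{u, v}` of `G̅` (for `u ≠ v`). -/
def edgesOver (u v : G.V) : Finset G.E := Finset.univ.filter fun e => G.Inc e u ∧ G.Inc e v

end Multigraph

/-- An admissible multidegree on `(G, n)`. -/
@[ext]
structure AdmMultideg (G : Multigraph) (n : G.E → ℕ+) where
  wG : G.V → ℤ
  μ : ∀ e : G.E, ZMod (n e)

namespace AdmMultideg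

variable {G : Multigraph} {n : G.E → ℕ+}

/-- The total degree. -/
def degree (w : AdmMultideg G n) : ℤ :=
  ((Finset.univ.filter fun e => w.μ e ≠ 0).card : ℤ) + ∑ v, w.wG v

/-- The twisting operation at `v`, performed only along a given set `S` of edges incident
on `v`. -/
def twistAlong (S : Finset G.E) (v : G.V) (w : AdmMultideg G n) : AdmMultideg G n where
  wG u := w.wG u
    + ((S.filter fun e => u ≠ v ∧ G.Inc e u ∧ w.μ e + (G.sgn e v : ZMod (n e)) = 0).card : ℤ)
    - if u = v then ((S.filter fun e => w.μ e = 0).card : ℤ) else 0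
  μ e := if e ∈ S then w.μ e + (G.sgn e v : ZMod (n e)) else w.μ e

/-- The twist at the vertex `v`. -/
def twist (v : G.V) (w : AdmMultideg G n) : AdmMultideg G n := twistAlong (G.edgesAt v) v w

/-- The twist at `(e, v)`, where `e` is the edge of `G̅` joining `v` and `v'`. -/
def partialTwist (v v' : G.V) (w : AdmMultideg G n) : AdmMultideg G n :=
  twistAlong (G.edgesOver v v') v w

/-- Successive twists at the vertices of a list. -/
def twistList (l : List G.V) (w : AdmMultideg G n) : AdmMultideg G n :=
  l.foldl (fun w v => twist v w) w

/-- The set `V(G(w₀))` of admissible multidegrees obtained from `w₀` by twists. -/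
def orbit (w₀ : AdmMultideg G n) : Set (AdmMultideg G n) := {w | ∃ l, twistList l w₀ = w}

/-- `w` is concentrated on `v`: for some ordering of the vertices starting at `v`, for every later
vertex `u` the multidegree `w'` obtained from `w` by the negative twists at all the vertices
before `u` is negative at `u`. -/
def IsConcentrated (w : AdmMultideg G n) (v : G.V) : Prop :=
  ∃ l : List G.V, l.Nodup ∧ (∀ u, u ∈ l) ∧ l.head? = some v ∧
    ∀ p u s, l = p ++ u :: s → p ≠ [] → ∃ w', twistList p w' = w ∧ w'.wG u < 0

/-- A tight tuple of admissible multidegrees. -/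
def IsTight (w : G.V → AdmMultideg G n) : Prop :=
  (∀ v, (w v).IsConcentrated v) ∧
    ∀ u v, G.bar.Adj u v → ∃ b : ℕ, w u = (partialTwist v u)^[b] (w v)

/-- The number `b_{u,v}` of twists at `(e, v)` leading from `w_v` to `w_u`, for adjacent `u`, `v`
(it is unique). -/
def gap (w : G.V → AdmMultideg G n) (u v : G.V) : ℕ :=
  sInf {b : ℕ | w u = (partialTwist v u)^[b] (w v)}

/-- The vertices of the subdivision `G̃`. -/
abbrev SubdivVertex (G : Multigraph) (n : G.E → ℕ+) : Type :=
  G.V ⊕ (Σ e : G.E, {k : ℕ // 0 < k ∧ k < n e})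

/-- The vertex of `G̃` on the edge `e` at distance `k` from the tail. -/
def subdivVertex (n : G.E → ℕ+) (e : G.E) (k : ℕ) : SubdivVertex G n :=
  if h : 0 < k ∧ k < n e then Sum.inr ⟨e, k, h⟩
  else if k = 0 then Sum.inl (G.tail e) else Sum.inl (G.head e)

/-- The edge-reduced divisor `D_w`, as a divisor on `G̃`. -/
def subdivDivisor (w : AdmMultideg G n) : SubdivVertex G n → ℤ
  | Sum.inl v => w.wG v
  | Sum.inr x => if (w.μ x.1).val = x.2.1 then 1 else 0

/-- The number of edges of `G̃` from `x` to the complement of `S`. -/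
def outdeg (n : G.E → ℕ+) (S : Set (SubdivVertex G n)) (x : SubdivVertex G n) : ℕ :=
  (Finset.univ.filter fun a : Σ e : G.E, Fin (n e) =>
    (subdivVertex n a.1 a.2 = x ∧ subdivVertex n a.1 (a.2 + 1) ∉ S) ∨
      (subdivVertex n a.1 (a.2 + 1) = x ∧ subdivVertex n a.1 a.2 ∉ S)).card

/-- The divisor `D_w` is `v`-reduced. -/
def IsReducedAt (w : AdmMultideg G n) (v : G.V) : Prop :=
  (∀ x, x ≠ Sum.inl v → 0 ≤ w.subdivDivisor x) ∧
    ∀ S : Set (SubdivVertex G n), S.Nonempty → Sum.inl v ∉ S →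
      ∃ x ∈ S, w.subdivDivisor x < outdeg n S x

/-- The change at `v` along the edge `e` produced by one twist of `w` at `u`. -/
def stepCoeff (v : G.V) (w : AdmMultideg G n) (u : G.V) (e : G.E) : ℤ :=
  if u = v then (if G.Inc e v ∧ w.μ e = 0 then -1 else 0)
  else (if G.Inc e v ∧ G.Inc e u ∧ (twist u w).μ e = 0 then 1 else 0)

/-- The total change at `v` along the edge `e` when twisting `w` successively at the vertices of
a list. -/
def pathCoeff (v : G.V) : List G.V → AdmMultideg G n → G.E → ℤ
  | [], _, _ => 0
  | u :: l, w, e => stepCoeff v w u e + pathCoeff v l (twist u w) e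

/-- The total change at `v` along the edge `e` when twisting from `w` to `w'` (it does not depend
on the path from `w` to `w'`). -/
def twistCoeff (w w' : AdmMultideg G n) (v : G.V) (e : G.E) : ℤ :=
  if h : ∃ l, twistList l w = w' then pathCoeff v h.choose w e else 0

/-- The edges over the edge `{v, v'}` of `G̅` on which `v` loses a chip in the `(i+1)`-st twist at
that edge and `v`, starting from `w`. -/
def lossEdges (w : AdmMultideg G n) (v v' : G.V) (i : ℕ) : Finset G.E :=
  (G.edgesOver v v').filter fun e => (G.sgn e v : ZMod (n e)) * w.μ e = -(i : ZMod (n e))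

end AdmMultideg

/-! ### Nodal curves -/

/-- A nodal curve over `κ` with smooth irreducible components, together with a labelling of its
components and nodes by the vertices and edges of its dual graph `G`: a proper reduced connected
scheme covered by closed smooth curves `Z_v`, any two of which meet transversally (their
scheme-theoretic intersection is reduced), exactly in the nodes joining them, each node lying on
exactly two of them. -/
structure NodalCurve (κ : Type u) [Field κ] where
  X : Scheme.{u}
  str : X ⟶ Spec (CommRingCat.of κ)
  isProper : IsProper str
  isReduced : AlgebraicGeometry.IsReduced X
  connected : ConnectedSpace X
  G : Multigraph
  Z : G.V → SmoothCurve κ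
  incl : ∀ v, (Z v).X ⟶ X
  incl_str : ∀ v, incl v ≫ str = (Z v).str
  isClosedImmersion : ∀ v, IsClosedImmersion (incl v)
  cover : ∀ x : X, ∃ v, ∃ p : (Z v).X, incl v p = x
  /-- The point `P_e^v` of `Z_v` over the node corresponding to `e`. -/
  node : ∀ (e : G.E) (v : G.V), G.Inc e v → (Z v).Pt
  node_injective : ∀ (v : G.V) (e e' : G.E) (h : G.Inc e v) (h' : G.Inc e' v),
    node e v h = node e' v h' → e = e'
  glue : ∀ (e : G.E) (u v : G.V) (hu : G.Inc e u) (hv : G.Inc e v),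
    incl u (node e u hu).1 = incl v (node e v hv).1
  glue_only : ∀ (u v : G.V), u ≠ v → ∀ (p : (Z u).X) (q : (Z v).X), incl u p = incl v q →
    ∃ (e : G.E) (hu : G.Inc e u) (hv : G.Inc e v), (node e u hu).1 = p ∧ (node e v hv).1 = q
  transversal : ∀ u v, u ≠ v →
    AlgebraicGeometry.IsReduced (Limits.pullback (incl u) (incl v))

namespace NodalCurve

variable {κ : Type u} [Field κ] (X₀ : NodalCurve κ)

/-- `X₀` is of pseudocompact type. -/
def IsPseudocompact : Prop := X₀.G.IsMultitree

/-- The divisor `∑ c(e) P_e^v` on `Z_v`, over the edges `e` incident on `v`. -/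
def nodeDiv (v : X₀.G.V) (c : X₀.G.E → ℤ) : (X₀.Z v).Div :=
  ∑ e, if h : X₀.G.Inc e v then Finsupp.single (X₀.node e v h) (c e) else 0

variable {X₀} {n : X₀.G.E → ℕ+}

/-- The divisor `D^v_{w,w'}` on `Z_v` obtained by twisting from `w` to `w'`. -/
def twistDiv (w w' : AdmMultideg X₀.G n) (v : X₀.G.V) : (X₀.Z v).Div :=
  X₀.nodeDiv v (AdmMultideg.twistCoeff w w' v)

/-- The twisting divisors `D_i^{e,v}` on `Z_v` associated to a tuple `(w_v)_v`, where `e` is the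
edge of `G̅` joining `v` and `v'`. -/
def chipDiv (w : X₀.G.V → AdmMultideg X₀.G n) (v v' : X₀.G.V) (i : ℕ) : (X₀.Z v).Div :=
  X₀.nodeDiv v fun e => (((Finset.range i).filter fun k => e ∈ (w v).lossEdges v v' k).card : ℤ)

/-! ### Pre-limit linear series -/

variable (X₀) in
/-- A tuple of invertible sheaves `𝒪(D_v)` on the `Z_v` together with spaces `V_v` of sections,
regarded as rational functions. -/
structure SheafTuple where
  D : ∀ v, (X₀.Z v).Div
  V : ∀ v, Submodule κ (X₀.Z v).K

namespace SheafTuple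

/-- Isomorphism of tuples: multiplication by nonzero rational functions `f_v` gives isomorphisms
`𝒪(D_v) ≅ 𝒪(D'_v)` carrying `V_v` to `V'_v`. -/
instance : Setoid (SheafTuple X₀) where
  r x y := ∃ f : ∀ v, (X₀.Z v).K, (∀ v, f v ≠ 0) ∧
    (∀ v P, y.D v P = x.D v P - (X₀.Z v).ord P (f v)) ∧
    ∀ v, y.V v = (X₀.Z v).mulBy (x.V v) (f v)
  iseqv :=
    { refl := fun x => ⟨fun _ => 1, fun _ => one_ne_zero,
        fun v P => by rw [SmoothCurve.ord_one, sub_zero],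
        fun v => by rw [SmoothCurve.mulBy_one]⟩
      symm := by
        rintro x y ⟨f, hf, hD, hV⟩
        refine ⟨fun v => (f v)⁻¹, fun v => inv_ne_zero (hf v), fun v P => ?_, fun v => ?_⟩
        · rw [SmoothCurve.ord_inv _ _ (hf v), hD]
          ring
        · rw [hV, SmoothCurve.mulBy_mulBy, mul_inv_cancel₀ (hf v), SmoothCurve.mulBy_one]
      trans := by
        rintro x y z ⟨f, hf, hD, hV⟩ ⟨g, hg, hD', hV'⟩
        refine ⟨fun v => f v * g v, fun v => mul_ne_zero (hf v) (hg v), fun v P => ?_,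
          fun v => ?_⟩
        · rw [SmoothCurve.ord_mul _ _ (hf v) (hg v), hD', hD]
          ring
        · rw [hV', hV, SmoothCurve.mulBy_mulBy] }

end SheafTuple

section Vanishing

variable {C : SmoothCurve κ}

/-- `V(-D')`, the sections in `V ⊆ H⁰(𝒪(D))` whose divisor of zeros is at least `D'`. -/
def sectionsVanishing (D : C.Div) (V : Submodule κ C.K) (D' : C.Div) : Submodule κ C.K :=
  V ⊓ C.H0 (D - D')

/-- `V(-D₁) / V(-D₂)`. -/
abbrev gradedPiece (D : C.Div) (V : Submodule κ C.K) (D₁ D₂ : C.Div) : Type u :=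
  ↥(sectionsVanishing D V D₁) ⧸
    (sectionsVanishing D V D₂).submoduleOf (sectionsVanishing D V D₁)

/-- `i` is critical for the sequence of divisors. -/
def IsCritical (Ds : ℕ → C.Div) (i : ℕ) : Prop := Ds (i + 1) ≠ Ds i

/-- `a₀ ≤ ⋯ ≤ a_r` is the multivanishing sequence of `V` along `Ds`: its members are degrees of
the `Ds i` with `i` critical, and such a degree is taken `dim V(-Ds i) / V(-Ds (i+1))` times. -/
def IsMultivanishing {r : ℕ} (D : C.Div) (V : Submodule κ C.K) (Ds : ℕ → C.Div)
    (a : Fin (r + 1) → ℤ) : Prop :=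
  Monotone a ∧ (∀ l, ∃ i, IsCritical Ds i ∧ a l = (Ds i).degree) ∧
    ∀ i, IsCritical Ds i →
      (Finset.univ.filter fun l => a l = (Ds i).degree).card =
        Module.finrank κ (gradedPiece D V (Ds i) (Ds (i + 1)))

end Vanishing

/-- The tuple is a pre-limit linear series of rank `r` with respect to `(w_v)_v`. (In the last
condition the subtraction is truncated, so that it is void, as it should be, for `j > b`.) -/
def IsPreLimit (w : X₀.G.V → AdmMultideg X₀.G n) (r : ℕ) (x : SheafTuple X₀) : Prop :=
  (∀ v, (x.D v).degree = (w v).wG v) ∧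
  (∀ v, x.V v ≤ (X₀.Z v).H0 (x.D v)) ∧
  (∀ v, Module.finrank κ (x.V v) = r + 1) ∧
  ∃ a : X₀.G.V → X₀.G.V → Fin (r + 1) → ℤ,
    (∀ v v', X₀.G.bar.Adj v v' → IsMultivanishing (x.D v) (x.V v) (chipDiv w v v') (a v v')) ∧
    ∀ v v', X₀.G.bar.Adj v v' → ∀ (l : Fin (r + 1)) (j : ℕ), IsCritical (chipDiv w v v') j →
      a v v' l = (chipDiv w v v' j).degree →
        (chipDiv w v' v (AdmMultideg.gap w v v' - j)).degree ≤ a v' v l.rev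

/-- The space `P^r_d(X₀, n, (w_v)_v)` of (isomorphism classes of) pre-limit linear series. -/
def PreLimitSpace (w : X₀.G.V → AdmMultideg X₀.G n) (r : ℕ) : Type u :=
  Quotient (Setoid.comap (Subtype.val : {x : SheafTuple X₀ // IsPreLimit w r x} → SheafTuple X₀)
    inferInstance)

/-- The class of a pre-limit linear series. -/
def PreLimitSpace.mk {w : X₀.G.V → AdmMultideg X₀.G n} {r : ℕ} (x : SheafTuple X₀)
    (hx : IsPreLimit w r x) : PreLimitSpace w r := Quotient.mk _ ⟨x, hx⟩

/-! ### The weak glueing condition -/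

/-- The elements of `W ⊆ V(-D_j) / V(-D_{j+1})` which lie in the torus orbit given by `I`: for the
critical edges `e` at step `j`, the value at `P_e^v` in `𝒪(D)(-D_j)` is nonzero exactly when
`e ∈ I`. -/
def orbitPart (w : X₀.G.V → AdmMultideg X₀.G n) (x : SheafTuple X₀) (v v' : X₀.G.V) (j : ℕ)
    (W : Submodule κ (gradedPiece (x.D v) (x.V v) (chipDiv w v v' j) (chipDiv w v v' (j + 1))))
    (I : Finset X₀.G.E) :
    Set (gradedPiece (x.D v) (x.V v) (chipDiv w v v' j) (chipDiv w v v' (j + 1))) :=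
  {q | q ∈ W ∧ ∃ s : sectionsVanishing (x.D v) (x.V v) (chipDiv w v v' j),
    Submodule.Quotient.mk s = q ∧ ∀ e ∈ (w v).lossEdges v v' j,
      (e ∈ I ↔ (s : (X₀.Z v).K) ∉
        (X₀.Z v).H0 (x.D v - chipDiv w v v' j - X₀.nodeDiv v (Pi.single e 1)))}

/-- The weak glueing condition for a pre-limit linear series with respect to `(w_v)_v`. The torus
orbits of the fibres correspond on both sides to sets `I` of critical edges, and the dimension
of the intersection of an orbit with a linear space is that of its linear span. -/
def SheafTuple.WeakGlueing (w : X₀.G.V → AdmMultideg X₀.G n) (r : ℕ) (x : SheafTuple X₀) : Prop :=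
  ∀ v v', X₀.G.bar.Adj v v' → ∃ a a' : Fin (r + 1) → ℤ,
    IsMultivanishing (x.D v) (x.V v) (chipDiv w v v') a ∧
    IsMultivanishing (x.D v') (x.V v') (chipDiv w v' v) a' ∧
    ∀ j j' : ℕ, j + j' = AdmMultideg.gap w v v' → IsCritical (chipDiv w v v') j →
      ∃ (W : Submodule κ (gradedPiece (x.D v) (x.V v)
          (chipDiv w v v' j) (chipDiv w v v' (j + 1))))
        (W' : Submodule κ (gradedPiece (x.D v') (x.V v')
          (chipDiv w v' v j') (chipDiv w v' v (j' + 1)))) (g : ℕ),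
        g = (Finset.univ.filter fun l : Fin (r + 1) =>
          a l = (chipDiv w v v' j).degree ∧ a' l.rev = (chipDiv w v' v j').degree).card ∧
        Module.finrank κ W = g ∧ Module.finrank κ W' = g ∧
        ∀ I ⊆ (w v).lossEdges v v' j,
          Module.finrank κ (Submodule.span κ (orbitPart w x v v' j W I)) =
            Module.finrank κ (Submodule.span κ (orbitPart w x v' v j' W' I))

/-- The weak glueing condition for a class of pre-limit linear series (it does not depend on the
representative). -/
def PreLimitSpace.WeakGlueing {w : X₀.G.V → AdmMultideg X₀.G n} {r : ℕ}
    (p : PreLimitSpace w r) : Prop :=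
  ∃ x hx, p = PreLimitSpace.mk x hx ∧ x.WeakGlueing w r

/-! ### The metrized complex of a nodal curve with chain structure -/

variable (X₀ n) in
/-- The points of the metrized complex `ℭ` of `(X₀, n)`: closed points of the curves `Z_v`, and
interior points of the edges `e`, given by their distance from the tail of `e`. -/
abbrev ComplexPoint : Type u :=
  (Σ v : X₀.G.V, (X₀.Z v).Pt) ⊕ (Σ e : X₀.G.E, Set.Ioo (0 : ℝ) (n e : ℝ))

variable (X₀ n) in
/-- Divisors on `ℭ`. -/
abbrev ComplexDiv : Type u := ComplexPoint X₀ n →₀ ℤ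

/-- The `Z_v`-part of a divisor on `ℭ`. -/
def ComplexDiv.part (D : ComplexDiv X₀ n) (v : X₀.G.V) : (X₀.Z v).Div :=
  D.comapDomain (fun P => Sum.inl ⟨v, P⟩) (fun P _ Q _ h => by
    simpa using h)

/-- The divisor is of multidegree `w`, i.e. its `Γ`-part is `D_w`. -/
def ComplexDiv.IsOfMultidegree (D : ComplexDiv X₀ n) (w : AdmMultideg X₀.G n) : Prop :=
  (∀ v, (ComplexDiv.part D v).degree = w.wG v) ∧
    ∀ (e : X₀.G.E) (t : Set.Ioo (0 : ℝ) (n e : ℝ)),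
      D (Sum.inr ⟨e, t⟩) = if (t : ℝ) = ((w.μ e).val : ℝ) then 1 else 0

end NodalCurve

/-- A rational function on the metric graph `Γ` of `(G, n)`: a continuous piecewise linear function
with integer slopes. It is given by its values `vert` on the vertices and `edge e t` at distance
`t` from the tail of `e`; `right` and `left` are its outgoing slopes in the two directions.
(Being linear near each point, on both sides, it has finitely many pieces on each edge.) -/
structure TropFunction (G : Multigraph) (n : G.E → ℕ+) where
  vert : G.V → ℝ
  edge : G.E → ℝ → ℝ
  right : G.E → ℝ → ℤ
  left : G.E → ℝ → ℤ
  edge_tail : ∀ e, edge e 0 = vert (G.tail e)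
  edge_head : ∀ e, edge e (n e) = vert (G.head e)
  right_spec : ∀ e t, 0 ≤ t → t < (n e : ℝ) →
    ∀ᶠ s in 𝓝[>] t, edge e s = edge e t + right e t * (s - t)
  left_spec : ∀ e t, 0 < t → t ≤ (n e : ℝ) →
    ∀ᶠ s in 𝓝[<] t, edge e s = edge e t + left e t * (t - s)

namespace TropFunction

variable {G : Multigraph} {n : G.E → ℕ+}

/-- The order at an interior point of an edge: the sum of the outgoing slopes. -/
def ordAt (f : TropFunction G n) (e : G.E) (t : ℝ) : ℤ := f.right e t + f.left e t

/-- The outgoing slope at the vertex `v` along the edge `e` incident on `v`. -/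
def slope (f : TropFunction G n) (v : G.V) (e : G.E) : ℤ :=
  if v = G.tail e then f.right e 0 else f.left e (n e)

instance : Zero (TropFunction G n) :=
  ⟨⟨0, 0, 0, 0, fun _ => rfl, fun _ => rfl, fun _ _ _ _ => by simp, fun _ _ _ _ => by simp⟩⟩

instance : Neg (TropFunction G n) :=
  ⟨fun f => ⟨-f.vert, -f.edge, -f.right, -f.left,
    fun e => by simp [f.edge_tail], fun e => by simp [f.edge_head],
    fun e t h h' => by
      filter_upwards [f.right_spec e t h h'] with s hs
      simp only [Pi.neg_apply, hs, Int.cast_neg]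
      ring,
    fun e t h h' => by
      filter_upwards [f.left_spec e t h h'] with s hs
      simp only [Pi.neg_apply, hs, Int.cast_neg]
      ring⟩⟩

instance : Add (TropFunction G n) :=
  ⟨fun f g => ⟨f.vert + g.vert, f.edge + g.edge, f.right + g.right, f.left + g.left,
    fun e => by simp [f.edge_tail, g.edge_tail], fun e => by simp [f.edge_head, g.edge_head],
    fun e t h h' => by
      filter_upwards [f.right_spec e t h h', g.right_spec e t h h'] with s hs hs'
      simp only [Pi.add_apply, hs, hs', Int.cast_add]
      ring,
    fun e t h h' => by
      filter_upwards [f.left_spec e t h h', g.left_spec e t h h'] with s hs hs'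
      simp only [Pi.add_apply, hs, hs', Int.cast_add]
      ring⟩⟩

end TropFunction

namespace NodalCurve

variable {κ : Type u} [Field κ] {X₀ : NodalCurve κ} {n : X₀.G.E → ℕ+}

variable (X₀ n) in
/-- A nonzero rational function on `ℭ`. -/
structure ComplexFunction where
  graphPart : TropFunction X₀.G n
  part : ∀ v, (X₀.Z v).K
  part_ne_zero : ∀ v, part v ≠ 0

/-- The coefficients of the divisor of a nonzero rational function on `ℭ`. -/
def ComplexFunction.ord (f : ComplexFunction X₀ n) : ComplexPoint X₀ n → ℤ
  | Sum.inl P => (X₀.Z P.1).ord P.2 (f.part P.1) +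
      X₀.nodeDiv P.1 (f.graphPart.slope P.1) P.2
  | Sum.inr x => f.graphPart.ordAt x.1 x.2

/-- The possible values of `r` in the definition of the `H`-rank of `D`: for every effective
divisor `E` of degree `r` there is a nonzero rational function `f` on `ℭ` with `f_v ∈ H_v`
and `D + div f - E ≥ 0`. -/
def rankSet (D : ComplexDiv X₀ n) (H : ∀ v, Submodule κ (X₀.Z v).K) : Set ℕ :=
  {r | ∀ E : ComplexDiv X₀ n, 0 ≤ E → E.degree = (r : ℤ) →
    ∃ f : ComplexFunction X₀ n, (∀ v, f.part v ∈ H v) ∧ ∀ x, 0 ≤ D x + f.ord x - E x}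

variable (X₀ n) in
/-- A divisor on `ℭ` together with spaces of rational functions on the `Z_v`. -/
structure ComplexPair where
  D : ComplexDiv X₀ n
  H : ∀ v, Submodule κ (X₀.Z v).K

/-- `(D, H)` is a limit linear series of degree `d` and rank `r` on `ℭ`. -/
def ComplexPair.IsLimitSeries (d : ℤ) (r : ℕ) (y : ComplexPair X₀ n) : Prop :=
  y.D.degree = d ∧ (∀ v, Module.finrank κ (y.H v) = r + 1) ∧ IsGreatest (rankSet y.D y.H) r

lemma nodeDiv_zero (v : X₀.G.V) : X₀.nodeDiv v 0 = 0 := by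
  simp [nodeDiv]

lemma nodeDiv_add (v : X₀.G.V) (c c' : X₀.G.E → ℤ) :
    X₀.nodeDiv v (c + c') = X₀.nodeDiv v c + X₀.nodeDiv v c' := by
  unfold nodeDiv
  rw [← Finset.sum_add_distrib]
  refine Finset.sum_congr rfl fun e _ => ?_
  split_ifs <;> simp

lemma nodeDiv_neg (v : X₀.G.V) (c : X₀.G.E → ℤ) :
    X₀.nodeDiv v (-c) = - X₀.nodeDiv v c := by
  rw [eq_neg_iff_add_eq_zero, ← nodeDiv_add, neg_add_cancel, nodeDiv_zero]

namespace ComplexFunction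

instance : One (ComplexFunction X₀ n) := ⟨⟨0, fun _ => 1, fun _ => one_ne_zero⟩⟩

instance : Inv (ComplexFunction X₀ n) :=
  ⟨fun f => ⟨-f.graphPart, fun v => (f.part v)⁻¹, fun v => inv_ne_zero (f.part_ne_zero v)⟩⟩

instance : Mul (ComplexFunction X₀ n) :=
  ⟨fun f g => ⟨f.graphPart + g.graphPart, fun v => f.part v * g.part v,
    fun v => mul_ne_zero (f.part_ne_zero v) (g.part_ne_zero v)⟩⟩

lemma ord_one (x : ComplexPoint X₀ n) : (1 : ComplexFunction X₀ n).ord x = 0 := by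
  rcases x with ⟨v, P⟩ | ⟨e, t⟩
  · have h : (1 : ComplexFunction X₀ n).graphPart.slope v = 0 := by
      funext e
      change (if _ then (0 : ℤ) else 0) = 0
      simp
    change (X₀.Z v).ord P 1 + X₀.nodeDiv v _ P = 0
    rw [h, nodeDiv_zero, SmoothCurve.ord_one]
    rfl
  · rfl

lemma ord_inv (f : ComplexFunction X₀ n) (x : ComplexPoint X₀ n) : f⁻¹.ord x = -f.ord x := by
  rcases x with ⟨v, P⟩ | ⟨e, t⟩
  · have h : f⁻¹.graphPart.slope v = -f.graphPart.slope v := by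
      funext e
      change (if _ then - f.graphPart.right e 0 else - f.graphPart.left e (n e)) =
        - (if _ then f.graphPart.right e 0 else f.graphPart.left e (n e))
      split_ifs <;> rfl
    change (X₀.Z v).ord P (f.part v)⁻¹ + X₀.nodeDiv v _ P =
      - ((X₀.Z v).ord P (f.part v) + X₀.nodeDiv v _ P)
    rw [h, nodeDiv_neg, SmoothCurve.ord_inv _ _ (f.part_ne_zero v), Finsupp.neg_apply]
    ring
  · change -f.graphPart.right e t + -f.graphPart.left e t =
      -(f.graphPart.right e t + f.graphPart.left e t)
    ring

lemma ord_mul (f g : ComplexFunction X₀ n) (x : ComplexPoint X₀ n) :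
    (f * g).ord x = f.ord x + g.ord x := by
  rcases x with ⟨v, P⟩ | ⟨e, t⟩
  · have h : (f * g).graphPart.slope v = f.graphPart.slope v + g.graphPart.slope v := by
      funext e
      change (if _ then f.graphPart.right e 0 + g.graphPart.right e 0
          else f.graphPart.left e (n e) + g.graphPart.left e (n e)) =
        (if _ then f.graphPart.right e 0 else f.graphPart.left e (n e)) +
          (if _ then g.graphPart.right e 0 else g.graphPart.left e (n e))
      split_ifs <;> rfl
    change (X₀.Z v).ord P (f.part v * g.part v) + X₀.nodeDiv v _ P =
      ((X₀.Z v).ord P (f.part v) + X₀.nodeDiv v _ P) +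
        ((X₀.Z v).ord P (g.part v) + X₀.nodeDiv v _ P)
    rw [h, nodeDiv_add, SmoothCurve.ord_mul _ _ (f.part_ne_zero v) (g.part_ne_zero v),
      Finsupp.add_apply]
    ring
  · change (f.graphPart.right e t + g.graphPart.right e t) +
        (f.graphPart.left e t + g.graphPart.left e t) =
      (f.graphPart.right e t + f.graphPart.left e t) +
        (g.graphPart.right e t + g.graphPart.left e t)
    ring

end ComplexFunction

/-- Equivalence of pairs: `D' = D + div f` and `H_v = H'_v · f_v` for a nonzero rational function
`f` on `ℭ`. -/
instance : Setoid (ComplexPair X₀ n) where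
  r y y' := ∃ f : ComplexFunction X₀ n, (∀ x, y'.D x = y.D x + f.ord x) ∧
    ∀ v, y.H v = (X₀.Z v).mulBy (y'.H v) (f.part v)
  iseqv :=
    { refl := fun y => ⟨1, fun x => by rw [ComplexFunction.ord_one, add_zero],
        fun v => ((X₀.Z v).mulBy_one _).symm⟩
      symm := by
        rintro y y' ⟨f, hD, hH⟩
        refine ⟨f⁻¹, fun x => by rw [ComplexFunction.ord_inv, hD]; ring, fun v => ?_⟩
        rw [hH, SmoothCurve.mulBy_mulBy]
        change _ = (X₀.Z v).mulBy _ (f.part v * (f.part v)⁻¹)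
        rw [mul_inv_cancel₀ (f.part_ne_zero v), SmoothCurve.mulBy_one]
      trans := by
        rintro y y' y'' ⟨f, hD, hH⟩ ⟨g, hD', hH'⟩
        refine ⟨g * f, fun x => by rw [ComplexFunction.ord_mul, hD', hD]; ring, fun v => ?_⟩
        rw [hH, hH', SmoothCurve.mulBy_mulBy]
        rfl }

variable (X₀ n) in
/-- The set `𝔊^r_d(ℭ)` of limit linear series of degree `d` and rank `r` on `ℭ`. -/
def LimitSpace (d : ℤ) (r : ℕ) : Type u :=
  Quotient (Setoid.comap
    (Subtype.val : {y : ComplexPair X₀ n // y.IsLimitSeries d r} → ComplexPair X₀ n)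
    inferInstance)

/-- The class of a limit linear series. -/
def LimitSpace.mk {d : ℤ} {r : ℕ} (y : ComplexPair X₀ n) (hy : y.IsLimitSeries d r) :
    LimitSpace X₀ n d r := Quotient.mk _ ⟨y, hy⟩

/-- The set `𝔊^r_d(ℭ, w₀)` of limit linear series of multidegree `w₀`. -/
def limitsOfMultidegree (d : ℤ) (r : ℕ) (w₀ : AdmMultideg X₀.G n) : Set (LimitSpace X₀ n d r) :=
  {q | ∃ y hy, q = LimitSpace.mk y hy ∧ y.D.IsOfMultidegree w₀}

/-! ### The forgetful map -/

/-- The pair `y = (D, H)` is obtained from the tuple `x` by the choice of nonzero sections `s_v` of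
`V_v` and of `w ∈ V(G(w₀))`: `D` is of multidegree `w`, `D_v = div⁰(s_v) - D^v_{w, w_v}`, and
`H_v = {s / s_v | s ∈ V_v}`. -/
def IsForgetfulImage (wt : X₀.G.V → AdmMultideg X₀.G n) (x : SheafTuple X₀)
    (s : ∀ v, (X₀.Z v).K) (w : AdmMultideg X₀.G n) (y : ComplexPair X₀ n) : Prop :=
  y.D.IsOfMultidegree w ∧
  (∀ v P, ComplexDiv.part y.D v P =
    ((X₀.Z v).ord P (s v) + x.D v P) - twistDiv w (wt v) v P) ∧
  ∀ v, y.H v = (X₀.Z v).mulBy (x.V v) (s v)⁻¹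

/-- `F` is the forgetful map `𝔉_{(w_v)_v}`: for every pre-limit linear series and every choice of
sections `s_v` and of `w ∈ V(G(w₀))`, the construction yields a limit linear series, whose class
is the value of `F`. (This determines `F`.) -/
def IsForgetfulMap {d : ℤ} {r : ℕ} (w₀ : AdmMultideg X₀.G n) (wt : X₀.G.V → AdmMultideg X₀.G n)
    (F : PreLimitSpace wt r → LimitSpace X₀ n d r) : Prop :=
  ∀ (x : SheafTuple X₀) (hx : IsPreLimit wt r x) (s : ∀ v, (X₀.Z v).K),
    (∀ v, s v ∈ x.V v ∧ s v ≠ 0) → ∀ w ∈ w₀.orbit,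
      (∃ y, IsForgetfulImage wt x s w y) ∧
      ∀ y, IsForgetfulImage wt x s w y →
        ∃ hy : y.IsLimitSeries d r, F (PreLimitSpace.mk x hx) = LimitSpace.mk y hy

end NodalCurve

end LimitLinear

end

open LimitLinear LimitLinear.NodalCurve

/-! Everything is expressed through potentials. Twisting once at every vertex changes nothing, so
the multidegrees obtained from `w₀` are the `w₀.state c` for integral potentials `c` on the
vertices, unique up to constants (`state_eq_iff`). What `v` gains along an edge depends only on the
difference of `c` between the ends, through the ceiling expression `drop`, which is decreasing and
makes sense for real differences too. This gives closed formulas for D^v_{w,w'} and D_i^{e,v}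
(`twistDiv_state_state`, `chipDiv_eq`). Concentration on `v` is used only through `IsUnfireable`,
which yields a maximum principle (`IsUnfireable.sub_le_sub`): a real potential with nonnegative
degrees away from `v` drops from `v` to every other vertex at least as much as an unfireable one.

The core is `isPreLimit_toTuple_iff`: a pair (D, H) of multidegree `w₀` is a limit linear series if
and only if the sheaves 𝒪(D_v + D^v_{w₀,w_v}) with the spaces H_v form a pre-limit linear series. By
`isPreLimit_iff` the condition on multivanishing sequences becomes `EdgeCondition`: for each edge
{v, u} of the tree and each integer s, the sections at v compatible with a drop of s + 1 from v to
u, and the sections at u compatible with a drop of s, have dimensions adding up to at least r + 1.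

Necessity. Let f be a rational function on ℭ with D + div f - E effective. Its slopes at the
vertices are bounded by `drop` of the differences of its vertex values (`slope_le_drop`, a convexity
argument). As principal divisors on Z_v have degree zero, the vertex values form a real potential
with nonnegative degrees, to which the maximum principle applies. If some H_v were too large for its
sheaf, or an edge inequality failed, general points on one or two components would give an E of
degree r admitting no such f; for an edge, f drops either by more than s or by at most s, and both
cases are excluded.

Sufficiency (`EdgeCondition.mem_rankSet`). Given E of degree r, one finds for each edge {v, u} of
the tree a real drop at which the sections surviving at v have codimension at most the degree of E
beyond that edge, and likewise at u (`EdgeCondition.exists_split`). On a tree these drops are the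
differences of a potential. At v the codimensions then leave a space of dimension greater than deg
E_v, so a nonzero section vanishes along E_v. A function on Γ with the chosen vertex values that
absorbs the points of E inside the edges exists by `TropFunction.exists_of_vert`.

Two equivalent pairs of the same multidegree differ by a function whose Γ-part is harmonic, hence
has no slopes at the vertices, so they differ only by functions on the components; this is
injectivity of the forgetful map.

Reduced potentials are built from the leaves towards `v`, and unfireability on G is translated into
the chip-firing condition on the subdivision (`isReducedAt_state_iff`). If every reduced multidegree
is nonnegative at its own vertex, the reduced tuple satisfies `TightPotentials`
(`tightPotentials_of_reduced`) and the above applies to it; otherwise the spaces of pre-limit series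
are empty for the reduced tuple and for every tight one. The map 𝔍 is the composite of one forgetful
map with the inverse of the other. Weak glueing is preserved because passing between the tuples only
shifts the filtrations of H_v by constants, the additional steps having zero graded pieces. -/

noncomputable section
namespace LimitLinear

/-! ### Local rings, global functions and residue fields of a smooth proper curve -/

namespace SmoothCurve

variable {κ : Type u} [Field κ] (C : SmoothCurve κ)

instance isDVR_stalk (P : C.Pt) : IsDiscreteValuationRing (C.X.presheaf.stalk P.1) := C.isDVR P.1 P.2

instance : CompactSpace C.X := (quasiCompact_iff_compactSpace C.str).mp inferInstance

instance : AlgebraicGeometry.IsNoetherian C.X := {}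

/-- A discrete valuation ring has Krull dimension one. At points of codimension one `Scheme.ord` is
given by `Ring.ordFrac` of the local ring. -/
lemma coheight_eq_one (P : C.Pt) : Order.coheight P.1 = 1 := by
  have h1 := ringKrullDim_stalk_eq_coheight P.1
  have h2 : ringKrullDim (C.X.presheaf.stalk P.1) = 1 :=
    IsDiscreteValuationRing.ringKrullDim_eq_one _
  rw [h2] at h1
  exact_mod_cast h1.symm

lemma ord_eq_iff (P : C.Pt) {f : C.K} (hf : f ≠ 0) (m : ℤ) :
    C.ord P f = m ↔ Ring.ordFrac (C.X.presheaf.stalk P.1) f = WithZero.exp m :=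
  Scheme.ord_eq_iff (C.coheight_eq_one P) hf

lemma ord_algebraMap_nonneg (P : C.Pt) (a : C.X.presheaf.stalk P.1) (ha : a ≠ 0) :
    0 ≤ C.ord P (algebraMap _ C.K a) := by
  have h0 : algebraMap (C.X.presheaf.stalk P.1) C.K a ≠ 0 := by
    simpa using ha
  have := Ring.ordFrac_ge_one_of_ne_zero (K := C.K) ha
  rw [ord, Scheme.le_ord_iff (C.coheight_eq_one P) h0]
  exact this

lemma ord_algebraMap_eq_zero_iff (P : C.Pt) (a : C.X.presheaf.stalk P.1) (ha : a ≠ 0) :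
    C.ord P (algebraMap _ C.K a) = 0 ↔ IsUnit a := by
  have h0 : algebraMap (C.X.presheaf.stalk P.1) C.K a ≠ 0 := by
    simpa using ha
  rw [C.ord_eq_iff P h0, Ring.isUnit_iff_ordFrac_one_of_isDiscreteValuationRing (K := C.K)]
  rfl

lemma ord_nonneg_iff (P : C.Pt) {f : C.K} (hf : f ≠ 0) :
    0 ≤ C.ord P f ↔ ∃ a, algebraMap (C.X.presheaf.stalk P.1) C.K a = f := by
  constructor
  · intro h
    rcases ValuationRing.isInteger_or_isInteger (C.X.presheaf.stalk P.1) f with ⟨a, ha⟩ | ⟨a, ha⟩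
    · exact ⟨a, ha⟩
    · have a0 : a ≠ 0 := by
        rintro rfl
        rw [map_zero] at ha
        exact inv_ne_zero hf ha.symm
      have h1 := C.ord_algebraMap_nonneg P a a0
      rw [ha, C.ord_inv P hf] at h1
      have h2 : C.ord P (algebraMap _ C.K a) = 0 := by
        rw [ha, C.ord_inv P hf]; omega
      obtain ⟨u, rfl⟩ := (C.ord_algebraMap_eq_zero_iff P a a0).1 h2
      refine ⟨(u⁻¹ : (C.X.presheaf.stalk P.1)ˣ), ?_⟩
      have h3 : algebraMap (C.X.presheaf.stalk P.1) C.K u *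
          algebraMap (C.X.presheaf.stalk P.1) C.K (u⁻¹ : (C.X.presheaf.stalk P.1)ˣ) = 1 := by
        rw [← map_mul, Units.mul_inv, map_one]
      rw [ha] at h3
      field_simp at h3
      exact h3
  · rintro ⟨a, rfl⟩
    exact C.ord_algebraMap_nonneg P a (by rintro rfl; simp at hf)

lemma exists_ord_eq_one (P : C.Pt) : ∃ t : C.K, t ≠ 0 ∧ C.ord P t = 1 := by
  obtain ⟨ϖ, hϖ⟩ := IsDiscreteValuationRing.exists_irreducible (C.X.presheaf.stalk P.1)
  have h0 : algebraMap (C.X.presheaf.stalk P.1) C.K ϖ ≠ 0 := by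
    simpa using hϖ.ne_zero
  exact ⟨_, h0, (C.ord_eq_iff P h0 1).2 (Ring.ordFrac_irreducible hϖ)⟩

lemma algebraMap_eq (c : κ) : algebraMap κ C.K c = C.X.germToFunctionField ⊤ (C.const c) := rfl

lemma ord_algebraMap (P : C.Pt) {c : κ} (hc : c ≠ 0) : C.ord P (algebraMap κ C.K c) = 0 := by
  rw [algebraMap_eq]
  exact Scheme.ord_of_isUnit ((IsUnit.mk0 c hc).map C.const) trivial

lemma exists_isClosed_point_mem {Z : Set C.X} (hZ : IsClosed Z) (hne : Z.Nonempty) :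
    ∃ P : C.Pt, P.1 ∈ Z := by
  obtain ⟨x, hx, hx'⟩ := hZ.exists_closed_singleton hne
  exact ⟨⟨x, hx'⟩, hx⟩

/-- The set has finitely many irreducible components, and each contains at most one closed point: a
closed point different from the generic point of its component would start a chain of length two up
to the generic point of the curve, against codimension one. -/
lemma finite_setOf_mem_isClosed {Z : Set C.X} (hZ : IsClosed Z) (hη : genericPoint C.X ∉ Z) :
    {P : C.Pt | P.1 ∈ Z}.Finite := by
  obtain ⟨S, hS, hcl, hirr, rfl⟩ :=
    TopologicalSpace.NoetherianSpace.exists_finite_set_isClosed_irreducible hZ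
  have h : {P : C.Pt | P.1 ∈ ⋃₀ S} = ⋃ T ∈ S, {P : C.Pt | P.1 ∈ T} := by
    ext P; simp
  rw [h]
  refine hS.biUnion fun T hT => Set.Subsingleton.finite ?_
  obtain ⟨z, hz⟩ := QuasiSober.sober (hirr T hT) (hcl T hT)
  have key : ∀ P : C.Pt, P.1 ∈ T → P.1 = z := by
    intro P hP
    have h1 : P.1 ≤ z := hz.specializes hP
    have hzT : z ∈ T := hz.mem
    by_contra hne
    have h2 : P.1 < z := lt_iff_le_not_ge.2
      ⟨h1, fun h => hne ((Specializes.antisymm h1 h).eq.symm)⟩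
    have h3 : z < ⊤ := lt_iff_le_not_ge.2 ⟨le_top, fun h =>
      hη ⟨T, hT, Specializes.mem_closed h (hcl T hT) hzT⟩⟩
    have h4 := Order.coheight_add_one_le h2
    have h5 := Order.coheight_add_one_le h3
    rw [C.coheight_eq_one P] at h4
    have h6 : (0 + 1) + 1 ≤ (1 : ℕ∞) := le_trans (by gcongr; exact le_trans (by gcongr; simp) h5) h4
    norm_num at h6
  intro P hP Q hQ
  exact Subtype.ext ((key P hP).trans (key Q hQ).symm)

lemma finite_ord_ne_zero {f : C.K} (hf : f ≠ 0) : {P | C.ord P f ≠ 0}.Finite := by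
  obtain ⟨U, -, g, hU, rfl, hg⟩ := exists_isUnit_germ_eq C.X f hf
  refine (C.finite_setOf_mem_isClosed (Z := (U : Set C.X)ᶜ) U.isOpen.isClosed_compl ?_).subset ?_
  · simpa using ((genericPoint_spec C.X).mem_open_set_iff U.isOpen).mpr (by simpa using hU)
  · intro P hP hPU
    exact hP (Scheme.ord_of_isUnit hg hPU)

lemma exists_mem_opens_germ_eq (P : C.Pt) {f : C.K} (h : f ≠ 0 → 0 ≤ C.ord P f) :
    ∃ (U : C.X.Opens) (_ : P.1 ∈ U) (_ : Nonempty U) (g : Γ(C.X, U)),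
      C.X.germToFunctionField U g = f := by
  obtain ⟨a, rfl⟩ : ∃ a, algebraMap (C.X.presheaf.stalk P.1) C.K a = f := by
    by_cases hf : f = 0
    · exact ⟨0, by rw [hf, map_zero]⟩
    · exact (C.ord_nonneg_iff P hf).1 (h hf)
  obtain ⟨U, hU, g, rfl⟩ := C.X.presheaf.exists_germ_eq a
  have : Nonempty U := ⟨⟨_, hU⟩⟩
  exact ⟨U, hU, this, g, (Scheme.algebraMap_germ_eq_germToFunctionField C.X hU g).symm⟩

/-- Near each closed point `f` is a section. These sections agree on overlaps because they do at the
generic point, and their domains cover the curve because every nonempty closed set contains a closed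
point. -/
lemma exists_global_of_ord_nonneg {f : C.K} (h : f ≠ 0 → ∀ P, 0 ≤ C.ord P f) :
    ∃ g : Γ(C.X, ⊤), C.X.germToFunctionField ⊤ g = f := by
  choose U hU hne g hg using fun P : C.Pt => C.exists_mem_opens_germ_eq P fun hf => h hf P
  have hcov : (⊤ : C.X.Opens) ≤ iSup U := by
    rintro x -
    by_contra hx
    obtain ⟨P, hP⟩ := C.exists_isClosed_point_mem
      (Z := ((iSup U : C.X.Opens) : Set C.X)ᶜ) (iSup U).isOpen.isClosed_compl ⟨x, hx⟩
    exact hP (TopologicalSpace.Opens.mem_iSup.2 ⟨P, hU P⟩)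
  have hη : ∀ V : C.X.Opens, Nonempty V → genericPoint C.X ∈ V := fun V hV =>
    ((genericPoint_spec C.X).mem_open_set_iff V.isOpen).mpr (by simpa using hV)
  obtain ⟨s, hs, -⟩ := C.X.sheaf.existsUnique_gluing' U ⊤ (fun P => homOfLE le_top) hcov g (by
    intro P Q
    have hPQ : genericPoint C.X ∈ U P ⊓ U Q := ⟨hη _ (hne P), hη _ (hne Q)⟩
    apply germ_injective_of_isIntegral C.X (genericPoint C.X) hPQ
    have e1 := C.X.presheaf.germ_res_apply (TopologicalSpace.Opens.infLELeft (U P) (U Q)) _ hPQ (g P)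
    have e2 := C.X.presheaf.germ_res_apply (TopologicalSpace.Opens.infLERight (U P) (U Q)) _ hPQ (g Q)
    exact (e1.trans (hg P)).trans (e2.trans (hg Q)).symm)
  obtain ⟨P, -⟩ := C.exists_isClosed_point_mem (Z := Set.univ) isClosed_univ ⟨genericPoint C.X, trivial⟩
  refine ⟨s, ?_⟩
  have e := C.X.presheaf.germ_res_apply (homOfLE le_top : U P ⟶ ⊤) _ (hη _ (hne P)) s
  rw [← hg P]
  exact e.symm.trans (congrArg _ (hs P))

/-- Properness makes the global functions integral over `κ`, and an integral domain that is integral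
over an algebraically closed field equals it. -/
lemma const_bijective [IsAlgClosed κ] : Function.Bijective C.const := by
  refine IsAlgClosed.ringHom_bijective_of_isIntegral _ ?_
  apply RingHom.IsIntegral.trans
  · exact RingHom.isIntegral_of_surjective _
      (ConcreteCategory.bijective_of_isIso (Scheme.ΓSpecIso (CommRingCat.of κ)).inv).2
  · exact isIntegral_appTop_of_universallyClosed C.str

lemma exists_const_of_ord_nonneg [IsAlgClosed κ] {f : C.K} (h : f ≠ 0 → ∀ P, 0 ≤ C.ord P f) :
    ∃ c : κ, algebraMap κ C.K c = f := by
  obtain ⟨g, rfl⟩ := C.exists_global_of_ord_nonneg h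
  obtain ⟨c, rfl⟩ := C.const_bijective.2 g
  exact ⟨c, rfl⟩

lemma exists_const_eq_residue [IsAlgClosed κ] (P : C.Pt) (a : C.X.presheaf.stalk P.1) :
    ∃ c : κ, C.X.residue P.1 a =
      C.X.residue P.1 (C.X.presheaf.germ ⊤ P.1 trivial (C.const c)) := by
  have key : (residueFieldIsoBase C.str P.1 P.2).inv =
      (Scheme.ΓSpecIso (CommRingCat.of κ)).inv ≫ C.str.appTop ≫
        C.X.presheaf.germ ⊤ P.1 trivial ≫ C.X.residue P.1 := by
    apply Spec.map_injective
    rw [SpecMap_residueFieldIsoBase_inv]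
    simp only [Spec.map_comp, Category.assoc]
    have e2 : Spec.map (C.X.presheaf.germ ⊤ P.1 trivial) ≫ Spec.map C.str.appTop ≫
        Spec.map (Scheme.ΓSpecIso (CommRingCat.of κ)).inv = C.X.fromSpecStalk P.1 ≫ C.str := by
      rw [← Scheme.fromSpecStalk_toSpecΓ, Category.assoc, ← Category.assoc C.X.toSpecΓ,
        ← Scheme.toSpecΓ_naturality, Category.assoc, toSpecΓ_SpecMap_ΓSpecIso_inv,
        Category.comp_id]
    rw [e2]
    rfl
  obtain ⟨c, hc⟩ := (ConcreteCategory.bijective_of_isIso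
    (residueFieldIsoBase C.str P.1 P.2).inv).2 (C.X.residue P.1 a)
  refine ⟨c, ?_⟩
  rw [← hc, key]
  rfl

/-- The constant is the value of `f` at `P`, the residue field being `κ`. Subtracting leading terms
in this way is the source of all dimension estimates on the curve. -/
lemma exists_leading [IsAlgClosed κ] (P : C.Pt) {f : C.K} (hf : f ≠ 0) (h : 0 ≤ C.ord P f) :
    ∃ c : κ, f - algebraMap κ C.K c ≠ 0 → 0 < C.ord P (f - algebraMap κ C.K c) := by
  obtain ⟨a, rfl⟩ := (C.ord_nonneg_iff P hf).1 h
  obtain ⟨c, hc⟩ := C.exists_const_eq_residue P a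
  refine ⟨c, fun h0 => ?_⟩
  have e : algebraMap (C.X.presheaf.stalk P.1) C.K
      (a - C.X.presheaf.germ ⊤ P.1 trivial (C.const c)) =
      algebraMap (C.X.presheaf.stalk P.1) C.K a - algebraMap κ C.K c := by
    rw [map_sub]
    congr 1
    exact Scheme.algebraMap_germ_eq_germToFunctionField C.X (U := ⊤) (x := P.1) trivial (C.const c)
  rw [← e] at h0 ⊢
  set b := a - C.X.presheaf.germ ⊤ P.1 trivial (C.const c)
  have b0 : b ≠ 0 := by
    intro hb
    rw [hb, map_zero] at h0
    exact h0 rfl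
  refine lt_of_le_of_ne (C.ord_algebraMap_nonneg P b b0) fun hb => ?_
  have hu := (C.ord_algebraMap_eq_zero_iff P b b0).1 hb.symm
  have : C.X.residue P.1 b = 0 := by rw [map_sub, hc, sub_self]
  exact (hu.map (C.X.residue P.1).hom).ne_zero this

instance : C.X.IsSeparated := ⟨by
  rw [Limits.terminal.comp_from C.str |>.symm]
  infer_instance⟩

/-- Separatedness: if the local ring at `P` lies in the one at `Q`, the resulting morphism Spec 𝒪_Q
→ Spec 𝒪_P → X agrees with the canonical one at the generic point, hence everywhere. So `Q`
specializes to `P`, and `Q` is closed. -/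
lemma eq_of_ord_nonneg_imp {P Q : C.Pt} (h : ∀ f : C.K, f ≠ 0 → 0 ≤ C.ord P f → 0 ≤ C.ord Q f) :
    P = Q := by
  have h1 : ∀ a : C.X.presheaf.stalk P.1, ∃ b : C.X.presheaf.stalk Q.1,
      algebraMap _ C.K b = algebraMap _ C.K a := by
    intro a
    by_cases ha : a = 0
    · exact ⟨0, by rw [ha, map_zero, map_zero]⟩
    · have h0 : algebraMap (C.X.presheaf.stalk P.1) C.K a ≠ 0 := by simpa using ha
      exact (C.ord_nonneg_iff Q h0).1 (h _ h0 (C.ord_algebraMap_nonneg P a ha))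
  choose φ hφ using h1
  have inj : Function.Injective (algebraMap (C.X.presheaf.stalk Q.1) C.K) :=
    IsFractionRing.injective _ _
  let ψ : C.X.presheaf.stalk P.1 →+* C.X.presheaf.stalk Q.1 :=
    { toFun := φ
      map_one' := inj (by rw [hφ, map_one, map_one])
      map_zero' := inj (by rw [hφ, map_zero, map_zero])
      map_mul' := fun a b => inj (by rw [hφ, map_mul, map_mul, hφ, hφ])
      map_add' := fun a b => inj (by rw [hφ, map_add, map_add, hφ, hφ]) }
  have sQ := (genericPoint_spec C.X).specializes (Set.mem_univ Q.1)
  have sP := (genericPoint_spec C.X).specializes (Set.mem_univ P.1)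
  have hcomp : CommRingCat.ofHom ψ ≫ C.X.presheaf.stalkSpecializes sQ =
      C.X.presheaf.stalkSpecializes sP := by
    ext a
    exact hφ a
  have hdom : IsDominant (Spec.map (C.X.presheaf.stalkSpecializes sQ)) := by
    constructor
    refine (PrimeSpectrum.denseRange_comap_iff_ker_le_nilRadical _).2 ?_
    intro x hx
    have : x = 0 := inj ((RingHom.mem_ker.1 hx).trans (map_zero _).symm)
    rw [this]
    exact zero_mem _
  have e : Spec.map (CommRingCat.ofHom ψ) ≫ C.X.fromSpecStalk P.1 = C.X.fromSpecStalk Q.1 := by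
    apply ext_of_isDominant (Spec.map (C.X.presheaf.stalkSpecializes sQ))
    rw [← Category.assoc, ← Spec.map_comp, hcomp, Scheme.SpecMap_stalkSpecializes_fromSpecStalk,
      Scheme.SpecMap_stalkSpecializes_fromSpecStalk]
  have hQ : Q.1 ∈ Set.range (C.X.fromSpecStalk P.1) := by
    refine ⟨Spec.map (CommRingCat.ofHom ψ) (IsLocalRing.closedPoint _), ?_⟩
    refine (Scheme.Hom.comp_apply _ _ _).symm.trans ?_
    rw [e]
    exact Scheme.fromSpecStalk_closedPoint
  rw [Scheme.range_fromSpecStalk] at hQ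
  have hQP : Q.1 ⤳ P.1 := hQ
  have : P.1 ∈ ({Q.1} : Set C.X) := hQP.mem_closed Q.2 rfl
  exact Subtype.ext this

end SmoothCurve
-- Induction over effective divisors
lemma finsupp_nonneg_induction {α : Type*} {p : (α →₀ ℤ) → Prop} (h0 : p 0)
    (hadd : ∀ (D : α →₀ ℤ) (P : α), 0 ≤ D → p D → p (D + Finsupp.single P 1)) :
    ∀ D : α →₀ ℤ, 0 ≤ D → p D := by
  suffices h : ∀ (k : ℕ) (D : α →₀ ℤ), 0 ≤ D → D.degree = k → p D by
    intro D hD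
    have h1 : 0 ≤ D.degree := Finset.sum_nonneg fun P _ => hD P
    exact h D.degree.toNat D hD (Int.toNat_of_nonneg h1).symm
  intro k
  induction k with
  | zero =>
    intro D hD hd
    have : D = 0 := by
      ext P
      by_contra hP
      have h1 : D P ≤ D.degree :=
        Finset.single_le_sum (fun Q _ => hD Q) (Finsupp.mem_support_iff.2 hP)
      have h2 := hD P
      simp only [Finsupp.coe_zero, Pi.zero_apply] at h2 hP
      simp at hd
      omega
    rw [this]
    exact h0
  | succ k ih =>
    intro D hD hd
    obtain ⟨P, hP⟩ : ∃ P, D P ≠ 0 := by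
      by_contra! hcon
      have : D = 0 := by ext P; exact hcon P
      rw [this, map_zero] at hd
      push_cast at hd
      omega
    have hP' : 1 ≤ D P := by
      have := hD P
      simp only [Finsupp.coe_zero, Pi.zero_apply] at this
      omega
    have hE : 0 ≤ D - Finsupp.single P 1 := by
      intro Q
      have := hD Q
      simp only [Finsupp.coe_zero, Pi.zero_apply, Finsupp.coe_sub, Pi.sub_apply] at this ⊢
      by_cases hQ : P = Q
      · subst hQ; simp; omega
      · rw [Finsupp.single_eq_of_ne (Ne.symm hQ)]; omega
    have := hadd _ P hE (ih _ hE (by rw [map_sub, hd, Finsupp.degree_single]; push_cast; ring))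
    rwa [sub_add_cancel] at this

namespace SmoothCurve

variable {κ : Type u} [Field κ] (C : SmoothCurve κ)

/-! ### Orders and spaces of functions with prescribed orders -/

lemma ord_zero (P : C.Pt) : C.ord P 0 = 0 := by
  rw [ord, Scheme.ord_zero]; rfl

lemma ord_neg (P : C.Pt) (f : C.K) : C.ord P (-f) = C.ord P f := by
  by_cases hf : f = 0
  · rw [hf, neg_zero]
  have h : -f = algebraMap κ C.K (-1) * f := by rw [map_neg, map_one, neg_one_mul]
  rw [h, C.ord_mul P (by simp) hf, C.ord_algebraMap P (by simp), zero_add]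

lemma ord_pow (P : C.Pt) {f : C.K} (hf : f ≠ 0) (k : ℕ) : C.ord P (f ^ k) = k * C.ord P f := by
  induction k with
  | zero => simp [C.ord_one]
  | succ k ih => rw [pow_succ, C.ord_mul P (pow_ne_zero k hf) hf, ih]; push_cast; ring

lemma ord_zpow (P : C.Pt) {f : C.K} (hf : f ≠ 0) (k : ℤ) : C.ord P (f ^ k) = k * C.ord P f := by
  obtain ⟨m, rfl | rfl⟩ := k.eq_nat_or_neg
  · rw [zpow_natCast, C.ord_pow P hf]
  · rw [zpow_neg, zpow_natCast, C.ord_inv P (pow_ne_zero m hf), C.ord_pow P hf]; ring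

lemma add_ne_zero_of_ord_lt {P : C.Pt} {f g : C.K} (h : C.ord P f < C.ord P g) : f + g ≠ 0 := by
  intro h0
  rw [eq_neg_of_add_eq_zero_left h0, C.ord_neg] at h
  exact lt_irrefl _ h

lemma ord_add_of_lt {P : C.Pt} {f g : C.K} (hf : f ≠ 0) (h : C.ord P f < C.ord P g) :
    C.ord P (f + g) = C.ord P f := by
  have h0 := C.add_ne_zero_of_ord_lt h
  have h1 := C.min_ord_le_ord_add P h0
  have h2 := C.min_ord_le_ord_add P (f := f + g) (g := -g) (by simpa using hf)
  rw [C.ord_neg, add_neg_cancel_right] at h2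
  rcases min_le_iff.1 h1 with h3 | h3 <;> rcases min_le_iff.1 h2 with h4 | h4 <;> omega

lemma ord_smul (P : C.Pt) {c : κ} (hc : c ≠ 0) (f : C.K) : C.ord P (c • f) = C.ord P f := by
  by_cases hf : f = 0
  · rw [hf, smul_zero]
  rw [Algebra.smul_def, C.ord_mul P (by simpa using hc) hf, C.ord_algebraMap P hc, zero_add]

/-- The functions of order at least `z P` at the points `P` of `S`. -/
def ordGe (S : Set C.Pt) (z : C.Pt → ℤ) : Submodule κ C.K where
  carrier := {f | f ≠ 0 → ∀ P ∈ S, z P ≤ C.ord P f}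
  zero_mem' := fun h => absurd rfl h
  add_mem' := by
    intro f g hf hg h P hP
    by_cases f0 : f = 0
    · subst f0
      rw [zero_add] at h ⊢
      exact hg h P hP
    by_cases g0 : g = 0
    · subst g0
      rw [add_zero] at h ⊢
      exact hf h P hP
    exact (le_min (hf f0 P hP) (hg g0 P hP)).trans (C.min_ord_le_ord_add P h)
  smul_mem' := by
    intro c f hf h P hP
    have hc : c ≠ 0 := by
      rintro rfl
      exact h (zero_smul _ _)
    rw [C.ord_smul P hc]
    exact hf (by rintro rfl; exact h (smul_zero _)) P hP

lemma mem_H0 {D : C.Div} {f : C.K} : f ∈ C.H0 D ↔ (f ≠ 0 → ∀ P, 0 ≤ C.ord P f + D P) := Iff.rfl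

lemma H0_mono {D D' : C.Div} (h : D ≤ D') : C.H0 D ≤ C.H0 D' := fun f hf h0 P => by
  have h1 := hf h0 P
  have h2 := h P
  omega

lemma mem_mulBy {V : Submodule κ C.K} {f g : C.K} : g ∈ C.mulBy V f ↔ ∃ h ∈ V, h * f = g := by
  simp [mulBy, Submodule.mem_map]

lemma finrank_mulBy (V : Submodule κ C.K) {f : C.K} (hf : f ≠ 0) :
    Module.finrank κ (C.mulBy V f) = Module.finrank κ V :=
  (LinearEquiv.finrank_eq (Submodule.equivMapOfInjective (LinearMap.mulRight κ f)
    (fun _ _ h => mul_right_cancel₀ hf h) V)).symm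

/-- The principal divisor of a rational function. -/
def div (f : C.K) : C.Div :=
  if hf : f = 0 then 0 else Finsupp.ofSupportFinite (fun P => C.ord P f) (C.finite_ord_ne_zero hf)

lemma div_apply (f : C.K) (P : C.Pt) : C.div f P = C.ord P f := by
  unfold div
  split_ifs with h
  · rw [h, C.ord_zero]; rfl
  · rfl

/-! ### Dimension estimates -/

lemma exists_smul_ord_lt [IsAlgClosed κ] (P : C.Pt) {f g : C.K} (hf : f ≠ 0) (hg : g ≠ 0)
    (h : C.ord P g ≤ C.ord P f) :
    ∃ c : κ, f - c • g ≠ 0 → C.ord P g < C.ord P (f - c • g) := by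
  have h1 : C.ord P (f / g) = C.ord P f - C.ord P g := by
    rw [div_eq_mul_inv, C.ord_mul P hf (inv_ne_zero hg), C.ord_inv P hg]; ring
  obtain ⟨c, hc⟩ := C.exists_leading P (div_ne_zero hf hg) (by omega)
  refine ⟨c, fun h0 => ?_⟩
  have h2 : f - c • g = (f / g - algebraMap κ C.K c) * g := by
    rw [sub_mul, div_mul_cancel₀ _ hg, Algebra.smul_def]
  rw [h2] at h0 ⊢
  have h3 := left_ne_zero_of_mul h0
  rw [C.ord_mul P h3 hg]
  have := hc h3
  omega

/-- If one more zero at `P` is a genuine condition, some `g` has the minimal order allowed at `P`,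
and a suitable multiple of `g` cancels the leading term at `P` of any other element. -/
lemma finrank_inf_H0_le_add_one [IsAlgClosed κ] (U : Submodule κ C.K) [FiniteDimensional κ U]
    (D : C.Div) (P : C.Pt) :
    Module.finrank κ ↥(U ⊓ C.H0 D) ≤
      Module.finrank κ ↥(U ⊓ C.H0 (D - Finsupp.single P 1)) + 1 := by
  have hfin : ∀ W : Submodule κ C.K, FiniteDimensional κ ↥(U ⊓ W) := fun W =>
    Submodule.finiteDimensional_of_le inf_le_left
  by_cases h : U ⊓ C.H0 D ≤ U ⊓ C.H0 (D - Finsupp.single P 1)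
  · have := hfin (C.H0 (D - Finsupp.single P 1))
    exact (Submodule.finrank_mono h).trans (Nat.le_succ _)
  obtain ⟨g, hg, hg'⟩ := SetLike.not_le_iff_exists.1 h
  have g0 : g ≠ 0 := by
    rintro rfl
    exact hg' (zero_mem _)
  have hgP : C.ord P g + D P ≤ 0 := by
    by_contra hlt
    refine hg' ⟨hg.1, fun _ Q => ?_⟩
    have := hg.2 g0 Q
    rw [Finsupp.sub_apply]
    by_cases hQ : P = Q
    · subst hQ; rw [Finsupp.single_eq_same]; omega
    · rw [Finsupp.single_eq_of_ne (Ne.symm hQ)]; omega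
  have key : U ⊓ C.H0 D ≤ (U ⊓ C.H0 (D - Finsupp.single P 1)) ⊔ Submodule.span κ {g} := by
    intro f hf
    by_cases f0 : f = 0
    · rw [f0]; exact zero_mem _
    have h1 := hf.2 f0 P
    obtain ⟨c, hc⟩ := C.exists_smul_ord_lt P f0 g0 (by omega)
    have h2 : f - c • g ∈ U ⊓ C.H0 D := sub_mem hf (Submodule.smul_mem _ _ hg)
    refine Submodule.mem_sup.2 ⟨f - c • g, ⟨h2.1, fun h3 Q => ?_⟩, c • g,
      Submodule.smul_mem _ _ (Submodule.mem_span_singleton_self g), by simp⟩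
    have h4 := h2.2 h3 Q
    have h5 := hc h3
    have h6 := hg.2 g0 P
    rw [Finsupp.sub_apply]
    by_cases hQ : P = Q
    · subst hQ; rw [Finsupp.single_eq_same]; omega
    · rw [Finsupp.single_eq_of_ne (Ne.symm hQ)]; omega
  have := hfin (C.H0 (D - Finsupp.single P 1))
  calc Module.finrank κ ↥(U ⊓ C.H0 D)
      ≤ Module.finrank κ ↥((U ⊓ C.H0 (D - Finsupp.single P 1)) ⊔ Submodule.span κ {g}) :=
        Submodule.finrank_mono key
    _ ≤ _ := (Submodule.finrank_add_le_finrank_add_finrank _ _).trans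
        (by gcongr; exact (finrank_span_le_card _).trans (by simp))

lemma finrank_inf_H0_le_add_degree [IsAlgClosed κ] (U : Submodule κ C.K) [FiniteDimensional κ U]
    (D : C.Div) {B : C.Div} (hB : 0 ≤ B) :
    (Module.finrank κ ↥(U ⊓ C.H0 D) : ℤ) ≤ Module.finrank κ ↥(U ⊓ C.H0 (D - B)) + B.degree := by
  refine finsupp_nonneg_induction (p := fun B => (Module.finrank κ ↥(U ⊓ C.H0 D) : ℤ) ≤
    Module.finrank κ ↥(U ⊓ C.H0 (D - B)) + B.degree) ?_ ?_ B hB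
  · rw [sub_zero, map_zero, add_zero]
  · intro B P _ h
    have h1 := C.finrank_inf_H0_le_add_one U (D - B) P
    rw [sub_sub] at h1
    rw [map_add, Finsupp.degree_single]
    omega

/-- After removing `A` point by point only functions without poles remain, and these are constants.
-/
lemma finrank_le_degree_add_one [IsAlgClosed κ] (U : Submodule κ C.K) [FiniteDimensional κ U]
    {A : C.Div} (hA : 0 ≤ A) (hU : U ≤ C.H0 A) :
    (Module.finrank κ U : ℤ) ≤ A.degree + 1 := by
  have h1 := C.finrank_inf_H0_le_add_degree U A hA
  rw [inf_eq_left.2 hU, sub_self] at h1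
  have h2 : U ⊓ C.H0 0 ≤ Submodule.span κ {1} := by
    intro f hf
    obtain ⟨c, rfl⟩ := C.exists_const_of_ord_nonneg (f := f) (fun h P => by simpa using hf.2 h P)
    exact Submodule.mem_span_singleton.2 ⟨c, (Algebra.algebraMap_eq_smul_one c).symm⟩
  have h3 := (Submodule.finrank_mono h2).trans (finrank_span_le_card (R := κ) ({1} : Set C.K))
  simp at h3
  omega

lemma exists_le_H0 (U : Submodule κ C.K) [FiniteDimensional κ U] :
    ∃ D : C.Div, 0 ≤ D ∧ U ≤ C.H0 D := by
  obtain ⟨s, rfl⟩ := Module.Finite.iff_fg.1 ‹FiniteDimensional κ U›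
  have h0 : ∀ f : C.K, (0 : C.Div) ≤ (-C.div f) ⊔ 0 := fun f => le_sup_right
  refine ⟨∑ f ∈ s, ((-C.div f) ⊔ 0), Finset.sum_nonneg fun f _ => h0 f, Submodule.span_le.2 ?_⟩
  intro f hf h P
  have h1 : (-C.div f) ⊔ 0 ≤ ∑ f ∈ s, ((-C.div f) ⊔ 0) :=
    Finset.single_le_sum (f := fun f => (-C.div f) ⊔ 0) (fun g _ => h0 g) hf
  have h2 := (le_sup_left.trans h1 : -C.div f ≤ _) P
  rw [Finsupp.neg_apply, C.div_apply] at h2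
  omega

/-! ### Approximation -/

/-- Neither local ring contains the other; divide the two functions witnessing this. -/
lemma exists_ord_pos_neg {P Q : C.Pt} (h : P ≠ Q) :
    ∃ f : C.K, f ≠ 0 ∧ 0 < C.ord P f ∧ C.ord Q f < 0 := by
  have h1 : ∃ f : C.K, f ≠ 0 ∧ 0 ≤ C.ord P f ∧ C.ord Q f < 0 := by
    by_contra! hcon
    exact h (C.eq_of_ord_nonneg_imp hcon)
  have h2 : ∃ f : C.K, f ≠ 0 ∧ 0 ≤ C.ord Q f ∧ C.ord P f < 0 := by
    by_contra! hcon
    exact h (C.eq_of_ord_nonneg_imp hcon).symm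
  obtain ⟨f, hf, f1, f2⟩ := h1
  obtain ⟨g, hg, g1, g2⟩ := h2
  refine ⟨f * g⁻¹, mul_ne_zero hf (inv_ne_zero hg), ?_, ?_⟩ <;>
  · rw [C.ord_mul _ hf (inv_ne_zero hg), C.ord_inv _ hg]; omega

lemma exists_ord_pos_forall_neg (P : C.Pt) (S : Finset C.Pt) (hP : P ∉ S) :
    ∃ f : C.K, f ≠ 0 ∧ 0 < C.ord P f ∧ ∀ Q ∈ S, C.ord Q f < 0 := by
  induction S using Finset.induction_on with
  | empty =>
    obtain ⟨t, t0, ht⟩ := C.exists_ord_eq_one P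
    exact ⟨t, t0, by omega, by simp⟩
  | insert R S hR ih =>
    rw [Finset.mem_insert, not_or] at hP
    obtain ⟨f, f0, f1, f2⟩ := ih hP.2
    obtain ⟨g, g0, g1, g2⟩ := C.exists_ord_pos_neg hP.1
    rcases lt_or_ge (C.ord R f) 0 with hRf | hRf
    · refine ⟨f, f0, f1, fun Q hQ => ?_⟩
      rcases Finset.mem_insert.1 hQ with rfl | hQ
      exacts [hRf, f2 Q hQ]
    obtain ⟨N, hN⟩ : ∃ N : ℕ, 0 < N ∧ ∀ Q ∈ S, -C.ord Q f < N := by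
      refine ⟨(∑ Q ∈ S, (-C.ord Q f)).toNat + 1, Nat.succ_pos _, fun Q hQ => ?_⟩
      have := Finset.single_le_sum (f := fun Q => -C.ord Q f)
        (fun Q hQ => by have := f2 Q hQ; omega) hQ
      push_cast
      omega
    have gN := pow_ne_zero N g0
    have hRN : C.ord R (g ^ N) < C.ord R f := by
      rw [C.ord_pow R g0]
      have : (N : ℤ) * C.ord R g < 0 := mul_neg_of_pos_of_neg (by exact_mod_cast hN.1) g2
      omega
    have h0 : f + g ^ N ≠ 0 := by
      rw [add_comm]
      exact C.add_ne_zero_of_ord_lt hRN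
    refine ⟨f + g ^ N, h0, ?_, fun Q hQ => ?_⟩
    · refine lt_of_lt_of_le (lt_min f1 ?_) (C.min_ord_le_ord_add P h0)
      rw [C.ord_pow P g0]
      exact mul_pos (by exact_mod_cast hN.1) g1
    · rcases Finset.mem_insert.1 hQ with rfl | hQ
      · rw [add_comm, C.ord_add_of_lt gN hRN, C.ord_pow _ g0]
        exact mul_neg_of_pos_of_neg (by exact_mod_cast hN.1) g2
      · have hf := f2 Q hQ
        have hN' := hN.2 Q hQ
        rcases le_or_gt 0 (C.ord Q g) with hg | hg
        · rw [C.ord_add_of_lt f0]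
          · exact hf
          · rw [C.ord_pow Q g0]
            exact hf.trans_le (mul_nonneg (by positivity) hg)
        · have h1 : C.ord Q (g ^ N) < C.ord Q f := by
            rw [C.ord_pow Q g0]
            nlinarith
          rw [add_comm, C.ord_add_of_lt gN h1]
          omega

/-- Multiply a power of a uniformizer at `P` by 1 / (1 + h ^ N), where `h` vanishes at `P` and has
poles on the rest of `S`. This factor is a unit at `P` and has a zero of order at least `N` at the
other points of `S`. -/
lemma exists_ord_eq_and_le (P : C.Pt) (S : Finset C.Pt) (z : C.Pt → ℤ) :
    ∃ g : C.K, g ≠ 0 ∧ C.ord P g = z P ∧ ∀ Q ∈ S, z Q ≤ C.ord Q g := by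
  obtain ⟨t, t0, ht⟩ := C.exists_ord_eq_one P
  obtain ⟨h, h0, h1, h2⟩ := C.exists_ord_pos_forall_neg P (S.erase P) (by simp)
  have s0 : t ^ z P ≠ 0 := zpow_ne_zero _ t0
  obtain ⟨N, hN⟩ : ∃ N : ℕ, 0 < N ∧ ∀ Q ∈ S, z Q - C.ord Q (t ^ z P) ≤ N := by
    refine ⟨(∑ Q ∈ S, |z Q - C.ord Q (t ^ z P)|).toNat + 1, Nat.succ_pos _, fun Q hQ => ?_⟩
    have h3 := Finset.single_le_sum (f := fun Q => |z Q - C.ord Q (t ^ z P)|)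
      (fun Q _ => abs_nonneg _) hQ
    have h4 := le_abs_self (z Q - C.ord Q (t ^ z P))
    push_cast
    omega
  have hN0 : h ^ N ≠ 0 := pow_ne_zero N h0
  have hP1 : C.ord P 1 < C.ord P (h ^ N) := by
    rw [C.ord_one, C.ord_pow P h0]
    exact mul_pos (by exact_mod_cast hN.1) h1
  have u0 : 1 + h ^ N ≠ 0 := C.add_ne_zero_of_ord_lt hP1
  refine ⟨t ^ z P * (1 + h ^ N)⁻¹, mul_ne_zero s0 (inv_ne_zero u0), ?_, fun Q hQ => ?_⟩
  · rw [C.ord_mul P s0 (inv_ne_zero u0), C.ord_inv P u0, C.ord_add_of_lt one_ne_zero hP1,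
      C.ord_one, C.ord_zpow P t0, ht]
    ring
  · by_cases hQP : Q = P
    · subst hQP
      rw [C.ord_mul _ s0 (inv_ne_zero u0), C.ord_inv _ u0, C.ord_add_of_lt one_ne_zero hP1,
        C.ord_one, C.ord_zpow _ t0, ht]
      omega
    · have h3 := h2 Q (Finset.mem_erase.2 ⟨hQP, hQ⟩)
      have h4 : C.ord Q (h ^ N) < C.ord Q 1 := by
        rw [C.ord_one, C.ord_pow Q h0]
        exact mul_neg_of_pos_of_neg (by exact_mod_cast hN.1) h3
      rw [C.ord_mul _ s0 (inv_ne_zero u0), C.ord_inv _ u0, add_comm 1, C.ord_add_of_lt hN0 h4,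
        C.ord_pow _ h0]
      have h5 := hN.2 Q hQ
      nlinarith

/-- With finitely many points, approximation would give a nonzero function vanishing at all of them;
it would be constant. -/
lemma infinite_pt [IsAlgClosed κ] : Infinite C.Pt := by
  by_contra hfin
  rw [not_infinite_iff_finite] at hfin
  have := Fintype.ofFinite C.Pt
  obtain ⟨P, -⟩ := C.exists_isClosed_point_mem (Z := Set.univ) isClosed_univ
    ⟨genericPoint C.X, trivial⟩
  obtain ⟨g, g0, g1, g2⟩ := C.exists_ord_eq_and_le P Finset.univ (fun _ => 1)
  obtain ⟨c, rfl⟩ := C.exists_const_of_ord_nonneg (f := g)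
    (fun _ Q => zero_le_one.trans (g2 Q (Finset.mem_univ _)))
  rw [C.ord_algebraMap P (by simpa using g0)] at g1
  omega

/-! ### Principal divisors have degree zero -/

/-- The space `U` lifts the functions on the scheme `Z`. It grows by one dimension for each point
added to `Z`, through a function of the exact order so far at that point and of at least the
prescribed orders on the rest of `S`. -/
lemma exists_finrank_eq_degree (S : Finset C.Pt) {Z : C.Div} (hZ : 0 ≤ Z)
    (hS : Z.support ⊆ S) :
    ∃ U : Submodule κ C.K, FiniteDimensional κ U ∧ (Module.finrank κ U : ℤ) = Z.degree ∧
      U ≤ C.ordGe S 0 ∧ U ⊓ C.ordGe S Z = ⊥ := by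
  revert hS
  refine finsupp_nonneg_induction (p := fun Z : C.Div => Z.support ⊆ S →
    ∃ U : Submodule κ C.K, FiniteDimensional κ U ∧ (Module.finrank κ U : ℤ) = Z.degree ∧
      U ≤ C.ordGe S 0 ∧ U ⊓ C.ordGe S Z = ⊥) ?_ ?_ Z hZ
  · intro _
    exact ⟨⊥, inferInstance, by simp, bot_le, by simp⟩
  · intro Z P hZ ih hS
    have hsupp : ∀ Q, Z Q ≠ 0 → Q ∈ S := by
      intro Q hQ
      refine hS (Finsupp.mem_support_iff.2 ?_)
      have h1 := hZ Q
      have h2 : 0 ≤ Finsupp.single P (1 : ℤ) Q := Finsupp.single_nonneg.2 zero_le_one Q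
      rw [Finsupp.add_apply]
      simp only [Finsupp.coe_zero, Pi.zero_apply] at h1
      omega
    have hPS : P ∈ S := hS (Finsupp.mem_support_iff.2 (by
      have h1 := hZ P
      simp only [Finsupp.coe_zero, Pi.zero_apply] at h1
      rw [Finsupp.add_apply, Finsupp.single_eq_same]
      omega))
    obtain ⟨U, hU, hdim, hU0, hUZ⟩ := ih fun Q hQ => hsupp Q (Finsupp.mem_support_iff.1 hQ)
    obtain ⟨g, g0, g1, g2⟩ := C.exists_ord_eq_and_le P S Z
    have hgZ : g ∈ C.ordGe S Z := fun _ Q hQ => g2 Q hQ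
    have hmono : C.ordGe S (Z + Finsupp.single P 1 : C.Div) ≤ C.ordGe S Z := by
      intro f hf f0 Q hQ
      have h1 := hf f0 Q hQ
      have h2 : 0 ≤ Finsupp.single P (1 : ℤ) Q := Finsupp.single_nonneg.2 zero_le_one Q
      rw [Finsupp.add_apply] at h1
      omega
    have hUg : U ⊓ Submodule.span κ {g} = ⊥ := by
      rw [eq_bot_iff, ← hUZ]
      exact inf_le_inf_left _ (Submodule.span_le.2 (by simpa using hgZ))
    have hfin : FiniteDimensional κ ↥(U ⊔ Submodule.span κ {g}) := inferInstance
    refine ⟨U ⊔ Submodule.span κ {g}, hfin, ?_, sup_le hU0 (Submodule.span_le.2 ?_), ?_⟩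
    · have := Submodule.finrank_sup_add_finrank_inf_eq U (Submodule.span κ {g})
      rw [hUg, finrank_bot, finrank_span_singleton g0] at this
      rw [map_add, Finsupp.degree_single, ← hdim]
      omega
    · simp only [Set.singleton_subset_iff, SetLike.mem_coe]
      exact fun _ Q hQ => (hZ Q).trans (g2 Q hQ)
    · rw [eq_bot_iff]
      rintro f ⟨hf, hf'⟩
      obtain ⟨u, hu, v, hv, rfl⟩ := Submodule.mem_sup.1 hf
      obtain ⟨c, rfl⟩ := Submodule.mem_span_singleton.1 hv
      have hu' : u ∈ C.ordGe S Z := by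
        have := sub_mem (hmono hf') (Submodule.smul_mem _ c hgZ)
        rwa [add_sub_cancel_right] at this
      have hu0 : u = 0 := by
        have : u ∈ U ⊓ C.ordGe S Z := ⟨hu, hu'⟩
        rwa [hUZ] at this
      rw [hu0, zero_add] at hf' ⊢
      by_cases hc : c = 0
      · simp [hc]
      · have := hf' (smul_ne_zero hc g0) P hPS
        rw [C.ord_smul P hc, g1, Finsupp.add_apply, Finsupp.single_eq_same] at this
        omega

/-- Growth argument: a lift `U` of the functions on the zero divisor `Z` of `f` gives subspaces U +
Uf + ⋯ + Uf^k of dimension (k + 1) deg Z, while the bound on their poles limits the dimension to k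
deg B + deg A + 1. -/
lemma degree_posPart_div_le [IsAlgClosed κ] {f : C.K} (hf : f ≠ 0) :
    (C.div f ⊔ 0).degree ≤ ((-C.div f) ⊔ 0).degree := by
  set Z := C.div f ⊔ 0 with hZ
  set B := (-C.div f) ⊔ 0 with hB
  have hZ0 : 0 ≤ Z := le_sup_right
  have hB0 : 0 ≤ B := le_sup_right
  obtain ⟨U, hU, hdim, hU0, hUZ⟩ := C.exists_finrank_eq_degree Z.support hZ0 subset_rfl
  obtain ⟨A, hA0, hUA⟩ := C.exists_le_H0 U
  have hZf : ∀ P ∈ Z.support, Z P = C.ord P f := by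
    intro P hP
    have h1 := Finsupp.mem_support_iff.1 hP
    rw [hZ, Finsupp.sup_apply, C.div_apply] at h1 ⊢
    simp only [Finsupp.coe_zero, Pi.zero_apply] at h1 ⊢
    omega
  have hBf : ∀ P, -C.ord P f ≤ B P := by
    intro P
    have : -C.div f ≤ B := le_sup_left
    have := this P
    rwa [Finsupp.neg_apply, C.div_apply] at this
  -- The next space is `U ⊔ W · f`. The sum is direct because the elements of `W · f` vanish along
  -- `Z`, whereas no nonzero element of `U` does.
  have key : ∀ k : ℕ, ∃ W : Submodule κ C.K, FiniteDimensional κ W ∧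
      (Module.finrank κ W : ℤ) = Z.degree * (k + 1) ∧ W ≤ C.ordGe Z.support 0 ∧
      W ≤ C.H0 (k • B + A) := by
    intro k
    induction k with
    | zero => exact ⟨U, hU, by simp [hdim], hU0, by simpa using hUA⟩
    | succ k ih =>
      obtain ⟨W, hW, hWdim, hW0, hWA⟩ := ih
      have hWf : FiniteDimensional κ (C.mulBy W f) := by
        unfold mulBy; infer_instance
      have hWZ : C.mulBy W f ≤ C.ordGe Z.support Z := by
        intro g hg g0 P hP
        obtain ⟨h, hh, rfl⟩ := C.mem_mulBy.1 hg
        have h0 := left_ne_zero_of_mul g0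
        have h1 := hW0 hh h0 P hP
        rw [C.ord_mul P h0 hf, hZf P hP]
        simp only [Pi.zero_apply] at h1
        omega
      have hint : U ⊓ C.mulBy W f = ⊥ := by
        rw [eq_bot_iff, ← hUZ]
        exact inf_le_inf_left _ hWZ
      refine ⟨U ⊔ C.mulBy W f, inferInstance, ?_, sup_le hU0 ?_, sup_le ?_ ?_⟩
      · have := Submodule.finrank_sup_add_finrank_inf_eq U (C.mulBy W f)
        rw [hint, finrank_bot, C.finrank_mulBy W hf] at this
        push_cast
        have h2 : (Module.finrank κ ↥(U ⊔ C.mulBy W f) : ℤ) =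
          Module.finrank κ U + Module.finrank κ W := by exact_mod_cast this
        rw [h2, hdim, hWdim]
        ring
      · exact hWZ.trans fun g hg g0 P hP => (hZ0 P).trans (hg g0 P hP)
      · exact hUA.trans (C.H0_mono (le_add_of_nonneg_left (nsmul_nonneg hB0 _)))
      · intro g hg g0 P
        obtain ⟨h, hh, rfl⟩ := C.mem_mulBy.1 hg
        have h0 := left_ne_zero_of_mul g0
        have h1 := hWA hh h0 P
        have h2 := hBf P
        rw [C.ord_mul P h0 hf]
        simp only [Finsupp.coe_add, Pi.add_apply, Finsupp.coe_smul, Pi.smul_apply,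
          succ_nsmul] at h1 ⊢
        omega
  by_contra! hlt
  -- If deg Z exceeds deg B, the value k = deg A + 1 already contradicts the upper bound.
  obtain ⟨W, hW, hWdim, -, hWA⟩ := key (A.degree + 1).toNat
  have h1 := C.finrank_le_degree_add_one W (add_nonneg (nsmul_nonneg hB0 _) hA0) hWA
  have h2 : 0 ≤ A.degree := Finset.sum_nonneg fun P _ => hA0 P
  have h3 : 0 ≤ B.degree := Finset.sum_nonneg fun P _ => hB0 P
  rw [hWdim, map_add, map_nsmul, nsmul_eq_mul, Int.toNat_of_nonneg (by omega)] at h1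
  nlinarith

lemma degree_div [IsAlgClosed κ] {f : C.K} (hf : f ≠ 0) : (C.div f).degree = 0 := by
  have h1 := C.degree_posPart_div_le hf
  have h2 := C.degree_posPart_div_le (inv_ne_zero hf)
  have h3 : C.div f⁻¹ = -C.div f := by
    ext P
    rw [C.div_apply, C.ord_inv P hf, Finsupp.neg_apply, C.div_apply]
  rw [h3, neg_neg] at h2
  have h4 : C.div f = (C.div f ⊔ 0) - ((-C.div f) ⊔ 0) := by
    ext P
    simp only [Finsupp.sub_apply, Finsupp.sup_apply, Finsupp.neg_apply, Finsupp.coe_zero,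
      Pi.zero_apply]
    omega
  rw [h4, map_sub]
  omega

lemma H0_eq_bot_of_degree_neg [IsAlgClosed κ] {D : C.Div} (hD : D.degree < 0) : C.H0 D = ⊥ := by
  rw [eq_bot_iff]
  intro f hf
  by_contra h0
  have h1 : 0 ≤ C.div f + D := fun P => by
    have := hf h0 P
    rw [Finsupp.add_apply, C.div_apply]
    exact this
  have h2 : 0 ≤ (C.div f + D).degree := Finset.sum_nonneg fun P _ => h1 P
  rw [map_add, C.degree_div h0] at h2
  omega

/-! ### General points -/

/-- Each new point is chosen outside the zeros of one element of the remaining space, so requiring a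
zero there lowers the dimension; after `m` points nothing nonzero is left. -/
lemma exists_general_points [IsAlgClosed κ] (bad : Finset C.Pt) (m : ℕ) (U : Submodule κ C.K)
    [FiniteDimensional κ U] (hm : Module.finrank κ U ≤ m) :
    ∃ E : C.Div, 0 ≤ E ∧ E.degree = m ∧ (∀ P ∈ bad, E P = 0) ∧
      ∀ f ∈ U, f ≠ 0 → ∃ P, 0 < E P ∧ C.ord P f < E P := by
  induction m generalizing U with
  | zero =>
    refine ⟨0, le_rfl, by simp, fun _ _ => rfl, fun f hf f0 => ?_⟩
    have : U = ⊥ := Submodule.finrank_eq_zero.1 (Nat.le_zero.1 hm)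
    rw [this] at hf
    exact absurd hf f0
  | succ m ih =>
    have := C.infinite_pt
    obtain ⟨D, hD0, hUD⟩ := C.exists_le_H0 U
    obtain ⟨Q, hQ, hUQ⟩ : ∃ Q, Q ∉ bad ∪ D.support ∧
        Module.finrank κ ↥(U ⊓ C.H0 (D - Finsupp.single Q 1)) ≤ m := by
      by_cases hU : U = ⊥
      · obtain ⟨Q, hQ⟩ := Infinite.exists_notMem_finset (bad ∪ D.support)
        exact ⟨Q, hQ, by rw [hU, bot_inf_eq, finrank_bot]; exact Nat.zero_le _⟩
      · obtain ⟨f, hf, f0⟩ := Submodule.exists_mem_ne_zero_of_ne_bot hU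
        obtain ⟨Q, hQ⟩ := Infinite.exists_notMem_finset (bad ∪ D.support ∪ (C.div f).support)
        rw [Finset.mem_union, not_or, Finsupp.mem_support_iff, not_not, C.div_apply] at hQ
        refine ⟨Q, hQ.1, ?_⟩
        have hlt : U ⊓ C.H0 (D - Finsupp.single Q 1) < U := by
          refine lt_of_le_of_ne inf_le_left fun heq => ?_
          rw [← heq] at hf
          have h1 := hf.2 f0 Q
          have h2 : D Q = 0 := by
            have := hQ.1
            rw [Finset.mem_union, not_or, Finsupp.mem_support_iff, not_not] at this
            exact this.2
          rw [Finsupp.sub_apply, Finsupp.single_eq_same] at h1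
          omega
        have := Submodule.finrank_lt_finrank_of_lt hlt
        omega
    rw [Finset.mem_union, not_or, Finsupp.mem_support_iff, not_not] at hQ
    have : FiniteDimensional κ ↥(U ⊓ C.H0 (D - Finsupp.single Q 1)) :=
      Submodule.finiteDimensional_of_le inf_le_left
    obtain ⟨E, hE0, hEd, hEb, hE⟩ := ih (U ⊓ C.H0 (D - Finsupp.single Q 1)) hUQ
    have hle : E ≤ E + Finsupp.single Q 1 :=
      le_add_of_nonneg_right (Finsupp.single_nonneg.2 zero_le_one)
    refine ⟨E + Finsupp.single Q 1, hE0.trans hle, by simp [hEd], fun P hP => ?_,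
      fun f hf f0 => ?_⟩
    · rw [Finsupp.add_apply, hEb P hP, Finsupp.single_eq_of_ne (by rintro rfl; exact hQ.1 hP),
        add_zero]
    · by_cases hf' : f ∈ C.H0 (D - Finsupp.single Q 1)
      · obtain ⟨P, hP0, hP⟩ := hE f ⟨hf, hf'⟩ f0
        exact ⟨P, hP0.trans_le (hle P), hP.trans_le (hle P)⟩
      · have hQ0 : 0 ≤ E Q := hE0 Q
        refine ⟨Q, by rw [Finsupp.add_apply, Finsupp.single_eq_same]; omega, ?_⟩
        by_contra! hcon
        refine hf' fun _ P => ?_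
        have h1 := hUD hf f0 P
        have h2 := hE0 Q
        rw [Finsupp.add_apply, Finsupp.single_eq_same] at hcon
        simp only [Finsupp.coe_zero, Pi.zero_apply] at h2
        rw [Finsupp.sub_apply]
        by_cases hP : Q = P
        · subst hP; rw [Finsupp.single_eq_same]; omega
        · rw [Finsupp.single_eq_of_ne (Ne.symm hP)]; omega

/-- The form in which general points are used: no nonzero element of `U` is a section of 𝒪(B - E).
Elements outside `C.H0 B` fail because `E` is effective, the others because `E` is general and
avoids the support of `B`. -/
lemma exists_general_divisor [IsAlgClosed κ] (U : Submodule κ C.K) [FiniteDimensional κ U]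
    (B : C.Div) {m : ℕ} (hm : Module.finrank κ ↥(U ⊓ C.H0 B) ≤ m) :
    ∃ E : C.Div, 0 ≤ E ∧ E.degree = m ∧ ∀ f ∈ U, f ≠ 0 → ∃ P, C.ord P f + B P < E P := by
  have : FiniteDimensional κ ↥(U ⊓ C.H0 B) := Submodule.finiteDimensional_of_le inf_le_left
  obtain ⟨E, hE0, hEd, hEb, hE⟩ := C.exists_general_points B.support m (U ⊓ C.H0 B) hm
  refine ⟨E, hE0, hEd, fun f hf f0 => ?_⟩
  by_cases hfB : f ∈ C.H0 B
  · obtain ⟨P, hP, hPE⟩ := hE f ⟨hf, hfB⟩ f0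
    refine ⟨P, ?_⟩
    have hB : B P = 0 := by
      by_contra h
      rw [hEb P (Finsupp.mem_support_iff.2 h)] at hP
      exact lt_irrefl _ hP
    rwa [hB, add_zero]
  · rw [mem_H0] at hfB
    push Not at hfB
    obtain ⟨-, P, hP⟩ := hfB
    exact ⟨P, hP.trans_le (hE0 P)⟩

end SmoothCurve
/-! ### Graphs -/

namespace Multigraph

variable {G : Multigraph}

/-- The other end of the edge `e`, seen from its end `v`. -/
def other (e : G.E) (v : G.V) : G.V := if v = G.tail e then G.head e else G.tail e

lemma inc_tail (e : G.E) : G.Inc e (G.tail e) := Or.inl rfl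

lemma inc_head (e : G.E) : G.Inc e (G.head e) := Or.inr rfl

lemma other_tail (e : G.E) : other e (G.tail e) = G.head e := if_pos rfl

lemma other_head (e : G.E) : other e (G.head e) = G.tail e := if_neg (G.loopless e).symm

lemma sgn_tail (e : G.E) : G.sgn e (G.tail e) = 1 := if_pos rfl

lemma sgn_head (e : G.E) : G.sgn e (G.head e) = -1 := if_neg (G.loopless e).symm

lemma inc_other (e : G.E) (v : G.V) : G.Inc e (other e v) := by
  unfold other; split_ifs
  exacts [inc_head e, inc_tail e]

lemma other_ne {e : G.E} {v : G.V} (h : G.Inc e v) : other e v ≠ v := by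
  rcases h with rfl | rfl
  · rw [other_tail]; exact (G.loopless e).symm
  · rw [other_head]; exact G.loopless e

lemma sgn_other {e : G.E} {v : G.V} (h : G.Inc e v) : G.sgn e (other e v) = -G.sgn e v := by
  rcases h with rfl | rfl
  · rw [other_tail, sgn_head, sgn_tail]
  · rw [other_head, sgn_head, sgn_tail, neg_neg]

lemma sgn_mul_self (e : G.E) (v : G.V) : G.sgn e v * G.sgn e v = 1 := by
  unfold sgn; split_ifs <;> rfl

lemma eq_or_eq_other {e : G.E} {u v : G.V} (hu : G.Inc e u) (hv : G.Inc e v) :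
    u = v ∨ u = other e v := by
  rcases hu with rfl | rfl <;> rcases hv with h | rfl
  · exact Or.inl h.symm
  · right; rw [other_head]
  · right; rw [h, other_tail]
  · exact Or.inl rfl

lemma eq_other {e : G.E} {u v : G.V} (hu : G.Inc e u) (hv : G.Inc e v) (h : u ≠ v) :
    u = other e v := (eq_or_eq_other hu hv).resolve_left h

lemma adj_other {e : G.E} {v : G.V} (h : G.Inc e v) : G.bar.Adj v (other e v) :=
  ⟨(other_ne h).symm, e, h, inc_other e v⟩

lemma mem_edgesAt {e : G.E} {v : G.V} : e ∈ G.edgesAt v ↔ G.Inc e v := by simp [edgesAt]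

lemma mem_edgesOver {e : G.E} {u v : G.V} : e ∈ G.edgesOver u v ↔ G.Inc e u ∧ G.Inc e v := by
  simp [edgesOver]

lemma edgesOver_comm (u v : G.V) : G.edgesOver u v = G.edgesOver v u := by
  ext e; simp [mem_edgesOver, and_comm]

lemma mem_edgesOver_iff {e : G.E} {u v : G.V} (h : u ≠ v) :
    e ∈ G.edgesOver u v ↔ G.Inc e u ∧ other e u = v := by
  rw [mem_edgesOver]
  refine and_congr_right fun hu => ⟨fun hv => (eq_other hv hu h.symm).symm, ?_⟩
  rintro rfl
  exact inc_other e u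

lemma sgn_mul_sub {A : Type*} [Ring A] {e : G.E} {v : G.V} (h : G.Inc e v) (c : G.V → A) :
    (G.sgn e v : A) * (c (G.tail e) - c (G.head e)) = c v - c (other e v) := by
  rcases h with rfl | rfl
  · rw [other_tail, sgn_tail]; simp
  · rw [other_head, sgn_head]; simp

lemma sum_edgesAt {M : Type*} [AddCommMonoid M] (g : G.V → G.E → M) :
    ∑ v, ∑ e ∈ G.edgesAt v, g v e = ∑ e, (g (G.tail e) e + g (G.head e) e) := by
  simp_rw [edgesAt, Finset.sum_filter]
  rw [Finset.sum_comm]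
  refine Finset.sum_congr rfl fun e _ => ?_
  rw [← Finset.sum_filter]
  have : (Finset.univ.filter fun v => G.Inc e v) = {G.tail e, G.head e} := by
    ext v
    rw [Finset.mem_filter, Finset.mem_insert, Finset.mem_singleton]
    exact ⟨fun h => h.2, fun h => ⟨Finset.mem_univ v, h⟩⟩
  rw [this, Finset.sum_pair (G.loopless e)]

end Multigraph

/-! ### Ceilings of quotients -/

lemma ceil_div_le_iff (n : ℕ+) (x : ℝ) (k : ℤ) : ⌈x / (n : ℕ)⌉ ≤ k ↔ x ≤ k * (n : ℕ) := by
  rw [Int.ceil_le, div_le_iff₀ (by exact_mod_cast n.pos)]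

lemma ceil_div_mono (n : ℕ+) {x y : ℝ} (h : x ≤ y) : ⌈x / (n : ℕ)⌉ ≤ ⌈y / (n : ℕ)⌉ :=
  Int.ceil_le_ceil (div_le_div_of_nonneg_right h (by positivity))

/-- Ceilings encode the twisting rule: the value jumps exactly when the position leaves a multiple
of the length, that is, when a chip leaves the vertex. -/
lemma ceil_div_succ (n : ℕ+) (z : ℤ) :
    ⌈((z + 1 : ℤ) : ℝ) / (n : ℕ)⌉ - ⌈(z : ℝ) / (n : ℕ)⌉ = if ((n : ℕ) : ℤ) ∣ z then 1 else 0 := by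
  have hn : (0 : ℤ) < (n : ℕ) := by exact_mod_cast n.pos
  have key : ∀ (y k : ℤ), ⌈(y : ℝ) / (n : ℕ)⌉ ≤ k ↔ y ≤ k * (n : ℕ) := fun y k => by
    rw [ceil_div_le_iff]; exact_mod_cast Iff.rfl
  have key' : ∀ (y k : ℤ), ⌈(y : ℝ) / (n : ℕ)⌉ = k ↔ y ≤ k * (n : ℕ) ∧ (k - 1) * (n : ℕ) < y := by
    intro y k
    rw [← key, ← not_le, ← key]
    omega
  split_ifs with h
  · obtain ⟨k, rfl⟩ := h
    rw [(key' _ (k + 1)).2 ⟨by nlinarith, by nlinarith⟩, (key' _ k).2 ⟨by nlinarith, by nlinarith⟩]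
    ring
  · obtain ⟨k, hk⟩ : ∃ k, ⌈(z : ℝ) / (n : ℕ)⌉ = k := ⟨_, rfl⟩
    have h1 := (key' _ _).1 hk
    have h2 : z ≠ k * (n : ℕ) := fun h2 => h (h2 ▸ dvd_mul_left _ _)
    rw [hk, (key' _ k).2 ⟨by omega, by omega⟩, sub_self]

/-- A real displacement may be rounded up to an integral one. Real values of functions on Γ become
comparable with integral numbers of twists in this way. -/
lemma ceil_div_ceil (n : ℕ+) (m : ℤ) (t : ℝ) :
    ⌈((m : ℝ) + ⌈t⌉) / (n : ℕ)⌉ = ⌈((m : ℝ) + t) / (n : ℕ)⌉ := by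
  refine eq_of_forall_ge_iff fun k => ?_
  rw [ceil_div_le_iff, ceil_div_le_iff]
  constructor
  · intro h; linarith [Int.le_ceil t]
  · intro h
    have h1 : t ≤ ((k * (n : ℕ) - m : ℤ) : ℝ) := by push_cast; linarith
    have h2 := Int.ceil_le.2 h1
    have h3 : ((⌈t⌉ : ℤ) : ℝ) ≤ ((k * (n : ℕ) - m : ℤ) : ℝ) := by exact_mod_cast h2
    push_cast at h3
    linarith

/-- The two ceilings belong to the two ends of an edge, and the right-hand side counts the chip in
the interior. This is the source of the invariance of the degree. -/
lemma ceil_add_ceil_neg (n : ℕ+) (z : ℤ) :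
    ⌈(z : ℝ) / (n : ℕ)⌉ + ⌈((-z : ℤ) : ℝ) / (n : ℕ)⌉ = if ((n : ℕ) : ℤ) ∣ z then 0 else 1 := by
  have h := ceil_div_succ n z
  have e : ⌈((z + 1 : ℤ) : ℝ) / (n : ℕ)⌉ = 1 - ⌈((-z : ℤ) : ℝ) / (n : ℕ)⌉ := by
    have hn : (0 : ℤ) < (n : ℕ) := by exact_mod_cast n.pos
    have key : ∀ (y k : ℤ), ⌈(y : ℝ) / (n : ℕ)⌉ ≤ k ↔ y ≤ k * (n : ℕ) := fun y k => by
      rw [ceil_div_le_iff]; exact_mod_cast Iff.rfl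
    refine eq_of_forall_ge_iff fun k => ?_
    rw [key]
    have h2 := key (-z) (-k)
    constructor
    · intro h3
      by_contra h4
      have := h2.1 (by omega)
      nlinarith
    · intro h3
      by_contra h4
      have := h2.2 (by nlinarith)
      omega
  rw [e] at h
  split_ifs at h ⊢ <;> omega

/-! ### Multidegrees obtained by moving chips along the edges -/

namespace AdmMultideg

variable {G : Multigraph} {n : G.E → ℕ+}

/-- The position of the chip on `e`, measured in the direction away from `v`, up to multiples of
the length of `e`. -/
def lift (w : AdmMultideg G n) (e : G.E) (v : G.V) : ℤ := G.sgn e v * (w.μ e).val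

/-- The change at `v` along `e` when the chips on `e` move away from `v` by a distance of `t`. -/
def drop (w : AdmMultideg G n) (e : G.E) (v : G.V) (t : ℝ) : ℤ :=
  ⌈(w.lift e v : ℝ) / (n e : ℕ)⌉ - ⌈((w.lift e v : ℝ) + t) / (n e : ℕ)⌉

lemma drop_zero (w : AdmMultideg G n) (e : G.E) (v : G.V) : w.drop e v 0 = 0 := by
  rw [drop, add_zero, sub_self]

lemma drop_anti (w : AdmMultideg G n) (e : G.E) (v : G.V) {s t : ℝ} (h : s ≤ t) :
    w.drop e v t ≤ w.drop e v s :=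
  sub_le_sub_left (ceil_div_mono _ (by linarith)) _

lemma drop_ceil (w : AdmMultideg G n) (e : G.E) (v : G.V) (t : ℝ) :
    w.drop e v (⌈t⌉ : ℤ) = w.drop e v t := by
  rw [drop, drop, ceil_div_ceil]

/-- Strictly exceeding an integer counts as a full further twist. This is where integrality enters
the maximum principle. -/
lemma drop_le_of_lt (w : AdmMultideg G n) (e : G.E) (v : G.V) {s : ℤ} {t : ℝ} (h : (s : ℝ) < t) :
    w.drop e v t ≤ w.drop e v (s + 1) := by
  rw [← w.drop_ceil e v t]
  refine w.drop_anti e v ?_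
  have : s + 1 ≤ ⌈t⌉ := Int.add_one_le_iff.2 (Int.lt_ceil.2 h)
  exact_mod_cast this

lemma dvd_lift_add_iff (w : AdmMultideg G n) (e : G.E) (v : G.V) (x : ℤ) :
    ((n e : ℕ) : ℤ) ∣ w.lift e v + G.sgn e v * x ↔ w.μ e + (x : ZMod (n e)) = 0 := by
  have h : w.lift e v + G.sgn e v * x = G.sgn e v * ((w.μ e).val + x) := by rw [lift]; ring
  have hu : IsUnit (G.sgn e v) := IsUnit.of_mul_eq_one _ (G.sgn_mul_self e v)
  rw [h, hu.dvd_mul_left, ← ZMod.intCast_zmod_eq_zero_iff_dvd]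
  push_cast
  rw [ZMod.natCast_zmod_val]

lemma drop_succ (w : AdmMultideg G n) (e : G.E) (v : G.V) (x : ℤ) :
    w.drop e v ((G.sgn e v * x + 1 : ℤ) : ℝ) =
      w.drop e v ((G.sgn e v * x : ℤ) : ℝ) - if w.μ e + (x : ZMod (n e)) = 0 then 1 else 0 := by
  have h := ceil_div_succ (n e) (w.lift e v + G.sgn e v * x)
  simp only [w.dvd_lift_add_iff] at h
  rw [← h, drop, drop]
  push_cast
  rw [← add_assoc]
  ring

lemma drop_pred (w : AdmMultideg G n) (e : G.E) (v : G.V) (x : ℤ) :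
    w.drop e v ((G.sgn e v * x - 1 : ℤ) : ℝ) =
      w.drop e v ((G.sgn e v * x : ℤ) : ℝ) +
        if w.μ e + (x : ZMod (n e)) - (G.sgn e v : ZMod (n e)) = 0 then 1 else 0 := by
  have h := w.drop_succ e v (x - G.sgn e v)
  rw [mul_sub, G.sgn_mul_self, sub_add_cancel] at h
  rw [h]
  push_cast
  rw [← add_sub_assoc]
  ring

/-- The multidegree obtained by moving the chips on the edges `e` by distances `x e` (in the
direction of `e`). -/
def moved (w : AdmMultideg G n) (x : G.E → ℤ) : AdmMultideg G n where
  wG v := w.wG v + ∑ e ∈ G.edgesAt v, w.drop e v ((G.sgn e v * x e : ℤ) : ℝ)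
  μ e := w.μ e + x e

lemma moved_zero (w : AdmMultideg G n) : w.moved 0 = w := by
  ext v
  · simp [moved, drop_zero]
  · simp [moved]

/-- Twists only add to displacements. Along each edge the rule for chips leaving `v` is `drop_succ`,
and the rule for chips arriving at the other end is `drop_pred`. -/
lemma twistAlong_moved (w : AdmMultideg G n) (x : G.E → ℤ) {v : G.V} {S : Finset G.E}
    (hS : S ⊆ G.edgesAt v) :
    twistAlong S v (w.moved x) = w.moved (x + fun e => if e ∈ S then G.sgn e v else 0) := by
  ext u
  · have key : ∀ e ∈ G.edgesAt u, w.drop e u ((G.sgn e u * (x e + if e ∈ S then G.sgn e v else 0) : ℤ) : ℝ) =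
        w.drop e u ((G.sgn e u * x e : ℤ) : ℝ) +
        ((if e ∈ S ∧ u ≠ v ∧ G.Inc e u ∧ (w.moved x).μ e + (G.sgn e v : ZMod (n e)) = 0 then 1 else 0) -
          if u = v then (if e ∈ S ∧ (w.moved x).μ e = 0 then 1 else 0) else 0) := by
      intro e he
      rw [Multigraph.mem_edgesAt] at he
      by_cases heS : e ∈ S
      · have hev := Multigraph.mem_edgesAt.1 (hS heS)
        by_cases huv : u = v
        · subst huv
          simp only [heS, if_true, true_and, ne_eq, not_true_eq_false, false_and, if_false]
          rw [mul_add, G.sgn_mul_self, w.drop_succ]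
          simp only [moved]
          by_cases h0 : w.μ e + (x e : ZMod (n e)) = 0 <;> simp [h0, sub_eq_add_neg]
        · have hsg : G.sgn e v = -G.sgn e u := by
            rw [Multigraph.eq_other hev he (Ne.symm huv), Multigraph.sgn_other he]
          simp only [heS, if_true, true_and, ne_eq, huv, not_false_eq_true, if_false, he, sub_zero]
          rw [hsg, mul_add, mul_neg, G.sgn_mul_self, ← sub_eq_add_neg, w.drop_pred]
          simp only [moved]
          push_cast
          rw [← sub_eq_add_neg]
      · simp [heS]
    have h2 : (w.moved (x + fun e => if e ∈ S then G.sgn e v else 0)).wG u = w.wG u +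
      ∑ e ∈ G.edgesAt u, w.drop e u ((G.sgn e u * (x e + if e ∈ S then G.sgn e v else 0) : ℤ) : ℝ) := rfl
    rw [h2, Finset.sum_congr rfl key, Finset.sum_add_distrib, Finset.sum_sub_distrib, ← add_assoc,
      add_sub_assoc']
    simp only [twistAlong]
    congr 1
    · congr 1
      rw [Finset.card_filter]
      push_cast
      rw [← Finset.sum_filter, ← Finset.sum_filter]
      refine Finset.sum_congr ?_ fun _ _ => rfl
      ext e
      simp only [Finset.mem_filter, Multigraph.mem_edgesAt]
      tauto
    · by_cases huv : u = v
      · subst huv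
        simp only [if_true]
        rw [Finset.card_filter]
        push_cast
        rw [← Finset.sum_filter, ← Finset.sum_filter]
        refine Finset.sum_congr ?_ fun _ _ => rfl
        ext e
        simp only [Finset.mem_filter]
        have := @hS e
        tauto
      · simp [huv]
  · simp only [twistAlong, moved, Pi.add_apply]
    split_ifs <;> push_cast <;> ring

/-- The multidegree obtained by `c v` twists at each vertex `v`. -/
def state (w : AdmMultideg G n) (c : G.V → ℤ) : AdmMultideg G n :=
  w.moved fun e => c (G.tail e) - c (G.head e)

/-- The change at `v` along `e` for the potential `c`. -/
def coef (w : AdmMultideg G n) (c : G.V → ℝ) (v : G.V) (e : G.E) : ℤ :=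
  w.drop e v (c v - c (Multigraph.other e v))

/-- The degree at `v` for the potential `c`. -/
def degAt (w : AdmMultideg G n) (c : G.V → ℝ) (v : G.V) : ℤ :=
  w.wG v + ∑ e ∈ G.edgesAt v, w.coef c v e

lemma drop_sgn_mul (w : AdmMultideg G n) (c : G.V → ℤ) {e : G.E} {v : G.V} (h : G.Inc e v) :
    w.drop e v ((G.sgn e v * (c (G.tail e) - c (G.head e)) : ℤ) : ℝ) =
      w.coef (fun u => c u) v e := by
  have := Multigraph.sgn_mul_sub (A := ℤ) h c
  rw [Int.cast_id] at this
  rw [this, coef]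
  push_cast
  rfl

lemma state_wG (w : AdmMultideg G n) (c : G.V → ℤ) (v : G.V) :
    (w.state c).wG v = w.degAt (fun u => c u) v := by
  simp only [state, moved, degAt]
  congr 1
  exact Finset.sum_congr rfl fun e he => w.drop_sgn_mul c (Multigraph.mem_edgesAt.1 he)

lemma state_μ (w : AdmMultideg G n) (c : G.V → ℤ) (e : G.E) :
    (w.state c).μ e = w.μ e + ((c (G.tail e) - c (G.head e) : ℤ) : ZMod (n e)) := rfl

lemma state_zero (w : AdmMultideg G n) : w.state 0 = w := by
  rw [state]
  convert w.moved_zero using 2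
  ext e; simp

/-- Twisting at all vertices is trivial, so negative twists are compositions of twists and lists of
twists reach every potential. -/
lemma state_add_const (w : AdmMultideg G n) (c : G.V → ℤ) (k : ℤ) :
    w.state (fun v => c v + k) = w.state c := by
  rw [state, state]
  congr 1
  ext e; ring

lemma twist_state (w : AdmMultideg G n) (c : G.V → ℤ) (v : G.V) :
    twist v (w.state c) = w.state (c + Pi.single v 1) := by
  rw [twist, state, twistAlong_moved _ _ subset_rfl, state]
  congr 1
  ext e
  simp only [Pi.add_apply, Multigraph.mem_edgesAt]
  split_ifs with h
  · rcases h with rfl | rfl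
    · rw [Multigraph.sgn_tail, Pi.single_eq_same, Pi.single_eq_of_ne (G.loopless e).symm]; ring
    · rw [Multigraph.sgn_head, Pi.single_eq_same, Pi.single_eq_of_ne (G.loopless e)]; ring
  · rw [Pi.single_eq_of_ne, Pi.single_eq_of_ne]
    · ring
    · rintro rfl; exact h (Multigraph.inc_head e)
    · rintro rfl; exact h (Multigraph.inc_tail e)

lemma twistList_state (l : List G.V) (w : AdmMultideg G n) (c : G.V → ℤ) :
    twistList l (w.state c) = w.state (fun v => c v + l.count v) := by
  induction l generalizing c with
  | nil => simp [twistList]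
  | cons u l ih =>
    have h : twistList (u :: l) (w.state c) = twistList l (twist u (w.state c)) := rfl
    rw [h, twist_state, ih]
    congr 1
    ext v
    rw [List.count_cons, Pi.add_apply]
    by_cases huv : u = v
    · subst huv; simp; ring
    · simp [huv]

lemma exists_list_count (c : G.V → ℕ) : ∃ l : List G.V, ∀ v, l.count v = c v := by
  refine ⟨(Finsupp.toMultiset (Finsupp.equivFunOnFinite.symm c)).toList, fun v => ?_⟩
  rw [← Multiset.coe_count, Multiset.coe_toList, Finsupp.count_toMultiset]
  rfl

lemma exists_twistList_state (w : AdmMultideg G n) (c c' : G.V → ℤ) :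
    ∃ (l : List G.V) (k : ℤ), (∀ v, c v + l.count v = c' v + k) ∧
      twistList l (w.state c) = w.state c' := by
  obtain ⟨k, hk⟩ : ∃ k : ℤ, ∀ v, c v - c' v ≤ k := by
    refine ⟨∑ v, |c v - c' v|, fun v => (le_abs_self _).trans
      (Finset.single_le_sum (f := fun v => |c v - c' v|) (fun _ _ => abs_nonneg _)
        (Finset.mem_univ v))⟩
  obtain ⟨l, hl⟩ := exists_list_count (fun v => (c' v - c v + k).toNat)
  have h : ∀ v, c v + l.count v = c' v + k := by
    intro v
    have := hk v
    rw [hl, Int.toNat_of_nonneg (by omega)]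
    ring
  refine ⟨l, k, h, ?_⟩
  rw [twistList_state]
  simp_rw [h]
  exact w.state_add_const c' k

lemma mem_orbit_iff {w₀ w : AdmMultideg G n} : w ∈ w₀.orbit ↔ ∃ c, w = w₀.state c := by
  constructor
  · rintro ⟨l, rfl⟩
    refine ⟨fun v => 0 + l.count v, ?_⟩
    rw [← w₀.twistList_state l (fun _ => 0)]
    congr 1
    exact w₀.state_zero.symm
  · rintro ⟨c, rfl⟩
    obtain ⟨l, k, -, h⟩ := w₀.exists_twistList_state 0 c
    rw [state_zero] at h
    exact ⟨l, h⟩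

lemma state_mem_orbit (w : AdmMultideg G n) (c : G.V → ℤ) : w.state c ∈ w.orbit :=
  mem_orbit_iff.2 ⟨c, rfl⟩

lemma mem_orbit_self (w : AdmMultideg G n) : w ∈ w.orbit := ⟨[], rfl⟩

lemma mem_orbit_trans {w w' w'' : AdmMultideg G n} (h : w' ∈ w.orbit) (h' : w'' ∈ w'.orbit) :
    w'' ∈ w.orbit := by
  obtain ⟨l, rfl⟩ := h
  obtain ⟨l', rfl⟩ := h'
  exact ⟨l ++ l', by simp [twistList, List.foldl_append]⟩

lemma mem_orbit_symm {w w' : AdmMultideg G n} (h : w' ∈ w.orbit) : w ∈ w'.orbit := by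
  obtain ⟨c, rfl⟩ := mem_orbit_iff.1 h
  obtain ⟨l, k, -, h⟩ := w.exists_twistList_state c 0
  rw [state_zero] at h
  exact ⟨l, h⟩

end AdmMultideg
/-! ### Branches of trees -/

section Branch

variable {V : Type*} {H : SimpleGraph V}

lemma connected_induction (hH : H.Connected) {p : V → Prop} {a : V} (ha : p a)
    (h : ∀ x y, H.Adj x y → p x → p y) (b : V) : p b := by
  obtain ⟨W⟩ := hH.preconnected a b
  induction W with
  | nil => exact ha
  | cons hadj _ ih => exact ih (h _ _ hadj ha)

variable (H) in
/-- The component of `v` after removal of the edge `{v, u}`. -/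
def branch (v u : V) : Set V := {x | (H.deleteEdges {s(v, u)}).Reachable v x}

lemma self_mem_branch (v u : V) : v ∈ branch H v u := SimpleGraph.Reachable.refl v

lemma not_mem_branch (hH : H.IsTree) {v u : V} (h : H.Adj v u) : u ∉ branch H v u := by
  have := SimpleGraph.isAcyclic_iff_forall_adj_isBridge.1 hH.isAcyclic h
  rwa [SimpleGraph.isBridge_iff] at this

lemma mem_branch_of_adj {v u x y : V} (hx : x ∈ branch H v u) (h : H.Adj x y)
    (hne : s(x, y) ≠ s(v, u)) : y ∈ branch H v u :=
  SimpleGraph.Reachable.trans hx (SimpleGraph.Adj.reachable (by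
    rw [SimpleGraph.deleteEdges_adj]
    exact ⟨h, by simpa using hne⟩))

lemma eq_of_adj_branch (hH : H.IsTree) {v u x y : V} (huv : H.Adj v u) (hx : x ∈ branch H v u)
    (hy : y ∉ branch H v u) (h : H.Adj x y) : x = v ∧ y = u := by
  by_contra hne
  refine hy (mem_branch_of_adj hx h fun heq => ?_)
  rcases Sym2.eq_iff.1 heq with h1 | ⟨rfl, rfl⟩
  · exact hne h1
  · exact not_mem_branch hH huv hx

lemma mem_branch_or (hH : H.IsTree) (v u x : V) : x ∈ branch H v u ∨ x ∈ branch H u v := by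
  refine connected_induction hH.connected (p := fun x => x ∈ branch H v u ∨ x ∈ branch H u v)
    (a := v) (Or.inl (self_mem_branch v u)) (fun x y h hx => ?_) x
  by_cases hne : s(x, y) = s(v, u)
  · rcases Sym2.eq_iff.1 hne with ⟨-, rfl⟩ | ⟨-, rfl⟩
    · exact Or.inr (self_mem_branch _ _)
    · exact Or.inl (self_mem_branch _ _)
  · rcases hx with hx | hx
    · exact Or.inl (mem_branch_of_adj hx h hne)
    · exact Or.inr (mem_branch_of_adj hx h (by rwa [Sym2.eq_swap (a := u)]))

lemma mem_branch_iff_not (hH : H.IsTree) {v u : V} (h : H.Adj v u) (x : V) :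
    x ∈ branch H u v ↔ x ∉ branch H v u := by
  refine ⟨fun hx hx' => not_mem_branch hH h ?_, (mem_branch_or hH v u x).resolve_left⟩
  have hx : (H.deleteEdges {s(u, v)}).Reachable u x := hx
  rw [Sym2.eq_swap] at hx
  exact SimpleGraph.Reachable.trans hx' hx.symm

lemma mem_branch_iff_of_adj {v u x y : V} (h : H.Adj x y)
    (hne : s(x, y) ≠ s(v, u)) : x ∈ branch H v u ↔ y ∈ branch H v u :=
  ⟨fun hx => mem_branch_of_adj hx h hne,
    fun hy => mem_branch_of_adj hy h.symm (by rwa [Sym2.eq_swap])⟩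

/-- A walk inside the branch of `u'` could enter the branch of `u` only from `v`, which does not
belong to the branch of `u'`. -/
lemma not_mem_branch_of_mem_branch (hH : H.IsTree) {v u u' x : V} (hu : H.Adj v u)
    (hu' : H.Adj v u') (hne : u ≠ u') (hx : x ∈ branch H u v) : x ∉ branch H u' v := by
  intro hx'
  have hv : v ∉ branch H u v := not_mem_branch hH hu.symm
  have hv' : v ∉ branch H u' v := not_mem_branch hH hu'.symm
  have h0 : u' ∉ branch H u v := fun h =>
    hne (eq_of_adj_branch hH hu.symm h hv hu'.symm).1.symm
  have key : ∀ y, y ∈ branch H u' v → y ∉ branch H u v := by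
    rintro y ⟨W⟩
    have gen : ∀ {a b : V} (_ : (H.deleteEdges {s(u', v)}).Walk a b), a ∈ branch H u' v →
        a ∉ branch H u v → b ∉ branch H u v := by
      intro a b W
      induction W with
      | nil => exact fun _ h => h
      | @cons a b c hadj W ih =>
        intro ha ha'
        have hab : H.Adj a b := (SimpleGraph.deleteEdges_adj.1 hadj).1
        refine ih (SimpleGraph.Reachable.trans ha hadj.reachable) fun hb => ?_
        have := (eq_of_adj_branch hH hu.symm hb ha' hab.symm).2
        rw [this] at ha
        exact hv' ha
    exact gen W (self_mem_branch _ _) h0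
  exact key x hx' hx

/-- On a tree every antisymmetric function on the edges is a gradient: each oriented edge
contributes its value on the branch of its first end, and the ends of any other edge lie on the same
side of it. The bijection `φ` only selects one orientation per edge. -/
lemma exists_potential [Fintype V] (hH : H.IsTree) {A : Type*} [AddCommGroup A] (t : V → V → A)
    (ht : ∀ u v, H.Adj u v → t u v = -t v u) :
    ∃ c : V → A, ∀ u v, H.Adj u v → c u - c v = t u v := by
  let φ := Fintype.equivFin V
  let term : V × V → V → A := fun p x =>
    if H.Adj p.1 p.2 ∧ φ p.1 < φ p.2 ∧ x ∈ branch H p.1 p.2 then t p.1 p.2 else 0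
  have key : ∀ u v, H.Adj u v → φ u < φ v →
      ∑ p, term p u - ∑ p, term p v = t u v := by
    intro u v huv hlt
    rw [← Finset.sum_sub_distrib, Finset.sum_eq_single (u, v)]
    · simp [term, huv, hlt, self_mem_branch, not_mem_branch hH huv]
    · rintro ⟨a, b⟩ - hne
      simp only [term]
      by_cases hab : H.Adj a b ∧ φ a < φ b
      · have : s(u, v) ≠ s(a, b) := by
          intro h
          rcases Sym2.eq_iff.1 h with ⟨rfl, rfl⟩ | ⟨rfl, rfl⟩
          · exact hne rfl
          · exact lt_asymm hlt hab.2
        simp [mem_branch_iff_of_adj huv this]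
      · have : ∀ x, ¬(H.Adj a b ∧ φ a < φ b ∧ x ∈ branch H a b) :=
          fun x h => hab ⟨h.1, h.2.1⟩
        simp [this]
    · simp
  refine ⟨fun x => ∑ p, term p x, fun u v huv => ?_⟩
  rcases lt_trichotomy (φ u) (φ v) with h | h | h
  · exact key u v huv h
  · exact absurd (φ.injective h) huv.ne
  · rw [ht u v huv, ← key v u huv.symm h, neg_sub]

end Branch

namespace AdmMultideg

variable {G : Multigraph} {n : G.E → ℕ+}

open Multigraph

/-! ### The potential of a multidegree -/

lemma coef_congr (w : AdmMultideg G n) {c c' : G.V → ℝ} {v : G.V} {e : G.E}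
    (h : c v - c (other e v) = c' v - c' (other e v)) : w.coef c v e = w.coef c' v e := by
  rw [coef, coef, h]

lemma drop_add_length (w : AdmMultideg G n) (e : G.E) (v : G.V) (t : ℝ) :
    w.drop e v (t + (n e : ℕ)) = w.drop e v t - 1 := by
  have hn : ((n e : ℕ) : ℝ) ≠ 0 := by exact_mod_cast (n e).ne_zero
  rw [drop, drop, ← add_assoc, add_div _ ((n e : ℕ) : ℝ), div_self hn, Int.ceil_add_one]
  ring

/-- Where `c - c'` is maximal, each coefficient for `c` is at most that for `c'`; the sums agree,
hence so do the terms. Along an edge on which `c - c'` decreased, the decrease would be a positive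
multiple of the length, the chips being in the same position, and would cost a chip. So the maximum
spreads to all vertices. -/
lemma sub_eq_of_state_eq (hG : G.bar.Connected) (w : AdmMultideg G n) {c c' : G.V → ℤ}
    (h : w.state c = w.state c') (u v : G.V) : c u - c v = c' u - c' v := by
  have := hG.nonempty
  obtain ⟨a, ha⟩ := Finite.exists_max fun v => c v - c' v
  suffices key : ∀ v, c v - c' v = c a - c' a by
    have h1 := key u
    have h2 := key v
    omega
  refine connected_induction hG (p := fun v => c v - c' v = c a - c' a) (a := a) rfl ?_
  intro x y hxy hx
  obtain ⟨hne, e, hex, hey⟩ := hxy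
  have hdiv : ∀ e v, G.Inc e v → ((n e : ℕ) : ℤ) ∣ (c v - c (other e v)) - (c' v - c' (other e v)) := by
    intro e v hev
    have h1 : (w.state c).μ e = (w.state c').μ e := by rw [h]
    rw [state_μ, state_μ, add_right_inj, ← sub_eq_zero, ← Int.cast_sub,
      ZMod.intCast_zmod_eq_zero_iff_dvd] at h1
    rcases hev with rfl | rfl
    · rw [other_tail]; exact h1
    · rw [other_head]
      have h2 := (dvd_neg).2 h1
      rwa [show -(c (G.tail e) - c (G.head e) - (c' (G.tail e) - c' (G.head e))) =
        c (G.head e) - c (G.tail e) - (c' (G.head e) - c' (G.tail e)) by ring] at h2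
  have hterm : ∀ e ∈ G.edgesAt x, w.coef (fun v => c v) x e ≤ w.coef (fun v => c' v) x e := by
    intro e _
    refine w.drop_anti e x ?_
    have := ha (other e x)
    have h1 : c' x - c' (other e x) ≤ c x - c (other e x) := by omega
    show (c' x : ℝ) - c' (other e x) ≤ c x - c (other e x)
    exact_mod_cast h1
  have hsum : ∑ e ∈ G.edgesAt x, w.coef (fun v => c v) x e =
      ∑ e ∈ G.edgesAt x, w.coef (fun v => c' v) x e := by
    have h1 : (w.state c).wG x = (w.state c').wG x := by rw [h]
    rw [state_wG, state_wG, degAt, degAt] at h1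
    exact add_left_cancel h1
  have heq := (Finset.sum_eq_sum_iff_of_le hterm).1 hsum e (mem_edgesAt.2 hex)
  have hy : y = other e x := eq_other hey hex (Ne.symm hne)
  subst hy
  by_contra hcon
  have h2 : 0 < (c x - c (other e x)) - (c' x - c' (other e x)) := by
    have := ha (other e x)
    omega
  have h3 := Int.le_of_dvd h2 (hdiv e x hex)
  have h4 : w.coef (fun v => c v) x e ≤ w.coef (fun v => c' v) x e - 1 := by
    rw [coef, coef, ← drop_add_length]
    refine w.drop_anti e x ?_
    have : (c' x - c' (other e x)) + (n e : ℕ) ≤ c x - c (other e x) := by omega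
    show (c' x : ℝ) - c' (other e x) + (n e : ℕ) ≤ c x - c (other e x)
    exact_mod_cast this
  omega

lemma state_eq_iff (hG : G.bar.Connected) (w : AdmMultideg G n) {c c' : G.V → ℤ} :
    w.state c = w.state c' ↔ ∀ u v, c u - c v = c' u - c' v := by
  refine ⟨fun h u v => w.sub_eq_of_state_eq hG h u v, fun h => ?_⟩
  rw [state, state]
  congr 1
  ext e
  exact h _ _

lemma degree_moved (w : AdmMultideg G n) (x : G.E → ℤ) : (w.moved x).degree = w.degree := by
  have hcard : ∀ w : AdmMultideg G n, (((Finset.univ.filter fun e => w.μ e ≠ 0).card : ℕ) : ℤ) =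
      ∑ e, if w.μ e ≠ 0 then 1 else 0 := by
    intro w
    rw [Finset.card_filter]
    push_cast
    rfl
  have key : ∀ e, (if (w.moved x).μ e ≠ 0 then (1 : ℤ) else 0) +
      (w.drop e (G.tail e) ((G.sgn e (G.tail e) * x e : ℤ) : ℝ) +
        w.drop e (G.head e) ((G.sgn e (G.head e) * x e : ℤ) : ℝ)) = if w.μ e ≠ 0 then 1 else 0 := by
    intro e
    have h1 := ceil_add_ceil_neg (n e) (w.lift e (G.tail e))
    have h2 := ceil_add_ceil_neg (n e) (w.lift e (G.tail e) + G.sgn e (G.tail e) * x e)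
    have d0 := w.dvd_lift_add_iff e (G.tail e) 0
    rw [mul_zero, add_zero, Int.cast_zero, add_zero] at d0
    simp only [w.dvd_lift_add_iff] at h2
    simp only [d0] at h1
    have hl : w.lift e (G.head e) = -w.lift e (G.tail e) := by
      rw [lift, lift, sgn_head, sgn_tail]; ring
    have hμ : (w.moved x).μ e = w.μ e + (x e : ZMod (n e)) := rfl
    rw [hμ, drop, drop, hl]
    rw [sgn_tail] at h2 ⊢
    rw [sgn_head]
    push_cast at h1 h2 ⊢
    have h3 : (-(w.lift e (G.tail e) : ℝ) + -1 * (x e : ℝ)) =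
      -((w.lift e (G.tail e) : ℝ) + 1 * x e) := by ring
    have h3' : (-((w.lift e (G.tail e) : ℝ) + 1 * x e)) / (n e : ℕ) =
      (-(1 * (x e : ℝ)) + -(w.lift e (G.tail e) : ℝ)) / (n e : ℕ) := by ring
    simp only [neg_add_rev] at h2
    rw [h3, h3']
    split_ifs at h1 h2 ⊢ <;> first | omega | (exfalso; tauto)
  rw [degree, degree, hcard, hcard]
  have hw : ∑ v, (w.moved x).wG v = ∑ v, w.wG v +
      ∑ e, (w.drop e (G.tail e) ((G.sgn e (G.tail e) * x e : ℤ) : ℝ) +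
        w.drop e (G.head e) ((G.sgn e (G.head e) * x e : ℤ) : ℝ)) := by
    rw [← sum_edgesAt (fun v e => w.drop e v ((G.sgn e v * x e : ℤ) : ℝ)),
      ← Finset.sum_add_distrib]
    rfl
  have hk := Finset.sum_congr (s₁ := Finset.univ) rfl fun e _ => key e
  rw [Finset.sum_add_distrib] at hk
  rw [hw, ← hk]
  ring

lemma degree_eq_of_mem_orbit {w w' : AdmMultideg G n} (h : w' ∈ w.orbit) :
    w'.degree = w.degree := by
  obtain ⟨c, rfl⟩ := mem_orbit_iff.1 h
  exact w.degree_moved _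

/-! ### Twisting coefficients -/

lemma stepCoeff_state (w : AdmMultideg G n) (c : G.V → ℤ) (u : G.V) {v : G.V} {e : G.E}
    (he : G.Inc e v) :
    stepCoeff v (w.state c) u e =
      w.coef (fun x => ((c + Pi.single u 1 : G.V → ℤ) x : ℝ)) v e - w.coef (fun x => c x) v e := by
  have hx : ((G.sgn e v * (c (G.tail e) - c (G.head e)) : ℤ) : ℝ) =
      (c v : ℝ) - c (other e v) := by
    have := sgn_mul_sub (A := ℤ) he c
    rw [Int.cast_id] at this
    rw [this]; push_cast; rfl
  unfold stepCoeff
  by_cases huv : u = v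
  · subst huv
    have h := w.drop_succ e u (c (G.tail e) - c (G.head e))
    have h1 : ((G.sgn e u * (c (G.tail e) - c (G.head e)) + 1 : ℤ) : ℝ) =
        ((c + Pi.single u 1 : G.V → ℤ) u : ℝ) - ((c + Pi.single u 1 : G.V → ℤ) (other e u) : ℝ) := by
      rw [Int.cast_add, hx, Pi.add_apply, Pi.add_apply, Pi.single_eq_same,
        Pi.single_eq_of_ne (other_ne he)]
      push_cast
      ring
    rw [h1, hx] at h
    rw [coef, coef, h, state_μ]
    simp only [if_true, he, true_and]
    push_cast
    split_ifs <;> ring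
  · rw [if_neg huv]
    by_cases heu : G.Inc e u
    · have hu := eq_other heu he huv
      have h := w.drop_pred e v (c (G.tail e) - c (G.head e))
      have h1 : ((G.sgn e v * (c (G.tail e) - c (G.head e)) - 1 : ℤ) : ℝ) =
          ((c + Pi.single u 1 : G.V → ℤ) v : ℝ) - ((c + Pi.single u 1 : G.V → ℤ) (other e v) : ℝ) := by
        rw [Int.cast_sub, hx, Pi.add_apply, Pi.add_apply, ← hu, Pi.single_eq_same,
          Pi.single_eq_of_ne (Ne.symm huv)]
        push_cast
        ring
      have h2 : (twist u (w.state c)).μ e = w.μ e +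
          ((c (G.tail e) - c (G.head e) : ℤ) : ZMod (n e)) - (G.sgn e v : ZMod (n e)) := by
        rw [twist, twistAlong]
        simp only [mem_edgesAt, heu, if_true]
        rw [hu, sgn_other he, state_μ]
        push_cast
        ring
      rw [h1, hx] at h
      rw [coef, coef, h, h2]
      simp only [he, heu, true_and]
      push_cast
      split_ifs <;> ring
    · rw [if_neg (by tauto)]
      rw [w.coef_congr (c' := fun x => c x), sub_self]
      rw [Pi.add_apply, Pi.add_apply, Pi.single_eq_of_ne (Ne.symm huv), Pi.single_eq_of_ne]
      · simp
      · rintro rfl; exact heu (inc_other e v)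

lemma pathCoeff_state (w : AdmMultideg G n) (l : List G.V) (c : G.V → ℤ) {v : G.V} {e : G.E}
    (he : G.Inc e v) :
    pathCoeff v l (w.state c) e =
      w.coef (fun x => ((c x + l.count x : ℤ) : ℝ)) v e - w.coef (fun x => c x) v e := by
  induction l generalizing c with
  | nil => simp [pathCoeff]
  | cons u l ih =>
    rw [pathCoeff, w.stepCoeff_state c u he, twist_state, ih]
    have : (fun x => (((c + Pi.single u 1 : G.V → ℤ) x + l.count x : ℤ) : ℝ)) =
        fun x => ((c x + (u :: l).count x : ℤ) : ℝ) := by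
      funext x
      congr 1
      rw [List.count_cons, Pi.add_apply]
      by_cases hux : u = x
      · subst hux; simp; ring
      · simp [hux]
    rw [this]
    ring

/-- Independence of the path: the steps telescope to a difference of coefficients, and any path to
the same multidegree ends at the same potential up to a constant. -/
lemma twistCoeff_state (hG : G.bar.Connected) (w : AdmMultideg G n) (c c' : G.V → ℤ) {v : G.V}
    {e : G.E} (he : G.Inc e v) :
    twistCoeff (w.state c) (w.state c') v e =
      w.coef (fun x => c' x) v e - w.coef (fun x => c x) v e := by
  have hex : ∃ l, twistList l (w.state c) = w.state c' := by
    obtain ⟨l, -, -, h⟩ := w.exists_twistList_state c c'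
    exact ⟨l, h⟩
  rw [twistCoeff, dif_pos hex, pathCoeff_state _ _ _ he]
  have h := hex.choose_spec
  rw [twistList_state] at h
  have h1 := w.sub_eq_of_state_eq hG h v (other e v)
  congr 1
  refine w.coef_congr ?_
  exact_mod_cast h1

/-! ### Multidegrees concentrated on a vertex -/

/-- No set of vertices avoiding `v` can be fired without making one of its members negative. -/
def IsUnfireable (w : AdmMultideg G n) (c : G.V → ℤ) (v : G.V) : Prop :=
  ∀ A : Set G.V, A.Nonempty → v ∉ A →
    ∃ u ∈ A, w.degAt (fun x => c x + if x ∈ A then 1 else 0) u < 0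

lemma degAt_le_of_forall (w : AdmMultideg G n) {c c' : G.V → ℝ} {u : G.V}
    (h : ∀ x, G.bar.Adj u x → ∀ e ∈ G.edgesOver u x, w.drop e u (c' u - c' x) ≤ w.drop e u (c u - c x)) :
    w.degAt c' u ≤ w.degAt c u := by
  refine add_le_add_right (Finset.sum_le_sum fun e he => ?_) _
  rw [mem_edgesAt] at he
  exact h _ (adj_other he) e (mem_edgesOver.2 ⟨he, inc_other e u⟩)

/-- The maximum principle for potentials. -/
lemma IsUnfireable.sub_le_sub {w : AdmMultideg G n} {c : G.V → ℤ} {v : G.V}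
    (h : w.IsUnfireable c v) {c' : G.V → ℝ} (hc' : ∀ u, u ≠ v → 0 ≤ w.degAt c' u) (x : G.V) :
    (c v : ℝ) - c x ≤ c' v - c' x := by
  have : Nonempty G.V := ⟨v⟩
  obtain ⟨a, ha⟩ := Finite.exists_max fun x => c' x - c x
  by_cases hv : c' v - c v = c' a - c a
  · have := ha x
    linarith
  exfalso
  -- Fire the set where `c' - c` is maximal. If it avoids `v`, some `u` in it becomes negative, and
  -- the potential `c'` leaves no more at `u` than this firing does.
  obtain ⟨u, hu, hneg⟩ := h {x | c' x - c x = c' a - c a} ⟨a, rfl⟩ hv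
  have hu : c' u - c u = c' a - c a := hu
  have huv : u ≠ v := by rintro rfl; exact hv hu
  refine absurd (hc' u huv) (not_le.2 (lt_of_le_of_lt (w.degAt_le_of_forall ?_) hneg))
  intro y _ e _
  have hy := ha y
  simp only [Set.mem_ofPred_eq, hu, if_true]
  split_ifs with h1
  · exact w.drop_anti e u (by linarith)
  · have h2 : c' y - c y < c' a - c a := lt_of_le_of_ne hy h1
    -- Towards vertices outside the set `c'` drops by more than the integer `c u - c y`, hence
    -- counts as at least one further twist.
    have h3 := w.drop_le_of_lt e u (s := c u - c y) (t := c' u - c' y) (by push_cast; linarith)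
    refine h3.trans (le_of_eq ?_)
    congr 1
    push_cast
    ring

lemma exists_eq_append_cons_of_mem {α : Type*} {A : Set α} {l : List α} (h : ∃ u ∈ l, u ∈ A) :
    ∃ p u s, l = p ++ u :: s ∧ u ∈ A ∧ ∀ x ∈ p, x ∉ A := by
  induction l with
  | nil => simp at h
  | cons a l ih =>
    by_cases ha : a ∈ A
    · exact ⟨[], a, l, rfl, ha, by simp⟩
    · obtain ⟨u, hu, huA⟩ := h
      have : u ∈ l := (List.mem_cons.1 hu).resolve_left (by rintro rfl; exact ha huA)
      obtain ⟨p, u', s, rfl, h1, h2⟩ := ih ⟨u, this, huA⟩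
      refine ⟨a :: p, u', s, rfl, h1, fun x hx => ?_⟩
      rcases List.mem_cons.1 hx with rfl | hx
      exacts [ha, h2 x hx]

/-- Let `u` be the first member of `A` in the ordering. Negative twists at the vertices before `u`,
all outside `A`, take no more from `u` than firing `A` does, and they already make `u` negative. -/
lemma IsConcentrated.isUnfireable (hG : G.bar.Connected) {w : AdmMultideg G n} {c : G.V → ℤ}
    {v : G.V} (h : (w.state c).IsConcentrated v) : w.IsUnfireable c v := by
  obtain ⟨l, hnd, hall, hhead, hl⟩ := h
  intro A ⟨a, ha⟩ hv
  obtain ⟨p, u, s, rfl, hu, hp⟩ := exists_eq_append_cons_of_mem ⟨a, hall a, ha⟩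
  have hp0 : p ≠ [] := by
    rintro rfl
    simp only [List.nil_append, List.head?_cons, Option.some.injEq] at hhead
    exact hv (hhead ▸ hu)
  obtain ⟨w', hw', hneg⟩ := hl p u s rfl hp0
  have horb : w' ∈ w.orbit := by
    have h1 : twistList p w' ∈ w'.orbit := ⟨p, rfl⟩
    rw [hw'] at h1
    exact mem_orbit_trans (w.state_mem_orbit c) (mem_orbit_symm h1)
  obtain ⟨c'', rfl⟩ := mem_orbit_iff.1 horb
  rw [twistList_state] at hw'
  refine ⟨u, hu, lt_of_le_of_lt ?_ hneg⟩
  rw [state_wG]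
  have hup : u ∉ p := fun hmem => hp u hmem hu
  refine w.degAt_le_of_forall fun y _ e _ => w.drop_anti e u ?_
  have h1 := w.sub_eq_of_state_eq hG hw' u y
  rw [List.count_eq_zero_of_not_mem hup] at h1
  have h2 : (List.count y p) ≤ 1 :=
    List.nodup_iff_count_le_one.1 (hnd.sublist (List.sublist_append_left _ _)) y
  simp only [hu, if_true]
  split_ifs with hy
  · have : y ∉ p := fun hmem => hp y hmem hy
    rw [List.count_eq_zero_of_not_mem this] at h1
    have h3 : c'' u - c'' y ≤ (c u + 1) - (c y + 1) := by push_cast at h1; omega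
    exact_mod_cast h3
  · have h3 : c'' u - c'' y ≤ (c u + 1) - (c y + 0) := by push_cast at h1; omega
    exact_mod_cast h3

/-! ### Twists along one edge of the tree -/

/-- The edges over {v, u} are exactly those joining the branch of `v` to its complement, so twisting
along them alone amounts to twisting once at every vertex of that branch. -/
lemma partialTwist_state (hG : G.IsMultitree) (w : AdmMultideg G n) (c : G.V → ℤ) {v u : G.V}
    (h : G.bar.Adj v u) :
    partialTwist v u (w.state c) =
      w.state (fun x => c x + if x ∈ branch G.bar v u then 1 else 0) := by
  rw [partialTwist, state, twistAlong_moved, state]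
  · congr 1
    ext e
    have hadj : G.bar.Adj (G.tail e) (G.head e) := ⟨G.loopless e, e, inc_tail e, inc_head e⟩
    simp only [Pi.add_apply]
    have key : (if e ∈ G.edgesOver v u then G.sgn e v else 0) =
        (if G.tail e ∈ branch G.bar v u then (1 : ℤ) else 0) -
          if G.head e ∈ branch G.bar v u then 1 else 0 := by
      have b1 := self_mem_branch (H := G.bar) v u
      have b2 := not_mem_branch hG h
      by_cases hs : s(G.tail e, G.head e) = s(v, u)
      · rcases Sym2.eq_iff.1 hs with ⟨rfl, rfl⟩ | ⟨rfl, rfl⟩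
        · rw [if_pos (mem_edgesOver.2 ⟨inc_tail e, inc_head e⟩), if_pos b1, if_neg b2, sgn_tail,
            sub_zero]
        · rw [if_pos (mem_edgesOver.2 ⟨inc_head e, inc_tail e⟩), if_pos b1, if_neg b2, sgn_head,
            zero_sub]
      · have : e ∉ G.edgesOver v u := by
          intro he
          rw [mem_edgesOver] at he
          refine hs ?_
          rcases he with ⟨rfl | rfl, h1 | h1⟩
          · exact absurd h1.symm h.ne
          · rw [h1]
          · rw [h1]; exact Sym2.eq_swap
          · exact absurd h1.symm h.ne
        rw [if_neg this]
        simp [mem_branch_iff_of_adj hadj hs]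
    rw [key]
    ring
  · intro e he
    exact mem_edgesAt.2 (mem_edgesOver.1 he).1

lemma partialTwist_iterate_state (hG : G.IsMultitree) (w : AdmMultideg G n) (c : G.V → ℤ)
    {v u : G.V} (h : G.bar.Adj v u) (b : ℕ) :
    (partialTwist v u)^[b] (w.state c) =
      w.state (fun x => c x + if x ∈ branch G.bar v u then (b : ℤ) else 0) := by
  induction b with
  | zero => simp
  | succ b ih =>
    rw [Function.iterate_succ_apply', ih, partialTwist_state hG w _ h]
    congr 1
    funext x
    split_ifs <;> push_cast <;> ring

/-- The tuple `(w_v)_v` is given by potentials `c v`, each unfireable away from `v`, and `w_u`,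
`w_v` for adjacent `u`, `v` differ by `gap u v` twists at the edge joining them. -/
structure TightPotentials (w : AdmMultideg G n) (wt : G.V → AdmMultideg G n)
    (c : G.V → G.V → ℤ) : Prop where
  eq_state : ∀ v, wt v = w.state (c v)
  unfireable : ∀ v, w.IsUnfireable (c v) v
  gap_eq : ∀ u v, G.bar.Adj u v → c u v - c u u = c v v - c v u + gap wt u v

lemma TightPotentials.mem_orbit {w₀ : AdmMultideg G n} {wt : G.V → AdmMultideg G n}
    {c : G.V → G.V → ℤ} (hc : TightPotentials w₀ wt c) (v : G.V) : wt v ∈ w₀.orbit :=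
  mem_orbit_iff.2 ⟨_, hc.eq_state v⟩

/-- The number of partial twists is determined by the potentials, so the infimum defining `gap` is
taken over a single number. -/
lemma gap_eq_of_eq_iterate (hG : G.IsMultitree) (w : AdmMultideg G n)
    {wt : G.V → AdmMultideg G n} {c : G.V → G.V → ℤ} (hc : ∀ v, wt v = w.state (c v)) {u v : G.V}
    (h : G.bar.Adj u v) {b : ℕ} (hb : wt u = (partialTwist v u)^[b] (wt v)) :
    c u v - c u u = c v v - c v u + gap wt u v := by
  have key : ∀ b : ℕ, wt u = (partialTwist v u)^[b] (wt v) →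
      c u v - c u u = c v v - c v u + b := by
    intro b hb
    rw [hc, hc, partialTwist_iterate_state hG w _ h.symm] at hb
    have := w.sub_eq_of_state_eq hG.connected hb v u
    rw [if_pos (self_mem_branch v u), if_neg (not_mem_branch hG h.symm)] at this
    omega
  exact key _ (Nat.sInf_mem (s := {b : ℕ | wt u = (partialTwist v u)^[b] (wt v)}) ⟨b, hb⟩)

lemma IsTight.exists_tightPotentials (hG : G.IsMultitree) {w : AdmMultideg G n}
    {wt : G.V → AdmMultideg G n} (hwt : ∀ v, wt v ∈ w.orbit) (h : IsTight wt) :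
    ∃ c, TightPotentials w wt c := by
  choose c hc using fun v => mem_orbit_iff.1 (hwt v)
  refine ⟨c, hc, fun v => ?_, fun u v huv => ?_⟩
  · have := h.1 v
    rw [hc] at this
    exact this.isUnfireable hG.connected
  · obtain ⟨b, hb⟩ := h.2 u v huv
    exact w.gap_eq_of_eq_iterate hG hc huv hb

end AdmMultideg
section Branch

variable {V : Type*} {H : SimpleGraph V}

lemma exists_adj_mem_branch (hH : H.Connected) {u v : V} (h : u ≠ v) :
    ∃ p, H.Adj u p ∧ v ∈ branch H p u := by
  obtain ⟨W, hW⟩ := hH.exists_isPath u v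
  cases W with
  | nil => exact absurd rfl h
  | @cons _ p _ hadj W =>
    rw [SimpleGraph.Walk.cons_isPath_iff] at hW
    refine ⟨p, hadj, (W.toDeleteEdge s(p, u) fun hmem => hW.2 ?_).reachable⟩
    exact W.snd_mem_support_of_mem_edges hmem

/-- The distance to `v` up to a constant, as the potential of the function that is 1 on edges
pointing towards `v`. -/
lemma exists_height [Fintype V] (hH : H.IsTree) (v : V) :
    ∃ h : V → ℤ, ∀ u p, H.Adj u p → v ∈ branch H p u → h u = h p + 1 := by
  obtain ⟨h, hh⟩ := exists_potential hH
    (fun u p => if v ∈ branch H p u then (1 : ℤ) else -1) (fun u p hup => by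
      rw [mem_branch_iff_not hH hup v]
      split_ifs <;> simp_all)
  refine ⟨h, fun u p hup hv => ?_⟩
  have := hh u p hup
  rw [if_pos hv] at this
  omega

end Branch

namespace AdmMultideg

variable {G : Multigraph} {n : G.E → ℕ+}

open Multigraph

/-! ### Existence and uniqueness of reduced potentials -/

lemma drop_mul_length (w : AdmMultideg G n) (e : G.E) (v : G.V) (k : ℤ) :
    w.drop e v ((k * (n e : ℕ) : ℤ) : ℝ) = -k := by
  have hn : ((n e : ℕ) : ℝ) ≠ 0 := by exact_mod_cast (n e).ne_zero
  rw [drop]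
  push_cast
  rw [add_div, mul_div_cancel_right₀ _ hn, Int.ceil_add_intCast]
  ring

/-- Take the largest `s` with nonnegative sum. It exists because the sum decreases in `s`, and
displacing the chip on `e₀` by multiples of its length makes it unbounded in both directions. -/
lemma exists_between_sum_drop (w : AdmMultideg G n) (u : G.V) (q : G.E → Prop) (a : G.E → ℤ)
    (d : ℤ) (hq : ∃ e ∈ G.edgesAt u, q e) :
    ∃ s : ℤ, 0 ≤ d + ∑ e ∈ G.edgesAt u, w.drop e u ((if q e then s else a e : ℤ) : ℝ) ∧
      d + ∑ e ∈ G.edgesAt u, w.drop e u ((if q e then s + 1 else a e : ℤ) : ℝ) < 0 := by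
  obtain ⟨e₀, he₀, hq₀⟩ := hq
  let F : ℤ → ℤ := fun s => d + ∑ e ∈ G.edgesAt u, w.drop e u ((if q e then s else a e : ℤ) : ℝ)
  have hdiff : ∀ s t : ℤ, s ≤ t → F t ≤ F s - (w.drop e₀ u s - w.drop e₀ u t) := by
    intro s t hst
    have hterm : ∀ e ∈ G.edgesAt u, w.drop e u ((if q e then t else a e : ℤ) : ℝ) +
        (if e = e₀ then w.drop e₀ u s - w.drop e₀ u t else 0) ≤
        w.drop e u ((if q e then s else a e : ℤ) : ℝ) := by
      intro e _
      have hst' : (s : ℝ) ≤ t := by exact_mod_cast hst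
      by_cases h1 : e = e₀
      · subst h1; simp [hq₀]
      · rw [if_neg h1, add_zero]
        split_ifs
        · exact w.drop_anti e u hst'
        · exact le_rfl
    have := Finset.sum_le_sum hterm
    rw [Finset.sum_add_distrib, Finset.sum_ite_eq' (G.edgesAt u) e₀, if_pos he₀] at this
    simp only [F]
    linarith
  have hn : (0 : ℤ) < (n e₀ : ℕ) := by exact_mod_cast (n e₀).pos
  have h0 : w.drop e₀ u ((0 : ℤ) : ℝ) = 0 := by rw [Int.cast_zero, drop_zero]
  have hlow : 0 ≤ F (-|F 0| * (n e₀ : ℕ)) := by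
    have h1 := hdiff (-|F 0| * (n e₀ : ℕ)) 0 (by nlinarith [abs_nonneg (F 0)])
    rw [w.drop_mul_length, h0] at h1
    have := neg_abs_le (F 0)
    linarith
  have hhigh : ∀ z : ℤ, 0 ≤ F z → z ≤ (|F 0| + 1) * (n e₀ : ℕ) := by
    intro z hz
    by_contra hcon
    have h1 := hdiff 0 ((|F 0| + 1) * (n e₀ : ℕ)) (by positivity)
    have h2 := hdiff _ z (not_le.1 hcon).le
    rw [w.drop_mul_length, h0] at h1
    have h3 := w.drop_anti e₀ u (s := (((|F 0| + 1) * (n e₀ : ℕ) : ℤ) : ℝ)) (t := z)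
      (by exact_mod_cast (not_le.1 hcon).le)
    have := le_abs_self (F 0)
    linarith
  obtain ⟨s, hs, hmax⟩ := Int.exists_greatest_of_bdd (P := fun z => 0 ≤ F z) ⟨_, hhigh⟩ ⟨_, hlow⟩
  refine ⟨s, hs, ?_⟩
  by_contra hcon
  have := hmax (s + 1) (not_lt.1 hcon)
  omega

lemma exists_reduced_potential (hG : G.IsMultitree) (w : AdmMultideg G n) (v : G.V) :
    ∃ c : G.V → ℤ, (∀ u, u ≠ v → 0 ≤ w.degAt (fun x => c x) u) ∧ w.IsUnfireable c v := by
  obtain ⟨h, hh⟩ := exists_height hG v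
  -- `t u` is the difference of potentials from `u` to its neighbour towards `v`. It is to be the
  -- largest one keeping `u` nonnegative, given the differences already chosen farther from `v`, so
  -- the construction runs from the leaves inwards.
  let arg : (G.V → ℤ) → G.V → ℤ → G.E → ℤ := fun t u s e =>
    if v ∈ branch G.bar (other e u) u then s else -t (other e u)
  let Good : (G.V → ℤ) → G.V → ℤ → Prop := fun t u s =>
    0 ≤ w.wG u + ∑ e ∈ G.edgesAt u, w.drop e u (arg t u s e : ℝ) ∧
      w.wG u + ∑ e ∈ G.edgesAt u, w.drop e u (arg t u (s + 1) e : ℝ) < 0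
  have hex : ∀ t u, u ≠ v → ∃ s, Good t u s := by
    intro t u huv
    obtain ⟨p, hp, hvp⟩ := exists_adj_mem_branch hG.connected huv
    obtain ⟨hne, e, heu, hep⟩ := hp
    refine w.exists_between_sum_drop u _ _ _ ⟨e, mem_edgesAt.2 heu, ?_⟩
    rwa [← eq_other hep heu hne.symm]
  obtain ⟨M, hM⟩ : ∃ M : ℤ, ∀ u, h u ≤ M :=
    ⟨∑ u, |h u|, fun u => (le_abs_self _).trans
      (Finset.single_le_sum (f := fun v => |h v|) (fun _ _ => abs_nonneg _) (Finset.mem_univ u))⟩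
  have step : ∀ k : ℕ, ∃ t : G.V → ℤ, ∀ u, u ≠ v → M - k < h u → Good t u (t u) := by
    intro k
    induction k with
    | zero => exact ⟨0, fun u _ hu => absurd (hM u) (by push_cast at hu; omega)⟩
    | succ k ih =>
      obtain ⟨t, ht⟩ := ih
      choose s hs using hex t
      let t' : G.V → ℤ := fun u => if M - k < h u then t u else
        if huv : u ≠ v then s u huv else 0
      refine ⟨t', fun u huv hu => ?_⟩
      have harg : ∀ s, ∀ e ∈ G.edgesAt u,
          w.drop e u (arg t' u s e : ℝ) = w.drop e u (arg t u s e : ℝ) := by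
        intro s e he
        rw [mem_edgesAt] at he
        simp only [arg]
        by_cases hv : v ∈ branch G.bar (other e u) u
        · simp only [if_pos hv]
        · simp only [if_neg hv]
          rw [mem_branch_iff_not hG (adj_other he), not_not] at hv
          have := hh _ _ (adj_other he).symm hv
          simp only [t']
          rw [if_pos (by push_cast at hu; omega)]
      have hG' : ∀ s, Good t' u s ↔ Good t u s := fun s => by
        simp only [Good]
        rw [Finset.sum_congr rfl (harg s), Finset.sum_congr rfl (harg (s + 1))]
      rw [hG']
      by_cases hk : M - k < h u
      · simp only [t', if_pos hk]; exact ht u huv hk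
      · simp only [t', if_neg hk, dif_pos huv]; exact hs u huv
  obtain ⟨N, hN⟩ : ∃ N : ℕ, ∀ u, M - N < h u := by
    refine ⟨(M + ∑ u, |h u| + 1).toNat, fun u => ?_⟩
    have h1 := (neg_le_abs (h u)).trans
      (Finset.single_le_sum (f := fun v => |h v|) (fun _ _ => abs_nonneg _) (Finset.mem_univ u))
    have := Int.self_le_toNat (M + ∑ u, |h u| + 1)
    linarith
  obtain ⟨t, ht⟩ := step N
  obtain ⟨c, hc⟩ := exists_potential hG
    (fun u p => if v ∈ branch G.bar p u then t u else -t p) (fun u p hup => by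
      rw [mem_branch_iff_not hG hup v]
      split_ifs <;> simp_all)
  have hcarg : ∀ u e, G.Inc e u → c u - c (other e u) = arg t u (t u) e :=
    fun u e he => hc u _ (adj_other he)
  have hgood : ∀ u, u ≠ v → Good t u (t u) := fun u huv => ht u huv (hN u)
  refine ⟨c, fun u huv => ?_, fun A hA hvA => ?_⟩
  · refine (hgood u huv).1.trans (le_of_eq ?_)
    rw [degAt]
    congr 1
    refine Finset.sum_congr rfl fun e he => ?_
    rw [← hcarg u e (mem_edgesAt.1 he), coef]
    push_cast
    rfl
  -- For a member `u` of `A` closest to `v`, the neighbour towards `v` is outside `A`. Firing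
  -- increases the difference in that direction by one and lowers no other difference at `u`, so
  -- maximality of `t u` makes `u` negative.
  · obtain ⟨u, hu, hmin⟩ := A.toFinite.exists_minimalFor h A hA
    refine ⟨u, hu, lt_of_le_of_lt ?_ (hgood u (by rintro rfl; exact hvA hu)).2⟩
    rw [degAt]
    refine add_le_add_right (Finset.sum_le_sum fun e he => ?_) _
    rw [mem_edgesAt] at he
    refine w.drop_anti e u ?_
    have h1 := hcarg u e he
    simp only [if_pos hu]
    simp only [arg] at h1 ⊢
    by_cases hv : v ∈ branch G.bar (other e u) u
    · rw [if_pos hv] at h1 ⊢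
      have h2 := hh _ _ (adj_other he) hv
      have h3 : other e u ∉ A := fun h3 => by
        have := hmin h3 (by omega)
        omega
      rw [if_neg h3, ← h1]
      push_cast
      linarith
    · rw [if_neg hv] at h1 ⊢
      rw [← h1]
      push_cast
      split_ifs <;> linarith

lemma sub_eq_of_reduced {w : AdmMultideg G n} {v : G.V} {c c' : G.V → ℤ}
    (h : (∀ u, u ≠ v → 0 ≤ w.degAt (fun x => c x) u) ∧ w.IsUnfireable c v)
    (h' : (∀ u, u ≠ v → 0 ≤ w.degAt (fun x => c' x) u) ∧ w.IsUnfireable c' v) (x : G.V) :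
    c v - c x = c' v - c' x := by
  have h1 := h.2.sub_le_sub h'.1 x
  have h2 := h'.2.sub_le_sub h.1 x
  exact_mod_cast le_antisymm h1 h2

lemma degAt_congr (w : AdmMultideg G n) {c c' : G.V → ℝ} {u : G.V}
    (h : ∀ x, G.bar.Adj u x → c u - c x = c' u - c' x) : w.degAt c u = w.degAt c' u := by
  rw [degAt, degAt]
  congr 1
  exact Finset.sum_congr rfl fun e he => w.coef_congr (h _ (adj_other (mem_edgesAt.1 he)))

/-- Moving the base point across an edge: twist at the edge on the side of `v` as often as `v` stays
nonnegative. The degrees at vertices other than `v` and `u` do not change, `v` becomes impossible to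
fire without `u`, and nonnegativity at `v` beforehand ensures that the number of twists is
nonnegative. -/
lemma exists_reduced_of_adj (hG : G.IsMultitree) {w : AdmMultideg G n} {v u : G.V}
    (hvu : G.bar.Adj v u) {c : G.V → ℤ} (hnn : ∀ x, 0 ≤ w.degAt (fun x => c x) x)
    (hc : w.IsUnfireable c v) :
    ∃ b : ℕ, (∀ x, x ≠ u →
        0 ≤ w.degAt (fun x => ((c x + if x ∈ branch G.bar v u then (b : ℤ) else 0 : ℤ) : ℝ)) x) ∧
      w.IsUnfireable (fun x => c x + if x ∈ branch G.bar v u then (b : ℤ) else 0) u := by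
  have b1 := self_mem_branch (H := G.bar) v u
  have b2 := not_mem_branch hG hvu
  let cb : ℤ → G.V → ℤ := fun b x => c x + if x ∈ branch G.bar v u then b else 0
  have hv : ∀ b, w.degAt (fun x => cb b x) v = w.wG v + ∑ e ∈ G.edgesAt v,
      w.drop e v ((if other e v = u then (c v - c u) + b else c v - c (other e v) : ℤ) : ℝ) := by
    intro b
    rw [degAt]
    congr 1
    refine Finset.sum_congr rfl fun e he => ?_
    rw [mem_edgesAt] at he
    rw [coef]
    congr 1
    simp only [cb]
    rw [if_pos b1]
    by_cases h : other e v = u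
    · rw [if_pos h, h, if_neg b2]; push_cast; ring
    · have : other e v ∈ branch G.bar v u := mem_branch_of_adj b1 (adj_other he) (by
        intro h'
        rcases Sym2.eq_iff.1 h' with h' | h'
        · exact h h'.2
        · exact hvu.ne h'.1)
      rw [if_neg h, if_pos this]; push_cast; ring
  have hother : ∀ x, x ≠ v → x ≠ u → ∀ y, G.bar.Adj x y →
      (y ∈ branch G.bar v u ↔ x ∈ branch G.bar v u) := fun x hxv hxu y hxy =>
    mem_branch_iff_of_adj hxy.symm (by
      intro h'
      rcases Sym2.eq_iff.1 h' with h' | h'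
      · exact hxu h'.2
      · exact hxv h'.2)
  obtain ⟨hne, e₀, hev, heu⟩ := hvu
  obtain ⟨s, hs, hs'⟩ := w.exists_between_sum_drop v (fun e => other e v = u)
    (fun e => c v - c (other e v)) (w.wG v)
    ⟨e₀, mem_edgesAt.2 hev, (eq_other heu hev hne.symm).symm⟩
  -- The present difference keeps `v` nonnegative, so the largest such difference `s` is not
  -- smaller.
  have hs0 : 0 ≤ s - (c v - c u) := by
    by_contra hcon
    have h0 := hnn v
    refine absurd h0 (not_le.2 (lt_of_le_of_lt ?_ hs'))
    have h1 := hv 0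
    have h2 : cb 0 = c := by funext x; simp [cb]
    rw [h2] at h1
    rw [h1]
    refine add_le_add_right (Finset.sum_le_sum fun e he => w.drop_anti e v ?_) _
    split_ifs
    · have : s + 1 ≤ c v - c u + 0 := by omega
      exact_mod_cast this
    · exact le_rfl
  obtain ⟨b, hb⟩ := Int.eq_ofNat_of_zero_le hs0
  have hs1 : s = (c v - c u) + b := by omega
  subst hs1
  refine ⟨b, fun x hxu => ?_, fun A hA huA => ?_⟩
  · by_cases hxv : x = v
    · subst hxv
      exact hs.trans_eq (hv b).symm
    · rw [w.degAt_congr (c' := fun x => c x)]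
      · exact hnn x
      · intro y hxy
        simp only [hother x hxv hxu y hxy]
        push_cast
        ring
  · by_cases hvA : v ∈ A
    · refine ⟨v, hvA, lt_of_le_of_lt ?_ hs'⟩
      rw [add_assoc, ← hv (b + 1)]
      refine w.degAt_le_of_forall fun y hy e he => w.drop_anti e v ?_
      simp only [cb, if_pos b1, if_pos hvA]
      by_cases hyu : y = u
      · subst hyu
        rw [if_neg b2, if_neg b2, if_neg huA]
        push_cast
        linarith
      · have : y ∈ branch G.bar v u := mem_branch_of_adj b1 hy (by
          intro h'
          rcases Sym2.eq_iff.1 h' with h' | h'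
          · exact hyu h'.2
          · exact hne h'.1)
        rw [if_pos this, if_pos this]
        push_cast
        split_ifs <;> linarith
    · obtain ⟨x, hx, hneg⟩ := hc A hA hvA
      have hxv : x ≠ v := by rintro rfl; exact hvA hx
      have hxu : x ≠ u := by rintro rfl; exact huA hx
      refine ⟨x, hx, ?_⟩
      rw [w.degAt_congr (c' := fun y => (c y : ℝ) + if y ∈ A then 1 else 0)]
      · exact hneg
      · intro y hxy
        simp only [hother x hxv hxu y hxy]
        push_cast
        ring

/-- By uniqueness of reduced potentials, the one for `u` is the one obtained from `v` by crossing
the edge, so neighbouring reduced multidegrees differ by partial twists as tightness requires. -/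
lemma tightPotentials_of_reduced (hG : G.IsMultitree) {w : AdmMultideg G n}
    {wt : G.V → AdmMultideg G n} {c : G.V → G.V → ℤ} (hwt : ∀ v, wt v = w.state (c v))
    (h : ∀ v, (∀ u, u ≠ v → 0 ≤ w.degAt (fun x => c v x) u) ∧ w.IsUnfireable (c v) v)
    (hnn : ∀ v, 0 ≤ (wt v).wG v) : TightPotentials w wt c := by
  refine ⟨hwt, fun v => (h v).2, fun u v huv => ?_⟩
  obtain ⟨b, hb⟩ := exists_reduced_of_adj hG huv.symm (c := c v) (fun x => by
    by_cases hx : x = v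
    · subst hx
      have := hnn x
      rwa [hwt, state_wG] at this
    · exact (h v).1 x hx) (h v).2
  refine w.gap_eq_of_eq_iterate hG hwt huv (b := b) ?_
  rw [hwt, hwt, partialTwist_iterate_state hG w _ huv.symm, w.state_eq_iff hG.connected]
  intro x y
  have h1 := sub_eq_of_reduced (h u) hb x
  have h2 := sub_eq_of_reduced (h u) hb y
  linarith

end AdmMultideg
namespace AdmMultideg

variable {G : Multigraph} {n : G.E → ℕ+}

open Multigraph

/-! ### Reduced divisors on the subdivision -/

lemma state_state (w : AdmMultideg G n) (c a : G.V → ℤ) :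
    (w.state c).state a = w.state (fun x => c x + a x) := by
  obtain ⟨l, k, hl, h⟩ := (w.state c).exists_twistList_state 0 a
  rw [state_zero, twistList_state] at h
  rw [← h, ← w.state_add_const (fun x => c x + a x) k]
  congr 1
  funext x
  have := hl x
  simp only [Pi.zero_apply, zero_add] at this
  rw [this]
  ring

lemma degAt_indicator (w : AdmMultideg G n) (A : Set G.V) {u : G.V} (hu : u ∈ A) :
    w.degAt (fun x => if x ∈ A then 1 else 0) u =
      w.wG u - ((G.edgesAt u).filter fun e => other e u ∉ A ∧ w.μ e = 0).card := by
  rw [degAt, Finset.card_filter, sub_eq_add_neg]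
  push_cast
  rw [← Finset.sum_neg_distrib]
  congr 1
  refine Finset.sum_congr rfl fun e _ => ?_
  rw [coef, if_pos hu]
  have h := w.drop_succ e u 0
  simp only [mul_zero, zero_add, Int.cast_zero, add_zero, Int.cast_one, drop_zero, zero_sub] at h
  by_cases ho : other e u ∈ A
  · rw [if_pos ho, sub_self, drop_zero, if_neg (by tauto), neg_zero]
  · rw [if_neg ho, sub_zero, h]
    simp [ho]

lemma subdivVertex_of_lt {e : G.E} {k : ℕ} (h : 0 < k ∧ k < n e) :
    subdivVertex n e k = Sum.inr ⟨e, k, h⟩ := dif_pos h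

lemma subdivVertex_zero (e : G.E) : subdivVertex n e 0 = Sum.inl (G.tail e) := by
  simp [subdivVertex]

lemma subdivVertex_length (e : G.E) : subdivVertex n e (n e) = Sum.inl (G.head e) := by
  simp [subdivVertex]

lemma subdivVertex_eq_inr_iff {e e' : G.E} {j k : ℕ} (h : 0 < k ∧ k < n e) :
    subdivVertex n e' j = Sum.inr ⟨e, k, h⟩ ↔ e' = e ∧ j = k := by
  constructor
  · intro h'
    by_cases hj : 0 < j ∧ j < n e'
    · rw [subdivVertex_of_lt hj, Sum.inr.injEq, Sigma.mk.injEq] at h'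
      obtain ⟨rfl, h2⟩ := h'
      exact ⟨rfl, congrArg Subtype.val (eq_of_heq h2)⟩
    · rw [subdivVertex, dif_neg hj] at h'
      split_ifs at h'
  · rintro ⟨rfl, rfl⟩
    exact subdivVertex_of_lt h

lemma subdivVertex_eq_inl_iff {e : G.E} {j : ℕ} (hj : j ≤ n e) {u : G.V} :
    subdivVertex n e j = Sum.inl u ↔ (j = 0 ∧ G.tail e = u) ∨ (j = n e ∧ G.head e = u) := by
  have hn := (n e).pos
  by_cases h : 0 < j ∧ j < n e
  · rw [subdivVertex_of_lt h]
    simp only [reduceCtorEq, false_iff]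
    omega
  · rw [subdivVertex, dif_neg h]
    split_ifs with h0
    · simp only [Sum.inl.injEq, h0, true_and]
      constructor
      · exact Or.inl
      · rintro (h1 | ⟨h1, -⟩)
        · exact h1
        · omega
    · simp only [Sum.inl.injEq, h0, false_and, false_or]
      constructor
      · exact fun h1 => ⟨by omega, h1⟩
      · exact fun h1 => h1.2

lemma outdeg_inr (S : Set (SubdivVertex G n)) {e : G.E} {k : ℕ} (h : 0 < k ∧ k < n e) :
    outdeg n S (Sum.inr ⟨e, k, h⟩) =
      (if subdivVertex n e (k + 1) ∉ S then 1 else 0) +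
        if subdivVertex n e (k - 1) ∉ S then 1 else 0 := by
  rw [outdeg, Finset.card_filter, Fintype.sum_sigma, Finset.sum_eq_single e]
  · simp only [subdivVertex_eq_inr_iff, true_and]
    have key : ∀ j : Fin (n e), (if (j : ℕ) = k ∧ subdivVertex n e (j + 1) ∉ S ∨
        (j : ℕ) + 1 = k ∧ subdivVertex n e j ∉ S then 1 else 0) =
        (if j = ⟨k, h.2⟩ then (if subdivVertex n e (k + 1) ∉ S then 1 else 0) else 0) +
        (if j = ⟨k - 1, by omega⟩ then (if subdivVertex n e (k - 1) ∉ S then 1 else 0) else 0) := by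
      intro j
      simp only [Fin.ext_iff]
      by_cases h1 : (j : ℕ) = k
      · have h2 : ¬ (k + 1 = k) := by omega
        have h3 : ¬ (k = k - 1) := by omega
        simp only [h1, h2, h3, true_and, false_and, or_false, if_true, if_false, add_zero]
      · by_cases h2 : (j : ℕ) + 1 = k
        · have h3 : (j : ℕ) = k - 1 := by omega
          simp only [h3, if_true]
          rw [if_neg (by omega : ¬ (k - 1 = k)), zero_add]
          simp only [show k - 1 + 1 = k by omega, true_and, show ¬ (k - 1 = k) by omega, false_and,
            false_or]
        · have h3 : ¬ (j : ℕ) = k - 1 := by omega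
          simp only [h1, h2, h3, false_and, or_false, if_false, add_zero]
    rw [Finset.sum_congr rfl fun j _ => key j, Finset.sum_add_distrib, Finset.sum_ite_eq',
      Finset.sum_ite_eq', if_pos (Finset.mem_univ _), if_pos (Finset.mem_univ _)]
  · intro e' _ hne
    simp [subdivVertex_eq_inr_iff, hne]
  · simp

/-- The neighbour of `u` on the edge `e` in the subdivision. -/
def subdivNeighbor (n : G.E → ℕ+) (e : G.E) (u : G.V) : SubdivVertex G n :=
  subdivVertex n e (if u = G.tail e then 1 else n e - 1)

lemma outdeg_inl (S : Set (SubdivVertex G n)) (u : G.V) :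
    outdeg n S (Sum.inl u) =
      ((G.edgesAt u).filter fun e => subdivNeighbor n e u ∉ S).card := by
  rw [outdeg, Finset.card_filter, Fintype.sum_sigma, Finset.card_filter, edgesAt,
    Finset.sum_filter]
  refine Finset.sum_congr rfl fun e _ => ?_
  have hn := (n e).pos
  have key : ∀ j : Fin (n e), (subdivVertex n e j = Sum.inl u ∧ subdivVertex n e (j + 1) ∉ S ∨
      subdivVertex n e (j + 1) = Sum.inl u ∧ subdivVertex n e j ∉ S) ↔
      j = ⟨if u = G.tail e then 0 else n e - 1, by split_ifs <;> omega⟩ ∧ G.Inc e u ∧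
        subdivNeighbor n e u ∉ S := by
    intro j
    have hj := j.2
    rw [subdivVertex_eq_inl_iff hj.le, subdivVertex_eq_inl_iff hj, Fin.ext_iff, subdivNeighbor, Inc]
    dsimp only
    by_cases h : u = G.tail e
    · subst h
      have h1 := G.loopless e
      simp only [if_true, true_or, true_and, and_true, h1.symm, and_false, or_false,
        show ¬ (j : ℕ) + 1 = 0 by omega, false_and]
      exact and_congr_right fun h => by rw [h]
    · rw [if_neg h, if_neg h]
      simp only [h, false_or, Ne.symm h, and_false, show ¬ (j : ℕ) = n e by omega,
        false_and, or_false, false_or]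
      constructor
      · rintro ⟨⟨h1, h2⟩, h3⟩
        have h4 : (j : ℕ) = n e - 1 := by omega
        exact ⟨h4, h2.symm, h4 ▸ h3⟩
      · rintro ⟨h1, h2, h3⟩
        exact ⟨⟨by omega, h2.symm⟩, h1 ▸ h3⟩
  simp only [key]
  by_cases h : G.Inc e u ∧ subdivNeighbor n e u ∉ S
  · simp [h]
  · rw [Finset.sum_eq_zero]
    · by_cases h1 : G.Inc e u
      · rw [if_pos h1, if_neg fun h2 => h ⟨h1, h2⟩]
      · rw [if_neg h1]
    · intro j _
      rw [if_neg (by tauto)]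

lemma exists_not_succ {p : ℕ → Prop} {a b : ℕ} (hab : a ≤ b) (ha : p a) (hb : ¬ p b) :
    ∃ k, a ≤ k ∧ k < b ∧ p k ∧ ¬ p (k + 1) := by
  by_contra hcon
  push Not at hcon
  refine hb (Nat.le_induction (P := fun k _ => k ≤ b → p k) (fun _ => ha) ?_ b hab le_rfl)
  intro k hk ih hkb
  exact hcon k hk (by omega) (ih (by omega))

lemma exists_not_pred {p : ℕ → Prop} {a b : ℕ} (hab : a ≤ b) (ha : ¬ p a) (hb : p b) :
    ∃ k, a < k ∧ k ≤ b ∧ p k ∧ ¬ p (k - 1) := by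
  obtain ⟨k, h1, h2, h3, h4⟩ := exists_not_succ (p := fun k => ¬ p k) hab ha (by simpa using hb)
  exact ⟨k + 1, by omega, by omega, not_not.1 h4, by simpa using h3⟩

/-- Suppose a set `S` of vertices of the subdivision could be fired legally. An end of a segment of
`S` inside an edge must carry the only chip of that edge. Hence along an edge without chip `S`
cannot stop in the interior, and the outgoing edges at a vertex of G are at least those counted for
`S ∩ V(G)`. -/
lemma not_legal_of_unfireable {w : AdmMultideg G n} {v : G.V}
    (h : ∀ A : Set G.V, A.Nonempty → v ∉ A → ∃ u ∈ A,
      w.wG u < ((G.edgesAt u).filter fun e => other e u ∉ A ∧ w.μ e = 0).card)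
    {S : Set (SubdivVertex G n)} (hS : S.Nonempty) (hv : Sum.inl v ∉ S) :
    ∃ x ∈ S, w.subdivDivisor x < outdeg n S x := by
  by_contra hcon
  push Not at hcon
  have hint : ∀ (e : G.E) (k : ℕ), 0 < k ∧ k < n e → subdivVertex n e k ∈ S →
      ((if subdivVertex n e (k + 1) ∉ S then 1 else 0) +
        (if subdivVertex n e (k - 1) ∉ S then 1 else 0) : ℕ) ≤
          (if (w.μ e).val = k then 1 else 0 : ℤ) := by
    intro e k hk hkS
    rw [subdivVertex_of_lt hk] at hkS
    have := hcon _ hkS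
    rw [outdeg_inr] at this
    exact this
  have hright : ∀ (e : G.E) (k : ℕ), 0 < k ∧ k < n e → subdivVertex n e k ∈ S →
      subdivVertex n e (k + 1) ∉ S → (w.μ e).val = k ∧ subdivVertex n e (k - 1) ∈ S := by
    intro e k hk hkS hk1
    have := hint e k hk hkS
    rw [if_pos hk1] at this
    split_ifs at this with h1 h2 <;> first | omega | exact ⟨h2, h1⟩
  have hleft : ∀ (e : G.E) (k : ℕ), 0 < k ∧ k < n e → subdivVertex n e k ∈ S →
      subdivVertex n e (k - 1) ∉ S → (w.μ e).val = k ∧ subdivVertex n e (k + 1) ∈ S := by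
    intro e k hk hkS hk1
    have := hint e k hk hkS
    rw [if_pos hk1] at this
    split_ifs at this with h1 h2 <;> first | omega | exact ⟨h2, h1⟩
  have hpos : ∀ e, 0 < (n e : ℕ) := fun e => (n e).pos
  have h1 : ∀ e, subdivVertex n e 0 = Sum.inl (G.tail e) := subdivVertex_zero
  have h2 : ∀ e, subdivVertex n e (n e) = Sum.inl (G.head e) := subdivVertex_length
  rcases ({u | Sum.inl u ∈ S} : Set G.V).eq_empty_or_nonempty with hA | hA
  · have hA' : ∀ u, Sum.inl u ∉ S := fun u hu => (Set.eq_empty_iff_forall_notMem.1 hA) u hu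
    obtain ⟨x, hx⟩ := hS
    rcases x with u | ⟨e, k, hk⟩
    · exact hA' u hx
    rw [← subdivVertex_of_lt hk] at hx
    obtain ⟨i, hi1, hi2, hi3, hi4⟩ := exists_not_succ (p := fun k => subdivVertex n e k ∈ S)
      hk.2.le hx (by rw [h2]; exact hA' _)
    obtain ⟨j, hj1, hj2, hj3, hj4⟩ := exists_not_pred (p := fun k => subdivVertex n e k ∈ S)
      (Nat.zero_le k) (by rw [h1]; exact hA' _) hx
    have e1 := (hright e i ⟨by omega, hi2⟩ hi3 hi4)
    have e2 := (hleft e j ⟨hj1, by omega⟩ hj3 hj4)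
    -- A segment contained in the interior of an edge has both ends at its single chip, so it is one
    -- point, with outdegree two.
    have : i = j := by rw [← e1.1, e2.1]
    subst this
    exact hi4 e2.2
  · obtain ⟨u, hu, hlt⟩ := h _ hA hv
    refine absurd (hcon _ hu) (not_le.2 (lt_of_lt_of_le hlt ?_))
    rw [outdeg_inl]
    refine Int.ofNat_le.2 (Finset.card_le_card fun e he => ?_)
    rw [Finset.mem_filter, mem_edgesAt] at he ⊢
    obtain ⟨heu, ho, hμ⟩ := he
    have ho : Sum.inl (other e u) ∉ S := ho
    have hu : Sum.inl u ∈ S := hu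
    refine ⟨heu, fun hnb => ?_⟩
    have hval : (w.μ e).val = 0 := by rw [hμ, ZMod.val_zero]
    rw [subdivNeighbor] at hnb
    have hn := hpos e
    rcases heu with rfl | rfl
    · rw [if_pos rfl] at hnb
      rw [other_tail] at ho
      obtain ⟨i, hi1, hi2, hi3, hi4⟩ := exists_not_succ (p := fun k => subdivVertex n e k ∈ S)
        (a := 1) hn hnb (by rw [h2]; exact ho)
      have := (hright e i ⟨by omega, hi2⟩ hi3 hi4).1
      omega
    · rw [if_neg (G.loopless e).symm] at hnb
      rw [other_head] at ho
      obtain ⟨i, hi1, hi2, hi3, hi4⟩ := exists_not_pred (p := fun k => subdivVertex n e k ∈ S)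
        (Nat.zero_le (n e - 1)) (by rw [h1]; exact ho) hnb
      have := (hleft e i ⟨by omega, by omega⟩ hi3 hi4).1
      omega

lemma unfireable_of_not_legal {w : AdmMultideg G n} {v : G.V}
    (h : ∀ S : Set (SubdivVertex G n), S.Nonempty → Sum.inl v ∉ S →
      ∃ x ∈ S, w.subdivDivisor x < outdeg n S x)
    {A : Set G.V} (hA : A.Nonempty) (hv : v ∉ A) : ∃ u ∈ A,
      w.wG u < ((G.edgesAt u).filter fun e => other e u ∉ A ∧ w.μ e = 0).card := by
  -- Extend `A` along each edge to the whole edge if both ends lie in `A`, and up to the chip if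
  -- only one end does. Interior points of `S` then never go into debt, so the violation found lies
  -- in `A`.
  let S : Set (SubdivVertex G n) := {x | match x with
    | Sum.inl u => u ∈ A
    | Sum.inr x => (G.tail x.1 ∈ A ∧ (G.head x.1 ∈ A ∨ x.2.1 ≤ (w.μ x.1).val)) ∨
        (G.head x.1 ∈ A ∧ (w.μ x.1).val ≠ 0 ∧ (w.μ x.1).val ≤ x.2.1)}
  have hinl : ∀ u, (Sum.inl u : SubdivVertex G n) ∈ S ↔ u ∈ A := fun u => Iff.rfl
  have hsub : ∀ (e : G.E) (k : ℕ), k ≤ n e → (subdivVertex n e k ∈ S ↔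
      (G.tail e ∈ A ∧ (G.head e ∈ A ∨ k ≤ (w.μ e).val)) ∨
        (G.head e ∈ A ∧ (k = n e ∨ (w.μ e).val ≠ 0 ∧ (w.μ e).val ≤ k))) := by
    intro e k hk
    have hlt := ZMod.val_lt (w.μ e)
    by_cases h0 : k = 0
    · subst h0
      rw [subdivVertex_zero, hinl]
      have := (n e).pos
      constructor
      · exact fun h => Or.inl ⟨h, Or.inr (Nat.zero_le _)⟩
      · rintro (h | ⟨-, h⟩)
        · exact h.1
        · omega
    by_cases h1 : k = n e
    · subst h1
      rw [subdivVertex_length, hinl]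
      constructor
      · exact fun h => Or.inr ⟨h, Or.inl rfl⟩
      · rintro (⟨-, h | h⟩ | h)
        · exact h
        · omega
        · exact h.1
    · rw [subdivVertex_of_lt ⟨by omega, by omega⟩]
      simp only [h1, false_or]
      exact Iff.rfl
  obtain ⟨a, ha⟩ := hA
  obtain ⟨x, hx, hlt⟩ := h S ⟨Sum.inl a, ha⟩ hv
  rcases x with u | ⟨e, k, hk⟩
  · refine ⟨u, hx, lt_of_lt_of_le hlt (Int.ofNat_le.2 ?_)⟩
    rw [outdeg_inl]
    refine Finset.card_le_card fun e he => ?_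
    rw [Finset.mem_filter, mem_edgesAt] at he ⊢
    obtain ⟨heu, hnb⟩ := he
    have hn := (n e).pos
    have hlt := ZMod.val_lt (w.μ e)
    have hu : u ∈ A := hx
    refine ⟨heu, ?_⟩
    rw [← ZMod.val_eq_zero]
    rw [subdivNeighbor] at hnb
    rcases heu with rfl | rfl
    · rw [if_pos rfl, hsub e 1 hn] at hnb
      rw [other_tail]
      push Not at hnb
      have := hnb.1 hu
      exact ⟨this.1, by omega⟩
    · rw [if_neg (G.loopless e).symm, hsub e _ (by omega)] at hnb
      rw [other_head]
      push Not at hnb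
      have h2 := hnb.2 hu
      refine ⟨fun ht => (hnb.1 ht).1 hu, by_contra fun h0 => ?_⟩
      have := h2.2 h0
      omega
  · exfalso
    refine absurd hlt (not_lt.2 ?_)
    rw [outdeg_inr]
    rw [← subdivVertex_of_lt hk, hsub e k hk.2.le] at hx
    rw [hsub e (k + 1) hk.2, hsub e (k - 1) (by omega)]
    show _ ≤ (if (w.μ e).val = k then 1 else 0 : ℤ)
    by_cases ht : G.tail e ∈ A <;> by_cases hh : G.head e ∈ A <;> by_cases hk' : (w.μ e).val = k <;>
      simp only [ht, hh, hk', true_and, false_and, or_false, false_or, true_or, not_true,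
        if_true, if_false] at hx ⊢ <;> (try split_ifs) <;> push_cast <;> omega

/-- Interior points carry zero or one chip, so nonnegativity is a condition at the vertices of G
only; firing `A` once costs a vertex of `A` one chip for each chipless edge leaving `A`. -/
lemma isReducedAt_state_iff (w : AdmMultideg G n) (c : G.V → ℤ) (v : G.V) :
    (w.state c).IsReducedAt v ↔
      (∀ u, u ≠ v → 0 ≤ w.degAt (fun x => c x) u) ∧ w.IsUnfireable c v := by
  have h1 : (∀ x, x ≠ Sum.inl v → 0 ≤ (w.state c).subdivDivisor x) ↔
      ∀ u, u ≠ v → 0 ≤ w.degAt (fun x => c x) u := by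
    constructor
    · intro h u hu
      rw [← state_wG]
      exact h (Sum.inl u) (by simpa using hu)
    · rintro h (u | x) hx
      · have := h u (by simpa using hx)
        rwa [← state_wG] at this
      · simp only [subdivDivisor]
        split_ifs <;> norm_num
  have h2 : w.IsUnfireable c v ↔ ∀ A : Set G.V, A.Nonempty → v ∉ A → ∃ u ∈ A, (w.state c).wG u <
      ((G.edgesAt u).filter fun e => other e u ∉ A ∧ (w.state c).μ e = 0).card := by
    refine forall_congr' fun A => forall_congr' fun _ => forall_congr' fun _ =>
      exists_congr fun u => and_congr_right fun hu => ?_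
    have h3 := (w.state c).degAt_indicator A hu
    have h4 := (w.state c).state_wG (fun x => if x ∈ A then 1 else 0) u
    rw [state_state, state_wG] at h4
    push_cast at h4
    rw [h4, h3, sub_neg]
  rw [IsReducedAt, h1, h2]
  exact and_congr_right fun _ => ⟨fun h A hA hv => unfireable_of_not_legal h hA hv,
    fun h S hS hv => not_legal_of_unfireable h hS hv⟩

end AdmMultideg
/-! ### Piecewise linear functions on an interval -/

/-- The function `g` on `[0, L]` is piecewise linear with outgoing slopes `r` and `l`. -/
structure IsPL (L : ℝ) (g : ℝ → ℝ) (r l : ℝ → ℤ) : Prop where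
  right : ∀ t, 0 ≤ t → t < L → ∀ᶠ s in 𝓝[>] t, g s = g t + r t * (s - t)
  left : ∀ t, 0 < t → t ≤ L → ∀ᶠ s in 𝓝[<] t, g s = g t + l t * (t - s)

namespace IsPL

variable {L : ℝ} {g g' : ℝ → ℝ} {r l r' l' : ℝ → ℤ}

lemma affine (c : ℝ) (a : ℤ) : IsPL L (fun t => c + a * t) (fun _ => a) (fun _ => -a) := by
  constructor <;> intro t _ _ <;> refine Eventually.of_forall fun s => ?_ <;> push_cast <;> ring

lemma add (h : IsPL L g r l) (h' : IsPL L g' r' l') : IsPL L (g + g') (r + r') (l + l') := by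
  constructor
  · intro t h0 h1
    filter_upwards [h.right t h0 h1, h'.right t h0 h1] with s hs hs'
    simp only [Pi.add_apply, hs, hs']
    push_cast
    ring
  · intro t h0 h1
    filter_upwards [h.left t h0 h1, h'.left t h0 h1] with s hs hs'
    simp only [Pi.add_apply, hs, hs']
    push_cast
    ring

lemma zsmul (h : IsPL L g r l) (z : ℤ) :
    IsPL L (fun t => z * g t) (fun t => z * r t) (fun t => z * l t) := by
  constructor
  · intro t h0 h1
    filter_upwards [h.right t h0 h1] with s hs
    rw [hs]
    push_cast
    ring
  · intro t h0 h1
    filter_upwards [h.left t h0 h1] with s hs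
    rw [hs]
    push_cast
    ring

lemma sum {ι : Type*} (S : Finset ι) {g : ι → ℝ → ℝ} {r l : ι → ℝ → ℤ}
    (h : ∀ i, IsPL L (g i) (r i) (l i)) :
    IsPL L (∑ i ∈ S, g i) (∑ i ∈ S, r i) (∑ i ∈ S, l i) := by
  induction S using Finset.induction_on with
  | empty =>
    simp only [Finset.sum_empty]
    constructor <;> intro t _ _ <;> refine Eventually.of_forall fun s => ?_ <;> simp
  | insert a S ha ih =>
    rw [Finset.sum_insert ha, Finset.sum_insert ha, Finset.sum_insert ha]
    exact (h a).add ih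

lemma hinge (p : ℝ) : IsPL L (fun t => max (t - p) 0) (fun t => if p ≤ t then 1 else 0)
    (fun t => if p < t then -1 else 0) := by
  constructor
  · intro t _ _
    by_cases h : p ≤ t
    · filter_upwards [self_mem_nhdsWithin] with s hs
      have hs : t < s := hs
      rw [if_pos h, max_eq_left (by linarith), max_eq_left (by linarith)]
      push_cast; ring
    · filter_upwards [mem_nhdsWithin_of_mem_nhds (Iio_mem_nhds (not_le.1 h))] with s hs
      have hs : s < p := hs
      rw [if_neg h, max_eq_right (by linarith), max_eq_right (by linarith [not_le.1 h])]
      push_cast; ring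
  · intro t _ _
    by_cases h : p < t
    · filter_upwards [mem_nhdsWithin_of_mem_nhds (Ioi_mem_nhds h)] with s hs
      have hs : p < s := hs
      rw [if_pos h, max_eq_left (by linarith), max_eq_left (by linarith)]
      push_cast; ring
    · filter_upwards [self_mem_nhdsWithin] with s hs
      have hs : s < t := hs
      rw [if_neg h, max_eq_right (by linarith), max_eq_right (by linarith)]
      push_cast; ring

lemma reflect (h : IsPL L g r l) :
    IsPL L (fun t => g (L - t)) (fun t => l (L - t)) (fun t => r (L - t)) := by
  constructor
  · intro t h0 h1
    have hl := h.left (L - t) (by linarith) (by linarith)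
    have ht : Tendsto (fun s => L - s) (𝓝[>] t) (𝓝[<] (L - t)) := by
      refine tendsto_nhdsWithin_iff.2 ⟨?_, ?_⟩
      · exact ((continuous_const.sub continuous_id).tendsto t).mono_left nhdsWithin_le_nhds
      · filter_upwards [self_mem_nhdsWithin] with s hs
        have hs : t < s := hs
        show L - s < L - t
        linarith
    filter_upwards [ht.eventually hl] with s hs
    rw [hs]
    ring
  · intro t h0 h1
    have hr := h.right (L - t) (by linarith) (by linarith)
    have ht : Tendsto (fun s => L - s) (𝓝[<] t) (𝓝[>] (L - t)) := by
      refine tendsto_nhdsWithin_iff.2 ⟨?_, ?_⟩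
      · exact ((continuous_const.sub continuous_id).tendsto t).mono_left nhdsWithin_le_nhds
      · filter_upwards [self_mem_nhdsWithin] with s hs
        have hs : s < t := hs
        show L - t < L - s
        linarith
    filter_upwards [ht.eventually hr] with s hs
    rw [hs]
    ring

lemma continuousOn (h : IsPL L g r l) : ContinuousOn g (Set.Icc 0 L) := by
  intro t ht
  have hr : ∀ a : ℤ, Tendsto (fun s => g t + a * (s - t)) (𝓝 t) (𝓝 (g t)) := fun a => by
    have : Continuous fun s => g t + a * (s - t) := by fun_prop
    simpa using this.tendsto t
  have hl : ∀ a : ℤ, Tendsto (fun s => g t + a * (t - s)) (𝓝 t) (𝓝 (g t)) := fun a => by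
    have : Continuous fun s => g t + a * (t - s) := by fun_prop
    simpa using this.tendsto t
  have h1 : ContinuousWithinAt g (Set.Icc 0 L ∩ Set.Ioi t) t := by
    rcases lt_or_ge t L with htL | htL
    · refine ContinuousWithinAt.mono ?_ Set.inter_subset_right
      exact ((hr (r t)).mono_left nhdsWithin_le_nhds).congr'
        ((h.right t ht.1 htL).mono fun s hs => hs.symm)
    · have : Set.Icc 0 L ∩ Set.Ioi t = ∅ := by
        ext s; simp; intro _ h; linarith
      rw [this]; simp [ContinuousWithinAt]
  have h2 : ContinuousWithinAt g (Set.Icc 0 L ∩ Set.Iio t) t := by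
    rcases lt_or_ge 0 t with ht0 | ht0
    · refine ContinuousWithinAt.mono ?_ Set.inter_subset_right
      exact ((hl (l t)).mono_left nhdsWithin_le_nhds).congr'
        ((h.left t ht0 ht.2).mono fun s hs => hs.symm)
    · have : Set.Icc 0 L ∩ Set.Iio t = ∅ := by
        ext s; simp; intro h _; linarith
      rw [this]; simp [ContinuousWithinAt]
  have h3 : ContinuousWithinAt g {t} t := continuousWithinAt_singleton
  refine ((h1.union h2).union h3).mono fun s hs => ?_
  rcases lt_trichotomy s t with h | h | h
  · exact Or.inl (Or.inr ⟨hs, h⟩)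
  · exact Or.inr h
  · exact Or.inl (Or.inl ⟨hs, h⟩)

/-- A convex piecewise linear function lies below its chord. -/
lemma right_mul_le (h : IsPL L g r l) (hL : 0 < L)
    (hc : ∀ t, 0 < t → t < L → 0 ≤ r t + l t) : r 0 * L ≤ g L - g 0 := by
  by_contra hcon
  rw [not_le] at hcon
  set m := (g L - g 0) / L with hm
  have hmL : m * L = g L - g 0 := div_mul_cancel₀ _ hL.ne'
  have hrm : m < r 0 := by
    by_contra h1
    nlinarith
  let ψ : ℝ → ℝ := fun t => g t - m * t
  have hψ : ContinuousOn ψ (Set.Icc 0 L) := h.continuousOn.sub (by fun_prop)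
  have hψL : ψ L = ψ 0 := by simp only [ψ]; linarith
  -- Subtracting the chord gives equal values at both ends and an initial increase, so the maximum
  -- is interior. At the last maximum the function decreases strictly afterwards and does not exceed
  -- it before, so the outgoing slopes have negative sum, against convexity.
  obtain ⟨M, hM, hmax⟩ := isCompact_Icc.exists_isMaxOn ⟨0, by simp [hL.le]⟩ hψ
  have hcpt : IsCompact (Set.Icc 0 L ∩ ψ ⁻¹' {ψ M}) :=
    isCompact_Icc.of_isClosed_subset (hψ.preimage_isClosed_of_isClosed isClosed_Icc
      isClosed_singleton) Set.inter_subset_left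
  obtain ⟨t, ⟨⟨ht0, htL⟩, htM⟩, htmax⟩ := hcpt.exists_isGreatest ⟨M, hM, rfl⟩
  have htM : ψ t = ψ M := htM
  have hle : ∀ s, 0 ≤ s → s ≤ L → ψ s ≤ ψ t := fun s h0 h1 => htM ▸ hmax ⟨h0, h1⟩
  have hpos : ψ 0 < ψ t := by
    obtain ⟨s, hs, hs'⟩ := ((h.right 0 le_rfl hL).and (Ioo_mem_nhdsGT hL)).exists
    refine lt_of_lt_of_le ?_ (hle s hs'.1.le hs'.2.le)
    simp only [ψ, hs]
    nlinarith [hs'.1]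
  have ht0' : 0 < t := lt_of_le_of_ne ht0 (by rintro rfl; exact lt_irrefl _ hpos)
  have htL' : t < L := lt_of_le_of_ne htL (by rintro rfl; rw [hψL] at hpos; exact lt_irrefl _ hpos)
  have e1 : (r t : ℝ) < m := by
    obtain ⟨s, hs, hs'⟩ := ((h.right t ht0 htL').and (Ioo_mem_nhdsGT htL')).exists
    have h1 : ψ s < ψ t := lt_of_le_of_ne (hle s (ht0.trans hs'.1.le) hs'.2.le) fun heq =>
      absurd (htmax ⟨⟨ht0.trans hs'.1.le, hs'.2.le⟩, heq.trans htM⟩) (not_le.2 hs'.1)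
    simp only [ψ, hs] at h1
    by_contra h2
    nlinarith [hs'.1]
  have e2 : (l t : ℝ) ≤ -m := by
    obtain ⟨s, hs, hs'⟩ := ((h.left t ht0' htL).and (Ioo_mem_nhdsLT ht0')).exists
    have h1 := hle s hs'.1.le (hs'.2.le.trans htL)
    simp only [ψ, hs] at h1
    by_contra h2
    nlinarith [hs'.2]
  have := hc t ht0' htL'
  have : (0 : ℝ) ≤ r t + l t := by exact_mod_cast this
  linarith

/-- The bound for the slope at the beginning of the interval when the function is convex apart
from a defect of `1` at `m`. -/
lemma right_le {n m : ℕ} (hm : m < n) (h : IsPL n g r l)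
    (hc : ∀ t : ℝ, 0 < t → t < n → 0 ≤ r t + l t + if t = m then 1 else 0) :
    r 0 ≤ ⌈(m : ℝ) / n⌉ - ⌈(m + (g 0 - g n)) / (n : ℝ)⌉ := by
  have hn : (0 : ℝ) < n := by exact_mod_cast (Nat.zero_le m).trans_lt hm
  rw [le_sub_comm, Int.ceil_le, div_le_iff₀ hn]
  push_cast
  rcases Nat.eq_zero_or_pos m with rfl | hm0
  · have := h.right_mul_le hn fun t h0 h1 => by
      have := hc t h0 h1
      rwa [if_neg (by push_cast; exact h0.ne'), add_zero] at this
    simp only [Nat.cast_zero, zero_div, Int.ceil_zero, Int.cast_zero]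
    linarith
  -- The hinge at `m` cancels the defect without affecting the slope at 0. It adds `n - m` at the
  -- far end, which accounts for the ceiling of `m / n` being 1.
  · have hm0' : (0 : ℝ) < m := by exact_mod_cast hm0
    have hmn : (m : ℝ) < n := by exact_mod_cast hm
    have h1 := (h.add (hinge (m : ℝ))).right_mul_le hn fun t h0 h1 => by
      have := hc t h0 h1
      simp only [Pi.add_apply]
      rcases lt_trichotomy t m with h2 | rfl | h2
      · rw [if_neg h2.ne] at this
        rw [if_neg (not_le.2 h2), if_neg h2.not_gt]
        linarith
      · rw [if_pos rfl] at this
        rw [if_pos le_rfl, if_neg (lt_irrefl _)]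
        linarith
      · rw [if_neg h2.ne'] at this
        rw [if_pos h2.le, if_pos h2]
        linarith
    simp only [Pi.add_apply] at h1
    rw [if_neg (not_le.2 hm0'), max_eq_left (by linarith), max_eq_right (by linarith)] at h1
    have hceil : ⌈(m : ℝ) / n⌉ = 1 := by
      rw [Int.ceil_eq_iff]
      push_cast
      exact ⟨by rw [sub_self]; positivity, (div_le_one hn).2 hmn.le⟩
    rw [hceil]
    push_cast at h1 ⊢
    linarith

end IsPL

/-! ### Slopes of rational functions on the metric graph -/

namespace TropFunction

variable {G : Multigraph} {n : G.E → ℕ+}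

open Multigraph AdmMultideg

lemma isPL (f : TropFunction G n) (e : G.E) : IsPL (n e : ℕ) (f.edge e) (f.right e) (f.left e) :=
  ⟨f.right_spec e, f.left_spec e⟩

/-- If the divisor `D_w + div f` is effective in the interior of the edge `e`, then the slope of
`f` along `e` is bounded in terms of the values of `f` at the ends of `e`. -/
lemma slope_le_drop (f : TropFunction G n) (w : AdmMultideg G n) {e : G.E} {v : G.V}
    (hv : G.Inc e v) (h : ∀ t : ℝ, 0 < t → t < (n e : ℕ) →
      0 ≤ f.ordAt e t + if t = (w.μ e).val then 1 else 0) :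
    f.slope v e ≤ w.drop e v (f.vert v - f.vert (other e v)) := by
  have hlt := ZMod.val_lt (w.μ e)
  have hn : ((n e : ℕ) : ℝ) ≠ 0 := by exact_mod_cast (n e).ne_zero
  rcases hv with rfl | rfl
  · have := (f.isPL e).right_le hlt h
    rw [f.edge_tail, f.edge_head] at this
    rw [slope, if_pos rfl, drop, lift, sgn_tail, other_tail]
    simpa using this
  · rw [slope, if_neg (G.loopless e).symm, drop, lift, sgn_head, other_head]
    -- Seen from the head the chip lies at distance `n e - μ`. Without a chip this would be the full
    -- length, so the bound is then applied with 0 instead.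
    by_cases h0 : (w.μ e).val = 0
    · have := (f.isPL e).reflect.right_le (n := n e) (m := 0) (n e).pos fun t ht0 ht1 => by
        have := h (n e - t) (by linarith) (by linarith)
        rw [if_neg (by rw [h0]; push_cast; linarith)] at this
        rw [if_neg (by push_cast; linarith), add_comm (f.left e _)]
        exact this
      rw [sub_zero, sub_self, f.edge_tail, f.edge_head] at this
      simpa [h0] using this
    · have := (f.isPL e).reflect.right_le (n := n e) (m := n e - (w.μ e).val) (by omega)
        fun t ht0 ht1 => by
          have := h (n e - t) (by linarith) (by linarith)
          have hiff : t = ((n e - (w.μ e).val : ℕ) : ℝ) ↔ (n e : ℕ) - t = (w.μ e).val := by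
            rw [Nat.cast_sub hlt.le]
            constructor <;> intro h <;> linarith
          rw [add_comm (f.left e _)]
          simp only [hiff]
          exact this
      rw [sub_zero, sub_self, f.edge_tail, f.edge_head, Nat.cast_sub hlt.le] at this
      refine this.trans (le_of_eq ?_)
      have e1 : ((n e : ℕ) - ((w.μ e).val : ℝ)) / (n e : ℕ) =
          ((-1 * (w.μ e).val : ℤ) : ℝ) / (n e : ℕ) + 1 := by
        field_simp; push_cast; ring
      have e2 : ((n e : ℕ) - ((w.μ e).val : ℝ) +
            (f.vert (G.head e) - f.vert (G.tail e))) / (n e : ℕ) =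
          (((-1 * (w.μ e).val : ℤ) : ℝ) + (f.vert (G.head e) - f.vert (G.tail e))) / (n e : ℕ)
            + 1 := by
        field_simp; push_cast; ring
      rw [e1, e2, Int.ceil_add_one, Int.ceil_add_one]
      ring

/-- The chord inequality applies both to the function and to its negative. -/
lemma slope_mul_length (f : TropFunction G n) {e : G.E} {v : G.V} (hv : G.Inc e v)
    (h : ∀ t : ℝ, 0 < t → t < (n e : ℕ) → f.ordAt e t = 0) :
    (f.slope v e : ℝ) * (n e : ℕ) = f.vert (other e v) - f.vert v := by
  have hn : (0 : ℝ) < (n e : ℕ) := by exact_mod_cast (n e).pos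
  have key : ∀ {g r l}, IsPL (n e : ℕ) g r l → (∀ t : ℝ, 0 < t → t < (n e : ℕ) → r t + l t = 0) →
      (r 0 : ℝ) * (n e : ℕ) = g (n e : ℕ) - g 0 := by
    intro g r l hpl h0
    have h1 := hpl.right_mul_le hn fun t ht0 ht1 => (h0 t ht0 ht1).ge
    have h2 := (hpl.zsmul (-1)).right_mul_le hn fun t ht0 ht1 => by
      have := h0 t ht0 ht1
      linarith
    push_cast at h2
    linarith
  rcases hv with rfl | rfl
  · rw [slope, if_pos rfl, other_tail, key (f.isPL e) h, f.edge_tail, f.edge_head]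
  · rw [slope, if_neg (G.loopless e).symm, other_head]
    have := key (f.isPL e).reflect fun t ht0 ht1 => by
      rw [add_comm]
      exact h (n e - t) (by linarith) (by linarith)
    rwa [sub_zero, sub_self, f.edge_tail, f.edge_head] at this

/-- A harmonic function has slope zero everywhere at the vertices. -/
lemma slope_eq_zero (hG : G.bar.Connected) (f : TropFunction G n)
    (h : ∀ e, ∀ t : ℝ, 0 < t → t < (n e : ℕ) → f.ordAt e t = 0)
    (hv : ∀ v, ∑ e ∈ G.edgesAt v, f.slope v e = 0) {e : G.E} {v : G.V} (hev : G.Inc e v) :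
    f.slope v e = 0 := by
  have hn : ∀ e, (0 : ℝ) < (n e : ℕ) := fun e => by exact_mod_cast (n e).pos
  have : Nonempty G.V := hG.nonempty
  obtain ⟨a, ha⟩ := Finite.exists_max f.vert
  have hmax : ∀ x, f.vert x = f.vert a → ∀ e ∈ G.edgesAt x, f.slope x e = 0 := by
    intro x hx
    refine (Finset.sum_eq_zero_iff_of_nonpos fun e he => ?_).1 (hv x)
    have h1 := f.slope_mul_length (mem_edgesAt.1 he) (h e)
    have h2 := ha (other e x)
    have h3 := hn e
    by_contra hcon
    have : (0 : ℝ) < f.slope x e := by exact_mod_cast not_le.1 hcon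
    nlinarith
  -- At a vertex with maximal value all slopes are nonpositive and sum to zero, so they vanish and
  -- the maximum passes to the neighbours.
  have key : ∀ x, f.vert x = f.vert a := by
    refine connected_induction hG (a := a) rfl fun x y hxy hx => ?_
    obtain ⟨hne, e, hex, hey⟩ := hxy
    have h1 := hmax x hx e (mem_edgesAt.2 hex)
    have h2 := f.slope_mul_length hex (h e)
    rw [h1, ← eq_other hey hex hne.symm] at h2
    push_cast at h2
    linarith
  exact hmax v (key v) e (mem_edgesAt.2 hev)

/-- The sum of the distances from the end opposite to `v`, over the points of a divisor on the
edge `e`. -/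
def moment (e : G.E) (E : Set.Ioo (0 : ℝ) (n e : ℝ) →₀ ℤ) (v : G.V) : ℝ :=
  E.sum fun p z => z * if v = G.tail e then (n e : ℝ) - p else p

lemma moment_zero (e : G.E) (v : G.V) : moment e (0 : Set.Ioo (0 : ℝ) (n e : ℝ) →₀ ℤ) v = 0 :=
  Finsupp.sum_zero_index

lemma moment_add_moment (e : G.E) (E : Set.Ioo (0 : ℝ) (n e : ℝ) →₀ ℤ) {v : G.V}
    (hv : G.Inc e v) : moment e E v + moment e E (other e v) = E.degree * (n e : ℕ) := by
  rw [moment, moment, ← Finsupp.sum_add, Finsupp.degree_apply]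
  push_cast
  rw [Finset.sum_mul, Finsupp.sum]
  refine Finset.sum_congr rfl fun p _ => ?_
  rcases hv with rfl | rfl
  · rw [other_tail, if_pos rfl, if_neg (G.loopless e).symm]; ring
  · rw [other_head, if_pos rfl, if_neg (G.loopless e).symm]; ring

lemma moment_nonneg (e : G.E) {E : Set.Ioo (0 : ℝ) (n e : ℝ) →₀ ℤ} (hE : 0 ≤ E) (v : G.V) :
    0 ≤ moment e E v := by
  refine Finset.sum_nonneg fun p _ => mul_nonneg (by exact_mod_cast hE p) ?_
  split_ifs
  · exact sub_nonneg.2 p.2.2.le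
  · exact p.2.1.le

/-- The position of the chip on `e` of the divisor `D_w + div f - E`, where `f` is the function
constructed in `exists_of_vert`. -/
def chipPos (w : AdmMultideg G n) (c : G.V → ℝ) (e : G.E)
    (E : Set.Ioo (0 : ℝ) (n e : ℝ) →₀ ℤ) : ℝ :=
  (n e : ℕ) * Int.fract ((((w.μ e).val : ℝ) + (c (G.tail e) - c (G.head e)) +
    moment e E (G.tail e)) / (n e : ℕ))

/-- There is a rational function on `Γ` with given values at the vertices such that
`D_w + div f - E` consists of at most one chip on each edge. -/
lemma exists_of_vert (w : AdmMultideg G n) (c : G.V → ℝ)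
    (E : ∀ e : G.E, Set.Ioo (0 : ℝ) (n e : ℝ) →₀ ℤ) :
    ∃ f : TropFunction G n, f.vert = c ∧
      (∀ e (t : Set.Ioo (0 : ℝ) (n e : ℝ)), f.ordAt e t = E e t +
        (if (t : ℝ) = chipPos w c e (E e) then 1 else 0) -
          if (t : ℝ) = (w.μ e).val then 1 else 0) ∧
      ∀ v e, G.Inc e v → f.slope v e = ⌈(w.lift e v : ℝ) / (n e : ℕ)⌉ -
        ⌈((w.lift e v : ℝ) + (c v - c (other e v)) + moment e (E e) v) / (n e : ℕ)⌉ := by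
  let Y : G.E → ℝ := fun e => ((w.μ e).val : ℝ) + (c (G.tail e) - c (G.head e)) +
    moment e (E e) (G.tail e)
  let q : G.E → ℝ := fun e => chipPos w c e (E e)
  have hn : ∀ e, (0 : ℝ) < (n e : ℕ) := fun e => by exact_mod_cast (n e).pos
  have hq0 : ∀ e, 0 ≤ q e := fun e => mul_nonneg (hn e).le (Int.fract_nonneg _)
  have hqn : ∀ e, q e < (n e : ℕ) := fun e => by
    have := mul_lt_mul_of_pos_left (Int.fract_lt_one (Y e / (n e : ℕ))) (hn e)
    rwa [mul_one] at this
  have hqY : ∀ e, (n e : ℕ) * (⌊Y e / (n e : ℕ)⌋ : ℝ) + q e = Y e := fun e => by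
    show (n e : ℕ) * (⌊Y e / (n e : ℕ)⌋ : ℝ) + (n e : ℕ) * Int.fract (Y e / (n e : ℕ)) = Y e
    rw [← mul_add, Int.floor_add_fract, mul_div_cancel₀ _ (hn e).ne']
  have hμn : ∀ e, ((w.μ e).val : ℝ) < (n e : ℕ) := fun e => by exact_mod_cast ZMod.val_lt (w.μ e)
  have hμ0 : ∀ e, (0 : ℝ) ≤ ((w.μ e).val : ℝ) := fun e => Nat.cast_nonneg _
  -- A hinge contributes one to the divisor at its corner. Hinges at the points of `E` and at `q`,
  -- and a negative hinge at the chip of `w`, give the required divisor. The linear slope is the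
  -- integral part of the prescribed difference, and `q` is the remainder needed to reach the value
  -- at the head.
  have hpl := fun e => (((IsPL.affine (L := (n e : ℕ)) (c (G.tail e)) (-⌊Y e / (n e : ℕ)⌋)).add
    (IsPL.sum (E e).support fun p : Set.Ioo (0 : ℝ) (n e : ℝ) =>
      (IsPL.hinge (L := (n e : ℕ)) (p : ℝ)).zsmul (E e p))).add (IsPL.hinge (q e))).add
        ((IsPL.hinge ((w.μ e).val : ℝ)).zsmul (-1))
  refine ⟨⟨c, _, _, _, fun e => ?_, fun e => ?_, fun e => (hpl e).right, fun e => (hpl e).left⟩,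
    rfl, fun e t => ?_, fun v e hv => ?_⟩
  · simp only [Pi.add_apply, Finset.sum_apply]
    rw [Finset.sum_eq_zero fun p _ => by rw [max_eq_right (by linarith [p.2.1]), mul_zero],
      max_eq_right (by linarith [hq0 e]), max_eq_right (by linarith [hμ0 e])]
    ring
  · simp only [Pi.add_apply, Finset.sum_apply]
    have hS : ∑ p ∈ (E e).support, ((E e p : ℤ) : ℝ) * max ((n e : ℕ) - (p : ℝ)) 0 =
        moment e (E e) (G.tail e) := by
      rw [moment, Finsupp.sum]
      refine Finset.sum_congr rfl fun p _ => ?_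
      rw [if_pos rfl, max_eq_left (by linarith [p.2.2])]
    rw [hS, max_eq_left (by linarith [hqn e]), max_eq_left (by linarith [hμn e])]
    have := hqY e
    simp only [Y] at this ⊢
    push_cast
    linarith
  · simp only [ordAt, Pi.add_apply, Finset.sum_apply]
    have hS : (∑ p ∈ (E e).support, E e p * if (p : ℝ) ≤ t then 1 else 0) +
        ∑ p ∈ (E e).support, E e p * (if (p : ℝ) < t then -1 else 0) = E e t := by
      rw [← Finset.sum_add_distrib, Finset.sum_congr rfl (g := fun p => if p = t then E e t else 0),
        Finset.sum_ite_eq']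
      · split_ifs with h
        · rfl
        · exact (Finsupp.notMem_support_iff.1 h).symm
      · intro p _
        rcases lt_trichotomy (p : ℝ) t with h | h | h
        · rw [if_pos h.le, if_pos h, if_neg (by rintro rfl; exact lt_irrefl _ h)]; ring
        · rw [if_pos h.le, if_neg h.not_lt, if_pos (Subtype.ext h), Subtype.ext h]; ring
        · rw [if_neg h.not_ge, if_neg h.not_gt, if_neg (by rintro rfl; exact lt_irrefl _ h)]; ring
    have key : ∀ a : ℝ, (if a ≤ t then (1 : ℤ) else 0) + (if a < t then -1 else 0) =
        if (t : ℝ) = a then 1 else 0 := by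
      intro a
      rcases lt_trichotomy a t with h | h | h
      · rw [if_pos h.le, if_pos h, if_neg h.ne']; rfl
      · rw [if_pos h.le, if_neg h.not_lt, if_pos h.symm]; rfl
      · rw [if_neg h.not_ge, if_neg h.not_gt, if_neg h.ne]; rfl
    have h1 := key (q e)
    have h2 := key (w.μ e).val
    change _ = E e t + (if (t : ℝ) = q e then 1 else 0) - _
    linarith
  · have hfl : ⌈Y e / (n e : ℕ)⌉ = ⌊Y e / (n e : ℕ)⌋ + if q e ≤ 0 then 0 else 1 := by
      have h1 := hqY e
      rw [Int.ceil_eq_iff]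
      split_ifs with h
      · have h2 : q e = 0 := le_antisymm h (hq0 e)
        rw [h2, add_zero] at h1
        rw [← h1, mul_div_cancel_left₀ _ (hn e).ne', Int.floor_intCast]
        push_cast
        constructor <;> linarith
      · push_cast
        rw [add_sub_cancel_right, div_le_iff₀ (hn e), lt_div_iff₀ (hn e)]
        constructor <;> nlinarith [hqn e]
    have hμc : ⌈((w.μ e).val : ℝ) / (n e : ℕ)⌉ = if ((w.μ e).val : ℝ) ≤ 0 then 0 else 1 := by
      rw [Int.ceil_eq_iff]
      split_ifs with h
      · have : ((w.μ e).val : ℝ) = 0 := le_antisymm h (hμ0 e)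
        rw [this]; norm_num
      · push_cast
        rw [sub_self, div_le_iff₀ (hn e), lt_div_iff₀ (hn e)]
        constructor <;> linarith [hμn e]
    rcases hv with rfl | rfl
    · rw [slope, if_pos rfl, lift, sgn_tail, other_tail]
      simp only [Pi.add_apply, Finset.sum_apply]
      rw [Finset.sum_eq_zero fun p _ => by rw [if_neg (not_le.2 p.2.1), mul_zero]]
      push_cast
      rw [one_mul]
      change _ = _ - ⌈Y e / (n e : ℕ)⌉
      rw [hfl, hμc]
      split_ifs <;> ring
    · rw [slope, if_neg (G.loopless e).symm, lift, sgn_head, other_head]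
      simp only [Pi.add_apply, Finset.sum_apply]
      have hS : ∑ p ∈ (E e).support, E e p * (if (p : ℝ) < (n e : ℕ) then -1 else 0) =
          -(E e).degree := by
        rw [Finsupp.degree_apply, ← Finset.sum_neg_distrib]
        refine Finset.sum_congr rfl fun p _ => ?_
        rw [if_pos p.2.2]; ring
      have hM := moment_add_moment e (E e) (inc_head e)
      rw [other_head] at hM
      rw [hS, if_pos (hqn e), if_pos (hμn e)]
      push_cast
      have e1 : ⌈-1 * ((w.μ e).val : ℝ) / (n e : ℕ)⌉ = 0 := by
        rw [Int.ceil_eq_iff]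
        push_cast
        rw [zero_sub, div_le_iff₀ (hn e), lt_div_iff₀ (hn e)]
        constructor <;> linarith [hμn e, hμ0 e]
      have e2 : (-1 * ((w.μ e).val : ℝ) + (c (G.head e) - c (G.tail e)) +
          moment e (E e) (G.head e)) / (n e : ℕ) = -(Y e / (n e : ℕ)) + (E e).degree := by
        have : moment e (E e) (G.head e) =
          (E e).degree * (n e : ℕ) - moment e (E e) (G.tail e) := by linarith
        have hn' := (hn e).ne'
        rw [this]
        simp only [Y]
        field_simp
        ring
      rw [e1, e2, Int.ceil_add_intCast, Int.ceil_neg]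
      ring

end TropFunction
namespace NodalCurve

variable {κ : Type u} [Field κ] {X₀ : NodalCurve κ} {n : X₀.G.E → ℕ+}

open Multigraph AdmMultideg

/-! ### Divisors supported on the nodes -/

lemma nodeDiv_apply_node (v : X₀.G.V) (c : X₀.G.E → ℤ) {e : X₀.G.E} (h : X₀.G.Inc e v) :
    X₀.nodeDiv v c (X₀.node e v h) = c e := by
  rw [nodeDiv, Finsupp.finsetSum_apply, Finset.sum_eq_single e]
  · rw [dif_pos h, Finsupp.single_eq_same]
  · intro e' _ hne
    split_ifs with h'
    · rw [Finsupp.single_eq_of_ne]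
      exact fun heq => hne (X₀.node_injective v e e' h h' heq).symm
    · rfl
  · simp

lemma nodeDiv_apply_of_ne (v : X₀.G.V) (c : X₀.G.E → ℤ) {P : (X₀.Z v).Pt}
    (hP : ∀ e (h : X₀.G.Inc e v), X₀.node e v h ≠ P) : X₀.nodeDiv v c P = 0 := by
  rw [nodeDiv, Finsupp.finsetSum_apply]
  refine Finset.sum_eq_zero fun e _ => ?_
  split_ifs with h
  · rw [Finsupp.single_eq_of_ne]
    exact (hP e h).symm
  · rfl

lemma nodeDiv_mono {v : X₀.G.V} {c c' : X₀.G.E → ℤ} (h : ∀ e, X₀.G.Inc e v → c e ≤ c' e) :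
    X₀.nodeDiv v c ≤ X₀.nodeDiv v c' := by
  intro P
  by_cases hP : ∃ e, ∃ h : X₀.G.Inc e v, X₀.node e v h = P
  · obtain ⟨e, he, rfl⟩ := hP
    rw [nodeDiv_apply_node, nodeDiv_apply_node]
    exact h e he
  · push Not at hP
    rw [nodeDiv_apply_of_ne v c hP, nodeDiv_apply_of_ne v c' hP]

lemma nodeDiv_congr {v : X₀.G.V} {c c' : X₀.G.E → ℤ} (h : ∀ e, X₀.G.Inc e v → c e = c' e) :
    X₀.nodeDiv v c = X₀.nodeDiv v c' :=
  le_antisymm (nodeDiv_mono fun e he => (h e he).le) (nodeDiv_mono fun e he => (h e he).ge)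

lemma nodeDiv_sub (v : X₀.G.V) (c c' : X₀.G.E → ℤ) :
    X₀.nodeDiv v (fun e => c e - c' e) = X₀.nodeDiv v c - X₀.nodeDiv v c' := by
  rw [sub_eq_add_neg, ← nodeDiv_neg, ← nodeDiv_add]
  rfl

lemma degree_nodeDiv (v : X₀.G.V) (c : X₀.G.E → ℤ) :
    (X₀.nodeDiv v c).degree = ∑ e ∈ X₀.G.edgesAt v, c e := by
  rw [nodeDiv, map_sum, edgesAt, Finset.sum_filter]
  refine Finset.sum_congr rfl fun e _ => ?_
  split_ifs
  · rw [Finsupp.degree_single]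
  · simp

lemma degree_mono {α : Type*} {D D' : α →₀ ℤ} (h : D ≤ D') : D.degree ≤ D'.degree := by
  have h1 : 0 ≤ D' - D := sub_nonneg.2 h
  have h2 : 0 ≤ (D' - D).degree := Finset.sum_nonneg fun a _ => h1 a
  rw [map_sub] at h2
  omega

lemma degree_lt {α : Type*} {D D' : α →₀ ℤ} (h : D ≤ D') (hne : D' ≠ D) :
    D.degree < D'.degree := by
  have h1 : 0 ≤ D' - D := sub_nonneg.2 h
  have h2 : (D' - D).support.Nonempty := Finsupp.support_nonempty_iff.2 (sub_ne_zero.2 hne)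
  have h3 : 0 < (D' - D).degree := Finset.sum_pos
    (fun a ha => lt_of_le_of_ne (h1 a) (Finsupp.mem_support_iff.1 ha).symm) h2
  rw [map_sub] at h3
  omega

lemma coef_zero (w : AdmMultideg X₀.G n) (v : X₀.G.V) (e : X₀.G.E) :
    w.coef (fun _ => (0 : ℝ)) v e = 0 := by
  rw [coef, sub_self, drop_zero]

lemma twistDiv_state_state (hG : X₀.G.bar.Connected) (w : AdmMultideg X₀.G n)
    (c c' : X₀.G.V → ℤ) (v : X₀.G.V) :
    twistDiv (w.state c) (w.state c') v =
      X₀.nodeDiv v (w.coef (fun x => c' x) v) - X₀.nodeDiv v (w.coef (fun x => c x) v) := by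
  rw [twistDiv, ← nodeDiv_sub]
  exact nodeDiv_congr fun e he => w.twistCoeff_state hG c c' he

lemma twistDiv_state (hG : X₀.G.bar.Connected) (w : AdmMultideg X₀.G n) (c : X₀.G.V → ℤ)
    (v : X₀.G.V) : twistDiv w (w.state c) v = X₀.nodeDiv v (w.coef (fun x => c x) v) := by
  have h := twistDiv_state_state hG w 0 c v
  rw [state_zero] at h
  rw [h, nodeDiv_congr (c := w.coef (fun x => (((0 : X₀.G.V → ℤ) x : ℤ) : ℝ)) v) (c' := 0),
    nodeDiv_zero, sub_zero]
  intro e _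
  simp only [Pi.zero_apply, Int.cast_zero]
  exact coef_zero w v e

/-- The divisor on `Z_v` of the changes at `v` for the potential `c`, except that a difference of
potentials `s` is used along the edges over `{v, u}`. -/
def edgeDiv (w : AdmMultideg X₀.G n) (c : X₀.G.V → ℤ) (v u : X₀.G.V) (s : ℝ) : (X₀.Z v).Div :=
  X₀.nodeDiv v fun e => if e ∈ X₀.G.edgesOver v u then w.drop e v s else w.coef (fun x => c x) v e

lemma edgeDiv_anti (w : AdmMultideg X₀.G n) (c : X₀.G.V → ℤ) (v u : X₀.G.V) {s t : ℝ}
    (h : s ≤ t) : edgeDiv w c v u t ≤ edgeDiv w c v u s := by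
  refine nodeDiv_mono fun e _ => ?_
  split_ifs
  · exact w.drop_anti e v h
  · exact le_rfl

lemma edgeDiv_self (w : AdmMultideg X₀.G n) (c : X₀.G.V → ℤ) {v u : X₀.G.V} (h : v ≠ u) :
    edgeDiv w c v u (c v - c u) = X₀.nodeDiv v (w.coef (fun x => c x) v) := by
  refine nodeDiv_congr fun e _ => ?_
  split_ifs with h'
  · rw [coef, ((mem_edgesOver_iff h).1 h').2]
  · rfl

/-- Only the total difference `c v - c u + i` matters. Shifts of the index between two tuples and
the symmetry between `v` and `u` follow from this. -/
lemma mem_lossEdges_iff (w : AdmMultideg X₀.G n) (c : X₀.G.V → ℤ) {v u : X₀.G.V} (h : v ≠ u)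
    {wt : X₀.G.V → AdmMultideg X₀.G n} (hwt : wt v = w.state c) (i : ℕ) (e : X₀.G.E) :
    e ∈ (wt v).lossEdges v u i ↔ e ∈ X₀.G.edgesOver v u ∧
      w.μ e + ((X₀.G.sgn e v * (c v - c u + i) : ℤ) : ZMod (n e)) = 0 := by
  rw [lossEdges, Finset.mem_filter]
  refine and_congr_right fun he => ?_
  obtain ⟨hev, ho⟩ := (mem_edgesOver_iff h).1 he
  have hx := sgn_mul_sub (A := ℤ) hev c
  rw [Int.cast_id, ho] at hx
  rw [hwt, state_μ, ← hx]
  have hs : ((X₀.G.sgn e v : ℤ) : ZMod (n e)) * (X₀.G.sgn e v : ZMod (n e)) = 1 := by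
    exact_mod_cast congrArg (Int.cast (R := ZMod (n e))) (X₀.G.sgn_mul_self e v)
  push_cast
  constructor
  · intro h1
    linear_combination (X₀.G.sgn e v : ZMod (n e)) * h1 - w.μ e * hs
  · intro h1
    linear_combination (X₀.G.sgn e v : ZMod (n e)) * h1 - ((X₀.G.sgn e v : ZMod (n e)) *
      ((c (X₀.G.tail e) : ZMod (n e)) - (c (X₀.G.head e) : ZMod (n e))) + i) * hs

lemma drop_natCast (w : AdmMultideg X₀.G n) (c : X₀.G.V → ℤ) {v u : X₀.G.V} (h : v ≠ u)
    {e : X₀.G.E} (he : e ∈ X₀.G.edgesOver v u) {wt : X₀.G.V → AdmMultideg X₀.G n}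
    (hwt : wt v = w.state c) (i : ℕ) :
    (((Finset.range i).filter fun k => e ∈ (wt v).lossEdges v u k).card : ℤ) =
      w.drop e v (c v - c u) - w.drop e v (c v - c u + i) := by
  induction i with
  | zero => simp
  | succ i ih =>
    rw [Finset.range_add_one, Finset.filter_insert]
    have hstep := w.drop_succ e v (X₀.G.sgn e v * (c v - c u + i))
    rw [← mul_assoc, X₀.G.sgn_mul_self, one_mul] at hstep
    have hiff := fun k => (mem_lossEdges_iff w c h hwt k e).trans (and_iff_right he)
    simp only [hiff] at ih ⊢
    push_cast at ih hstep ⊢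
    rw [← add_assoc, hstep]
    split_ifs with h1
    · rw [Finset.card_insert_of_notMem (by simp)]
      push_cast
      rw [ih]
      ring
    · rw [ih]
      ring

/-- The divisor D_i^{e,v} records what `v` has lost after raising the difference along the edge by
`i`; imposing it on sections amounts to replacing the difference of potentials. -/
lemma chipDiv_eq (w : AdmMultideg X₀.G n) (c : X₀.G.V → ℤ) {v u : X₀.G.V} (h : v ≠ u)
    {wt : X₀.G.V → AdmMultideg X₀.G n} (hwt : wt v = w.state c) (i : ℕ) :
    chipDiv wt v u i = edgeDiv w c v u (c v - c u) - edgeDiv w c v u (c v - c u + i) := by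
  rw [chipDiv, edgeDiv, edgeDiv, ← nodeDiv_sub]
  refine nodeDiv_congr fun e _ => ?_
  by_cases he : e ∈ X₀.G.edgesOver v u
  · rw [if_pos he, if_pos he, drop_natCast w c h he hwt]
  · rw [if_neg he, if_neg he, sub_self, Nat.cast_eq_zero, Finset.card_eq_zero]
    ext k
    simp [lossEdges, he]

/-! ### Divisors on the metrized complex -/

/-- The part of a divisor on `ℭ` in the interior of the edge `e`. -/
def ComplexDiv.edgePart (D : ComplexDiv X₀ n) (e : X₀.G.E) : Set.Ioo (0 : ℝ) (n e : ℝ) →₀ ℤ :=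
  D.comapDomain (fun t => Sum.inr ⟨e, t⟩) (fun P _ Q _ h => by simpa using h)

lemma ComplexDiv.part_apply (D : ComplexDiv X₀ n) (v : X₀.G.V) (P : (X₀.Z v).Pt) :
    ComplexDiv.part D v P = D (Sum.inl ⟨v, P⟩) := rfl

lemma ComplexDiv.edgePart_apply (D : ComplexDiv X₀ n) (e : X₀.G.E)
    (t : Set.Ioo (0 : ℝ) (n e : ℝ)) : ComplexDiv.edgePart D e t = D (Sum.inr ⟨e, t⟩) := rfl

/-- The divisor on `ℭ` with given parts. -/
def ComplexDiv.ofParts (D : ∀ v, (X₀.Z v).Div) (E : ∀ e : X₀.G.E, Set.Ioo (0 : ℝ) (n e : ℝ) →₀ ℤ) :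
    ComplexDiv X₀ n :=
  Finsupp.sumFinsuppEquivProdFinsupp.symm
    (Finsupp.sigmaFinsuppEquivPiFinsupp.symm D, Finsupp.sigmaFinsuppEquivPiFinsupp.symm E)

lemma ComplexDiv.part_ofParts (D : ∀ v, (X₀.Z v).Div)
    (E : ∀ e : X₀.G.E, Set.Ioo (0 : ℝ) (n e : ℝ) →₀ ℤ) (v : X₀.G.V) :
    ComplexDiv.part (ComplexDiv.ofParts D E) v = D v := by
  ext P
  rw [part_apply, ofParts, Finsupp.sumFinsuppEquivProdFinsupp_symm_inl,
    ← Finsupp.sigmaFinsuppEquivPiFinsupp_apply, Equiv.apply_symm_apply]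

lemma ComplexDiv.edgePart_ofParts (D : ∀ v, (X₀.Z v).Div)
    (E : ∀ e : X₀.G.E, Set.Ioo (0 : ℝ) (n e : ℝ) →₀ ℤ) (e : X₀.G.E) :
    ComplexDiv.edgePart (ComplexDiv.ofParts D E) e = E e := by
  ext P
  rw [edgePart_apply, ofParts, Finsupp.sumFinsuppEquivProdFinsupp_symm_inr,
    ← Finsupp.sigmaFinsuppEquivPiFinsupp_apply, Equiv.apply_symm_apply]

lemma ComplexDiv.ext_parts {D D' : ComplexDiv X₀ n}
    (h : ∀ v, ComplexDiv.part D v = ComplexDiv.part D' v)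
    (h' : ∀ e, ComplexDiv.edgePart D e = ComplexDiv.edgePart D' e) : D = D' := by
  ext x
  rcases x with ⟨v, P⟩ | ⟨e, t⟩
  · exact DFunLike.congr_fun (h v) P
  · exact DFunLike.congr_fun (h' e) t

lemma ComplexDiv.degree_eq (D : ComplexDiv X₀ n) :
    D.degree = ∑ v, (ComplexDiv.part D v).degree + ∑ e, (ComplexDiv.edgePart D e).degree := by
  have hadd : ∀ D D' : ComplexDiv X₀ n, ∀ v,
      ComplexDiv.part (D + D') v = ComplexDiv.part D v + ComplexDiv.part D' v :=
    fun D D' v => by ext P; rfl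
  have hadd' : ∀ D D' : ComplexDiv X₀ n, ∀ e,
      ComplexDiv.edgePart (D + D') e = ComplexDiv.edgePart D e + ComplexDiv.edgePart D' e :=
    fun D D' v => by ext P; rfl
  induction D using Finsupp.induction_linear with
  | zero =>
    have h1 : ∀ v, ComplexDiv.part (0 : ComplexDiv X₀ n) v = 0 := fun v => by ext P; rfl
    have h2 : ∀ e, ComplexDiv.edgePart (0 : ComplexDiv X₀ n) e = 0 := fun v => by ext P; rfl
    simp only [h1, h2, map_zero, Finset.sum_const_zero, add_zero]
  | add D D' h h' =>
    simp only [hadd, hadd', map_add, Finset.sum_add_distrib]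
    rw [h, h']
    ring
  | single x a =>
    rw [Finsupp.degree_single]
    rcases x with ⟨v, P⟩ | ⟨e, t⟩
    · have h2 : ∀ e, ComplexDiv.edgePart (Finsupp.single (Sum.inl ⟨v, P⟩) a : ComplexDiv X₀ n) e =
          0 := fun e => by
        ext t
        rw [edgePart_apply, Finsupp.single_eq_of_ne (by simp)]
        rfl
      have h1 : ComplexDiv.part (Finsupp.single (Sum.inl ⟨v, P⟩) a : ComplexDiv X₀ n) v =
          Finsupp.single P a := by
        ext Q
        rw [part_apply, Finsupp.single_apply, Finsupp.single_apply]
        simp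
      simp only [h2, map_zero, Finset.sum_const_zero, add_zero]
      rw [Finset.sum_eq_single v, h1, Finsupp.degree_single]
      · intro u _ hu
        rw [show ComplexDiv.part (Finsupp.single (Sum.inl ⟨v, P⟩) a : ComplexDiv X₀ n) u = 0 from ?_,
          map_zero]
        ext Q
        rw [part_apply, Finsupp.single_eq_of_ne]
        · rfl
        · intro h
          simp only [Sum.inl.injEq, Sigma.mk.injEq] at h
          exact hu h.1
      · simp
    · have h2 : ∀ v, ComplexDiv.part (Finsupp.single (Sum.inr ⟨e, t⟩) a : ComplexDiv X₀ n) v =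
          0 := fun v => by
        ext P
        rw [part_apply, Finsupp.single_eq_of_ne (by simp)]
        rfl
      have h1 : ComplexDiv.edgePart (Finsupp.single (Sum.inr ⟨e, t⟩) a : ComplexDiv X₀ n) e =
          Finsupp.single t a := by
        ext Q
        rw [edgePart_apply, Finsupp.single_apply, Finsupp.single_apply]
        simp
      simp only [h2, map_zero, Finset.sum_const_zero, zero_add]
      rw [Finset.sum_eq_single e, h1, Finsupp.degree_single]
      · intro u _ hu
        rw [show ComplexDiv.edgePart (Finsupp.single (Sum.inr ⟨e, t⟩) a : ComplexDiv X₀ n) u = 0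
          from ?_, map_zero]
        ext Q
        rw [edgePart_apply, Finsupp.single_eq_of_ne]
        · rfl
        · intro h
          simp only [Sum.inr.injEq, Sigma.mk.injEq] at h
          exact hu h.1
      · simp

/-- The chip on the edge `e` of the divisor `D_w`. -/
def chipPart (w : AdmMultideg X₀.G n) (e : X₀.G.E) : Set.Ioo (0 : ℝ) (n e : ℝ) →₀ ℤ :=
  if h : w.μ e ≠ 0 then
    Finsupp.single ⟨(w.μ e).val, by
      exact_mod_cast Nat.pos_of_ne_zero (mt (ZMod.val_eq_zero _).1 h), by
      exact_mod_cast ZMod.val_lt (w.μ e)⟩ 1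
  else 0

lemma chipPart_apply (w : AdmMultideg X₀.G n) (e : X₀.G.E) (t : Set.Ioo (0 : ℝ) (n e : ℝ)) :
    chipPart w e t = if (t : ℝ) = (w.μ e).val then 1 else 0 := by
  rw [chipPart]
  split_ifs with h h' h'
  · rw [Finsupp.single_apply, if_pos (Subtype.ext h'.symm)]
  · rw [Finsupp.single_apply, if_neg]
    rintro rfl
    exact h' rfl
  · exfalso
    rw [not_not] at h
    rw [h, ZMod.val_zero] at h'
    exact t.2.1.ne' (by simpa using h')
  · rfl

lemma degree_chipPart (w : AdmMultideg X₀.G n) (e : X₀.G.E) :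
    (chipPart w e).degree = if w.μ e ≠ 0 then 1 else 0 := by
  rw [chipPart]
  split_ifs
  · rw [Finsupp.degree_single]
  · rw [map_zero]

/-- The divisor on `ℭ` whose `Γ`-part is that of the multidegree `w` on the edges. -/
def ComplexDiv.ofMultideg (w : AdmMultideg X₀.G n) (D : ∀ v, (X₀.Z v).Div) : ComplexDiv X₀ n :=
  ComplexDiv.ofParts D (chipPart w)

lemma ComplexDiv.part_ofMultideg (w : AdmMultideg X₀.G n) (D : ∀ v, (X₀.Z v).Div) (v : X₀.G.V) :
    ComplexDiv.part (ComplexDiv.ofMultideg w D) v = D v := part_ofParts _ _ _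

lemma ComplexDiv.isOfMultidegree_iff {D : ComplexDiv X₀ n} {w : AdmMultideg X₀.G n} :
    D.IsOfMultidegree w ↔ D = ComplexDiv.ofMultideg w (ComplexDiv.part D) ∧
      ∀ v, (ComplexDiv.part D v).degree = w.wG v := by
  constructor
  · rintro ⟨h1, h2⟩
    refine ⟨ext_parts (fun v => (part_ofMultideg _ _ _).symm) fun e => ?_, h1⟩
    rw [ofMultideg, edgePart_ofParts]
    ext t
    rw [chipPart_apply]
    exact h2 e t
  · rintro ⟨h1, h2⟩
    refine ⟨h2, fun e t => ?_⟩
    rw [h1, ← edgePart_apply, ofMultideg, edgePart_ofParts, chipPart_apply]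

lemma ComplexDiv.isOfMultidegree_ofMultideg {w : AdmMultideg X₀.G n} {D : ∀ v, (X₀.Z v).Div}
    (h : ∀ v, (D v).degree = w.wG v) : (ComplexDiv.ofMultideg w D).IsOfMultidegree w :=
  isOfMultidegree_iff.2 ⟨by congr; funext v; exact (part_ofMultideg _ _ _).symm,
    fun v => by rw [part_ofMultideg]; exact h v⟩

lemma ComplexDiv.IsOfMultidegree.degree_eq {D : ComplexDiv X₀ n} {w : AdmMultideg X₀.G n}
    (h : D.IsOfMultidegree w) : D.degree = w.degree := by
  obtain ⟨h1, h2⟩ := isOfMultidegree_iff.1 h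
  rw [ComplexDiv.degree_eq, Finset.sum_congr rfl fun v _ => h2 v, h1]
  simp only [ofMultideg, edgePart_ofParts, degree_chipPart]
  rw [AdmMultideg.degree, Finset.card_filter]
  push_cast
  ring

end NodalCurve
namespace NodalCurve

section Vanishing

variable {κ : Type u} [Field κ] {C : SmoothCurve κ}

/-! ### Multivanishing sequences and dimensions of spaces of sections -/

lemma degree_lt_of_isCritical {Ds : ℕ → C.Div} (hDs : Monotone Ds) {i j : ℕ}
    (hi : IsCritical Ds i) (hij : i < j) : (Ds i).degree < (Ds j).degree :=
  (degree_lt (hDs (Nat.le_add_right i 1)) hi).trans_le (degree_mono (hDs hij))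

lemma sectionsVanishing_anti (D : C.Div) (V : Submodule κ C.K) {D₁ D₂ : C.Div} (h : D₁ ≤ D₂) :
    sectionsVanishing D V D₂ ≤ sectionsVanishing D V D₁ :=
  inf_le_inf_left V (C.H0_mono (sub_le_sub_left h D))

lemma sectionsVanishing_zero {D : C.Div} {V : Submodule κ C.K} (h : V ≤ C.H0 D) :
    sectionsVanishing D V 0 = V := by
  rw [sectionsVanishing, sub_zero, inf_eq_left.2 h]

variable {D : C.Div} {V : Submodule κ C.K} [FiniteDimensional κ V] {Ds : ℕ → C.Div} {r : ℕ}

lemma finrank_gradedPiece_add {D₁ D₂ : C.Div} (h : D₁ ≤ D₂) :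
    Module.finrank κ (gradedPiece D V D₁ D₂) + Module.finrank κ (sectionsVanishing D V D₂) =
      Module.finrank κ (sectionsVanishing D V D₁) := by
  have : FiniteDimensional κ (sectionsVanishing D V D₁) :=
    Submodule.finiteDimensional_of_le (S₂ := V) inf_le_left
  rw [← (Submodule.submoduleOfEquivOfLe (sectionsVanishing_anti D V h)).finrank_eq]
  exact Submodule.finrank_quotient_add_finrank _

lemma finrank_sectionsVanishing_anti (hDs : Monotone Ds) :
    Antitone fun i => Module.finrank κ (sectionsVanishing D V (Ds i)) := fun i j hij => by
  have : FiniteDimensional κ (sectionsVanishing D V (Ds i)) :=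
    Submodule.finiteDimensional_of_le (S₂ := V) inf_le_left
  exact Submodule.finrank_mono (sectionsVanishing_anti D V (hDs hij))

/-- Each critical step removes as many sections as there are entries of that degree, and noncritical
steps change nothing. Critical degrees increase strictly, so entries can be counted by index. -/
lemma IsMultivanishing.card_le {a : Fin (r + 1) → ℤ} (ha : IsMultivanishing D V Ds a)
    (hDs : Monotone Ds) (h0 : Ds 0 = 0) (hV : V ≤ C.H0 D) (hr : Module.finrank κ V = r + 1)
    (j : ℕ) : (Finset.univ.filter fun l => (Ds j).degree ≤ a l).card =
      Module.finrank κ (sectionsVanishing D V (Ds j)) := by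
  obtain ⟨-, ha1, ha2⟩ := ha
  induction j with
  | zero =>
    rw [h0, sectionsVanishing_zero hV, hr, Finset.filter_true_of_mem, Finset.card_univ,
      Fintype.card_fin]
    intro l _
    obtain ⟨i, -, hi⟩ := ha1 l
    rw [hi, ← h0]
    exact degree_mono (hDs (Nat.zero_le i))
  | succ j ih =>
    have hq := finrank_gradedPiece_add (D := D) (V := V) (hDs (Nat.le_add_right j 1))
    by_cases hj : IsCritical Ds j
    · rw [← ha2 j hj, ← ih] at hq
      have hsplit : (Finset.univ.filter fun l => (Ds j).degree ≤ a l) =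
          (Finset.univ.filter fun l => a l = (Ds j).degree) ∪
            Finset.univ.filter fun l => (Ds (j + 1)).degree ≤ a l := by
        ext l
        simp only [Finset.mem_filter, Finset.mem_univ, true_and, Finset.mem_union]
        constructor
        · intro hl
          obtain ⟨i, hi, hai⟩ := ha1 l
          rcases lt_trichotomy i j with h | rfl | h
          · have := degree_lt_of_isCritical hDs hi h
            omega
          · exact Or.inl hai
          · exact Or.inr (hai ▸ degree_mono (hDs h))
        · rintro (h | h)
          · exact h.ge
          · exact (degree_lt_of_isCritical hDs hj (Nat.lt_add_one j)).le.trans h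
      rw [hsplit, Finset.card_union_of_disjoint] at hq
      · omega
      · rw [Finset.disjoint_filter]
        intro l _ h1 h2
        have := degree_lt_of_isCritical hDs hj (Nat.lt_add_one j)
        omega
    · rw [IsCritical, not_not] at hj
      rw [hj, ih]

lemma Fin.le_iff_card_of_monotone {a : Fin (r + 1) → ℤ} (ha : Monotone a) (x : ℤ)
    (l : Fin (r + 1)) :
    x ≤ a l ↔ r + 1 ≤ (Finset.univ.filter fun i => x ≤ a i).card + l := by
  constructor
  · intro h
    have hsub : Finset.Ici l ⊆ Finset.univ.filter fun i => x ≤ a i := by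
      intro i hi
      simp only [Finset.mem_filter, Finset.mem_univ, true_and]
      exact h.trans (ha (Finset.mem_Ici.1 hi))
    have := Finset.card_le_card hsub
    rw [Fin.card_Ici] at this
    omega
  · intro h
    by_contra hcon
    have hsub : (Finset.univ.filter fun i => x ≤ a i) ⊆ Finset.Ioi l := by
      intro i hi
      simp only [Finset.mem_filter, Finset.mem_univ, true_and] at hi
      rw [Finset.mem_Ioi]
      by_contra hil
      exact hcon (hi.trans (ha (not_lt.1 hil)))
    have := Finset.card_le_card hsub
    rw [Fin.card_Ioi] at this
    have := l.2
    omega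

/-- Translates inequalities for the sorted sequence into inequalities for dimensions, in which form
all conditions on vanishing sequences are used. -/
lemma IsMultivanishing.degree_le_iff {a : Fin (r + 1) → ℤ} (ha : IsMultivanishing D V Ds a)
    (hDs : Monotone Ds) (h0 : Ds 0 = 0) (hV : V ≤ C.H0 D) (hr : Module.finrank κ V = r + 1)
    (j : ℕ) (l : Fin (r + 1)) : (Ds j).degree ≤ a l ↔
      r + 1 ≤ Module.finrank κ (sectionsVanishing D V (Ds j)) + l := by
  rw [Fin.le_iff_card_of_monotone ha.1, ha.card_le hDs h0 hV hr]

/-- The entry `a l` sits at the index where the dimension falls below `r + 1 - l`. Such an index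
exists because the dimension starts at `r + 1` and reaches 0. -/
lemma exists_isMultivanishing (hDs : Monotone Ds) (h0 : Ds 0 = 0) (hV : V ≤ C.H0 D)
    (hr : Module.finrank κ V = r + 1) (hbot : ∃ N, sectionsVanishing D V (Ds N) = ⊥) :
    ∃ a : Fin (r + 1) → ℤ, IsMultivanishing D V Ds a := by
  let f : ℕ → ℕ := fun i => Module.finrank κ (sectionsVanishing D V (Ds i))
  have hf : Antitone f := finrank_sectionsVanishing_anti hDs
  have hf0 : f 0 = r + 1 := by simp only [f]; rw [h0, sectionsVanishing_zero hV, hr]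
  obtain ⟨N, hN⟩ := hbot
  have hfN : f N = 0 := by simp only [f]; rw [hN, finrank_bot]
  have hex : ∀ l : Fin (r + 1), ∃ i, r + 1 ≤ f i + l ∧ f (i + 1) + l < r + 1 := by
    intro l
    obtain ⟨i, -, -, h1, h2⟩ := AdmMultideg.exists_not_succ (p := fun i => r + 1 ≤ f i + l)
      (Nat.zero_le N) (by rw [hf0]; omega) (by rw [hfN]; omega)
    exact ⟨i, h1, not_le.1 h2⟩
  choose i hi1 hi2 using hex
  have hcrit : ∀ l, IsCritical Ds (i l) := by
    intro l heq
    have h1 := hi1 l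
    have h2 := hi2 l
    simp only [f] at h1 h2
    rw [heq] at h2
    omega
  have hinj : ∀ {j k}, IsCritical Ds j → IsCritical Ds k → (Ds j).degree = (Ds k).degree →
      j = k := by
    intro j k hj hk h
    rcases lt_trichotomy j k with h1 | h1 | h1
    · exact absurd h (degree_lt_of_isCritical hDs hj h1).ne
    · exact h1
    · exact absurd h (degree_lt_of_isCritical hDs hk h1).ne'
  refine ⟨fun l => (Ds (i l)).degree, fun l m hlm => degree_mono (hDs ?_),
    fun l => ⟨i l, hcrit l, rfl⟩, fun j hj => ?_⟩
  · by_contra hcon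
    have h1 := hi1 l
    have h2 := hi2 m
    have h3 := hf (show i m + 1 ≤ i l by omega)
    have h4 : (l : ℕ) ≤ m := hlm
    omega
  · have hq := finrank_gradedPiece_add (D := D) (V := V) (hDs (Nat.le_add_right j 1))
    have hfilter : (Finset.univ.filter fun l => (Ds (i l)).degree = (Ds j).degree) =
        Finset.univ.filter fun l : Fin (r + 1) => r + 1 ≤ f j + l ∧ f (j + 1) + l < r + 1 := by
      ext l
      simp only [Finset.mem_filter, Finset.mem_univ, true_and]
      constructor
      · intro h
        have := hinj (hcrit l) hj h
        rw [← this]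
        exact ⟨hi1 l, hi2 l⟩
      · rintro ⟨h1, h2⟩
        have h3 := hi1 l
        have h4 := hi2 l
        congr 2
        rcases lt_trichotomy (i l) j with h | h | h
        · have := hf (show i l + 1 ≤ j from h)
          omega
        · exact h
        · have := hf (show j + 1 ≤ i l from h)
          omega
    have hle : f j ≤ r + 1 := hf0 ▸ hf (Nat.zero_le j)
    have hle' : f (j + 1) ≤ f j := hf (Nat.le_add_right j 1)
    rw [hfilter]
    have hcard : (Finset.univ.filter fun l : Fin (r + 1) =>
        r + 1 ≤ f j + l ∧ f (j + 1) + l < r + 1).card = f j - f (j + 1) := by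
      rw [← Finset.card_map Fin.valEmbedding]
      rw [show Finset.map Fin.valEmbedding (Finset.univ.filter fun l : Fin (r + 1) =>
          r + 1 ≤ f j + l ∧ f (j + 1) + l < r + 1) =
          Finset.Ico (r + 1 - f j) (r + 1 - f (j + 1)) from ?_, Nat.card_Ico]
      · omega
      · ext k
        simp only [Finset.mem_map, Finset.mem_filter, Finset.mem_univ, true_and, Finset.mem_Ico,
          Fin.valEmbedding_apply]
        constructor
        · rintro ⟨l, h, rfl⟩
          omega
        · intro h
          exact ⟨⟨k, by omega⟩, by simp only; omega, rfl⟩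
    rw [hcard]
    simp only [f]
    omega

end Vanishing

/-! ### Pre-limit linear series in terms of dimensions of spaces of sections -/

section PreLimit

variable {κ : Type u} [Field κ] {X₀ : NodalCurve κ} {n : X₀.G.E → ℕ+}

open Multigraph AdmMultideg

/-- The condition at the edges of the tree for a pre-limit linear series, in terms of the
dimensions of spaces of sections. -/
def EdgeCondition (w : AdmMultideg X₀.G n) (c : X₀.G.V → X₀.G.V → ℤ) (r : ℕ)
    (D : ∀ v, (X₀.Z v).Div) (H : ∀ v, Submodule κ (X₀.Z v).K) : Prop :=
  ∀ v u, X₀.G.bar.Adj v u → ∀ s : ℤ, r + 1 ≤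
    Module.finrank κ ↥(H v ⊓ (X₀.Z v).H0 (D v + edgeDiv w (c v) v u ((s + 1 : ℤ) : ℝ))) +
      Module.finrank κ ↥(H u ⊓ (X₀.Z u).H0 (D u + edgeDiv w (c u) u v ((-s : ℤ) : ℝ)))

lemma chipDiv_zero (wt : X₀.G.V → AdmMultideg X₀.G n) (v u : X₀.G.V) : chipDiv wt v u 0 = 0 := by
  rw [chipDiv, ← nodeDiv_zero v]
  refine nodeDiv_congr fun e _ => ?_
  simp

lemma chipDiv_mono (wt : X₀.G.V → AdmMultideg X₀.G n) (v u : X₀.G.V) :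
    Monotone (chipDiv wt v u) := by
  intro i j hij
  refine nodeDiv_mono fun e _ => ?_
  exact_mod_cast Finset.card_le_card (Finset.filter_subset_filter _ (Finset.range_mono hij))

lemma edgeDiv_unbounded (w : AdmMultideg X₀.G n) (c : X₀.G.V → ℤ) {v u : X₀.G.V}
    (h : X₀.G.bar.Adj v u) (N : ℤ) : ∃ s : ℝ, ∀ t, s ≤ t → (edgeDiv w c v u t).degree < N := by
  obtain ⟨hne, e₀, hv, hu⟩ := h
  have he₀ : e₀ ∈ X₀.G.edgesOver v u := mem_edgesOver.2 ⟨hv, hu⟩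
  obtain ⟨k, hk, hkN⟩ : ∃ k : ℤ, 0 ≤ k ∧ (edgeDiv w c v u 0).degree < N + k :=
    ⟨max 0 ((edgeDiv w c v u 0).degree - N + 1), le_max_left _ _, by
      have := le_max_right 0 ((edgeDiv w c v u 0).degree - N + 1); omega⟩
  refine ⟨((k * (n e₀ : ℕ) : ℤ) : ℝ), fun t ht => ?_⟩
  refine (degree_mono (edgeDiv_anti w c v u ht)).trans_lt ?_
  refine lt_of_le_of_lt ?_ (sub_lt_iff_lt_add.2 hkN)
  have hterm : ∀ e ∈ X₀.G.edgesAt v, (if e ∈ X₀.G.edgesOver v u then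
      w.drop e v ((k * (n e₀ : ℕ) : ℤ) : ℝ) else w.coef (fun x => c x) v e) +
      (if e = e₀ then k else 0) ≤
      if e ∈ X₀.G.edgesOver v u then w.drop e v 0 else w.coef (fun x => c x) v e := by
    intro e _
    by_cases h1 : e = e₀
    · subst h1
      rw [if_pos he₀, if_pos he₀, if_pos rfl, w.drop_mul_length, w.drop_zero]
      omega
    · rw [if_neg h1, add_zero]
      split_ifs
      · refine w.drop_anti e v ?_
        have : 0 ≤ k * ((n e₀ : ℕ) : ℤ) := by positivity
        exact_mod_cast this
      · exact le_rfl
  have := Finset.sum_le_sum hterm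
  rw [Finset.sum_add_distrib, Finset.sum_ite_eq', if_pos (mem_edgesAt.2 hv)] at this
  rw [edgeDiv, edgeDiv, degree_nodeDiv, degree_nodeDiv]
  omega

variable [IsAlgClosed κ]

/-- A difference s along {v, u} corresponds to the index j with s = c_v(v) - c_v(u) + j at v, and to
the index `gap - j` at u; so the condition on sequences compares V_v(-D_{j+1}) with V_u(-D_{gap-j}).
-/
lemma isPreLimit_iff {w : AdmMultideg X₀.G n} {wt : X₀.G.V → AdmMultideg X₀.G n}
    {c : X₀.G.V → X₀.G.V → ℤ} (hc : TightPotentials w wt c) {r : ℕ} {D : ∀ v, (X₀.Z v).Div}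
    {H : ∀ v, Submodule κ (X₀.Z v).K} :
    IsPreLimit wt r ⟨fun v => D v + X₀.nodeDiv v (w.coef (fun x => c v x) v), H⟩ ↔
      (∀ v, (D v).degree = w.wG v) ∧
      (∀ v, H v ≤ (X₀.Z v).H0 (D v + X₀.nodeDiv v (w.coef (fun x => c v x) v))) ∧
      (∀ v, Module.finrank κ (H v) = r + 1) ∧ EdgeCondition w c r D H := by
  rw [IsPreLimit]
  refine and_congr (forall_congr' fun v => ?_) (and_congr_right fun hH =>
    and_congr_right fun hr => ?_)
  · rw [map_add, degree_nodeDiv, hc.eq_state v, state_wG, degAt]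
    exact add_left_inj _
  dsimp only at hH hr ⊢
  have hfd : ∀ v, FiniteDimensional κ (H v) := fun v =>
    Module.finite_of_finrank_pos (by rw [hr]; omega)
  have hsv : ∀ v u, X₀.G.bar.Adj v u → ∀ j : ℕ,
      sectionsVanishing (D v + X₀.nodeDiv v (w.coef (fun x => c v x) v)) (H v) (chipDiv wt v u j) =
        H v ⊓ (X₀.Z v).H0 (D v + edgeDiv w (c v) v u ((c v v - c v u + j : ℤ) : ℝ)) := by
    intro v u h j
    rw [sectionsVanishing, chipDiv_eq w (c v) h.ne (hc.eq_state v), edgeDiv_self w (c v) h.ne,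
      add_sub_assoc, sub_sub_cancel]
    push_cast
    rfl
  have hfull : ∀ v u, X₀.G.bar.Adj v u → ∀ s : ℤ, s ≤ c v v - c v u →
      H v ⊓ (X₀.Z v).H0 (D v + edgeDiv w (c v) v u (s : ℝ)) = H v := by
    intro v u h s hs
    refine inf_eq_left.2 ((hH v).trans ((X₀.Z v).H0_mono (add_le_add_right ?_ _)))
    rw [← edgeDiv_self w (c v) h.ne]
    exact edgeDiv_anti w (c v) v u (by exact_mod_cast hs)
  have hbot : ∀ v u, X₀.G.bar.Adj v u → ∃ N, sectionsVanishing
      (D v + X₀.nodeDiv v (w.coef (fun x => c v x) v)) (H v) (chipDiv wt v u N) = ⊥ := by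
    intro v u h
    obtain ⟨s, hs⟩ := edgeDiv_unbounded w (c v) h (-(D v).degree)
    obtain ⟨N, hN⟩ := exists_nat_ge (s - (c v v - c v u))
    refine ⟨N, ?_⟩
    rw [hsv v u h, SmoothCurve.H0_eq_bot_of_degree_neg, inf_bot_eq]
    have := hs ((c v v - c v u + N : ℤ) : ℝ) (by push_cast; linarith)
    rw [map_add]
    omega
  constructor
  · rintro ⟨a, ha, hcond⟩ v u h s
    have hav := ha v u h
    have hau := ha u v h.symm
    have hgap := hc.gap_eq v u h
    -- Outside the range of indices between 0 and `gap`, one of the two spaces is all of `H` and the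
    -- inequality is trivial.
    rcases le_or_gt (s + 1) (c v v - c v u) with hs | hs
    · rw [hfull v u h _ hs, hr]; omega
    rcases le_or_gt (-s) (c u u - c u v) with hs' | hs'
    · rw [hfull u v h.symm _ hs', hr]; omega
    obtain ⟨j, hj⟩ := Int.eq_ofNat_of_zero_le (show 0 ≤ s - (c v v - c v u) by omega)
    have e1 : s + 1 = c v v - c v u + ((j + 1 : ℕ) : ℤ) := by push_cast; omega
    have hjb : j ≤ gap wt v u := by omega
    have e2 : -s = c u u - c u v + ((gap wt v u - j : ℕ) : ℤ) := by
      rw [Nat.cast_sub hjb]; omega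
    rw [e1, e2, ← hsv v u h, ← hsv u v h.symm]
    set m := Module.finrank κ (sectionsVanishing
      (D v + X₀.nodeDiv v (w.coef (fun x => c v x) v)) (H v) (chipDiv wt v u (j + 1))) with hm
    by_contra hcon
    have hmr : m ≤ r := by omega
    -- The last index whose entry is smaller than the degree of D_{j+1}.
    let l : Fin (r + 1) := ⟨r - m, by omega⟩
    obtain ⟨i, hi, hai⟩ := hav.2.1 l
    have h1 := (hav.degree_le_iff (chipDiv_mono wt v u) (chipDiv_zero wt v u) (hH v) (hr v) i l).1
      hai.ge
    have hij : i ≤ j := by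
      by_contra hij
      have := finrank_sectionsVanishing_anti (D := D v + X₀.nodeDiv v (w.coef (fun x => c v x) v))
        (V := H v) (chipDiv_mono wt v u) (show j + 1 ≤ i by omega)
      simp only [l] at h1 this
      omega
    have h2 := hcond v u h l i hi hai
    rw [hau.degree_le_iff (chipDiv_mono wt u v) (chipDiv_zero wt u v) (hH u) (hr u)] at h2
    have h3 := finrank_sectionsVanishing_anti (D := D u + X₀.nodeDiv u (w.coef (fun x => c u x) u))
        (V := H u) (chipDiv_mono wt u v) (show gap wt v u - j ≤ gap wt v u - i by omega)
    simp only [l, Fin.val_rev] at h2 h3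
    omega
  · intro hcond
    have hex : ∀ v u, ∃ a : Fin (r + 1) → ℤ, X₀.G.bar.Adj v u → IsMultivanishing
        (D v + X₀.nodeDiv v (w.coef (fun x => c v x) v)) (H v) (chipDiv wt v u) a := by
      intro v u
      by_cases h : X₀.G.bar.Adj v u
      · obtain ⟨a, ha⟩ := exists_isMultivanishing (chipDiv_mono wt v u) (chipDiv_zero wt v u) (hH v)
          (hr v) (hbot v u h)
        exact ⟨a, fun _ => ha⟩
      · exact ⟨0, fun h' => absurd h' h⟩
    choose a ha using hex
    refine ⟨a, ha, fun v u h l j hj hal => ?_⟩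
    have hav := ha v u h
    have hau := ha u v h.symm
    have hgap := hc.gap_eq v u h
    rw [hau.degree_le_iff (chipDiv_mono wt u v) (chipDiv_zero wt u v) (hH u) (hr u)]
    have h1 : ¬ (chipDiv wt v u (j + 1)).degree ≤ a v u l := by
      rw [hal, not_le]
      exact degree_lt_of_isCritical (chipDiv_mono wt v u) hj (Nat.lt_add_one j)
    rw [hav.degree_le_iff (chipDiv_mono wt v u) (chipDiv_zero wt v u) (hH v) (hr v)] at h1
    rcases le_or_gt j (gap wt v u) with hjb | hjb
    · have h2 := hcond v u h (c v v - c v u + j)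
      have e1 : c v v - c v u + (j : ℤ) + 1 = c v v - c v u + ((j + 1 : ℕ) : ℤ) := by
        push_cast; ring
      have e2 : -(c v v - c v u + (j : ℤ)) = c u u - c u v + ((gap wt v u - j : ℕ) : ℤ) := by
        rw [Nat.cast_sub hjb]; omega
      rw [e1, e2, ← hsv v u h, ← hsv u v h.symm] at h2
      rw [Fin.val_rev]
      omega
    -- For `j` beyond the gap the truncated difference is 0, and D_0 = 0 imposes nothing.
    · rw [Nat.sub_eq_zero_of_le hjb.le, chipDiv_zero, sectionsVanishing_zero (hH u), hr]
      omega

end PreLimit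

end NodalCurve
namespace NodalCurve

variable {κ : Type u} [Field κ] {X₀ : NodalCurve κ} {n : X₀.G.E → ℕ+}

open Multigraph AdmMultideg TropFunction

/-! ### From the rank condition to the conditions at the edges -/

section Necessity

variable {w : AdmMultideg X₀.G n} {wt : X₀.G.V → AdmMultideg X₀.G n}
  {c : X₀.G.V → X₀.G.V → ℤ} {r : ℕ} {D : ∀ v, (X₀.Z v).Div} {H : ∀ v, Submodule κ (X₀.Z v).K}

/-- Effectivity inside the edges bounds the slopes of `f` at `v` by the coefficients of the real
potential formed by its vertex values, so `f.part v` is a section of the corresponding sheaf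
vanishing along `E`. -/
lemma ord_part_nonneg {E : ComplexDiv X₀ n} (hE : 0 ≤ E)
    {f : ComplexFunction X₀ n} (hf : ∀ x, 0 ≤ ComplexDiv.ofMultideg w D x + f.ord x - E x)
    (v : X₀.G.V) (P : (X₀.Z v).Pt) :
    0 ≤ (X₀.Z v).ord P (f.part v) +
      (D v + X₀.nodeDiv v (w.coef f.graphPart.vert v)) P - ComplexDiv.part E v P := by
  have h1 := hf (Sum.inl ⟨v, P⟩)
  rw [← ComplexDiv.part_apply, ComplexDiv.part_ofMultideg, ← ComplexDiv.part_apply] at h1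
  have h1 : 0 ≤ D v P + ((X₀.Z v).ord P (f.part v) + X₀.nodeDiv v (f.graphPart.slope v) P) -
    ComplexDiv.part E v P := h1
  have h2 : X₀.nodeDiv v (f.graphPart.slope v) ≤
      X₀.nodeDiv v (w.coef f.graphPart.vert v) := by
    refine nodeDiv_mono fun e he => f.graphPart.slope_le_drop w he fun t h0 ht => ?_
    have h3 := hf (Sum.inr ⟨e, t, h0, ht⟩)
    have h4 : 0 ≤ E (Sum.inr ⟨e, t, h0, ht⟩) := hE _
    rw [← ComplexDiv.edgePart_apply (ComplexDiv.ofMultideg w D), ComplexDiv.ofMultideg,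
      ComplexDiv.edgePart_ofParts, chipPart_apply] at h3
    change 0 ≤ (if t = ((w.μ e).val : ℝ) then 1 else 0) + f.graphPart.ordAt e t - _ at h3
    omega
  have h3 := h2 P
  rw [Finsupp.add_apply]
  omega

lemma exists_of_degree_eq {E : ∀ v, (X₀.Z v).Div} (hE : ∀ v, 0 ≤ E v)
    (hr : ∑ v, (E v).degree = r) (h : r ∈ rankSet (ComplexDiv.ofMultideg w D) H) :
    ∃ (E' : ComplexDiv X₀ n) (f : ComplexFunction X₀ n), 0 ≤ E' ∧
      (∀ v, ComplexDiv.part E' v = E v) ∧ (∀ v, f.part v ∈ H v) ∧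
      ∀ x, 0 ≤ ComplexDiv.ofMultideg w D x + f.ord x - E' x := by
  have hE0 : 0 ≤ (ComplexDiv.ofParts E 0 : ComplexDiv X₀ n) := by
    rintro (⟨v, P⟩ | ⟨e, t⟩)
    · rw [← ComplexDiv.part_apply (ComplexDiv.ofParts E 0), ComplexDiv.part_ofParts]
      exact hE v P
    · rw [← ComplexDiv.edgePart_apply (ComplexDiv.ofParts E 0), ComplexDiv.edgePart_ofParts]
      exact le_rfl
  obtain ⟨f, hf, hf'⟩ := h (ComplexDiv.ofParts E 0) hE0 (by
    rw [ComplexDiv.degree_eq]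
    simp only [ComplexDiv.part_ofParts, ComplexDiv.edgePart_ofParts, Pi.zero_apply, map_zero,
      Finset.sum_const_zero, add_zero]
    exact hr)
  exact ⟨_, f, hE0, ComplexDiv.part_ofParts _ _, hf, hf'⟩

variable [IsAlgClosed κ]

/-- A sheaf with a nonzero section has nonnegative degree. This supplies the hypothesis of the
maximum principle for the vertex values of `f`. -/
lemma degAt_vert_nonneg (hD : ∀ v, (D v).degree = w.wG v) {E : ComplexDiv X₀ n} (hE : 0 ≤ E)
    {f : ComplexFunction X₀ n} (hf : ∀ x, 0 ≤ ComplexDiv.ofMultideg w D x + f.ord x - E x)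
    (u : X₀.G.V) : 0 ≤ w.degAt f.graphPart.vert u := by
  have h1 : 0 ≤ (X₀.Z u).div (f.part u) + (D u + X₀.nodeDiv u (w.coef f.graphPart.vert u)) := by
    intro P
    have h2 := ord_part_nonneg hE hf u P
    have h3 : 0 ≤ ComplexDiv.part E u P := hE _
    rw [Finsupp.add_apply, SmoothCurve.div_apply]
    simp only [Finsupp.coe_zero, Pi.zero_apply]
    omega
  have h2 := degree_mono h1
  rw [map_zero, map_add, (X₀.Z u).degree_div (f.part_ne_zero u), map_add, degree_nodeDiv, hD,
    zero_add] at h2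
  exact h2

lemma sub_le_vert_sub (hc : TightPotentials w wt c) (hD : ∀ v, (D v).degree = w.wG v)
    {E : ComplexDiv X₀ n} (hE : 0 ≤ E) {f : ComplexFunction X₀ n}
    (hf : ∀ x, 0 ≤ ComplexDiv.ofMultideg w D x + f.ord x - E x) (v x : X₀.G.V) :
    (c v v : ℝ) - c v x ≤ f.graphPart.vert v - f.graphPart.vert x :=
  (hc.unfireable v).sub_le_sub (fun u _ => degAt_vert_nonneg hD hE hf u) x

lemma ord_part_nonneg_edgeDiv (hc : TightPotentials w wt c) (hD : ∀ v, (D v).degree = w.wG v)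
    {E : ComplexDiv X₀ n} (hE : 0 ≤ E) {f : ComplexFunction X₀ n}
    (hf : ∀ x, 0 ≤ ComplexDiv.ofMultideg w D x + f.ord x - E x) {v u : X₀.G.V} (huv : v ≠ u)
    {s : ℝ} (hs : ∀ e, w.drop e v (f.graphPart.vert v - f.graphPart.vert u) ≤ w.drop e v s)
    (P : (X₀.Z v).Pt) : 0 ≤ (X₀.Z v).ord P (f.part v) + (D v + edgeDiv w (c v) v u s) P -
      ComplexDiv.part E v P := by
  have h1 := ord_part_nonneg hE hf v P
  have h2 : X₀.nodeDiv v (w.coef f.graphPart.vert v) ≤ edgeDiv w (c v) v u s := by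
    refine nodeDiv_mono fun e he => ?_
    split_ifs with h
    · rw [coef, ((mem_edgesOver_iff huv).1 h).2]
      exact hs e
    · exact w.drop_anti e v (sub_le_vert_sub hc hD hE hf v _)
  have h3 := h2 P
  rw [Finsupp.add_apply] at h1 ⊢
  omega

/-- Otherwise a general divisor of degree `r` on Z_v would exclude every candidate for `f.part v`.
When `H v` has dimension `r + 1`, this forces all of it to consist of sections. -/
lemma lt_finrank_of_mem_rankSet (hc : TightPotentials w wt c) (hD : ∀ v, (D v).degree = w.wG v)
    [∀ v, FiniteDimensional κ (H v)] (h : r ∈ rankSet (ComplexDiv.ofMultideg w D) H) (v : X₀.G.V) :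
    r < Module.finrank κ
      ↥(H v ⊓ (X₀.Z v).H0 (D v + X₀.nodeDiv v (w.coef (fun x => c v x) v))) := by
  by_contra hcon
  obtain ⟨E, hE0, hEd, hE⟩ := (X₀.Z v).exists_general_divisor (H v) _ (not_lt.1 hcon)
  obtain ⟨E', f, hE', hpart, hfH, hf⟩ := exists_of_degree_eq (w := w) (D := D) (H := H) (r := r)
    (E := Pi.single v E) (fun u => by
      by_cases hu : u = v
      · subst hu; rwa [Pi.single_eq_same]
      · rw [Pi.single_eq_of_ne hu])
    (by
      rw [Finset.sum_eq_single v, Pi.single_eq_same, hEd]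
      · intro u _ hu
        rw [Pi.single_eq_of_ne hu, map_zero]
      · simp) h
  obtain ⟨P, hP⟩ := hE _ (hfH v) (f.part_ne_zero v)
  have h1 := ord_part_nonneg hE' hf v P
  rw [hpart, Pi.single_eq_same] at h1
  have h2 : X₀.nodeDiv v (w.coef f.graphPart.vert v) ≤
      X₀.nodeDiv v (w.coef (fun x => c v x) v) :=
    nodeDiv_mono fun e he => w.drop_anti e v (sub_le_vert_sub hc hD hE' hf v _)
  have h3 := h2 P
  rw [Finsupp.add_apply] at h1 hP
  omega

lemma le_of_mem_rankSet (hc : TightPotentials w wt c) (hD : ∀ v, (D v).degree = w.wG v)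
    {v : X₀.G.V} (hr : ∀ v, Module.finrank κ (H v) = r + 1) {r' : ℕ}
    (h : r' ∈ rankSet (ComplexDiv.ofMultideg w D) H) : r' ≤ r := by
  have : ∀ v, FiniteDimensional κ (H v) := fun v =>
    Module.finite_of_finrank_pos (by rw [hr]; omega)
  have h1 := lt_finrank_of_mem_rankSet hc hD h v
  have h2 := Submodule.finrank_mono (inf_le_left : H v ⊓ (X₀.Z v).H0
    (D v + X₀.nodeDiv v (w.coef (fun x => c v x) v)) ≤ H v)
  rw [hr] at h2
  omega

lemma le_H0_of_mem_rankSet (hc : TightPotentials w wt c) (hD : ∀ v, (D v).degree = w.wG v)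
    (hr : ∀ v, Module.finrank κ (H v) = r + 1)
    (h : r ∈ rankSet (ComplexDiv.ofMultideg w D) H) (v : X₀.G.V) :
    H v ≤ (X₀.Z v).H0 (D v + X₀.nodeDiv v (w.coef (fun x => c v x) v)) := by
  have : ∀ v, FiniteDimensional κ (H v) := fun v =>
    Module.finite_of_finrank_pos (by rw [hr]; omega)
  have h1 := lt_finrank_of_mem_rankSet hc hD h v
  rw [← inf_eq_left]
  refine Submodule.eq_of_le_of_finrank_le inf_le_left ?_
  rw [hr]
  exact h1

lemma edgeCondition_of_mem_rankSet (hc : TightPotentials w wt c)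
    (hD : ∀ v, (D v).degree = w.wG v) (hr : ∀ v, Module.finrank κ (H v) = r + 1)
    (h : r ∈ rankSet (ComplexDiv.ofMultideg w D) H) : EdgeCondition w c r D H := by
  have : ∀ v, FiniteDimensional κ (H v) := fun v =>
    Module.finite_of_finrank_pos (by rw [hr]; omega)
  intro v u hvu s
  by_contra hcon
  -- If the inequality fails, the `r` points can be distributed over Z_v and Z_u so as to exclude
  -- all sections of both spaces.
  obtain ⟨E₁, hE₁, hd₁, hg₁⟩ := (X₀.Z v).exists_general_divisor (H v)
    (D v + edgeDiv w (c v) v u ((s + 1 : ℤ) : ℝ)) le_rfl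
  obtain ⟨E₂, hE₂, hd₂, hg₂⟩ := (X₀.Z u).exists_general_divisor (H u)
    (D u + edgeDiv w (c u) u v ((-s : ℤ) : ℝ)) (m := r - Module.finrank κ
      ↥(H v ⊓ (X₀.Z v).H0 (D v + edgeDiv w (c v) v u ((s + 1 : ℤ) : ℝ)))) (by omega)
  have hne : u ≠ v := hvu.ne'
  obtain ⟨E', f, hE', hpart, hfH, hf⟩ := exists_of_degree_eq (w := w) (D := D) (H := H) (r := r)
    (E := Pi.single v E₁ + Pi.single u E₂) (fun x => by
      refine add_nonneg ?_ ?_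
      · by_cases hx : x = v
        · subst hx; rwa [Pi.single_eq_same]
        · rw [Pi.single_eq_of_ne hx]
      · by_cases hx : x = u
        · subst hx; rwa [Pi.single_eq_same]
        · rw [Pi.single_eq_of_ne hx])
    (by
      simp only [Pi.add_apply, map_add]
      rw [Finset.sum_add_distrib, Finset.sum_eq_single v, Finset.sum_eq_single u,
        Pi.single_eq_same, Pi.single_eq_same, hd₁, hd₂]
      · push_cast [Nat.cast_sub (show Module.finrank κ ↥(H v ⊓ (X₀.Z v).H0
          (D v + edgeDiv w (c v) v u ((s + 1 : ℤ) : ℝ))) ≤ r by omega)]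
        ring
      · intro x _ hx
        rw [Pi.single_eq_of_ne hx, map_zero]
      · simp
      · intro x _ hx
        rw [Pi.single_eq_of_ne hx, map_zero]
      · simp) h
  -- A drop of more than `s` counts as at least `s + 1` and puts the section at `v` in the excluded
  -- space; a drop of at most `s` does so at `u`.
  rcases lt_or_ge (s : ℝ) (f.graphPart.vert v - f.graphPart.vert u) with ht | ht
  · obtain ⟨P, hP⟩ := hg₁ _ (hfH v) (f.part_ne_zero v)
    have h1 := ord_part_nonneg_edgeDiv hc hD hE' hf hvu.ne (s := ((s + 1 : ℤ) : ℝ))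
      (fun e => by push_cast; exact w.drop_le_of_lt e v ht) P
    rw [hpart, Pi.add_apply, Pi.single_eq_same, Pi.single_eq_of_ne hvu.ne, add_zero] at h1
    omega
  · obtain ⟨P, hP⟩ := hg₂ _ (hfH u) (f.part_ne_zero u)
    have h1 := ord_part_nonneg_edgeDiv hc hD hE' hf hvu.ne' (s := ((-s : ℤ) : ℝ))
      (fun e => w.drop_anti e u (by push_cast; linarith)) P
    rw [hpart, Pi.add_apply, Pi.single_eq_same, Pi.single_eq_of_ne hne, zero_add] at h1
    omega

end Necessity

end NodalCurve
-- Distribution of weights over the branches of the tree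
namespace Multigraph

variable {G : Multigraph}

/-- The total weight of the vertices and edges beyond `v` in the direction of its neighbour `u`,
for weights `a` on the vertices and `b` on the edges. -/
def weightBeyond (a : G.V → ℤ) (b : G.E → ℤ) (v u : G.V) : ℤ :=
  (∑ x, if x ∈ branch G.bar u v then a x else 0) +
    ∑ e, if G.tail e ∈ branch G.bar u v ∨ G.head e ∈ branch G.bar u v then b e else 0

/-- Each vertex lies on exactly one side, whereas the edges over {v, u} themselves are counted from
both. -/
lemma weightBeyond_add (hG : G.IsMultitree) (a : G.V → ℤ) (b : G.E → ℤ) {v u : G.V}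
    (h : G.bar.Adj v u) : weightBeyond a b v u + weightBeyond a b u v =
      ∑ x, a x + ∑ e, b e + ∑ e ∈ G.edgesOver v u, b e := by
  have h1 : (∑ x, if x ∈ branch G.bar u v then a x else 0) +
      (∑ x, if x ∈ branch G.bar v u then a x else 0) = ∑ x, a x := by
    rw [← Finset.sum_add_distrib]
    refine Finset.sum_congr rfl fun x _ => ?_
    rw [mem_branch_iff_not hG h x]
    split_ifs <;> simp_all
  have h2 : (∑ e, if G.tail e ∈ branch G.bar u v ∨ G.head e ∈ branch G.bar u v then b e else 0) +
      (∑ e, if G.tail e ∈ branch G.bar v u ∨ G.head e ∈ branch G.bar v u then b e else 0) =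
      ∑ e, b e + ∑ e ∈ G.edgesOver v u, b e := by
    rw [edgesOver, Finset.sum_filter, ← Finset.sum_add_distrib, ← Finset.sum_add_distrib]
    refine Finset.sum_congr rfl fun e _ => ?_
    rw [mem_branch_iff_not hG h, mem_branch_iff_not hG h]
    have b1 := self_mem_branch (H := G.bar) v u
    have b2 := not_mem_branch hG h
    by_cases he : G.Inc e v ∧ G.Inc e u
    · rw [if_pos he]
      obtain ⟨rfl | rfl, h3⟩ := he
      · have := eq_other h3 (inc_tail e) h.ne'
        rw [other_tail] at this
        subst this
        simp [b1, b2]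
      · have := eq_other h3 (inc_head e) h.ne'
        rw [other_head] at this
        subst this
        simp [b1, b2]
    · rw [if_neg he, add_zero]
      have hadj : G.bar.Adj (G.tail e) (G.head e) := ⟨G.loopless e, e, inc_tail e, inc_head e⟩
      have hs : s(G.tail e, G.head e) ≠ s(v, u) := by
        intro hs
        rcases Sym2.eq_iff.1 hs with ⟨rfl, rfl⟩ | ⟨rfl, rfl⟩
        · exact he ⟨inc_tail e, inc_head e⟩
        · exact he ⟨inc_head e, inc_tail e⟩
      rw [mem_branch_iff_of_adj hadj hs]
      by_cases hh : G.head e ∈ branch G.bar v u <;> simp [hh]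
  rw [weightBeyond, weightBeyond]
  linarith

lemma weightBeyond_nonneg {a : G.V → ℤ} {b : G.E → ℤ} (ha : ∀ x, 0 ≤ a x) (hb : ∀ e, 0 ≤ b e)
    (v u : G.V) : 0 ≤ weightBeyond a b v u := by
  refine add_nonneg (Finset.sum_nonneg fun x _ => ?_) (Finset.sum_nonneg fun e _ => ?_)
  · split_ifs
    exacts [ha x, le_rfl]
  · split_ifs
    exacts [hb e, le_rfl]

lemma sum_ite_le_of_subsingleton {ι : Type*} (S : Finset ι) (p : ι → Prop) [DecidablePred p] {z : ℤ} (hz : 0 ≤ z)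
    (h : ∀ i ∈ S, ∀ j ∈ S, p i → p j → i = j) : ∑ i ∈ S, (if p i then z else 0) ≤ z := by
  by_cases hex : ∃ i ∈ S, p i
  · obtain ⟨i, hi, hpi⟩ := hex
    rw [Finset.sum_eq_single_of_mem i hi, if_pos hpi]
    intro j hj hne
    rw [if_neg fun hpj => hne (h j hj i hi hpj hpi)]
  · push Not at hex
    rw [Finset.sum_eq_zero fun i hi => if_neg (hex i hi)]
    exact hz

/-- The branches at `v` are pairwise disjoint, and no edge of G meets two of them. -/
lemma sum_weightBeyond_add_le (hG : G.IsMultitree) {a : G.V → ℤ} {b : G.E → ℤ}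
    (ha : ∀ x, 0 ≤ a x) (hb : ∀ e, 0 ≤ b e) (v : G.V) :
    ∑ u ∈ Finset.univ.filter (fun u => G.bar.Adj v u), weightBeyond a b v u + a v ≤
      ∑ x, a x + ∑ e, b e := by
  have huniq : ∀ u u' x, G.bar.Adj v u → G.bar.Adj v u' → x ∈ branch G.bar u v →
      x ∈ branch G.bar u' v → u = u' := fun u u' x h h' hx hx' =>
    by_contra fun hne => not_mem_branch_of_mem_branch hG h h' hne hx hx'
  have hcross : ∀ u u' x y, G.bar.Adj v u → G.bar.Adj v u' → G.bar.Adj x y →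
      x ∈ branch G.bar u v → y ∈ branch G.bar u' v → u = u' := by
    intro u u' x y h h' hxy hx hy
    by_cases hy' : y ∈ branch G.bar u v
    · exact huniq u u' y h h' hy' hy
    · have := (eq_of_adj_branch hG h.symm hx hy' hxy).2
      rw [this] at hy
      exact absurd hy (not_mem_branch hG h'.symm)
  simp only [weightBeyond, Finset.sum_add_distrib]
  rw [Finset.sum_comm, Finset.sum_comm (s := Finset.univ.filter (fun u => G.bar.Adj v u))
    (t := (Finset.univ : Finset G.E))]
  have h1 : ∑ x, ((∑ u ∈ Finset.univ.filter (fun u => G.bar.Adj v u),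
      if x ∈ branch G.bar u v then a x else 0) + if x = v then a x else 0) ≤ ∑ x, a x := by
    refine Finset.sum_le_sum fun x _ => ?_
    by_cases hx : x = v
    · subst hx
      rw [Finset.sum_eq_zero, if_pos rfl, zero_add]
      intro u hu
      rw [if_neg (not_mem_branch hG (Finset.mem_filter.1 hu).2.symm)]
    · rw [if_neg hx, add_zero]
      refine sum_ite_le_of_subsingleton _ _ (ha x) fun u hu u' hu' h h' => ?_
      exact huniq u u' x (Finset.mem_filter.1 hu).2 (Finset.mem_filter.1 hu').2 h h'
  have h2 : ∑ e, (∑ u ∈ Finset.univ.filter (fun u => G.bar.Adj v u),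
      if G.tail e ∈ branch G.bar u v ∨ G.head e ∈ branch G.bar u v then b e else 0) ≤
      ∑ e, b e := by
    refine Finset.sum_le_sum fun e _ => ?_
    refine sum_ite_le_of_subsingleton _ _ (hb e) fun u hu u' hu' h h' => ?_
    have hadj : G.bar.Adj (G.tail e) (G.head e) := ⟨G.loopless e, e, inc_tail e, inc_head e⟩
    have hu := (Finset.mem_filter.1 hu).2
    have hu' := (Finset.mem_filter.1 hu').2
    rcases h with h | h <;> rcases h' with h' | h'
    · exact huniq u u' _ hu hu' h h'
    · exact hcross u u' _ _ hu hu' hadj h h'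
    · exact hcross u u' _ _ hu hu' hadj.symm h h'
    · exact huniq u u' _ hu hu' h h'
  rw [Finset.sum_add_distrib, Finset.sum_ite_eq', if_pos (Finset.mem_univ v)] at h1
  linarith

end Multigraph

/-- The codimension of an intersection is at most the sum of the codimensions. -/
lemma finrank_le_finrank_iInf_add {K M ι : Type*} [Field K] [AddCommGroup M] [Module K M]
    (S : Finset ι) (H : Submodule K M) [FiniteDimensional K H] (A : ι → Submodule K M) :
    (Module.finrank K H : ℤ) ≤ Module.finrank K ↥(H ⊓ ⨅ i ∈ S, A i) +
      ∑ i ∈ S, ((Module.finrank K H : ℤ) - Module.finrank K ↥(H ⊓ A i)) := by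
  induction S using Finset.induction_on with
  | empty =>
    have : (⨅ i ∈ (∅ : Finset ι), A i) = ⊤ := by simp
    rw [this, inf_top_eq, Finset.sum_empty, add_zero]
  | insert a S ha ih =>
    have hfd : ∀ B : Submodule K M, FiniteDimensional K ↥(H ⊓ B) := fun B =>
      Submodule.finiteDimensional_of_le inf_le_left
    rw [Finset.sum_insert ha, Finset.iInf_insert]
    have h1 := Submodule.finrank_sup_add_finrank_inf_eq (H ⊓ A a) (H ⊓ ⨅ i ∈ S, A i)
    rw [← inf_inf_distrib_left] at h1
    have h2 : Module.finrank K ↥(H ⊓ A a ⊔ H ⊓ ⨅ i ∈ S, A i) ≤ Module.finrank K H :=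
      Submodule.finrank_mono (sup_le inf_le_left inf_le_left)
    omega

lemma ceil_floor_add_one (n : ℕ+) (m : ℤ) (t : ℝ) :
    ⌈((m : ℝ) + (⌊t⌋ + 1)) / (n : ℕ)⌉ = ⌊((m : ℝ) + t) / (n : ℕ)⌋ + 1 := by
  have hn : (0 : ℝ) < (n : ℕ) := by exact_mod_cast n.pos
  refine eq_of_forall_ge_iff fun k => ?_
  rw [ceil_div_le_iff, Int.add_one_le_iff, Int.floor_lt, div_lt_iff₀ hn]
  have h1 : (m : ℝ) + (⌊t⌋ + 1) ≤ k * (n : ℕ) ↔ ⌊t⌋ < k * (n : ℕ) - m := by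
    rw [← Int.add_one_le_iff, ← Int.cast_le (R := ℝ)]
    push_cast
    constructor <;> intro h <;> linarith
  rw [h1, Int.floor_lt]
  push_cast
  constructor <;> intro h <;> linarith

namespace NodalCurve

variable {κ : Type u} [Field κ] {X₀ : NodalCurve κ} {n : X₀.G.E → ℕ+}

open Multigraph AdmMultideg TropFunction

/-! ### From the conditions at the edges to the rank condition -/

lemma degree_nonneg {α : Type*} {D : α →₀ ℤ} (h : 0 ≤ D) : 0 ≤ D.degree :=
  Finset.sum_nonneg fun i _ => h i

/-- The variant of `edgeDiv` with differences of potentials depending on the edges. -/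
def shiftDiv (w : AdmMultideg X₀.G n) (c : X₀.G.V → ℤ) (v u : X₀.G.V) (x : X₀.G.E → ℝ) (t : ℝ) :
    (X₀.Z v).Div :=
  X₀.nodeDiv v fun e => if e ∈ X₀.G.edgesOver v u then w.drop e v (t + x e) else
    w.coef (fun x => c x) v e

lemma shiftDiv_le_edgeDiv (w : AdmMultideg X₀.G n) (c : X₀.G.V → ℤ) (v u : X₀.G.V)
    {x : X₀.G.E → ℝ} (hx : ∀ e, 0 ≤ x e) (t : ℝ) :
    shiftDiv w c v u x t ≤ edgeDiv w c v u t := by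
  refine nodeDiv_mono fun e _ => ?_
  split_ifs
  · exact w.drop_anti e v (le_add_of_nonneg_right (hx e))
  · exact le_rfl

variable [IsAlgClosed κ] {w : AdmMultideg X₀.G n} {c : X₀.G.V → X₀.G.V → ℤ} {r : ℕ}
  {D : ∀ v, (X₀.Z v).Div} {H : ∀ v, Submodule κ (X₀.Z v).K}

/-- The difference `t` is the largest at which at least `α` dimensions survive at `v`. Just beyond
it fewer than `α` survive, and the edge condition at the integral part of `t` then bounds the
dimension at `u` from below. The shifts `x`, `x'`, caused by points of `E` inside the edges, cost `k
e` dimensions altogether for each edge. -/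
lemma EdgeCondition.exists_split (h : EdgeCondition w c r D H)
    (hH : ∀ v, H v ≤ (X₀.Z v).H0 (D v + X₀.nodeDiv v (w.coef (fun x => c v x) v)))
    (hr : ∀ v, Module.finrank κ (H v) = r + 1) {v u : X₀.G.V} (hvu : X₀.G.bar.Adj v u)
    {x x' : X₀.G.E → ℝ} {k : X₀.G.E → ℤ} (hx : ∀ e, 0 ≤ x e) (hx' : ∀ e, 0 ≤ x' e)
    (hxx' : ∀ e ∈ X₀.G.edgesOver v u, x e + x' e = k e * (n e : ℕ)) {α : ℕ} (hα : 1 ≤ α)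
    (hα' : α ≤ r + 1) :
    ∃ t : ℝ, α ≤ Module.finrank κ ↥(H v ⊓ (X₀.Z v).H0 (D v + shiftDiv w (c v) v u x t)) ∧
      (r + 2 : ℤ) ≤ α + ∑ e ∈ X₀.G.edgesOver v u, k e +
        Module.finrank κ ↥(H u ⊓ (X₀.Z u).H0 (D u + shiftDiv w (c u) u v x' (-t))) := by
  have hfd : ∀ v, FiniteDimensional κ (H v) := fun v =>
    Module.finite_of_finrank_pos (by rw [hr]; omega)
  have hfdi : ∀ v (B : Submodule κ (X₀.Z v).K), FiniteDimensional κ ↥(H v ⊓ B) := fun v B =>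
    Submodule.finiteDimensional_of_le inf_le_left
  have hn : ∀ e, (0 : ℝ) < (n e : ℕ) := fun e => by exact_mod_cast (n e).pos
  let S : Set ℝ :=
    {t | α ≤ Module.finrank κ ↥(H v ⊓ (X₀.Z v).H0 (D v + shiftDiv w (c v) v u x t))}
  have hSne : S.Nonempty := by
    refine ⟨c v v - c v u - ∑ e, |x e|, ?_⟩
    show α ≤ _
    rw [inf_eq_left.2, hr]
    · exact hα'
    · refine (hH v).trans ((X₀.Z v).H0_mono (add_le_add_right (nodeDiv_mono fun e _ => ?_) _))
      split_ifs with he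
      · rw [coef, ((mem_edgesOver_iff hvu.ne).1 he).2]
        refine w.drop_anti e v ?_
        have h1 := Finset.single_le_sum (f := fun e => |x e|) (fun _ _ => abs_nonneg _)
          (Finset.mem_univ e)
        have h2 := le_abs_self (x e)
        linarith
      · exact le_rfl
  have hSbd : BddAbove S := by
    obtain ⟨s, hs⟩ := edgeDiv_unbounded w (c v) hvu (-(D v).degree)
    refine ⟨s, fun t ht => ?_⟩
    by_contra hcon
    have h1 := degree_mono (shiftDiv_le_edgeDiv w (c v) v u hx t)
    have h2 := hs t (not_le.1 hcon).le
    have ht : α ≤ Module.finrank κ ↥(H v ⊓ (X₀.Z v).H0 (D v + shiftDiv w (c v) v u x t)) := ht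
    rw [SmoothCurve.H0_eq_bot_of_degree_neg _ (by rw [map_add]; omega), inf_bot_eq,
      finrank_bot] at ht
    omega
  obtain ⟨T, hT⟩ : ∃ T, T = sSup S := ⟨_, rfl⟩
  have hcont : ∀ e, Tendsto (fun t => ((w.lift e v : ℝ) + (t + x e)) / (n e : ℕ)) (𝓝 T)
      (𝓝 (((w.lift e v : ℝ) + (T + x e)) / (n e : ℕ))) := fun e => by
    have : Continuous fun t => ((w.lift e v : ℝ) + (t + x e)) / (n e : ℕ) := by fun_prop
    exact this.tendsto T
  -- Ceilings are lower semicontinuous, so the supremum is attained.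
  have hleft : ∀ᶠ t in 𝓝 T, ∀ e, w.drop e v (t + x e) ≤ w.drop e v (T + x e) := by
    refine eventually_all.2 fun e => ?_
    have h1 : ((⌈((w.lift e v : ℝ) + (T + x e)) / (n e : ℕ)⌉ - 1 : ℤ) : ℝ) <
        ((w.lift e v : ℝ) + (T + x e)) / (n e : ℕ) := Int.lt_ceil.1 (by omega)
    filter_upwards [(hcont e).eventually (lt_mem_nhds h1)] with t ht
    have := Int.lt_ceil.2 ht
    rw [drop, drop]
    omega
  -- The limits of the coefficients from the right at `T`, where fewer than `α` dimensions survive.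
  let p : X₀.G.E → ℤ := fun e => ⌈(w.lift e v : ℝ) / (n e : ℕ)⌉ -
    ⌊((w.lift e v : ℝ) + T + x e) / (n e : ℕ)⌋ - 1
  have hright : ∀ᶠ t in 𝓝 T, ∀ e, p e ≤ w.drop e v (t + x e) := by
    refine eventually_all.2 fun e => ?_
    have h1 := Int.lt_floor_add_one (((w.lift e v : ℝ) + (T + x e)) / (n e : ℕ))
    filter_upwards [(hcont e).eventually (gt_mem_nhds h1)] with t ht
    have : ⌈((w.lift e v : ℝ) + (t + x e)) / (n e : ℕ)⌉ ≤
        ⌊((w.lift e v : ℝ) + (T + x e)) / (n e : ℕ)⌋ + 1 :=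
      Int.ceil_le.2 (by push_cast; exact ht.le)
    simp only [p]
    rw [drop, add_assoc (w.lift e v : ℝ)]
    omega
  have hFT : α ≤ Module.finrank κ ↥(H v ⊓ (X₀.Z v).H0 (D v + shiftDiv w (c v) v u x T)) := by
    obtain ⟨ε, hε, hball⟩ := Metric.eventually_nhds_iff.1 hleft
    obtain ⟨t, ht, htT⟩ := exists_lt_of_lt_csSup hSne (show T - ε < sSup S by linarith)
    have htle : t ≤ T := hT ▸ le_csSup hSbd ht
    have hd := hball (show dist t T < ε by
      rw [Real.dist_eq, abs_sub_comm, abs_of_nonneg (by linarith)]; linarith)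
    have ht : α ≤ Module.finrank κ ↥(H v ⊓ (X₀.Z v).H0 (D v + shiftDiv w (c v) v u x t)) := ht
    refine ht.trans (Submodule.finrank_mono (inf_le_inf_left _ ((X₀.Z v).H0_mono
      (add_le_add_right (nodeDiv_mono fun e _ => ?_) _))))
    split_ifs
    · exact hd e
    · exact le_rfl
  have hFR : Module.finrank κ ↥(H v ⊓ (X₀.Z v).H0 (D v + X₀.nodeDiv v
      fun e => if e ∈ X₀.G.edgesOver v u then p e else w.coef (fun x => c v x) v e)) < α := by
    obtain ⟨ε, hε, hball⟩ := Metric.eventually_nhds_iff.1 hright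
    have hd := hball (show dist (T + ε / 2) T < ε by
      rw [Real.dist_eq, add_sub_cancel_left, abs_of_nonneg (by linarith)]; linarith)
    have hnot : ¬ α ≤ Module.finrank κ
        ↥(H v ⊓ (X₀.Z v).H0 (D v + shiftDiv w (c v) v u x (T + ε / 2))) := fun hmem => by
      have : T + ε / 2 ≤ sSup S := le_csSup hSbd hmem
      linarith
    refine lt_of_le_of_lt (Submodule.finrank_mono (inf_le_inf_left _ ((X₀.Z v).H0_mono
      (add_le_add_right (nodeDiv_mono fun e _ => ?_) _)))) (not_le.1 hnot)
    split_ifs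
    · exact hd e
    · exact le_rfl
  refine ⟨T, hFT, ?_⟩
  have hstar := h v u hvu ⌊T⌋
  -- `a` is the degree lost at `v` between the integral difference ⌊T⌋ + 1 and the right limit at
  -- `T`, and `a'` the degree lost at `u` between -⌊T⌋ and the shifted -T. They add up to `k` on
  -- every edge over {v, u}, and each unit costs at most one dimension.
  let a : X₀.G.E → ℤ := fun e => if e ∈ X₀.G.edgesOver v u then
    ⌊((w.lift e v : ℝ) + T + x e) / (n e : ℕ)⌋ - ⌊((w.lift e v : ℝ) + T) / (n e : ℕ)⌋ else 0
  let a' : X₀.G.E → ℤ := fun e => if e ∈ X₀.G.edgesOver v u then k e - a e else 0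
  have ha0 : ∀ e, 0 ≤ a e := fun e => by
    simp only [a]
    split_ifs
    · refine sub_nonneg.2 (Int.floor_le_floor (div_le_div_of_nonneg_right ?_ (hn e).le))
      linarith [hx e]
    · exact le_rfl
  have ha'0 : ∀ e, 0 ≤ a' e := fun e => by
    simp only [a', a]
    split_ifs with he
    · have h1 : ((w.lift e v : ℝ) + T + x e) / (n e : ℕ) =
          ((w.lift e v : ℝ) + T - x' e) / (n e : ℕ) + k e := by
        have := hxx' e he
        rw [eq_sub_of_add_eq this]
        have := (hn e).ne'
        field_simp
        ring
      have h2 : ⌊((w.lift e v : ℝ) + T - x' e) / (n e : ℕ)⌋ ≤ ⌊((w.lift e v : ℝ) + T) / (n e : ℕ)⌋ :=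
        Int.floor_le_floor (div_le_div_of_nonneg_right (by linarith [hx' e]) (hn e).le)
      rw [h1, Int.floor_add_intCast]
      omega
    · exact le_rfl
  have hnd0 : ∀ {v : X₀.G.V} {b : X₀.G.E → ℤ}, (∀ e, 0 ≤ b e) → 0 ≤ X₀.nodeDiv v b := by
    intro v b hb
    rw [← nodeDiv_zero v]
    exact nodeDiv_mono fun e _ => hb e
  have hv := (X₀.Z v).finrank_inf_H0_le_add_degree (H v)
    (D v + edgeDiv w (c v) v u ((⌊T⌋ + 1 : ℤ) : ℝ)) (hnd0 (v := v) ha0)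
  have hu := (X₀.Z u).finrank_inf_H0_le_add_degree (H u)
    (D u + edgeDiv w (c u) u v ((-⌊T⌋ : ℤ) : ℝ)) (hnd0 (v := u) ha'0)
  have ev : D v + edgeDiv w (c v) v u ((⌊T⌋ + 1 : ℤ) : ℝ) - X₀.nodeDiv v a =
      D v + X₀.nodeDiv v
        fun e => if e ∈ X₀.G.edgesOver v u then p e else w.coef (fun x => c v x) v e := by
    rw [add_sub_assoc, edgeDiv, ← nodeDiv_sub]
    congr 1
    refine nodeDiv_congr fun e _ => ?_
    simp only [a, p]
    split_ifs
    · rw [drop]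
      push_cast
      rw [ceil_floor_add_one]
      ring
    · ring
  have eu : D u + edgeDiv w (c u) u v ((-⌊T⌋ : ℤ) : ℝ) - X₀.nodeDiv u a' =
      D u + shiftDiv w (c u) u v x' (-T) := by
    rw [add_sub_assoc, edgeDiv, ← nodeDiv_sub]
    congr 1
    refine nodeDiv_congr fun e _ => ?_
    simp only [a', a, edgesOver_comm u v]
    split_ifs with he
    · rw [← Int.ceil_neg, drop_ceil, drop, drop]
      have hl : w.lift e u = -w.lift e v := by
        have h1 := (mem_edgesOver_iff hvu.ne).1 he
        rw [lift, lift, ← h1.2, sgn_other h1.1]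
        ring
      have e1 : ((w.lift e u : ℝ) + (-T + x' e)) / (n e : ℕ) =
          -(((w.lift e v : ℝ) + T + x e) / (n e : ℕ)) + k e := by
        have := hxx' e he
        rw [eq_sub_of_add_eq' this, hl]
        have := (hn e).ne'
        field_simp
        push_cast
        ring
      have e2 : ((w.lift e u : ℝ) + -T) / (n e : ℕ) = -(((w.lift e v : ℝ) + T) / (n e : ℕ)) := by
        rw [hl]
        push_cast
        ring
      rw [e1, e2, Int.ceil_add_intCast, Int.ceil_neg, Int.ceil_neg]
      ring
    · ring
  rw [ev, degree_nodeDiv] at hv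
  rw [eu, degree_nodeDiv] at hu
  have hsum : ∑ e ∈ X₀.G.edgesAt v, a e + ∑ e ∈ X₀.G.edgesAt u, a' e =
      ∑ e ∈ X₀.G.edgesOver v u, k e := by
    have s1 : ∑ e ∈ X₀.G.edgesAt v, a e = ∑ e ∈ X₀.G.edgesOver v u, a e :=
      (Finset.sum_subset (fun e he => mem_edgesAt.2 (mem_edgesOver.1 he).1)
        fun e _ he => if_neg he).symm
    have s2 : ∑ e ∈ X₀.G.edgesAt u, a' e = ∑ e ∈ X₀.G.edgesOver v u, a' e :=
      (Finset.sum_subset (fun e he => mem_edgesAt.2 (mem_edgesOver.1 he).2)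
        fun e _ he => if_neg he).symm
    rw [s1, s2, ← Finset.sum_add_distrib]
    refine Finset.sum_congr rfl fun e he => ?_
    simp only [a']
    rw [if_pos he]
    ring
  omega

lemma EdgeCondition.mem_rankSet (hG : X₀.G.IsMultitree) (h : EdgeCondition w c r D H)
    (hH : ∀ v, H v ≤ (X₀.Z v).H0 (D v + X₀.nodeDiv v (w.coef (fun x => c v x) v)))
    (hr : ∀ v, Module.finrank κ (H v) = r + 1) :
    r ∈ rankSet (ComplexDiv.ofMultideg w D) H := by
  have hfd : ∀ v, FiniteDimensional κ (H v) := fun v =>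
    Module.finite_of_finrank_pos (by rw [hr]; omega)
  intro E hE hEd
  rw [ComplexDiv.degree_eq] at hEd
  have hEe : ∀ e, 0 ≤ ComplexDiv.edgePart E e := fun e t => hE _
  have hEv : ∀ v, 0 ≤ ComplexDiv.part E v := fun v P => hE _
  let b : X₀.G.E → ℤ := fun e => (ComplexDiv.edgePart E e).degree
  let a : X₀.G.V → ℤ := fun v => (ComplexDiv.part E v).degree
  have ha : ∀ v, 0 ≤ a v := fun v => degree_nonneg (hEv v)
  have hb : ∀ e, 0 ≤ b e := fun e => degree_nonneg (hEe e)
  let x : X₀.G.V → X₀.G.E → ℝ := fun v e => moment e (ComplexDiv.edgePart E e) v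
  have hx : ∀ v e, 0 ≤ x v e := fun v e => moment_nonneg e (hEe e) v
  let B : X₀.G.V → X₀.G.V → ℤ := weightBeyond a b
  have hB0 : ∀ v u, 0 ≤ B v u := weightBeyond_nonneg ha hb
  have hBsum : ∀ v, ∑ u ∈ Finset.univ.filter (fun u => X₀.G.bar.Adj v u), B v u + a v ≤ r :=
    fun v => hEd ▸ sum_weightBeyond_add_le hG ha hb v
  have hBr : ∀ v u, X₀.G.bar.Adj v u → B v u ≤ r := fun v u hvu => by
    have h1 := Finset.single_le_sum (f := B v)
      (s := Finset.univ.filter (fun u => X₀.G.bar.Adj v u)) (fun u _ => hB0 v u)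
      (Finset.mem_filter.2 ⟨Finset.mem_univ u, hvu⟩)
    have h2 := hBsum v
    have h3 := ha v
    omega
  -- At `v` the direction of `u` may cost at most as many dimensions as `E` has points beyond `v` in
  -- that direction, interior points of the joining edges included.
  let Good : X₀.G.V → X₀.G.V → ℝ → Prop := fun v u t => r + 1 - B v u ≤
    Module.finrank κ ↥(H v ⊓ (X₀.Z v).H0 (D v + shiftDiv w (c v) v u (x v) t))
  have hgood : ∀ v u, ∃ t, X₀.G.bar.Adj v u → Good v u t ∧ Good u v (-t) := by
    intro v u
    by_cases hvu : X₀.G.bar.Adj v u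
    · have h1 := hB0 v u
      have h2 := hBr v u hvu
      -- With `α = r + 1 - B v u`, the bound at `u` becomes `r + 1 - B u v` by `weightBeyond_add`:
      -- the double count of the edges over {v, u} is exactly the sum of the `k e`.
      obtain ⟨t, ht, ht'⟩ := h.exists_split hH hr hvu (x := x v) (x' := x u) (k := b) (hx v) (hx u)
        (fun e he => by
          obtain ⟨hev, ho⟩ := (mem_edgesOver_iff hvu.ne).1 he
          simp only [x, ← ho]
          exact moment_add_moment e _ hev) (α := (r + 1 - B v u).toNat) (by omega) (by omega)
      have h3 : B v u + B u v = _ := weightBeyond_add hG a b hvu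
      rw [hEd] at h3
      refine ⟨t, fun _ => ⟨?_, ?_⟩⟩
      · simp only [Good]
        omega
      · simp only [Good]
        omega
    · exact ⟨0, fun h' => absurd h' hvu⟩
  choose τ hτ using hgood
  let φ := Fintype.equivFin X₀.G.V
  let t : X₀.G.V → X₀.G.V → ℝ := fun v u => if φ v < φ u then τ v u else -τ u v
  have ht : ∀ v u, X₀.G.bar.Adj v u → Good v u (t v u) := by
    intro v u hvu
    simp only [t]
    split_ifs
    · exact (hτ v u hvu).1
    · exact (hτ u v hvu.symm).2
  obtain ⟨c', hc'⟩ := exists_potential hG t (fun v u hvu => by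
    simp only [t]
    rcases lt_trichotomy (φ v) (φ u) with h | h | h
    · rw [if_pos h, if_neg h.not_gt, neg_neg]
    · exact absurd (φ.injective h) hvu.ne
    · rw [if_neg h.not_gt, if_pos h])
  have hpart : ∀ v, ∃ f ∈ H v, f ≠ 0 ∧ f ∈ (X₀.Z v).H0 (D v +
      X₀.nodeDiv v (fun e => w.drop e v (c' v - c' (other e v) + x v e)) -
        ComplexDiv.part E v) := by
    intro v
    -- The costs in the different directions add up to at most the degree of `E` away from Z_v, so
    -- `W` has dimension greater than deg E_v and contains a nonzero section vanishing along E_v.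
    let W := H v ⊓ ⨅ u ∈ Finset.univ.filter (fun u => X₀.G.bar.Adj v u),
      (X₀.Z v).H0 (D v + shiftDiv w (c v) v u (x v) (t v u))
    have hWfd : FiniteDimensional κ W := Submodule.finiteDimensional_of_le (S₂ := H v) inf_le_left
    have h1 := finrank_le_finrank_iInf_add (Finset.univ.filter (fun u => X₀.G.bar.Adj v u)) (H v)
      fun u => (X₀.Z v).H0 (D v + shiftDiv w (c v) v u (x v) (t v u))
    have h2 : ∑ u ∈ Finset.univ.filter (fun u => X₀.G.bar.Adj v u), ((Module.finrank κ (H v) : ℤ) -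
        Module.finrank κ ↥(H v ⊓ (X₀.Z v).H0 (D v + shiftDiv w (c v) v u (x v) (t v u)))) ≤
        ∑ u ∈ Finset.univ.filter (fun u => X₀.G.bar.Adj v u), B v u := by
      refine Finset.sum_le_sum fun u hu => ?_
      have := ht v u (Finset.mem_filter.1 hu).2
      simp only [Good] at this
      rw [hr]
      push_cast
      omega
    have hWle : W ≤ (X₀.Z v).H0 (D v +
        X₀.nodeDiv v (fun e => w.drop e v (c' v - c' (other e v) + x v e))) := by
      intro f hf f0 P
      by_cases hP : ∃ e, ∃ he : X₀.G.Inc e v, X₀.node e v he = P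
      · obtain ⟨e, he, rfl⟩ := hP
        have h3 := (Submodule.mem_iInf _).1 ((Submodule.mem_iInf _).1 hf.2 (other e v))
          (Finset.mem_filter.2 ⟨Finset.mem_univ _, adj_other he⟩) f0 (X₀.node e v he)
        rw [Finsupp.add_apply, shiftDiv, nodeDiv_apply_node, if_pos (mem_edgesOver.2
          ⟨he, inc_other e v⟩), ← hc' v _ (adj_other he)] at h3
        rw [Finsupp.add_apply, nodeDiv_apply_node]
        exact h3
      · push Not at hP
        have h3 := hH v hf.1 f0 P
        rw [Finsupp.add_apply, nodeDiv_apply_of_ne _ _ hP] at h3 ⊢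
        exact h3
    have h3 := (X₀.Z v).finrank_inf_H0_le_add_degree W (D v +
        X₀.nodeDiv v (fun e => w.drop e v (c' v - c' (other e v) + x v e))) (hEv v)
    rw [inf_eq_left.2 hWle] at h3
    have h4 := hBsum v
    have h5 : W ⊓ (X₀.Z v).H0 (D v +
        X₀.nodeDiv v (fun e => w.drop e v (c' v - c' (other e v) + x v e)) -
          ComplexDiv.part E v) ≠ ⊥ := by
      intro hbot
      rw [hbot, finrank_bot] at h3
      rw [hr] at h1
      rw [hr] at h2
      simp only [W, a] at h3 h4
      push_cast at h1 h2 h3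
      omega
    obtain ⟨f, hf, f0⟩ := Submodule.exists_mem_ne_zero_of_ne_bot h5
    exact ⟨f, hf.1.1, f0, hf.2⟩
  choose f hfH f0 hfE using hpart
  obtain ⟨g, hg, hgo, hgs⟩ := TropFunction.exists_of_vert w c' (ComplexDiv.edgePart E)
  refine ⟨⟨g, f, f0⟩, hfH, ?_⟩
  rintro (⟨v, P⟩ | ⟨e, s⟩)
  · have h1 := hfE v (f0 v) P
    rw [← ComplexDiv.part_apply, ComplexDiv.part_ofMultideg, ← ComplexDiv.part_apply]
    change 0 ≤ D v P + ((X₀.Z v).ord P (f v) + X₀.nodeDiv v (g.slope v) P) - _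
    have h2 : X₀.nodeDiv v (g.slope v) =
        X₀.nodeDiv v (fun e => w.drop e v (c' v - c' (other e v) + x v e)) := by
      refine nodeDiv_congr fun e he => ?_
      rw [hgs v e he, drop, ← add_assoc]
    rw [h2]
    rw [Finsupp.sub_apply, Finsupp.add_apply] at h1
    omega
  · rw [← ComplexDiv.edgePart_apply (ComplexDiv.ofMultideg w D), ComplexDiv.ofMultideg,
      ComplexDiv.edgePart_ofParts, chipPart_apply, ← ComplexDiv.edgePart_apply]
    change 0 ≤ _ + g.ordAt e s - _
    rw [hgo]
    split_ifs <;> omega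

end NodalCurve
namespace NodalCurve

variable {κ : Type u} [Field κ] {X₀ : NodalCurve κ} {n : X₀.G.E → ℕ+}

open Multigraph AdmMultideg TropFunction

/-! ### The forgetful map -/

/-- For integral vertex values and no points to absorb, the function of `exists_of_vert` moves the
chip of `w` precisely to that of the twisted multidegree. -/
lemma chipPos_zero (w : AdmMultideg X₀.G n) (a : X₀.G.V → ℤ) (e : X₀.G.E) :
    chipPos w (fun v => a v) e 0 = ((w.state a).μ e).val := by
  have hn : ((n e : ℕ) : ℝ) ≠ 0 := by exact_mod_cast (n e).ne_zero
  rw [chipPos, moment_zero, add_zero, state_μ]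
  have h1 : w.μ e + ((a (X₀.G.tail e) - a (X₀.G.head e) : ℤ) : ZMod (n e)) =
      (((w.μ e).val + (a (X₀.G.tail e) - a (X₀.G.head e)) : ℤ) : ZMod (n e)) := by
    push_cast
    rw [ZMod.natCast_zmod_val]
  have h2 (z : ℤ) : ((z : ZMod (n e)).val : ℝ) = ((z % (n e : ℕ) : ℤ) : ℝ) := by
    exact_mod_cast congrArg (Int.cast : ℤ → ℝ) (ZMod.val_intCast z)
  rw [h1, h2]
  have h3 : ((w.μ e).val : ℝ) + ((a (X₀.G.tail e) : ℝ) - a (X₀.G.head e)) =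
      (((w.μ e).val + (a (X₀.G.tail e) - a (X₀.G.head e)) : ℤ) : ℝ) := by push_cast; ring
  rw [h3]
  generalize ((w.μ e).val + (a (X₀.G.tail e) - a (X₀.G.head e)) : ℤ) = z
  have h4 := Int.emod_add_mul_ediv z (n e : ℕ)
  have h5 : (z : ℝ) / (n e : ℕ) = ((z % (n e : ℕ) : ℤ) : ℝ) / (n e : ℕ) + (z / (n e : ℕ) : ℤ) := by
    nth_rewrite 1 [← h4]
    push_cast
    field_simp
  have hpos : (0 : ℝ) < (n e : ℕ) := by exact_mod_cast (n e).pos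
  have h6 : (0 : ℝ) ≤ ((z % (n e : ℕ) : ℤ) : ℝ) := by
    exact_mod_cast Int.emod_nonneg z (by exact_mod_cast (n e).ne_zero)
  have h7 : ((z % (n e : ℕ) : ℤ) : ℝ) < (n e : ℕ) := by
    exact_mod_cast Int.emod_lt_of_pos z (by exact_mod_cast (n e).pos)
  rw [h5, Int.fract_add_intCast, Int.fract_eq_self.2 ⟨div_nonneg h6 hpos.le,
    (div_lt_one hpos).2 h7⟩, mul_div_cancel₀ _ hn]

lemma ComplexDiv.IsOfMultidegree.apply_inr {D : ComplexDiv X₀ n} {w : AdmMultideg X₀.G n}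
    (h : D.IsOfMultidegree w) (e : X₀.G.E) (t : Set.Ioo (0 : ℝ) (n e : ℝ)) :
    D (Sum.inr ⟨e, t⟩) = if (t : ℝ) = ((w.μ e).val : ℝ) then 1 else 0 := h.2 e t

/-- All forgetful images of isomorphic tuples are equivalent. -/
lemma IsForgetfulImage.equiv (hG : X₀.G.bar.Connected) {w₀ : AdmMultideg X₀.G n}
    {wt : X₀.G.V → AdmMultideg X₀.G n} (hwt : ∀ v, wt v ∈ w₀.orbit) {x x' : SheafTuple X₀}
    (hx : x ≈ x') {s s' : ∀ v, (X₀.Z v).K} (hs : ∀ v, s v ≠ 0) (hs' : ∀ v, s' v ≠ 0)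
    {w w' : AdmMultideg X₀.G n} (hw : w ∈ w₀.orbit) (hw' : w' ∈ w₀.orbit) {y y' : ComplexPair X₀ n}
    (hy : IsForgetfulImage wt x s w y) (hy' : IsForgetfulImage wt x' s' w' y') : y ≈ y' := by
  obtain ⟨f, hf, hD, hV⟩ := hx
  obtain ⟨a, rfl⟩ := mem_orbit_iff.1 (mem_orbit_trans (mem_orbit_symm hw) hw')
  choose c hc using fun v => mem_orbit_iff.1 (mem_orbit_trans (mem_orbit_symm hw) (hwt v))
  -- Twisting by the potential `a` is realized on Γ by a rational function with vertex values `a`;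
  -- changes of `s` and of the representative `x` only multiply by functions on the components.
  obtain ⟨g, -, hgo, hgs⟩ := TropFunction.exists_of_vert w (fun v => a v) (fun _ => 0)
  have hslope : ∀ v, X₀.nodeDiv v (g.slope v) = X₀.nodeDiv v (w.coef (fun v => a v) v) := by
    refine fun v => nodeDiv_congr fun e he => ?_
    rw [hgs v e he, moment_zero, add_zero, coef, drop]
  have hne : ∀ v, (f v)⁻¹ * s' v * (s v)⁻¹ ≠ 0 := fun v =>
    mul_ne_zero (mul_ne_zero (inv_ne_zero (hf v)) (hs' v)) (inv_ne_zero (hs v))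
  refine ⟨⟨g, _, hne⟩, ?_, fun v => ?_⟩
  · rintro (⟨v, P⟩ | ⟨e, t⟩)
    · have h1 := hy.2.1 v P
      have h2 := hy'.2.1 v P
      rw [hc v, twistDiv_state hG] at h1
      rw [hc v, twistDiv_state_state hG, hD, Finsupp.sub_apply] at h2
      rw [← ComplexDiv.part_apply, ← ComplexDiv.part_apply, h1, h2]
      change _ = _ + ((X₀.Z v).ord P _ + X₀.nodeDiv v (g.slope v) P)
      rw [hslope, SmoothCurve.ord_mul _ _ (mul_ne_zero (inv_ne_zero (hf v)) (hs' v))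
        (inv_ne_zero (hs v)), SmoothCurve.ord_mul _ _ (inv_ne_zero (hf v)) (hs' v),
        SmoothCurve.ord_inv _ _ (hf v), SmoothCurve.ord_inv _ _ (hs v)]
      ring
    · rw [hy.1.apply_inr, hy'.1.apply_inr]
      change _ = _ + g.ordAt e t
      rw [hgo, chipPos_zero]
      simp
  · rw [hy.2.2, hy'.2.2, hV, SmoothCurve.mulBy_mulBy, SmoothCurve.mulBy_mulBy]
    congr 1
    have := hf v
    have := hs' v
    field_simp

lemma rankSet_congr {y y' : ComplexPair X₀ n} (h : y ≈ y') :
    rankSet y'.D y'.H ⊆ rankSet y.D y.H := by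
  obtain ⟨g, hD, hH⟩ := h
  intro r hr E hE hEd
  obtain ⟨f, hf, hf'⟩ := hr E hE hEd
  refine ⟨f * g, fun v => ?_, fun x => ?_⟩
  · rw [hH, SmoothCurve.mem_mulBy]
    exact ⟨f.part v, hf v, rfl⟩
  · have := hf' x
    rw [hD] at this
    rw [ComplexFunction.ord_mul]
    omega

lemma ComplexPair.IsLimitSeries.of_equiv {y y' : ComplexPair X₀ n} (h : y ≈ y') {d : ℤ} {r : ℕ}
    (hd : y'.D.degree = d) (hy : y.IsLimitSeries d r) : y'.IsLimitSeries d r := by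
  have h1 : rankSet y'.D y'.H = rankSet y.D y.H :=
    (rankSet_congr h).antisymm (rankSet_congr (Setoid.symm h))
  refine ⟨hd, fun v => ?_, h1 ▸ hy.2.2⟩
  rw [← hy.2.1 v]
  obtain ⟨g, -, hH⟩ := h
  rw [hH v, SmoothCurve.finrank_mulBy _ _ (g.part_ne_zero v)]

/-- Equivalent pairs with the same `Γ`-part. -/
lemma exists_of_equiv_of_isOfMultidegree [IsAlgClosed κ] (hG : X₀.G.bar.Connected)
    {w : AdmMultideg X₀.G n} {y y' : ComplexPair X₀ n} (h : y ≈ y') (hy : y.D.IsOfMultidegree w)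
    (hy' : y'.D.IsOfMultidegree w) : ∃ g : ∀ v, (X₀.Z v).K, (∀ v, g v ≠ 0) ∧
      (∀ v P, ComplexDiv.part y'.D v P = ComplexDiv.part y.D v P + (X₀.Z v).ord P (g v)) ∧
      ∀ v, y.H v = (X₀.Z v).mulBy (y'.H v) (g v) := by
  obtain ⟨g, hD, hH⟩ := h
  have hpart : ∀ v, ComplexDiv.part y'.D v = ComplexDiv.part y.D v +
      ((X₀.Z v).div (g.part v) + X₀.nodeDiv v (g.graphPart.slope v)) := by
    intro v
    ext P
    rw [Finsupp.add_apply, Finsupp.add_apply, SmoothCurve.div_apply]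
    exact hD (Sum.inl ⟨v, P⟩)
  -- Both divisors have the same degree on Z_v and principal divisors have degree zero, so the
  -- Γ-part of `g` is harmonic at the vertices.
  have hsum : ∀ v, ∑ e ∈ X₀.G.edgesAt v, g.graphPart.slope v e = 0 := by
    intro v
    have h1 := congrArg Finsupp.degree (hpart v)
    rw [map_add, map_add, hy.1, hy'.1, SmoothCurve.degree_div _ (g.part_ne_zero v),
      degree_nodeDiv] at h1
    omega
  have hord : ∀ e, ∀ t : ℝ, 0 < t → t < (n e : ℕ) → g.graphPart.ordAt e t = 0 := by
    intro e t h0 ht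
    have h1 := hD (Sum.inr ⟨e, t, h0, ht⟩)
    rw [hy.apply_inr, hy'.apply_inr] at h1
    exact (left_eq_add.1 h1)
  have hslope : ∀ v, X₀.nodeDiv v (g.graphPart.slope v) = 0 := fun v => by
    rw [← nodeDiv_zero v]
    exact nodeDiv_congr fun e he => g.graphPart.slope_eq_zero hG hord hsum he
  refine ⟨g.part, g.part_ne_zero, fun v P => ?_, hH⟩
  rw [hpart, hslope, add_zero, Finsupp.add_apply, SmoothCurve.div_apply]

lemma degree_twistDiv (hG : X₀.G.bar.Connected) {w₀ w : AdmMultideg X₀.G n} (hw : w ∈ w₀.orbit)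
    (v : X₀.G.V) : (twistDiv w₀ w v).degree = w.wG v - w₀.wG v := by
  obtain ⟨c, rfl⟩ := mem_orbit_iff.1 hw
  rw [twistDiv_state hG, degree_nodeDiv, state_wG, degAt, add_sub_cancel_left]

/-- The pair on `ℭ` of multidegree `w₀` given by the tuple `x`. -/
def SheafTuple.toPair (w₀ : AdmMultideg X₀.G n) (wt : X₀.G.V → AdmMultideg X₀.G n)
    (x : SheafTuple X₀) : ComplexPair X₀ n :=
  ⟨ComplexDiv.ofMultideg w₀ fun v => x.D v - twistDiv w₀ (wt v) v, x.V⟩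

/-- The tuple given by a pair on `ℭ` of multidegree `w₀`. -/
def ComplexPair.toTuple (w₀ : AdmMultideg X₀.G n) (wt : X₀.G.V → AdmMultideg X₀.G n)
    (y : ComplexPair X₀ n) : SheafTuple X₀ :=
  ⟨fun v => ComplexDiv.part y.D v + twistDiv w₀ (wt v) v, y.H⟩

lemma SheafTuple.toTuple_toPair (w₀ : AdmMultideg X₀.G n) (wt : X₀.G.V → AdmMultideg X₀.G n)
    (x : SheafTuple X₀) : (x.toPair w₀ wt).toTuple w₀ wt = x := by
  simp only [toPair, ComplexPair.toTuple, ComplexDiv.part_ofMultideg, sub_add_cancel]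

lemma ComplexPair.isForgetfulImage_toTuple {w₀ : AdmMultideg X₀.G n}
    (wt : X₀.G.V → AdmMultideg X₀.G n) {y : ComplexPair X₀ n} (hy : y.D.IsOfMultidegree w₀) :
    IsForgetfulImage wt (y.toTuple w₀ wt) (fun _ => 1) w₀ y := by
  refine ⟨hy, fun v P => ?_, fun v => ?_⟩
  · rw [SmoothCurve.ord_one, toTuple, Finsupp.add_apply]
    ring
  · rw [inv_one, SmoothCurve.mulBy_one, toTuple]

lemma SheafTuple.isOfMultidegree_toPair (hG : X₀.G.bar.Connected) {w₀ : AdmMultideg X₀.G n}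
    {wt : X₀.G.V → AdmMultideg X₀.G n} (hwt : ∀ v, wt v ∈ w₀.orbit) {x : SheafTuple X₀}
    (hx : ∀ v, (x.D v).degree = (wt v).wG v) : (x.toPair w₀ wt).D.IsOfMultidegree w₀ :=
  ComplexDiv.isOfMultidegree_ofMultideg fun v => by
    rw [map_sub, hx, degree_twistDiv hG (hwt v), sub_sub_cancel]

lemma SheafTuple.isForgetfulImage_toPair (hG : X₀.G.bar.Connected) {w₀ : AdmMultideg X₀.G n}
    {wt : X₀.G.V → AdmMultideg X₀.G n} (hwt : ∀ v, wt v ∈ w₀.orbit) {x : SheafTuple X₀}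
    (hx : ∀ v, (x.D v).degree = (wt v).wG v) :
    IsForgetfulImage wt x (fun _ => 1) w₀ (x.toPair w₀ wt) := by
  have := ComplexPair.isForgetfulImage_toTuple wt (isOfMultidegree_toPair hG hwt hx)
  rwa [toTuple_toPair] at this

variable {w₀ : AdmMultideg X₀.G n} {wt : X₀.G.V → AdmMultideg X₀.G n} {c : X₀.G.V → X₀.G.V → ℤ}
  {d : ℤ} {r : ℕ}

variable [IsAlgClosed κ]

/-- Limit linear series of multidegree `w₀` correspond to pre-limit linear series. -/
lemma isPreLimit_toTuple_iff (hG : X₀.G.IsMultitree) (hc : TightPotentials w₀ wt c)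
    (hd : w₀.degree = d) {y : ComplexPair X₀ n} (hy : y.D.IsOfMultidegree w₀) :
    IsPreLimit wt r (y.toTuple w₀ wt) ↔ y.IsLimitSeries d r := by
  have := hG.connected.nonempty
  obtain ⟨v₀⟩ := this
  obtain ⟨h1, h2⟩ := ComplexDiv.isOfMultidegree_iff.1 hy
  have ht : y.toTuple w₀ wt = ⟨fun v => ComplexDiv.part y.D v +
      X₀.nodeDiv v (w₀.coef (fun x => c v x) v), y.H⟩ := by
    rw [ComplexPair.toTuple]
    congr 1
    funext v
    rw [hc.eq_state v, twistDiv_state hG.connected]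
  rw [ht, isPreLimit_iff hc]
  constructor
  · rintro ⟨-, hH, hr, hedge⟩
    refine ⟨hy.degree_eq.trans hd, hr, ?_, fun r' hr' => ?_⟩
    · rw [h1]
      exact hedge.mem_rankSet hG hH hr
    · rw [h1] at hr'
      exact le_of_mem_rankSet hc h2 (v := v₀) hr hr'
  · rintro ⟨-, hr, hrank, -⟩
    rw [h1] at hrank
    exact ⟨h2, le_H0_of_mem_rankSet hc h2 hr hrank, hr,
      edgeCondition_of_mem_rankSet hc h2 hr hrank⟩

lemma IsPreLimit.isLimitSeries_toPair (hG : X₀.G.IsMultitree) (hc : TightPotentials w₀ wt c)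
    (hd : w₀.degree = d) {x : SheafTuple X₀} (hx : IsPreLimit wt r x) :
    (x.toPair w₀ wt).IsLimitSeries d r := by
  rw [← isPreLimit_toTuple_iff hG hc hd
    (SheafTuple.isOfMultidegree_toPair hG.connected hc.mem_orbit hx.1), SheafTuple.toTuple_toPair]
  exact hx

/-- Invariance is inherited from limit linear series: isomorphic tuples give equivalent pairs, for
which `rankSet` is the same. -/
lemma IsPreLimit.of_equiv (hG : X₀.G.IsMultitree) (hc : TightPotentials w₀ wt c)
    {x x' : SheafTuple X₀} (h : x ≈ x') (hx : IsPreLimit wt r x) : IsPreLimit wt r x' := by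
  have hx' : ∀ v, (x'.D v).degree = (wt v).wG v := by
    intro v
    obtain ⟨f, hf, hD, -⟩ := h
    have : x'.D v = x.D v - (X₀.Z v).div (f v) := by
      ext P
      rw [Finsupp.sub_apply, SmoothCurve.div_apply, hD]
    rw [this, map_sub, SmoothCurve.degree_div _ (hf v), sub_zero, hx.1]
  have h1 := SheafTuple.isOfMultidegree_toPair hG.connected hc.mem_orbit hx'
  have h2 : x.toPair w₀ wt ≈ x'.toPair w₀ wt :=
    IsForgetfulImage.equiv hG.connected hc.mem_orbit h (fun _ => one_ne_zero)
      (fun _ => one_ne_zero) w₀.mem_orbit_self w₀.mem_orbit_self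
      (SheafTuple.isForgetfulImage_toPair hG.connected hc.mem_orbit hx.1)
      (SheafTuple.isForgetfulImage_toPair hG.connected hc.mem_orbit hx')
  have h3 := (hx.isLimitSeries_toPair hG hc rfl).of_equiv h2 h1.degree_eq
  rw [← isPreLimit_toTuple_iff hG hc rfl h1, SheafTuple.toTuple_toPair] at h3
  exact h3

/-- The forgetful map. -/
def forgetfulMap (hG : X₀.G.IsMultitree) (hc : TightPotentials w₀ wt c) (hd : w₀.degree = d) :
    PreLimitSpace wt r → LimitSpace X₀ n d r :=
  Quotient.lift (fun x => LimitSpace.mk (x.1.toPair w₀ wt) (x.2.isLimitSeries_toPair hG hc hd))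
    fun x x' h => Quotient.sound (IsForgetfulImage.equiv hG.connected hc.mem_orbit h
      (fun _ => one_ne_zero) (fun _ => one_ne_zero) w₀.mem_orbit_self w₀.mem_orbit_self
      (SheafTuple.isForgetfulImage_toPair hG.connected hc.mem_orbit x.2.1)
      (SheafTuple.isForgetfulImage_toPair hG.connected hc.mem_orbit x'.2.1))

lemma isForgetfulMap_forgetfulMap (hG : X₀.G.IsMultitree) (hc : TightPotentials w₀ wt c)
    (hd : w₀.degree = d) :
    IsForgetfulMap w₀ wt (forgetfulMap (r := r) hG hc hd) := by
  intro x hx s hs w hw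
  have hwt : ∀ v, wt v ∈ w.orbit := fun v => mem_orbit_trans (mem_orbit_symm hw) (hc.mem_orbit v)
  constructor
  · refine ⟨⟨ComplexDiv.ofMultideg w fun v => (X₀.Z v).div (s v) + x.D v - twistDiv w (wt v) v,
      fun v => (X₀.Z v).mulBy (x.V v) (s v)⁻¹⟩,
      ComplexDiv.isOfMultidegree_ofMultideg fun v => ?_, fun v P => ?_, fun v => rfl⟩
    · rw [map_sub, map_add, SmoothCurve.degree_div _ (hs v).2, hx.1,
        degree_twistDiv hG.connected (hwt v)]
      ring
    · rw [ComplexDiv.part_ofMultideg, Finsupp.sub_apply, Finsupp.add_apply, SmoothCurve.div_apply]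
  · intro y hy
    have h : x.toPair w₀ wt ≈ y := IsForgetfulImage.equiv hG.connected hc.mem_orbit
      (Setoid.refl x) (fun _ => one_ne_zero) (fun v => (hs v).2) w₀.mem_orbit_self hw
      (SheafTuple.isForgetfulImage_toPair hG.connected hc.mem_orbit hx.1) hy
    refine ⟨(hx.isLimitSeries_toPair hG hc hd).of_equiv h ?_, Quotient.sound h⟩
    rw [hy.1.degree_eq, degree_eq_of_mem_orbit hw, hd]

lemma forgetfulMap_mk_toTuple (hG : X₀.G.IsMultitree) (hc : TightPotentials w₀ wt c)
    (hd : w₀.degree = d) {y : ComplexPair X₀ n} (hy : y.IsLimitSeries d r)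
    (hyw : y.D.IsOfMultidegree w₀) : ∃ hx : IsPreLimit wt r (y.toTuple w₀ wt),
      forgetfulMap hG hc hd (PreLimitSpace.mk _ hx) = LimitSpace.mk y hy := by
  have hx := (isPreLimit_toTuple_iff hG hc hd hyw).2 hy
  refine ⟨hx, Quotient.sound ?_⟩
  exact IsForgetfulImage.equiv hG.connected hc.mem_orbit
    (Setoid.refl (y.toTuple w₀ wt)) (fun _ => one_ne_zero) (fun _ => one_ne_zero)
    w₀.mem_orbit_self w₀.mem_orbit_self
    (SheafTuple.isForgetfulImage_toPair hG.connected hc.mem_orbit hx.1)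
    (ComplexPair.isForgetfulImage_toTuple wt hyw)

lemma forgetfulMap_injective (hG : X₀.G.IsMultitree) (hc : TightPotentials w₀ wt c)
    (hd : w₀.degree = d) : Function.Injective (forgetfulMap (r := r) hG hc hd) := by
  intro p p' h
  obtain ⟨⟨x, hx⟩, rfl⟩ := Quotient.exists_rep p
  obtain ⟨⟨x', hx'⟩, rfl⟩ := Quotient.exists_rep p'
  have h₁ : LimitSpace.mk (x.toPair w₀ wt) _ = LimitSpace.mk (x'.toPair w₀ wt) _ := h
  have h : x.toPair w₀ wt ≈ x'.toPair w₀ wt :=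
    Quotient.exact (s := Setoid.comap (Subtype.val :
      {y : ComplexPair X₀ n // y.IsLimitSeries d r} → ComplexPair X₀ n) inferInstance) h₁
  obtain ⟨g, hg, hD, hH⟩ := exists_of_equiv_of_isOfMultidegree hG.connected h
    (SheafTuple.isOfMultidegree_toPair hG.connected hc.mem_orbit hx.1)
    (SheafTuple.isOfMultidegree_toPair hG.connected hc.mem_orbit hx'.1)
  refine Quotient.sound ?_
  change x ≈ x'
  refine Setoid.symm ⟨g, hg, fun v P => ?_, fun v => hH v⟩
  have := hD v P
  simp only [SheafTuple.toPair, ComplexDiv.part_ofMultideg, Finsupp.sub_apply] at this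
  omega

lemma bijOn_forgetfulMap (hG : X₀.G.IsMultitree) (hc : TightPotentials w₀ wt c)
    (hd : w₀.degree = d) :
    Set.BijOn (forgetfulMap (r := r) hG hc hd) Set.univ (limitsOfMultidegree d r w₀) := by
  refine ⟨fun p _ => ?_, (forgetfulMap_injective hG hc hd).injOn, ?_⟩
  · obtain ⟨⟨x, hx⟩, rfl⟩ := Quotient.exists_rep p
    exact ⟨_, _, rfl, SheafTuple.isOfMultidegree_toPair hG.connected hc.mem_orbit hx.1⟩
  · rintro q ⟨y, hy, rfl, hyw⟩
    obtain ⟨hx, h⟩ := forgetfulMap_mk_toTuple hG hc hd hy hyw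
    exact ⟨_, trivial, h⟩

/-- Changing from one tuple of multidegrees to another. -/
lemma forgetfulMap_mk_add (hG : X₀.G.IsMultitree) (hc : TightPotentials w₀ wt c)
    (hd : w₀.degree = d) {wt' : X₀.G.V → AdmMultideg X₀.G n} {c' : X₀.G.V → X₀.G.V → ℤ}
    (hc' : TightPotentials w₀ wt' c') {x : SheafTuple X₀} (hx : IsPreLimit wt r x) :
    ∃ hx' : IsPreLimit wt' r ⟨fun v => x.D v + twistDiv (wt v) (wt' v) v, x.V⟩,
      forgetfulMap hG hc' hd (PreLimitSpace.mk _ hx') =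
        forgetfulMap hG hc hd (PreLimitSpace.mk x hx) := by
  -- The twisting divisors satisfy the cocycle relation, so passing from one tuple of multidegrees
  -- to the other may go through `w₀`.
  have heq : (⟨fun v => x.D v + twistDiv (wt v) (wt' v) v, x.V⟩ : SheafTuple X₀) =
      (x.toPair w₀ wt).toTuple w₀ wt' := by
    rw [SheafTuple.toPair, ComplexPair.toTuple]
    congr 1
    funext v
    rw [ComplexDiv.part_ofMultideg, hc.eq_state v, hc'.eq_state v,
      twistDiv_state_state hG.connected, twistDiv_state hG.connected, twistDiv_state hG.connected]
    abel
  rw [heq]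
  exact forgetfulMap_mk_toTuple hG hc' hd (hx.isLimitSeries_toPair hG hc hd)
    (SheafTuple.isOfMultidegree_toPair hG.connected hc.mem_orbit hx.1)

end NodalCurve
namespace NodalCurve

/-! ### Glueing along one node of the tree -/

section Glue

variable {κ E K K' : Type*} [Field κ] [AddCommGroup K] [Module κ K] [AddCommGroup K'] [Module κ K']

/-- The elements of `W ⊆ S / T` which have a representative lying in `A e`, for `e ∈ L`, exactly
when `e ∉ I`. -/
def orbitIn (S T : Submodule κ K) (L : Finset E) (A : E → Set K)
    (W : Submodule κ (S ⧸ T.submoduleOf S)) (I : Finset E) : Set (S ⧸ T.submoduleOf S) :=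
  {q | q ∈ W ∧ ∃ s : S, Submodule.Quotient.mk s = q ∧ ∀ e ∈ L, (e ∈ I ↔ (s : K) ∉ A e)}

/-- There are `g`-dimensional subspaces of `S / T` and `S' / T'` meeting corresponding orbits in
sets of equal dimension. -/
def Glues (S T : Submodule κ K) (L : Finset E) (A : E → Set K) (S' T' : Submodule κ K')
    (L' : Finset E) (A' : E → Set K') (g : ℕ) : Prop :=
  ∃ (W : Submodule κ (S ⧸ T.submoduleOf S)) (W' : Submodule κ (S' ⧸ T'.submoduleOf S')),
    Module.finrank κ W = g ∧ Module.finrank κ W' = g ∧ ∀ I ⊆ L,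
      Module.finrank κ (Submodule.span κ (orbitIn S T L A W I)) =
        Module.finrank κ (Submodule.span κ (orbitIn S' T' L' A' W' I))

lemma orbitIn_congr {S T : Submodule κ K} {L : Finset E} {A B : E → Set K}
    (h : ∀ e ∈ L, ∀ s ∈ S, s ∈ A e ↔ s ∈ B e) : orbitIn S T L A = orbitIn S T L B := by
  funext W I
  ext q
  refine and_congr_right fun _ => exists_congr fun s => and_congr_right fun _ =>
    forall₂_congr fun e he => ?_
  rw [h e he s s.2]

lemma Glues.congr {S T S₁ T₁ : Submodule κ K} {L L₁ : Finset E} {A A₁ : E → Set K}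
    {S' T' S₁' T₁' : Submodule κ K'} {L' L₁' : Finset E} {A' A₁' : E → Set K'} {g g₁ : ℕ}
    (h : Glues S T L A S' T' L' A' g) (hS : S = S₁) (hT : T = T₁) (hL : L = L₁)
    (hA : ∀ e ∈ L, ∀ s ∈ S, s ∈ A e ↔ s ∈ A₁ e) (hS' : S' = S₁') (hT' : T' = T₁') (hL' : L' = L₁')
    (hA' : ∀ e ∈ L', ∀ s ∈ S', s ∈ A' e ↔ s ∈ A₁' e) (hg : g = g₁) :
    Glues S₁ T₁ L₁ A₁ S₁' T₁' L₁' A₁' g₁ := by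
  subst hS hT hL hS' hT' hL' hg
  rwa [Glues, ← orbitIn_congr hA, ← orbitIn_congr hA']

lemma glues_zero (S T : Submodule κ K) (L : Finset E) (A : E → Set K) (S' T' : Submodule κ K')
    (L' : Finset E) (A' : E → Set K') : Glues S T L A S' T' L' A' 0 := by
  refine ⟨⊥, ⊥, finrank_bot _ _, finrank_bot _ _, fun I _ => ?_⟩
  have h1 : Module.finrank κ (Submodule.span κ (orbitIn S T L A ⊥ I)) = 0 := by
    rw [eq_bot_iff.2 (Submodule.span_le.2 fun q hq => hq.1), finrank_bot]
  have h2 : Module.finrank κ (Submodule.span κ (orbitIn S' T' L' A' ⊥ I)) = 0 := by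
    rw [eq_bot_iff.2 (Submodule.span_le.2 fun q hq => hq.1), finrank_bot]
  rw [h1, h2]

end Glue

variable {κ : Type u} [Field κ] {X₀ : NodalCurve κ} {n : X₀.G.E → ℕ+}

open Multigraph AdmMultideg

/-- The zeros at the point of the edge `e`, beyond those in `D'`, of sections of `𝒪(D)`. -/
def vanishAt (v : X₀.G.V) (D : (X₀.Z v).Div) (e : X₀.G.E) : Set (X₀.Z v).K :=
  ((X₀.Z v).H0 (D - X₀.nodeDiv v (Pi.single e 1)) : Set (X₀.Z v).K)

lemma SheafTuple.weakGlueing_iff {wt : X₀.G.V → AdmMultideg X₀.G n} {r : ℕ} {x : SheafTuple X₀} :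
    x.WeakGlueing wt r ↔ ∀ v u, X₀.G.bar.Adj v u → ∃ a a' : Fin (r + 1) → ℤ,
      IsMultivanishing (x.D v) (x.V v) (chipDiv wt v u) a ∧
      IsMultivanishing (x.D u) (x.V u) (chipDiv wt u v) a' ∧
      ∀ j j' : ℕ, j + j' = gap wt v u → IsCritical (chipDiv wt v u) j →
        Glues (sectionsVanishing (x.D v) (x.V v) (chipDiv wt v u j))
          (sectionsVanishing (x.D v) (x.V v) (chipDiv wt v u (j + 1)))
          ((wt v).lossEdges v u j) (vanishAt v (x.D v - chipDiv wt v u j))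
          (sectionsVanishing (x.D u) (x.V u) (chipDiv wt u v j'))
          (sectionsVanishing (x.D u) (x.V u) (chipDiv wt u v (j' + 1)))
          ((wt u).lossEdges u v j') (vanishAt u (x.D u - chipDiv wt u v j'))
          (Finset.univ.filter fun l : Fin (r + 1) =>
            a l = (chipDiv wt v u j).degree ∧ a' l.rev = (chipDiv wt u v j').degree).card := by
  refine forall₃_congr fun v u _ => exists₂_congr fun a a' => and_congr_right fun _ =>
    and_congr_right fun _ => forall₄_congr fun j j' _ _ => ?_
  constructor
  · rintro ⟨W, W', g, rfl, h1, h2, h3⟩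
    exact ⟨W, W', h1, h2, h3⟩
  · rintro ⟨W, W', h1, h2, h3⟩
    exact ⟨W, W', _, rfl, h1, h2, h3⟩

/-! ### Critical indices -/

lemma lossEdges_congr (w : AdmMultideg X₀.G n) {c c' : X₀.G.V → ℤ} {v u : X₀.G.V} (h : v ≠ u)
    {wt wt' : X₀.G.V → AdmMultideg X₀.G n} (hwt : wt v = w.state c) (hwt' : wt' v = w.state c')
    {i j : ℕ} (hij : c v - c u + i = c' v - c' u + j) :
    (wt v).lossEdges v u i = (wt' v).lossEdges v u j := by
  ext e
  rw [mem_lossEdges_iff w c h hwt, mem_lossEdges_iff w c' h hwt', hij]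

/-- Both sides describe the edges whose chip position is zero modulo the length; exchanging the ends
changes the sign of the difference of potentials and of `sgn` simultaneously. -/
lemma lossEdges_symm (w : AdmMultideg X₀.G n) {c c' : X₀.G.V → ℤ} {v u : X₀.G.V} (h : v ≠ u)
    {wt : X₀.G.V → AdmMultideg X₀.G n} (hwt : wt v = w.state c) (hwt' : wt u = w.state c')
    {i j : ℕ} (hij : c' u - c' v + j = -(c v - c u + i)) :
    (wt u).lossEdges u v j = (wt v).lossEdges v u i := by
  ext e
  rw [mem_lossEdges_iff w c h hwt, mem_lossEdges_iff w c' h.symm hwt', hij, edgesOver_comm]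
  refine and_congr_right fun he => ?_
  obtain ⟨hev, ho⟩ := (mem_edgesOver_iff h).1 he
  rw [← ho, sgn_other hev, neg_mul_neg]

lemma isCritical_chipDiv_iff (wt : X₀.G.V → AdmMultideg X₀.G n) (v u : X₀.G.V) (i : ℕ) :
    IsCritical (chipDiv wt v u) i ↔ ((wt v).lossEdges v u i).Nonempty := by
  have key : ∀ e, (((Finset.range (i + 1)).filter fun k => e ∈ (wt v).lossEdges v u k).card : ℤ) =
      ((Finset.range i).filter fun k => e ∈ (wt v).lossEdges v u k).card +
        if e ∈ (wt v).lossEdges v u i then 1 else 0 := by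
    intro e
    rw [Finset.range_add_one, Finset.filter_insert]
    split_ifs with h
    · rw [Finset.card_insert_of_notMem (by simp)]
      push_cast
      rfl
    · rw [add_zero]
  constructor
  · contrapose!
    intro h
    rw [IsCritical, not_not]
    refine nodeDiv_congr fun e _ => ?_
    rw [key, if_neg (by simp [h]), add_zero]
  · rintro ⟨e, he⟩ h
    have hinc : X₀.G.Inc e v := (mem_edgesOver.1 (Finset.mem_filter.1 he).1).1
    have h1 := DFunLike.congr_fun h (X₀.node e v hinc)
    rw [chipDiv, chipDiv, nodeDiv_apply_node _ _ hinc, nodeDiv_apply_node _ _ hinc, key,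
      if_pos he] at h1
    omega

/-! ### Comparison of two tuples of multidegrees -/

/-- For a section of 𝒪(D), allowing additional poles imposes no condition, so only the negative
parts of the coefficients count. -/
lemma mem_H0_add_nodeDiv_congr {v : X₀.G.V} {D : (X₀.Z v).Div} {f : (X₀.Z v).K}
    (hf : f ∈ (X₀.Z v).H0 D) {k k' : X₀.G.E → ℤ}
    (h : ∀ e, X₀.G.Inc e v → min (k e) 0 = min (k' e) 0) :
    f ∈ (X₀.Z v).H0 (D + X₀.nodeDiv v k) ↔ f ∈ (X₀.Z v).H0 (D + X₀.nodeDiv v k') := by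
  refine forall_congr' fun f0 => forall_congr' fun P => ?_
  have h1 := hf f0 P
  rw [Finsupp.add_apply, Finsupp.add_apply]
  by_cases hP : ∃ e, ∃ he : X₀.G.Inc e v, P = X₀.node e v he
  · obtain ⟨e, he, rfl⟩ := hP
    rw [nodeDiv_apply_node _ _ he, nodeDiv_apply_node _ _ he]
    have := h e he
    omega
  · rw [nodeDiv_apply_of_ne, nodeDiv_apply_of_ne] <;>
    · intro e he h'
      exact hP ⟨e, he, h'.symm⟩

/-- The change of the coefficients at `v` when passing from the potential `c` to `c'`, where a
difference of potentials `s` is used along the edges over `{v, u}`. -/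
lemma add_twistDiv_sub_chipDiv (hG : X₀.G.bar.Connected) (w : AdmMultideg X₀.G n)
    {c c' : X₀.G.V → ℤ} {v u : X₀.G.V} (h : v ≠ u) {wt wt' : X₀.G.V → AdmMultideg X₀.G n}
    (hwt : wt v = w.state c) (hwt' : wt' v = w.state c') (D : (X₀.Z v).Div) (j : ℕ)
    (a : X₀.G.E → ℤ) :
    D + twistDiv (wt v) (wt' v) v - chipDiv wt' v u j - X₀.nodeDiv v a =
      D + X₀.nodeDiv v (fun e => (if e ∈ X₀.G.edgesOver v u then w.drop e v (c' v - c' u + j)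
        else w.coef (fun x => c' x) v e) - w.coef (fun x => c x) v e - a e) := by
  rw [hwt, hwt', twistDiv_state_state hG, chipDiv_eq w c' h hwt', edgeDiv_self w c' h,
    nodeDiv_sub v (fun e => (if e ∈ X₀.G.edgesOver v u then w.drop e v (c' v - c' u + j)
        else w.coef (fun x => c' x) v e) - w.coef (fun x => c x) v e) a, nodeDiv_sub, edgeDiv]
  abel

section Compare

variable {w : AdmMultideg X₀.G n} {c c' : X₀.G.V → ℤ} {v u : X₀.G.V}
  {wt wt' : X₀.G.V → AdmMultideg X₀.G n} {δ : ℕ} {D : (X₀.Z v).Div}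
  {V : Submodule κ (X₀.Z v).K}

lemma coef_le_coef (hle : ∀ x, c' v - c' x ≤ c v - c x) (e : X₀.G.E) :
    w.coef (fun x => c x) v e ≤ w.coef (fun x => c' x) v e :=
  w.drop_anti e v (by
    have := hle (other e v)
    dsimp only
    exact_mod_cast this)

lemma twistDiv_nonneg (hG : X₀.G.bar.Connected) (hwt : wt v = w.state c) (hwt' : wt' v = w.state c')
    (hle : ∀ x, c' v - c' x ≤ c v - c x) : 0 ≤ twistDiv (wt v) (wt' v) v := by
  rw [hwt, hwt', twistDiv_state_state hG]
  exact sub_nonneg.2 (nodeDiv_mono fun e _ => coef_le_coef hle e)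

/-- The indices `i` and `i + δ` describe the same difference of potentials along {v, u}. On the
other edges the second sheaf only allows more poles, which a section of 𝒪(D) does not have. -/
lemma mem_H0_sub_chipDiv_iff (hG : X₀.G.bar.Connected) (h : v ≠ u) (hwt : wt v = w.state c)
    (hwt' : wt' v = w.state c') (hle : ∀ x, c' v - c' x ≤ c v - c x)
    (hδ : c v - c u = c' v - c' u + δ) {f : (X₀.Z v).K} (hf : f ∈ (X₀.Z v).H0 D) (i : ℕ)
    {a : X₀.G.E → ℤ} (ha : ∀ e, e ∉ X₀.G.edgesOver v u → a e = 0) :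
    f ∈ (X₀.Z v).H0 (D + twistDiv (wt v) (wt' v) v - chipDiv wt' v u (i + δ) - X₀.nodeDiv v a) ↔
      f ∈ (X₀.Z v).H0 (D - chipDiv wt v u i - X₀.nodeDiv v a) := by
  have h0 : D - chipDiv wt v u i - X₀.nodeDiv v a =
      D + twistDiv (wt v) (wt v) v - chipDiv wt v u i - X₀.nodeDiv v a := by
    rw [hwt, twistDiv_state_state hG, sub_self, add_zero]
  rw [h0, add_twistDiv_sub_chipDiv hG w h hwt hwt', add_twistDiv_sub_chipDiv hG w h hwt hwt]
  refine mem_H0_add_nodeDiv_congr hf fun e _ => ?_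
  split_ifs with he
  · have h1 : (c' v : ℝ) - c' u + ((i + δ : ℕ) : ℝ) = c v - c u + i := by
      exact_mod_cast (show c' v - c' u + ((i + δ : ℕ) : ℤ) = c v - c u + i by push_cast; omega)
    rw [h1]
  · have := coef_le_coef (w := w) hle e
    rw [ha e he]
    omega

lemma sectionsVanishing_add (hG : X₀.G.bar.Connected) (h : v ≠ u) (hwt : wt v = w.state c)
    (hwt' : wt' v = w.state c') (hle : ∀ x, c' v - c' x ≤ c v - c x)
    (hδ : c v - c u = c' v - c' u + δ) (hV : V ≤ (X₀.Z v).H0 D) (i : ℕ) :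
    sectionsVanishing (D + twistDiv (wt v) (wt' v) v) V (chipDiv wt' v u (i + δ)) =
      sectionsVanishing D V (chipDiv wt v u i) := by
  ext f
  refine and_congr_right fun hf => ?_
  have := mem_H0_sub_chipDiv_iff hG h hwt hwt' hle hδ (hV hf) i (a := 0) fun _ _ => rfl
  rwa [nodeDiv_zero, sub_zero, sub_zero] at this

lemma sectionsVanishing_of_le (hG : X₀.G.bar.Connected) (h : v ≠ u) (hwt : wt v = w.state c)
    (hwt' : wt' v = w.state c') (hle : ∀ x, c' v - c' x ≤ c v - c x)
    (hδ : c v - c u = c' v - c' u + δ) (hV : V ≤ (X₀.Z v).H0 D) {j : ℕ} (hj : j ≤ δ) :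
    sectionsVanishing (D + twistDiv (wt v) (wt' v) v) V (chipDiv wt' v u j) = V := by
  refine le_antisymm inf_le_left ?_
  have h1 := sectionsVanishing_add hG h hwt hwt' hle hδ hV 0
  rw [chipDiv_zero, sectionsVanishing_zero hV, zero_add] at h1
  exact h1.ge.trans (sectionsVanishing_anti _ _ (chipDiv_mono wt' v u hj))

lemma degree_chipDiv_add (h : v ≠ u) (hwt : wt v = w.state c)
    (hwt' : wt' v = w.state c') (hδ : c v - c u = c' v - c' u + δ) (i : ℕ) :
    (chipDiv wt' v u (i + δ)).degree = (chipDiv wt v u i).degree + (chipDiv wt' v u δ).degree := by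
  rw [← map_add, chipDiv, chipDiv, chipDiv, ← nodeDiv_add]
  congr 1
  refine nodeDiv_congr fun e _ => ?_
  rw [Pi.add_apply]
  by_cases he : e ∈ X₀.G.edgesOver v u
  · have h1 := drop_natCast w c' h he hwt'
    have h2 : (c' v : ℝ) - c' u + ((i + δ : ℕ) : ℝ) = c v - c u + i := by
      exact_mod_cast (show c' v - c' u + ((i + δ : ℕ) : ℤ) = c v - c u + i by push_cast; omega)
    have h3 : (c' v : ℝ) - c' u + (δ : ℝ) = c v - c u := by exact_mod_cast hδ.symm
    rw [h1, h1, drop_natCast w c h he hwt, h2, h3]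
    ring
  · simp [lossEdges, he]

lemma isCritical_chipDiv_add (h : v ≠ u) (hwt : wt v = w.state c)
    (hwt' : wt' v = w.state c') (hδ : c v - c u = c' v - c' u + δ) (i : ℕ) :
    IsCritical (chipDiv wt' v u) (i + δ) ↔ IsCritical (chipDiv wt v u) i := by
  rw [isCritical_chipDiv_iff, isCritical_chipDiv_iff,
    lossEdges_congr w h hwt hwt' (j := i + δ) (by push_cast; omega)]

lemma degree_chipDiv_lt {j : ℕ} (hj : IsCritical (chipDiv wt' v u) j) (hjδ : j < δ) :
    (chipDiv wt' v u j).degree < (chipDiv wt' v u δ).degree :=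
  degree_lt_of_isCritical (chipDiv_mono wt' v u) hj hjδ

lemma IsMultivanishing.degree_nonneg {r : ℕ} {a : Fin (r + 1) → ℤ}
    (ha : IsMultivanishing D V (chipDiv wt v u) a) (l : Fin (r + 1)) : 0 ≤ a l := by
  obtain ⟨i, -, hi⟩ := ha.2.1 l
  rw [hi]
  have := degree_mono (chipDiv_mono wt v u (Nat.zero_le i))
  rwa [chipDiv_zero, map_zero] at this

lemma finrank_gradedPiece_congr {C : SmoothCurve κ} {D D' : C.Div} {V V' : Submodule κ C.K}
    {D₁ D₂ D₁' D₂' : C.Div} (h₁ : sectionsVanishing D V D₁ = sectionsVanishing D' V' D₁')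
    (h₂ : sectionsVanishing D V D₂ = sectionsVanishing D' V' D₂') :
    Module.finrank κ (gradedPiece D V D₁ D₂) = Module.finrank κ (gradedPiece D' V' D₁' D₂') := by
  have key : ∀ S T S' T' : Submodule κ C.K, S = S' → T = T' →
      Module.finrank κ (S ⧸ T.submoduleOf S) = Module.finrank κ (S' ⧸ T'.submoduleOf S') := by
    rintro S T _ _ rfl rfl
    rfl
  exact key _ _ _ _ h₁ h₂

lemma finrank_gradedPiece_eq_zero {C : SmoothCurve κ} {D : C.Div} {V : Submodule κ C.K}
    {D₁ D₂ : C.Div} (h : sectionsVanishing D V D₁ = sectionsVanishing D V D₂) :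
    Module.finrank κ (gradedPiece D V D₁ D₂) = 0 := by
  have : Subsingleton (gradedPiece D V D₁ D₂) := by
    rw [gradedPiece, h, Submodule.submoduleOf_self]
    infer_instance
  exact Module.finrank_zero_of_subsingleton

/-- The filtration for `wt'` is that for `wt` preceded by `δ` steps in which all of `V` survives.
These have zero graded pieces, so no entry takes their degrees and all entries shift by the degree
of D_δ. -/
lemma isMultivanishing_add_iff (hG : X₀.G.bar.Connected) (h : v ≠ u) (hwt : wt v = w.state c)
    (hwt' : wt' v = w.state c') (hle : ∀ x, c' v - c' x ≤ c v - c x)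
    (hδ : c v - c u = c' v - c' u + δ) (hV : V ≤ (X₀.Z v).H0 D) {r : ℕ} (a : Fin (r + 1) → ℤ) :
    IsMultivanishing (D + twistDiv (wt v) (wt' v) v) V (chipDiv wt' v u)
        (fun l => a l + (chipDiv wt' v u δ).degree) ↔ IsMultivanishing D V (chipDiv wt v u) a := by
  have hdeg := degree_chipDiv_add h hwt hwt' hδ
  have hcrit := isCritical_chipDiv_add h hwt hwt' hδ
  have hgr : ∀ i, Module.finrank κ (gradedPiece (D + twistDiv (wt v) (wt' v) v) V
      (chipDiv wt' v u (i + δ)) (chipDiv wt' v u (i + δ + 1))) =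
      Module.finrank κ (gradedPiece D V (chipDiv wt v u i) (chipDiv wt v u (i + 1))) := fun i => by
    refine finrank_gradedPiece_congr (sectionsVanishing_add hG h hwt hwt' hle hδ hV i) ?_
    rw [add_right_comm, sectionsVanishing_add hG h hwt hwt' hle hδ hV (i + 1)]
  have hgr0 : ∀ j, j < δ → Module.finrank κ (gradedPiece (D + twistDiv (wt v) (wt' v) v) V
      (chipDiv wt' v u j) (chipDiv wt' v u (j + 1))) = 0 := fun j hj =>
    finrank_gradedPiece_eq_zero (by
      rw [sectionsVanishing_of_le hG h hwt hwt' hle hδ hV hj.le,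
        sectionsVanishing_of_le hG h hwt hwt' hle hδ hV hj])
  constructor
  · rintro ⟨h1, h2, h3⟩
    refine ⟨fun l m hlm => le_of_add_le_add_right (h1 hlm), fun l => ?_, fun i hi => ?_⟩
    · obtain ⟨j, hj, hjl⟩ := h2 l
      rcases lt_or_ge j δ with hjδ | hjδ
      · have := h3 j hj
        rw [hgr0 j hjδ, Finset.card_eq_zero] at this
        exact absurd (Finset.mem_filter.2 ⟨Finset.mem_univ l, hjl⟩) (by rw [this]; simp)
      · obtain ⟨i, rfl⟩ := Nat.exists_eq_add_of_le' hjδ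
        exact ⟨i, (hcrit i).1 hj, by rw [hdeg] at hjl; exact add_right_cancel hjl⟩
    · have := h3 (i + δ) ((hcrit i).2 hi)
      rw [hgr, hdeg] at this
      simpa only [add_left_inj] using this
  · intro ha
    obtain ⟨h1, h2, h3⟩ := id ha
    refine ⟨fun l m hlm => add_le_add_left (h1 hlm) _, fun l => ?_, fun j hj => ?_⟩
    · obtain ⟨i, hi, hil⟩ := h2 l
      exact ⟨i + δ, (hcrit i).2 hi, by rw [hdeg, ← hil]⟩
    · rcases lt_or_ge j δ with hjδ | hjδ
      · rw [hgr0 j hjδ, Finset.card_eq_zero, Finset.filter_eq_empty_iff]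
        intro l _ hl
        dsimp only at hl
        have h4 := degree_chipDiv_lt hj hjδ
        have h5 := ha.degree_nonneg l
        omega
      · obtain ⟨i, rfl⟩ := Nat.exists_eq_add_of_le' hjδ
        have := h3 i ((hcrit i).1 hj)
        rw [hgr, hdeg]
        simpa only [add_left_inj] using this

end Compare

lemma glues_add_iff (hG : X₀.G.bar.Connected) {w : AdmMultideg X₀.G n}
    {wt wt' : X₀.G.V → AdmMultideg X₀.G n} {c c' : X₀.G.V → X₀.G.V → ℤ}
    (hwt : ∀ v, wt v = w.state (c v)) (hwt' : ∀ v, wt' v = w.state (c' v))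
    (hle : ∀ v u, c' v v - c' v u ≤ c v v - c v u) {x : SheafTuple X₀}
    (hx : ∀ v, x.V v ≤ (X₀.Z v).H0 (x.D v)) {v u : X₀.G.V} (h : v ≠ u) {δ δ' : ℕ}
    (hδ : c v v - c v u = c' v v - c' v u + δ) (hδ' : c u u - c u v = c' u u - c' u v + δ')
    (i i' g : ℕ) :
    Glues (sectionsVanishing (x.D v + twistDiv (wt v) (wt' v) v) (x.V v) (chipDiv wt' v u (i + δ)))
      (sectionsVanishing (x.D v + twistDiv (wt v) (wt' v) v) (x.V v) (chipDiv wt' v u (i + δ + 1)))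
      ((wt' v).lossEdges v u (i + δ))
      (vanishAt v (x.D v + twistDiv (wt v) (wt' v) v - chipDiv wt' v u (i + δ)))
      (sectionsVanishing (x.D u + twistDiv (wt u) (wt' u) u) (x.V u) (chipDiv wt' u v (i' + δ')))
      (sectionsVanishing (x.D u + twistDiv (wt u) (wt' u) u) (x.V u)
        (chipDiv wt' u v (i' + δ' + 1)))
      ((wt' u).lossEdges u v (i' + δ'))
      (vanishAt u (x.D u + twistDiv (wt u) (wt' u) u - chipDiv wt' u v (i' + δ'))) g ↔
    Glues (sectionsVanishing (x.D v) (x.V v) (chipDiv wt v u i))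
      (sectionsVanishing (x.D v) (x.V v) (chipDiv wt v u (i + 1)))
      ((wt v).lossEdges v u i) (vanishAt v (x.D v - chipDiv wt v u i))
      (sectionsVanishing (x.D u) (x.V u) (chipDiv wt u v i'))
      (sectionsVanishing (x.D u) (x.V u) (chipDiv wt u v (i' + 1)))
      ((wt u).lossEdges u v i') (vanishAt u (x.D u - chipDiv wt u v i')) g := by
  have hS : ∀ {v u : X₀.G.V} {δ : ℕ}, v ≠ u → c v v - c v u = c' v v - c' v u + δ → ∀ i,
      sectionsVanishing (x.D v + twistDiv (wt v) (wt' v) v) (x.V v) (chipDiv wt' v u (i + δ)) =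
        sectionsVanishing (x.D v) (x.V v) (chipDiv wt v u i) := fun {v _ _} h hδ i =>
    sectionsVanishing_add hG h (hwt v) (hwt' v) (hle v) hδ (hx v) i
  have hT : ∀ {v u : X₀.G.V} {δ : ℕ}, v ≠ u → c v v - c v u = c' v v - c' v u + δ → ∀ i,
      sectionsVanishing (x.D v + twistDiv (wt v) (wt' v) v) (x.V v) (chipDiv wt' v u (i + δ + 1)) =
        sectionsVanishing (x.D v) (x.V v) (chipDiv wt v u (i + 1)) := fun h hδ i => by
    rw [add_right_comm, hS h hδ]
  have hL : ∀ {v u : X₀.G.V} {δ : ℕ}, v ≠ u → c v v - c v u = c' v v - c' v u + δ → ∀ i : ℕ,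
      (wt' v).lossEdges v u (i + δ) = (wt v).lossEdges v u i := fun {v _ _} h hδ i =>
    (lossEdges_congr w h (hwt v) (hwt' v) (by push_cast; omega)).symm
  have hA : ∀ {v u : X₀.G.V} {δ : ℕ}, v ≠ u → c v v - c v u = c' v v - c' v u + δ → ∀ i : ℕ,
      ∀ e ∈ (wt v).lossEdges v u i, ∀ s ∈ x.V v,
        (s ∈ vanishAt v (x.D v + twistDiv (wt v) (wt' v) v - chipDiv wt' v u (i + δ)) e ↔
          s ∈ vanishAt v (x.D v - chipDiv wt v u i) e) := fun {v _ _} h hδ i e he s hs =>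
    mem_H0_sub_chipDiv_iff hG h (hwt v) (hwt' v) (hle v) hδ (hx v hs) i fun e' he' =>
      Pi.single_eq_of_ne (by rintro rfl; exact he' (Finset.mem_filter.1 he).1) _
  constructor
  · intro hg
    refine hg.congr (hS h hδ i) (hT h hδ i) (hL h hδ i) (fun e he s hs => ?_) (hS h.symm hδ' i')
      (hT h.symm hδ' i') (hL h.symm hδ' i') (fun e he s hs => ?_) rfl
    · rw [hL h hδ] at he
      exact hA h hδ i e he s hs.1
    · rw [hL h.symm hδ'] at he
      exact hA h.symm hδ' i' e he s hs.1
  · intro hg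
    exact hg.congr (hS h hδ i).symm (hT h hδ i).symm (hL h hδ i).symm
      (fun e he s hs => (hA h hδ i e he s hs.1).symm) (hS h.symm hδ' i').symm
      (hT h.symm hδ' i').symm (hL h.symm hδ' i').symm
      (fun e he s hs => (hA h.symm hδ' i' e he s hs.1).symm) rfl

lemma SheafTuple.weakGlueing_add_iff (hG : X₀.G.bar.Connected) {w : AdmMultideg X₀.G n}
    {wt wt' : X₀.G.V → AdmMultideg X₀.G n} {c c' : X₀.G.V → X₀.G.V → ℤ}
    (hc : TightPotentials w wt c) (hc' : TightPotentials w wt' c')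
    (hle : ∀ v u, c' v v - c' v u ≤ c v v - c v u) {x : SheafTuple X₀}
    (hx : ∀ v, x.V v ≤ (X₀.Z v).H0 (x.D v)) {r : ℕ} :
    (⟨fun v => x.D v + twistDiv (wt v) (wt' v) v, x.V⟩ : SheafTuple X₀).WeakGlueing wt' r ↔
      x.WeakGlueing wt r := by
  have hwt := hc.eq_state
  have hwt' := hc'.eq_state
  rw [weakGlueing_iff, weakGlueing_iff]
  refine forall₃_congr fun v u h => ?_
  have hne := h.ne
  have hδ : c v v - c v u = c' v v - c' v u + (c v v - c v u - (c' v v - c' v u)).toNat := by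
    have := hle v u
    omega
  have hδ' : c u u - c u v = c' u u - c' u v + (c u u - c u v - (c' u u - c' u v)).toNat := by
    have := hle u v
    omega
  generalize (c v v - c v u - (c' v v - c' v u)).toNat = δ at hδ
  generalize (c u u - c u v - (c' u u - c' u v)).toNat = δ' at hδ'
  have hg := hc.gap_eq v u h
  have hg' := hc'.gap_eq v u h
  have hgap : gap wt' v u = gap wt v u + δ + δ' := by omega
  have hm := isMultivanishing_add_iff hG hne (hwt v) (hwt' v) (hle v) hδ (hx v) (r := r)
  have hm' := isMultivanishing_add_iff hG hne.symm (hwt u) (hwt' u) (hle u) hδ' (hx u) (r := r)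
  have hd := degree_chipDiv_add hne (hwt v) (hwt' v) hδ
  have hd' := degree_chipDiv_add hne.symm (hwt u) (hwt' u) hδ'
  have hcrit := isCritical_chipDiv_add hne (hwt v) (hwt' v) hδ
  have hglue := glues_add_iff hG hwt hwt' hle hx hne hδ hδ'
  set k := (chipDiv wt' v u δ).degree with hk
  set k' := (chipDiv wt' u v δ').degree with hk'
  constructor
  · rintro ⟨a, a', ha, ha', hgl⟩
    refine ⟨fun l => a l - k, fun l => a' l - k', (hm _).1 (by simpa only [sub_add_cancel] using ha),
      (hm' _).1 (by simpa only [sub_add_cancel] using ha'), fun i i' hii hi => ?_⟩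
    have := (hglue i i' _).1 (hgl (i + δ) (i' + δ') (by omega) ((hcrit i).2 hi))
    rw [hd, hd'] at this
    simpa only [sub_eq_iff_eq_add] using this
  · rintro ⟨a, a', ha, ha', hgl⟩
    refine ⟨fun l => a l + k, fun l => a' l + k', (hm _).2 ha, (hm' _).2 ha', fun j j' hjj hj => ?_⟩
    have hj' : IsCritical (chipDiv wt' u v) j' := by
      rw [isCritical_chipDiv_iff] at hj ⊢
      rwa [lossEdges_symm w hne (hwt' v) (hwt' u)]
      omega
    -- In the additional initial steps no entry of the shifted sequence has the required degree on
    -- that side, so the glueing dimension is 0.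
    by_cases hlt : j < δ ∨ j' < δ'
    · rw [Finset.card_eq_zero.2]
      · exact glues_zero _ _ _ _ _ _ _ _
      rw [Finset.filter_eq_empty_iff]
      rintro l _ ⟨h1, h2⟩
      dsimp only at h1 h2
      have h3 := ha.degree_nonneg l
      have h4 := ha'.degree_nonneg l.rev
      rcases hlt with hlt | hlt
      · have := degree_chipDiv_lt hj hlt
        omega
      · have := degree_chipDiv_lt hj' hlt
        omega
    · push Not at hlt
      obtain ⟨i, rfl⟩ := Nat.exists_eq_add_of_le' hlt.1
      obtain ⟨i', rfl⟩ := Nat.exists_eq_add_of_le' hlt.2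
      rw [hd, hd']
      simpa only [add_left_inj] using (hglue i i' _).2 (hgl i i' (by omega) ((hcrit i).1 hj))

end NodalCurve
namespace NodalCurve

open Multigraph AdmMultideg

variable {κ : Type u} [Field κ] {X₀ : NodalCurve κ} {n : X₀.G.E → ℕ+}
  {w₀ : AdmMultideg X₀.G n} {wt wt' : X₀.G.V → AdmMultideg X₀.G n} {c c' : X₀.G.V → X₀.G.V → ℤ}
  {d : ℤ} {r : ℕ}

/-! ### Comparison of two forgetful maps -/

lemma PreLimitSpace.exists_mk (p : PreLimitSpace wt r) : ∃ x hx, p = PreLimitSpace.mk x hx := by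
  obtain ⟨⟨x, hx⟩, rfl⟩ := Quotient.exists_rep p
  exact ⟨x, hx, rfl⟩

lemma PreLimitSpace.mk_eq_mk_iff {x y : SheafTuple X₀} (hx : IsPreLimit wt r x)
    (hy : IsPreLimit wt r y) : PreLimitSpace.mk x hx = PreLimitSpace.mk y hy ↔ x ≈ y :=
  ⟨fun h => Quotient.exact (s := Setoid.comap (Subtype.val :
    {x : SheafTuple X₀ // IsPreLimit wt r x} → SheafTuple X₀) inferInstance) h,
    fun h => Quotient.sound h⟩

lemma PreLimitSpace.isEmpty_of_forall (h : ∀ x : SheafTuple X₀, ¬ IsPreLimit wt r x) :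
    IsEmpty (PreLimitSpace wt r) :=
  ⟨fun p => by obtain ⟨x, hx, -⟩ := p.exists_mk; exact h x hx⟩

variable [IsAlgClosed κ]

lemma exists_equiv_forgetfulMap (hG : X₀.G.IsMultitree) (hc : TightPotentials w₀ wt c)
    (hc' : TightPotentials w₀ wt' c') (hd : w₀.degree = d)
    (hle : ∀ v u, c' v v - c' v u ≤ c v v - c v u) :
    ∃ J : PreLimitSpace wt' r ≃ PreLimitSpace wt r,
      forgetfulMap hG hc' hd = forgetfulMap hG hc hd ∘ J ∧
      (∀ p, p.WeakGlueing ↔ (J p).WeakGlueing) ∧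
      ∀ (x : SheafTuple X₀) (hx : IsPreLimit wt r x),
        ∃ hx' : IsPreLimit wt' r ⟨fun v => x.D v + twistDiv (wt v) (wt' v) v, x.V⟩,
          J.symm (PreLimitSpace.mk x hx) = PreLimitSpace.mk _ hx' := by
  -- Both forgetful maps are bijections onto the same set of limit linear series, so compatibility
  -- determines `J`; its inverse is computed on representatives by `forgetfulMap_mk_add`.
  let e := (Equiv.Set.univ _).symm.trans ((bijOn_forgetfulMap (r := r) hG hc hd).equiv _)
  let e' := (Equiv.Set.univ _).symm.trans ((bijOn_forgetfulMap (r := r) hG hc' hd).equiv _)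
  have he : ∀ p, ((e p : limitsOfMultidegree d r w₀) : LimitSpace X₀ n d r) =
      forgetfulMap hG hc hd p := fun p => rfl
  have he' : ∀ p, ((e' p : limitsOfMultidegree d r w₀) : LimitSpace X₀ n d r) =
      forgetfulMap hG hc' hd p := fun p => rfl
  have hJ : ∀ p, forgetfulMap hG hc hd (e.symm (e' p)) = forgetfulMap hG hc' hd p := fun p => by
    rw [← he, ← he', Equiv.apply_symm_apply]
  have hinv : ∀ (x : SheafTuple X₀) (hx : IsPreLimit wt r x),
      ∃ hx' : IsPreLimit wt' r ⟨fun v => x.D v + twistDiv (wt v) (wt' v) v, x.V⟩,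
        e'.symm (e (PreLimitSpace.mk x hx)) = PreLimitSpace.mk _ hx' := by
    intro x hx
    obtain ⟨hx', h⟩ := forgetfulMap_mk_add hG hc hd hc' hx
    refine ⟨hx', ?_⟩
    rw [Equiv.symm_apply_eq]
    exact Subtype.ext h.symm
  refine ⟨e'.trans e.symm, funext fun p => (hJ p).symm, fun p => ⟨?_, ?_⟩, hinv⟩
  · rintro ⟨x, hx, rfl, hglue⟩
    obtain ⟨y, hy, h⟩ := (e.symm (e' (PreLimitSpace.mk x hx))).exists_mk
    obtain ⟨hy', h'⟩ := hinv y hy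
    rw [← h, Equiv.apply_symm_apply, Equiv.symm_apply_apply, PreLimitSpace.mk_eq_mk_iff] at h'
    obtain ⟨f, hf, hD, hV⟩ := Setoid.symm h'
    -- The representative of the image for which adding the twisting divisor returns exactly the
    -- given `x`, so that the comparison of glueing conditions applies to it.
    let z : SheafTuple X₀ := ⟨fun v => x.D v - twistDiv (wt v) (wt' v) v, x.V⟩
    have hyz : y ≈ z := ⟨f, hf, fun v P => by
      have := hD v P
      simp only [z, Finsupp.add_apply, Finsupp.sub_apply] at this ⊢
      omega, hV⟩
    have hz : IsPreLimit wt r z := IsPreLimit.of_equiv hG hc hyz hy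
    refine ⟨z, hz, h.trans ((PreLimitSpace.mk_eq_mk_iff hy hz).2 hyz), ?_⟩
    rw [← SheafTuple.weakGlueing_add_iff hG.connected hc hc' hle hz.2.1]
    simpa only [z, sub_add_cancel] using hglue
  · rintro ⟨x, hx, h, hglue⟩
    obtain ⟨hx', h'⟩ := hinv x hx
    refine ⟨_, hx', ?_, (SheafTuple.weakGlueing_add_iff hG.connected hc hc' hle hx.2.1).2 hglue⟩
    rw [← h', ← h]
    simp

/-! ### The reduced tuple -/

/-- A limit linear series yields some rational function with effective result, whose vertex values
have nonnegative degrees everywhere. By the maximum principle an unfireable potential drops less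
from `v`, so its degree at `v` is at least as large. -/
lemma IsPreLimit.degAt_nonneg (hG : X₀.G.IsMultitree) (hc : TightPotentials w₀ wt c)
    {x : SheafTuple X₀} (hx : IsPreLimit wt r x) {a : X₀.G.V → ℤ} {v : X₀.G.V}
    (ha : w₀.IsUnfireable a v) : 0 ≤ w₀.degAt (fun x => a x) v := by
  obtain ⟨P, -⟩ := (X₀.Z v).exists_isClosed_point_mem isClosed_univ ⟨genericPoint _, trivial⟩
  have hy := (hx.isLimitSeries_toPair hG hc rfl).2.2.1
  have hE : (0 : ComplexDiv X₀ n) ≤ Finsupp.single (Sum.inl ⟨v, P⟩) (r : ℤ) := by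
    simp
  obtain ⟨f, -, hf⟩ := hy _ hE (Finsupp.degree_single _ _)
  have hD : ∀ v, (x.D v - twistDiv w₀ (wt v) v).degree = w₀.wG v := fun v => by
    rw [map_sub, hx.1, degree_twistDiv hG.connected (hc.mem_orbit v), sub_sub_cancel]
  have hnn := degAt_vert_nonneg hD hE hf
  refine (hnn v).trans (w₀.degAt_le_of_forall fun y _ e _ => w₀.drop_anti e v ?_)
  exact ha.sub_le_sub (fun u _ => hnn u) y

lemma IsPreLimit.wG_nonneg {x : SheafTuple X₀} (hx : IsPreLimit wt r x) (v : X₀.G.V) :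
    0 ≤ (wt v).wG v := by
  by_contra! h
  have h1 := hx.2.1 v
  rw [SmoothCurve.H0_eq_bot_of_degree_neg _ (by rwa [hx.1]), le_bot_iff] at h1
  have h2 := hx.2.2.1 v
  rw [h1, finrank_bot] at h2
  omega

/-- The forgetful map of the reduced tuple, and its comparison with those of tight tuples. -/
lemma exists_forgetfulMap_reduced (hG : X₀.G.IsMultitree) (hd : w₀.degree = d)
    (hwt : ∀ v, wt v = w₀.state (c v))
    (hred : ∀ v, (∀ u, u ≠ v → 0 ≤ w₀.degAt (fun x => c v x) u) ∧ w₀.IsUnfireable (c v) v) :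
    ∃ Fred : PreLimitSpace wt r → LimitSpace X₀ n d r, IsForgetfulMap w₀ wt Fred ∧
      ∀ wt' c' (hc' : TightPotentials w₀ wt' c'),
        ∃ J : PreLimitSpace wt' r ≃ PreLimitSpace wt r,
          forgetfulMap hG hc' hd = Fred ∘ J ∧
          (∀ p, p.WeakGlueing ↔ (J p).WeakGlueing) ∧
          ∀ (x : SheafTuple X₀) (hx : IsPreLimit wt r x),
            ∃ hx' : IsPreLimit wt' r ⟨fun v => x.D v + twistDiv (wt v) (wt' v) v, x.V⟩,
              J.symm (PreLimitSpace.mk x hx) = PreLimitSpace.mk _ hx' := by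
  by_cases hnn : ∀ v, 0 ≤ (wt v).wG v
  · have hc := tightPotentials_of_reduced hG hwt hred hnn
    refine ⟨forgetfulMap hG hc hd, isForgetfulMap_forgetfulMap hG hc hd, fun wt' c' hc' =>
      exists_equiv_forgetfulMap hG hc hc' hd fun v u => ?_⟩
    exact_mod_cast (hc'.unfireable v).sub_le_sub (hred v).1 u
  -- A reduced multidegree negative at its own vertex leaves no pre-limit series for the reduced
  -- tuple, and by `IsPreLimit.degAt_nonneg` none for any tight tuple; all maps are then between
  -- empty types.
  · have h : ∀ x : SheafTuple X₀, ¬ IsPreLimit wt r x := fun x hx => hnn hx.wG_nonneg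
    have := PreLimitSpace.isEmpty_of_forall h
    refine ⟨isEmptyElim, fun x hx => absurd hx (h x), fun wt' c' hc' => ?_⟩
    have h' : ∀ x : SheafTuple X₀, ¬ IsPreLimit wt' r x := fun x hx => hnn fun v => by
      rw [hwt, state_wG]
      exact hx.degAt_nonneg hG hc' (hred v).2
    have := PreLimitSpace.isEmpty_of_forall h'
    exact ⟨Equiv.equivOfIsEmpty _ _, funext isEmptyElim, isEmptyElim,
      fun x hx => absurd hx (h x)⟩

end NodalCurve
end LimitLinear
end

/-! ### The main theorem -/

theorem mainTheorem4 {κ : Type u} [Field κ] [IsAlgClosed κ] (X₀ : NodalCurve κ)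
    (hX₀ : X₀.IsPseudocompact) (n : X₀.G.E → ℕ+) (d : ℤ) (r : ℕ)
    (w₀ : AdmMultideg X₀.G n) (hd : w₀.degree = d) :
    -- the tuple of reduced multidegrees
    ∃ wred : X₀.G.V → AdmMultideg X₀.G n,
      (∀ v w, (w ∈ w₀.orbit ∧ w.IsReducedAt v) ↔ w = wred v) ∧
      -- the forgetful map for the reduced tuple
      ∃ Fred : PreLimitSpace wred r → LimitSpace X₀ n d r, IsForgetfulMap w₀ wred Fred ∧
        ∀ w : X₀.G.V → AdmMultideg X₀.G n, (∀ v, w v ∈ w₀.orbit) → AdmMultideg.IsTight w →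
          -- the forgetful map for the tight tuple
          ∃ F : PreLimitSpace w r → LimitSpace X₀ n d r, IsForgetfulMap w₀ w F ∧
          -- the natural isomorphism, with its explicit inverse
          (∃ J : PreLimitSpace w r ≃ PreLimitSpace wred r,
            F = Fred ∘ J ∧
            (∀ p, p.WeakGlueing ↔ (J p).WeakGlueing) ∧
            (∀ v, 0 ≤ twistDiv (wred v) (w v) v) ∧
            ∀ (x : SheafTuple X₀) (hx : IsPreLimit wred r x),
              ∃ hx' : IsPreLimit w r ⟨fun v => x.D v + twistDiv (wred v) (w v) v, x.V⟩,
                J.symm (PreLimitSpace.mk x hx) = PreLimitSpace.mk _ hx') ∧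
          -- the forgetful map is a bijection, with its explicit inverse
          Set.BijOn F Set.univ (limitsOfMultidegree d r w₀) ∧
          ∀ (y : ComplexPair X₀ n) (hy : y.IsLimitSeries d r), y.D.IsOfMultidegree w₀ →
            (∀ v, y.H v ≤ (X₀.Z v).H0 (ComplexDiv.part y.D v + twistDiv w₀ (w v) v)) ∧
            ∃ hx : IsPreLimit w r ⟨fun v => ComplexDiv.part y.D v + twistDiv w₀ (w v) v, y.H⟩,
              F (PreLimitSpace.mk _ hx) = LimitSpace.mk y hy := by
  choose c hc using AdmMultideg.exists_reduced_potential hX₀ w₀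
  obtain ⟨Fred, hFred, hJ⟩ := exists_forgetfulMap_reduced (r := r) hX₀ hd (fun _ => rfl) hc
  refine ⟨fun v => w₀.state (c v), fun v w => ⟨?_, ?_⟩, Fred, hFred, fun w hw htight => ?_⟩
  · rintro ⟨h1, h2⟩
    obtain ⟨a, rfl⟩ := AdmMultideg.mem_orbit_iff.1 h1
    rw [AdmMultideg.isReducedAt_state_iff] at h2
    rw [w₀.state_eq_iff hX₀.connected]
    intro x y
    have h3 := AdmMultideg.sub_eq_of_reduced h2 (hc v) x
    have h4 := AdmMultideg.sub_eq_of_reduced h2 (hc v) y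
    omega
  · rintro rfl
    exact ⟨w₀.state_mem_orbit _, (w₀.isReducedAt_state_iff _ v).2 (hc v)⟩
  · obtain ⟨c', hc'⟩ := htight.exists_tightPotentials hX₀ hw
    obtain ⟨J, hF, hglue, hinv⟩ := hJ w c' hc'
    refine ⟨forgetfulMap hX₀ hc' hd, isForgetfulMap_forgetfulMap hX₀ hc' hd,
      ⟨J, hF, hglue, fun v => ?_, hinv⟩, bijOn_forgetfulMap hX₀ hc' hd, fun y hy hyw => ?_⟩
    -- Effectivity of D_v is the maximum principle once more: the reduced potential has nonnegative
    -- degrees away from `v`, so it drops from `v` at least as much as the unfireable one of the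
    -- tight tuple.
    · refine twistDiv_nonneg (wt := fun v => w₀.state (c v)) hX₀.connected rfl (hc'.eq_state v)
        fun x => ?_
      exact_mod_cast (hc'.unfireable v).sub_le_sub (hc v).1 x
    · obtain ⟨hx, h⟩ := forgetfulMap_mk_toTuple hX₀ hc' hd hy hyw
      exact ⟨hx.2.1, hx, h⟩
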